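/- **Setting.** For $t=1,\dots,d$ let $\ell_t=P_{(t)}a_t\in\mathbb R^n$, $n\ge 2$, $r\ge1$, with deterministic $P_{(t)}=P_j$ for $t\in[t_j,t_{j+1})$, $j=0,\dots,J$, where $t_0=1$, $t_{J+1}=d+1$ and each $P_j\in\mathbb R^{n\times r}$ has orthonormal columns (a basis matrix). The entries of $\ell_t$ in a set $\mathcal T_t\subseteq\{1,\dots,n\}$ are missing: one observes $\mathcal T_t$ and $y_t$, with $(y_t)_i=(\ell_t)_i$ for $i\notin\mathcal T_t$ and $(y_t)_i=0$ for $i\in\mathcal T_t$. Write $\sin\theta(P,Q)=\|(I-PP')Q\|$ (spectral norm), $\mathrm{dif}_j=\sin\theta(P_{j-1},P_j)$ for $j\ge1$, and $\mathrm{dif}_0=\sin\theta(0,P_0)=1$. "$r$-SVD" means a matrix of top $r$ left singular vectors. **Algorithm (NORST-miss, tracking mode)** with parameters $r,\alpha,K,\lambda_{thres}$. Start with $\hat P_{(0)}=0_{n\times r}$, $j=0$, $\hat t_0=0$, $\hat\ell_0=0$, phase = update. For $t=1,2,\dots$: (a) with $\Psi=I-\hat P_{(t-1)}\hat P_{(t-1)}'$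 and $\Psi_{\mathcal T}$ its columns in $\mathcal T$, set $\hat\ell_t=y_t-I_{\mathcal T_t}(\Psi_{\mathcal T_t}'\Psi_{\mathcal T_t})^{-1}\Psi_{\mathcal T_t}'\Psi y_t$; (b) if phase = update and $t=\hat t_j+u\alpha-1$ for an integer $u\ge1$, set $\hat P_{(t)}$ to an $r$-SVD of $[\hat\ell_{t-\alpha+1},\dots,\hat\ell_t]$; otherwise $\hat P_{(t)}=\hat P_{(t-1)}$; (c) if phase = update and $t=\hat t_j+K\alpha-1$, set $\hat t_{j,fin}=t$, $\hat P_j=\hat P_{(t)}$, increase $j$ by one, and set phase = detect; (d) if phase = detect and $t=\hat t_{j-1,fin}+u\alpha$ for an integer $u\ge1$, let $B=(I-\hat P_{j-1}\hat P_{j-1}')[\hat\ell_{t-\alpha+1},\dots,\hat\ell_t]$; if $\lambda_{\max}(BB')\ge\alpha\lambda_{thres}$, set $\hat t_j=t$ and phase = update. **Theorem.** There are numerical constants $c_1,c_2,C_K>0$ and, for every $\mu\ge1$, constants $C_\alpha,C_{gap}>0$ depending only on $\mu$, such that both parts below hold. *Tracking.* Suppose that 1. every $P_j$ is $\mu$-incoherent,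 i.e. each row satisfies $\|P_j^{(i)}\|^2\le\mu r/n$; the $a_t$ have zero mean, are mutually independent, have a common diagonal covariance $\Lambda$ with $\lambda^+=\lambda_{\max}(\Lambda)$, $\lambda^-=\lambda_{\min}(\Lambda)>0$, $f=\lambda^+/\lambda^-$, and satisfy $(a_t)_i^2\le\mu\lambda^+$ almost surely; 2. $\epsilon>0$ and $\epsilon\le\min\bigl(0.01,\ 0.03\min_{1\le j\le J}\mathrm{dif}_j^2/f\bigr)$; the algorithm is run with $\alpha=\lceil C_\alpha f^2r\log n\rceil$, $K=\lceil C_K\log(1/\epsilon)\rceil$ and $\lambda_{thres}=2\epsilon^2\lambda^+$; 3. almost surely, at most a fraction $c_1/(\mu r)$ of the entries of every column is missing, and at most a fraction $c_2/f^2$ of the entries of every row within any $\alpha$ consecutive columns in $[1,d]$ is missing; 4. $t_{j+1}-t_j>C_{gap}f^2\,r\log n\,\log(1/\epsilon)$ for $0\le j\le J$; 5. $(a_t)_{t\le d}$ is independent of $(\mathcal T_t)_{t\le d}$. Then, with probability at least $1-10dn^{-10}$, all of the following hold simultaneously: (i) the change times $\hat t_1,\dots,\hat t_J$ are produced by frame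 $d$ and $t_j\le\hat t_j\le t_j+2\alpha$ for $1\le j\le J$; (ii) for $0\le j\le J$: $\sin\theta(\hat P_{(t)},P_{(t)})\le0.3^{k-1}(\epsilon+\mathrm{dif}_j)$ for $t\in[\hat t_j+k\alpha,\hat t_j+(k+1)\alpha)$, $1\le k\le K$, and $\sin\theta(\hat P_{(t)},P_{(t)})\le\epsilon$ for $t\in[\hat t_j+(K+1)\alpha,t_{j+1})$; (iii) for $1\le t\le d$ the matrix $\Psi_{\mathcal T_t}'\Psi_{\mathcal T_t}$ inverted in (a) is invertible and $\|\hat\ell_t-\ell_t\|\le1.2\bigl(\sin\theta(\hat P_{(t-1)},P_{(t)})+\epsilon\bigr)\|\ell_t\|$; here $\hat P_{(t-1)}=\hat P_{(t)}$ unless the subspace is re-estimated at frame $t$. *Complexity.* For every $f_0\ge1$ there is $C>0$, depending only on $\mu$ and $f_0$, such that for all $n\ge2$, $1\le r\le n$, $0<\lambda^-\le\lambda^+$ with $f=\lambda^+/\lambda^-\le f_0$, $0<\epsilon\le0.01$ and $\alpha,K,\lambda_{thres}$ as above, the algorithm (with any $r$-SVD routine) is carried out by a real-number machine with at most $C\,nr\log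 n\log(1/\epsilon)$ real registers, which on every input stream with at most a fraction $c_1/(\mu r)$ of missing entries per column holds $\hat\ell_t$ and $\hat P_{(t)}$ in its registers after every frame $t$, and whose total time on the first $d$ frames is at most $C\,ndr\log(1/\epsilon)$, for every $d\ge1$. In this model loads, copies, arithmetic operations and comparisons of real registers have unit cost; reading a missing set costs $n$, and the program run at a frame may depend on the missing set of that frame; and the $r$-SVD of an $n\times\alpha$ matrix is a primitive charged $n\alpha r\lceil\log(1/\epsilon)\rceil$. -/

import Mathlib

open MeasureTheory ProbabilityTheory Matrix

noncomputable section

namespace NORST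

/-! ### Linear algebra -/

/-- The Euclidean norm of a vector. -/
def vnorm {m : ℕ} (v : Fin m → ℝ) : ℝ := ‖WithLp.toLp 2 v‖

/-- The spectral norm of a matrix (operator norm between Euclidean spaces). -/
def specNorm {m k : ℕ} (A : Matrix (Fin m) (Fin k) ℝ) : ℝ :=
  ‖LinearMap.toContinuousLinearMap (Matrix.toEuclideanLin A)‖

/-- The largest eigenvalue of `B Bᵀ`. -/
def lamMaxGram {m k : ℕ} (B : Matrix (Fin m) (Fin k) ℝ) : ℝ :=
  ⨆ i, (Matrix.isHermitian_mul_conjTranspose_self B).eigenvalues i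

/-- A basis matrix: mutually orthonormal columns. -/
def IsBasisMatrix {n r : ℕ} (P : Matrix (Fin n) (Fin r) ℝ) : Prop := Pᵀ * P = 1

/-- The orthogonal complement projector `I - P Pᵀ`. -/
def perp {n r : ℕ} (P : Matrix (Fin n) (Fin r) ℝ) : Matrix (Fin n) (Fin n) ℝ := 1 - P * Pᵀ

/-- The subspace error `‖(I - P₁ P₁ᵀ) P₂‖`. -/
def sinTheta {n r : ℕ} (P₁ P₂ : Matrix (Fin n) (Fin r) ℝ) : ℝ := specNorm (perp P₁ * P₂)

/-- `μ`-incoherence: every row satisfies `‖P⁽ⁱ⁾‖² ≤ μ r / n`. -/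
def IsIncoherent {n r : ℕ} (μ : ℝ) (P : Matrix (Fin n) (Fin r) ℝ) : Prop :=
  ∀ i, ∑ k, P i k ^ 2 ≤ μ * r / n

/-- `U` is a matrix of top `r` left singular vectors of `M`, in order of decreasing singular
value: its columns are orthonormal, the `k`-th one is an eigenvector of `M Mᵀ` with eigenvalue
`σ k ^ 2`, and every direction orthogonal to all of them is stretched by at most every `σ k`. -/
def IsTopLeftSingular {n m r : ℕ} (M : Matrix (Fin n) (Fin m) ℝ)
    (U : Matrix (Fin n) (Fin r) ℝ) : Prop :=
  Uᵀ * U = 1 ∧ ∃ σ : Fin r → ℝ, (∀ k, 0 ≤ σ k) ∧ Antitone σ ∧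
    M * Mᵀ * U = U * Matrix.diagonal (fun k => σ k ^ 2) ∧
    ∀ v : Fin n → ℝ, Uᵀ *ᵥ v = 0 → ∀ k, vnorm (Mᵀ *ᵥ v) ≤ σ k * vnorm v

/-- An `r`-SVD routine for `n × m` matrices (singular vectors are not unique; the routine fixes
one choice). -/
def IsRSVD {n m r : ℕ} (svd : Matrix (Fin n) (Fin m) ℝ → Matrix (Fin n) (Fin r) ℝ) : Prop :=
  ∀ M, IsTopLeftSingular M (svd M)

/-- Measurability of a matrix-valued function of a matrix, entrywise. -/
def IsMeasurableRSVD {n m r : ℕ}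
    (svd : Matrix (Fin n) (Fin m) ℝ → Matrix (Fin n) (Fin r) ℝ) : Prop :=
  ∀ i k, Measurable fun M : Fin n → Fin m → ℝ => svd (Matrix.of M) i k

/-! ### Data model -/

/-- Statistical right incoherence of `a_1, …, a_d`: zero mean, mutually independent, common
diagonal covariance with diagonal `lam`, and elementwise bounded. -/
structure StatRightIncoherent {Ω : Type*} [MeasurableSpace Ω] (Pr : Measure Ω) {r : ℕ} (d : ℕ)
    (μ : ℝ) (lam : Fin r → ℝ) (a : ℕ → Ω → Fin r → ℝ) : Prop where
  meas : ∀ t ∈ Set.Icc 1 d, Measurable (a t)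
  zeroMean : ∀ t ∈ Set.Icc 1 d, ∀ i, ∫ ω, a t ω i ∂Pr = 0
  cov : ∀ t ∈ Set.Icc 1 d, ∀ i k, ∫ ω, a t ω i * a t ω k ∂Pr = if i = k then lam i else 0
  indep : iIndepFun (fun t : Set.Icc 1 d => a t) Pr
  bdd : ∀ t ∈ Set.Icc 1 d, ∀ i, ∀ᵐ ω ∂Pr, a t ω i ^ 2 ≤ μ * ⨆ k, lam k

/-- Maximum fraction of missing entries in a column, over frames `1, …, d`. -/
def maxMissFracCol {n : ℕ} (d : ℕ) (T : ℕ → Finset (Fin n)) : ℝ :=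
  ⨆ t : Set.Icc 1 d, ((T t).card : ℝ) / n

/-- Maximum fraction of missing entries in a row of the `α` columns `s, …, s + α - 1`. -/
def missFracWindow {n : ℕ} (α s : ℕ) (T : ℕ → Finset (Fin n)) : ℝ :=
  ⨆ i : Fin n, (((Finset.Ico s (s + α)).filter fun t => i ∈ T t).card : ℝ) / α

/-- Maximum of the above over all windows of `α` consecutive columns inside `[1, d]`. -/
def maxMissFracRow {n : ℕ} (d α : ℕ) (T : ℕ → Finset (Fin n)) : ℝ :=
  ⨆ s : {s : ℕ // 1 ≤ s ∧ s + α ≤ d + 1}, missFracWindow α s T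

/-- The observation: entries in the missing set are replaced by zero. -/
def mask {n : ℕ} (T : Finset (Fin n)) (v : Fin n → ℝ) : Fin n → ℝ :=
  fun i => if i ∈ T then 0 else v i

/-- The amount of the `j`-th change; `dif 0` is measured from the zero initialization. -/
def dif {n r : ℕ} (P : ℕ → Matrix (Fin n) (Fin r) ℝ) : ℕ → ℝ
  | 0 => sinTheta 0 (P 0)
  | j + 1 => sinTheta (P j) (P (j + 1))

/-! ### The algorithm -/

/-- Columns of `Ψ = I - P Pᵀ` indexed by `T`. -/
def psiCols {n r : ℕ} (P : Matrix (Fin n) (Fin r) ℝ) (T : Finset (Fin n)) :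
    Matrix (Fin n) {i // i ∈ T} ℝ :=
  (perp P).submatrix id Subtype.val

/-- The matrix `Ψ_Tᵀ Ψ_T` inverted in the projected least squares step. -/
def lsGram {n r : ℕ} (P : Matrix (Fin n) (Fin r) ℝ) (T : Finset (Fin n)) :
    Matrix {i // i ∈ T} {i // i ∈ T} ℝ :=
  (psiCols P T)ᵀ * psiCols P T

/-- Projected least squares: `y - I_T (Ψ_Tᵀ Ψ_T)⁻¹ Ψ_Tᵀ (Ψ y)`. -/
def projLS {n r : ℕ} (P : Matrix (Fin n) (Fin r) ℝ) (T : Finset (Fin n)) (y : Fin n → ℝ) :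
    Fin n → ℝ :=
  fun i => y i -
    if h : i ∈ T then
      ((lsGram P T)⁻¹ *ᵥ ((psiCols P T)ᵀ *ᵥ (perp P *ᵥ y))) ⟨i, h⟩
    else 0

/-- State after a frame.  `Phat` and `lhat` are the outputs; `that j` is the `j`-th change
detection time once it exists; `tfin`, `Pfin` are the time at which the last update phase ended
and the estimate it produced. -/
structure State (n r : ℕ) where
  Phat : Matrix (Fin n) (Fin r) ℝ
  lhat : ℕ → Fin n → ℝ
  updating : Bool
  j : ℕ
  that : ℕ → Option ℕ
  tfin : ℕ
  Pfin : Matrix (Fin n) (Fin r) ℝ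

/-- Zero initialization, in the update phase for the initial subspace. -/
def State.init (n r : ℕ) : State n r where
  Phat := 0
  lhat := fun _ => 0
  updating := true
  j := 0
  that := fun j => if j = 0 then some 0 else none
  tfin := 0
  Pfin := 0

/-- The matrix of the last `α` estimates `[lhat (t-α+1), …, lhat t]`. -/
def window {n : ℕ} (α : ℕ) (lhat : ℕ → Fin n → ℝ) (t : ℕ) : Matrix (Fin n) (Fin α) ℝ :=
  Matrix.of fun i k => lhat (t + 1 + k - α) i

/-- Projected least squares at frame `t`. -/
def stepLS {n r : ℕ} (t : ℕ) (y : Fin n → ℝ) (T : Finset (Fin n)) (S : State n r) : State n r :=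
  { S with lhat := Function.update S.lhat t (projLS S.Phat T y) }

open Classical in
/-- Update phase: at `t = t̂_j + u α - 1`, `u = 1, 2, …`, re-estimate the subspace. -/
def stepUpdate {n r : ℕ} (α : ℕ) (svd : Matrix (Fin n) (Fin α) ℝ → Matrix (Fin n) (Fin r) ℝ)
    (t : ℕ) (S : State n r) : State n r :=
  if S.updating = true ∧ ∃ τ u, S.that S.j = some τ ∧ 1 ≤ u ∧ t + 1 = τ + u * α then
    { S with Phat := svd (window α S.lhat t) }
  else S

open Classical in
/-- End of the update phase: at `t = t̂_j + K α - 1`, switch to the detect phase. -/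
def stepFinish {n r : ℕ} (α K : ℕ) (t : ℕ) (S : State n r) : State n r :=
  if S.updating = true ∧ ∃ τ, S.that S.j = some τ ∧ t + 1 = τ + K * α then
    { S with tfin := t, Pfin := S.Phat, j := S.j + 1, updating := false }
  else S

open Classical in
/-- Detect phase: at `t = t̂_{j-1,fin} + u α`, `u = 1, 2, …`, test for a change. -/
def stepDetect {n r : ℕ} (α : ℕ) (thr : ℝ) (t : ℕ) (S : State n r) : State n r :=
  if S.updating = false ∧ (∃ u, 1 ≤ u ∧ t = S.tfin + u * α) ∧
      α * thr ≤ lamMaxGram (perp S.Pfin * window α S.lhat t) then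
    { S with updating := true, that := Function.update S.that S.j (some t) }
  else S

/-- The algorithm NORST-miss: the state after frame `t`, on input frames `(y 1, T 1), (y 2, T 2), …`,
with window length `α`, number of updates `K` and detection threshold `thr`. -/
def run {n r : ℕ} (α K : ℕ) (thr : ℝ)
    (svd : Matrix (Fin n) (Fin α) ℝ → Matrix (Fin n) (Fin r) ℝ)
    (y : ℕ → Fin n → ℝ) (T : ℕ → Finset (Fin n)) : ℕ → State n r
  | 0 => State.init n r
  | t + 1 =>
    stepDetect α thr (t + 1) <| stepFinish α K (t + 1) <| stepUpdate α svd (t + 1) <|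
      stepLS (t + 1) (y (t + 1)) (T (t + 1)) (run α K thr svd y T t)

/-! ### A real-number machine with a step count

A machine has `s` real registers.  At each frame it runs a program (a tree of instructions and
comparisons) chosen according to the missing set of that frame alone; registers are kept from
frame to frame. -/

/-- Instructions.  `svd` applies the `r`-SVD routine to an `n × α` matrix held in registers. -/
inductive Instr (n r α s : ℕ)
  | const (dst : Fin s) (c : ℝ)
  | copy (dst a : Fin s)
  | load (dst : Fin s) (i : Fin n)
  | add (dst a b : Fin s)
  | sub (dst a b : Fin s)
  | mul (dst a b : Fin s)
  | div (dst a b : Fin s)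
  | svd (src : Fin n → Fin α → Fin s) (dst : Fin n × Fin r ↪ Fin s)

/-- Effect of an instruction on the registers; `y` is the observed vector of the frame. -/
def Instr.exec {n r α s : ℕ} (svd : Matrix (Fin n) (Fin α) ℝ → Matrix (Fin n) (Fin r) ℝ)
    (y : Fin n → ℝ) (reg : Fin s → ℝ) : Instr n r α s → (Fin s → ℝ)
  | .const dst c => Function.update reg dst c
  | .copy dst a => Function.update reg dst (reg a)
  | .load dst i => Function.update reg dst (y i)
  | .add dst a b => Function.update reg dst (reg a + reg b)
  | .sub dst a b => Function.update reg dst (reg a - reg b)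
  | .mul dst a b => Function.update reg dst (reg a * reg b)
  | .div dst a b => Function.update reg dst (reg a / reg b)
  | .svd src dst =>
    Function.extend dst (fun p => svd (Matrix.of fun i k => reg (src i k)) p.1 p.2) reg

/-- Cost of an instruction: unit cost, except that the `r`-SVD of an `n × α` matrix is charged
`n α r ⌈log (1/ε)⌉`. -/
def Instr.cost {n r α s : ℕ} (ε : ℝ) : Instr n r α s → ℕ
  | .svd _ _ => n * α * r * ⌈Real.log (1 / ε)⌉₊
  | _ => 1

/-- Programs: halt, execute an instruction and go on, or branch on a comparison of registers. -/
inductive Prog (n r α s : ℕ)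
  | halt
  | seq (i : Instr n r α s) (p : Prog n r α s)
  | branch (a b : Fin s) (ifLE ifGT : Prog n r α s)

open Classical in
/-- Final registers and number of steps of a program. -/
def Prog.exec {n r α s : ℕ} (svd : Matrix (Fin n) (Fin α) ℝ → Matrix (Fin n) (Fin r) ℝ)
    (ε : ℝ) (y : Fin n → ℝ) : Prog n r α s → (Fin s → ℝ) → (Fin s → ℝ) × ℕ
  | .halt, reg => (reg, 0)
  | .seq i p, reg =>
    let q := Prog.exec svd ε y p (i.exec svd y reg)
    (q.1, i.cost ε + q.2)
  | .branch a b p₁ p₂, reg =>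
    let q := if reg a ≤ reg b then Prog.exec svd ε y p₁ reg else Prog.exec svd ε y p₂ reg
    (q.1, 1 + q.2)

/-- A machine with `s` registers: the program for each missing set, and the registers in which
the estimates of the data vector and of the subspace are found after each frame. -/
structure Machine (n r α s : ℕ) where
  code : Finset (Fin n) → Prog n r α s
  outL : Fin n → Fin s
  outP : Fin n → Fin r → Fin s

/-- Registers after frame `t` and total time spent on frames `1, …, t`, starting from zero
registers.  Reading the missing set of a frame is charged `n`. -/
def Machine.run {n r α s : ℕ} (M : Machine n r α s)
    (svd : Matrix (Fin n) (Fin α) ℝ → Matrix (Fin n) (Fin r) ℝ) (ε : ℝ)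
    (y : ℕ → Fin n → ℝ) (T : ℕ → Finset (Fin n)) : ℕ → (Fin s → ℝ) × ℕ
  | 0 => (fun _ => 0, 0)
  | t + 1 =>
    let q := (M.code (T (t + 1))).exec svd ε (y (t + 1)) (M.run svd ε y T t).1
    (q.1, (M.run svd ε y T t).2 + (n + q.2))

end NORST

end

/-! The proof combines a deterministic analysis of the algorithm on good paths, a probability bound
for good paths, and a simulation by a machine.

Deterministic part. Let Q be the estimate in force at frame t and q = sinθ(Q, P). If Q is incoherent
enough on the missing set T, least squares returns P a + E a, where E = `lsErr` is linear, supported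
on the rows in T, and of norm at most 1.2 q. Over a window of α frames the Gram matrix of the
estimates is P A Pᵀ + H, with A = Σ a aᵀ close to αΛ and H made of signal-error cross terms and
squared errors. Because E acts only on rows in T and every row is rarely missing, Cauchy-Schwarz
makes ‖H‖ a small multiple of q α λ⁻. The loss is f times the square root of the row fraction, which
is why that fraction has to be of order 1/f². A sin Theta theorem (`IsTopLeftSingular.sinTheta_le`)
then shows that each re-estimation multiplies the error by at most 0.02
(`RegularWindow.sinTheta_le`). The same expansion bounds the detection statistic by 1.5 α ε² λ⁺ when
nothing has changed, and below by 0.9 α λ⁻ q² in a window lying after a change (`lamMaxGram_lt`,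
`le_lamMaxGram`). A test window that straddles a change may go either way, but the next one must
raise the alarm, whence the delay of at most 2α. `TrackingModel.cycle` treats one update-detect
cycle, and an induction over the changes concludes.

Probability. The maps E depend on the past through Q, so concentration is needed for sums of M (a aᵀ
- Λ) Mᵀ with predictable M. Golden-Thompson gives a one-step bound for the trace exponential, and
independence of the new coefficient from the past lets it be iterated
(`AdaptedCoeffs.measure_quadratic_le`). Taking for M the identity stacked on E / (1.2 q) controls
signal, cross and error terms at once, each with the right power of q. The times chosen by the
algorithm are random, but the good event concerns every deterministic window with the estimate held
just before it, so a union bound over at most d windows suffices (`measure_not_regularPath_le`).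

Complexity. The |T| × |T| least squares system is replaced by an r × r one, whose inverse is built
by |T| rank-one updates. Since |T| r ≤ n, a frame costs O(nr) plus O(α) for bookkeeping. Work of
order n r α log(1/ε) is done only when the buffer of α columns is full, which happens at most once
in α - 1 frames. `Represents` is the simulation invariant. -/

noncomputable section

section

namespace NORST

open scoped Matrix.Norms.L2Operator
open Filter Topology

/-! ### Trace inequalities for powers of products of symmetric matrices. -/

section TraceInequalities

set_option linter.unusedSectionVars false

variable {ι : Type*} [Fintype ι] [DecidableEq ι]

lemma trace_mul_pow_comm (A B : Matrix ι ι ℝ) (m : ℕ) :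
    ((A * B) ^ m).trace = ((B * A) ^ m).trace := by
  cases m with
  | zero => simp
  | succ m =>
    have h : (A * B) ^ (m + 1) = A * ((B * A) ^ m * B) := by
      induction m with
      | zero => simp
      | succ m ih => rw [pow_succ, ih, pow_succ]; simp only [Matrix.mul_assoc]
    rw [h, Matrix.trace_mul_comm, Matrix.mul_assoc, ← pow_succ]

lemma trace_transpose_mul_self_nonneg (A : Matrix ι ι ℝ) : 0 ≤ (Aᵀ * A).trace := by
  simp only [Matrix.trace, Matrix.diag, Matrix.mul_apply, Matrix.transpose_apply]
  exact Finset.sum_nonneg fun i _ => Finset.sum_nonneg fun j _ => mul_self_nonneg _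

lemma two_mul_trace_mul_le {S T : Matrix ι ι ℝ} (hS : Sᵀ = S) (hT : Tᵀ = T) :
    2 * (S * T).trace ≤ (S * S).trace + (T * T).trace := by
  have h := trace_transpose_mul_self_nonneg (S - T)
  simp only [Matrix.transpose_sub, hS, hT, Matrix.sub_mul, Matrix.mul_sub, Matrix.trace_sub] at h
  rw [Matrix.trace_mul_comm T S] at h
  linarith

/-- Both signs come from the nonnegative squared Frobenius norms of X - Xᵀ and X + Xᵀ. -/
lemma abs_trace_mul_self_le (X : Matrix ι ι ℝ) : |(X * X).trace| ≤ (Xᵀ * X).trace := by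
  have h1 := trace_transpose_mul_self_nonneg (X - Xᵀ)
  have h2 := trace_transpose_mul_self_nonneg (X + Xᵀ)
  have e : (Xᵀ * Xᵀ).trace = (X * X).trace := by
    rw [← Matrix.transpose_mul, Matrix.trace_transpose]
  have e' : (X * Xᵀ).trace = (Xᵀ * X).trace := Matrix.trace_mul_comm _ _
  simp only [Matrix.transpose_sub, Matrix.transpose_add, Matrix.transpose_transpose,
    Matrix.sub_mul, Matrix.mul_sub, Matrix.trace_sub, Matrix.add_mul, Matrix.mul_add,
    Matrix.trace_add] at h1 h2
  rw [abs_le]; constructor <;> linarith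

/-- The two inequalities feed each other and are proved by one induction, doubling the exponent at
each step. Exponents that are powers of two are enough for Golden-Thompson and need no positivity of
P and R. -/
lemma abs_trace_pow_le_and_liebThirring (k : ℕ) :
    (∀ X : Matrix ι ι ℝ, |(X ^ (2 * 2 ^ k)).trace| ≤ ((Xᵀ * X) ^ (2 ^ k)).trace) ∧
    (∀ P R : Matrix ι ι ℝ, Pᵀ = P → Rᵀ = R →
      ((P * R) ^ (2 ^ k)).trace ≤ (P ^ (2 ^ k) * R ^ (2 ^ k)).trace) := by
  induction k with
  | zero =>
    refine ⟨fun X => ?_, fun P R _ _ => by simp⟩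
    simpa [pow_two] using abs_trace_mul_self_le X
  | succ k ih =>
    obtain ⟨ihA, ihL⟩ := ih
    constructor
    -- The bound for X² leads to the product (XᵀX)(XXᵀ). The second inequality separates the
    -- factors, and 2 tr(ST) ≤ tr S² + tr T² merges them, since XᵀX and XXᵀ have powers of equal
    -- trace.
    · intro X
      have h1 := ihA (X ^ 2)
      rw [← pow_mul] at h1
      have e1 : 2 * (2 * 2 ^ k) = 2 * 2 ^ (k + 1) := by ring
      rw [e1] at h1
      have e2 : (X ^ 2)ᵀ * X ^ 2 = (Xᵀ) * (Xᵀ * X * X) := by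
        rw [pow_two, Matrix.transpose_mul]; simp only [Matrix.mul_assoc]
      rw [e2, trace_mul_pow_comm] at h1
      have e3 : Xᵀ * X * X * Xᵀ = (Xᵀ * X) * (X * Xᵀ) := by simp only [Matrix.mul_assoc]
      rw [e3] at h1
      have hP : (Xᵀ * X)ᵀ = Xᵀ * X := by simp
      have hR : (X * Xᵀ)ᵀ = X * Xᵀ := by simp
      have h2 := ihL (Xᵀ * X) (X * Xᵀ) hP hR
      have h3 := two_mul_trace_mul_le (S := (Xᵀ * X) ^ 2 ^ k) (T := (X * Xᵀ) ^ 2 ^ k)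
        (by rw [Matrix.transpose_pow, hP]) (by rw [Matrix.transpose_pow, hR])
      rw [← pow_add, ← pow_add, trace_mul_pow_comm X Xᵀ] at h3
      have e4 : 2 ^ k + 2 ^ k = 2 ^ (k + 1) := by ring
      rw [e4] at h3
      linarith
    -- The first inequality for X = PR gives, after a cyclic shift, a power of P²R², to which the
    -- second applies with half the exponent.
    · intro P R hP hR
      have h1 := ihA (P * R)
      have e1 : 2 * 2 ^ k = 2 ^ (k + 1) := by ring
      have e2 : (P * R)ᵀ * (P * R) = R * (P * P * R) := by
        rw [Matrix.transpose_mul, hP, hR]; simp only [Matrix.mul_assoc]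
      rw [e2, trace_mul_pow_comm R, Matrix.mul_assoc (P * P)] at h1
      have h2 := ihL (P * P) (R * R) (by rw [Matrix.transpose_mul, hP])
        (by rw [Matrix.transpose_mul, hR])
      rw [← pow_two P, ← pow_two R, ← pow_mul, ← pow_mul] at h2
      rw [← pow_two P, ← pow_two R] at h1
      rw [e1] at h1 h2
      exact (le_abs_self _).trans (h1.trans h2)

end TraceInequalities

/-! ### The Lie product formula in a Banach algebra. -/

section Trotter

variable {𝔸 : Type*} [NormedRing 𝔸] [NormOneClass 𝔸]

lemma norm_pow_sub_pow_le (X Y : 𝔸) {c : ℝ} (hX : ‖X‖ ≤ c) (hY : ‖Y‖ ≤ c) (m : ℕ) :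
    ‖X ^ (m + 1) - Y ^ (m + 1)‖ ≤ (m + 1) * (‖X - Y‖ * c ^ m) := by
  have hc : 0 ≤ c := (norm_nonneg X).trans hX
  induction m with
  | zero => simp
  | succ m ih =>
    have e : X ^ (m + 1 + 1) - Y ^ (m + 1 + 1) =
        (X ^ (m + 1) - Y ^ (m + 1)) * X + Y ^ (m + 1) * (X - Y) := by
      rw [pow_succ X (m + 1), pow_succ Y (m + 1)]; noncomm_ring
    rw [e]
    have hYm : ‖Y ^ (m + 1)‖ ≤ c ^ (m + 1) :=
      (norm_pow_le Y (m + 1)).trans (pow_le_pow_left₀ (norm_nonneg _) hY _)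
    have h1 : ‖(X ^ (m + 1) - Y ^ (m + 1)) * X‖ ≤ ((m + 1) * (‖X - Y‖ * c ^ m)) * c :=
      (norm_mul_le _ _).trans (mul_le_mul ih hX (norm_nonneg _) (by positivity))
    have h2 : ‖Y ^ (m + 1) * (X - Y)‖ ≤ c ^ (m + 1) * ‖X - Y‖ :=
      (norm_mul_le _ _).trans (mul_le_mul_of_nonneg_right hYm (norm_nonneg _))
    refine (norm_add_le _ _).trans ((add_le_add h1 h2).trans (le_of_eq ?_))
    push_cast; ring

variable [NormedAlgebra ℝ 𝔸]

lemma norm_exp_le (x : 𝔸) : ‖NormedSpace.exp x‖ ≤ Real.exp ‖x‖ := by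
  rw [NormedSpace.exp_eq_tsum ℝ, Real.exp_eq_exp_ℝ, NormedSpace.exp_eq_tsum_div]
  refine tsum_of_norm_bounded (NormedSpace.expSeries_div_summable ‖x‖).hasSum fun m => ?_
  rw [norm_smul, norm_inv, Real.norm_natCast, div_eq_inv_mul]
  exact mul_le_mul_of_nonneg_left (norm_pow_le x m) (by positivity)

variable [CompleteSpace 𝔸]

/-- The Lie product formula. -/
lemma tendsto_exp_mul_exp_pow (A B : 𝔸) :
    Tendsto (fun p : ℕ => (NormedSpace.exp (((p + 1 : ℕ) : ℝ)⁻¹ • A) *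
      NormedSpace.exp (((p + 1 : ℕ) : ℝ)⁻¹ • B)) ^ (p + 1)) atTop (𝓝 (NormedSpace.exp (A + B))) := by
  let _ : NormedAlgebra ℚ 𝔸 := NormedAlgebra.restrictScalars ℚ ℝ 𝔸
  set s : ℕ → ℝ := fun p => ((p + 1 : ℕ) : ℝ)⁻¹ with hs
  have hspos : ∀ p, 0 < s p := fun p => by simp only [hs]; positivity
  have hs0 : Tendsto s atTop (𝓝 0) :=
    (tendsto_inv_atTop_zero.comp tendsto_natCast_atTop_atTop).comp (tendsto_add_atTop_nat 1)
  -- The local error of one splitting step vanishes together with its derivative at 0, so it is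
  -- o(1/(p+1)). The telescoping bound `norm_pow_sub_pow_le` multiplies it by p + 1 only.
  let g : ℝ → 𝔸 := fun u => NormedSpace.exp (u • A) * NormedSpace.exp (u • B) -
    NormedSpace.exp (u • (A + B))
  have hg : HasDerivAt g 0 0 := by
    have h := ((hasDerivAt_exp_smul_const (𝕂 := ℝ) A (0 : ℝ)).mul
      (hasDerivAt_exp_smul_const (𝕂 := ℝ) B (0 : ℝ))).sub
      (hasDerivAt_exp_smul_const (𝕂 := ℝ) (A + B) (0 : ℝ))
    convert! h using 1
    simp
  have hg0 : g 0 = 0 := by simp [g]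
  have hlim : Tendsto (fun p => (s p)⁻¹ * ‖g (s p)‖) atTop (𝓝 0) := by
    have h := hasDerivAt_iff_isLittleO_nhds_zero.mp hg
    simp only [zero_add, hg0, sub_zero, smul_zero] at h
    have h2 := (h.comp_tendsto hs0).norm_norm.tendsto_div_nhds_zero
    refine h2.congr fun p => ?_
    simp only [Function.comp_apply, Real.norm_eq_abs, abs_of_pos (hspos p)]
    field_simp
  set M : ℝ := ‖A‖ + ‖B‖
  have hbound : ∀ p, ‖(NormedSpace.exp (s p • A) * NormedSpace.exp (s p • B)) ^ (p + 1) -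
      NormedSpace.exp (A + B)‖ ≤ Real.exp M * ((s p)⁻¹ * ‖g (s p)‖) := by
    intro p
    have hY : NormedSpace.exp (A + B) = (NormedSpace.exp (s p • (A + B))) ^ (p + 1) := by
      rw [← NormedSpace.exp_nsmul, ← Nat.cast_smul_eq_nsmul ℝ, smul_smul]
      simp only [hs]
      rw [mul_inv_cancel₀ (by positivity), one_smul]
    have hne : ∀ Z : 𝔸, ‖NormedSpace.exp Z‖ ≤ Real.exp ‖Z‖ := norm_exp_le
    have h1 : ‖NormedSpace.exp (s p • A) * NormedSpace.exp (s p • B)‖ ≤ Real.exp (s p * M) := by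
      refine (norm_mul_le _ _).trans ((mul_le_mul (hne _) (hne _) (norm_nonneg _)
        (Real.exp_nonneg _)).trans (le_of_eq ?_))
      rw [← Real.exp_add, norm_smul, norm_smul, Real.norm_eq_abs, abs_of_pos (hspos p), mul_add]
    have h2 : ‖NormedSpace.exp (s p • (A + B))‖ ≤ Real.exp (s p * M) := by
      refine (hne _).trans (Real.exp_le_exp.mpr ?_)
      rw [norm_smul, Real.norm_eq_abs, abs_of_pos (hspos p)]
      exact mul_le_mul_of_nonneg_left (norm_add_le _ _) (hspos p).le
    rw [hY]
    refine (norm_pow_sub_pow_le _ _ h1 h2 p).trans ?_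
    have h3 : Real.exp (s p * M) ^ p ≤ Real.exp M := by
      rw [← Real.exp_nat_mul]
      refine Real.exp_le_exp.mpr ?_
      have : (p : ℝ) * s p ≤ 1 := by
        simp only [hs]; rw [← div_eq_mul_inv, div_le_one (by positivity)]; push_cast; linarith
      have hM : 0 ≤ M := by positivity
      nlinarith
    have e : (p : ℝ) + 1 = (s p)⁻¹ := by simp [hs]
    rw [e]
    have : (s p)⁻¹ * (‖g (s p)‖ * Real.exp (s p * M) ^ p) ≤ (s p)⁻¹ * (‖g (s p)‖ * Real.exp M) := by
      have := hspos p
      gcongr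
    calc _ ≤ _ := this
      _ = _ := by ring
  rw [tendsto_iff_norm_sub_tendsto_zero]
  refine squeeze_zero (fun _ => norm_nonneg _) hbound ?_
  simpa using hlim.const_mul (Real.exp M)

end Trotter

/-! ### The Golden-Thompson inequality and the one-step exponential estimate. -/

section MatrixExp

variable {ι : Type*} [Fintype ι] [DecidableEq ι]

lemma transpose_exp {A : Matrix ι ι ℝ} (hA : Aᵀ = A) :
    (NormedSpace.exp A)ᵀ = NormedSpace.exp A := by
  rw [← Matrix.exp_transpose, hA]

/-- The Golden-Thompson inequality. -/
theorem trace_exp_add_le {A B : Matrix ι ι ℝ} (hA : Aᵀ = A) (hB : Bᵀ = B) :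
    (NormedSpace.exp (A + B)).trace ≤ (NormedSpace.exp A * NormedSpace.exp B).trace := by
  cases isEmpty_or_nonempty ι with
  | inl h => simp [Matrix.trace]
  | inr h =>
  have hlim := tendsto_exp_mul_exp_pow A B
  -- The product formula is used along p + 1 = 2^k, where the trace inequality is available. Its
  -- right-hand side does not depend on k, because the 2^k-th power of exp(2^(-k) Z) is exp Z.
  have hsub : Tendsto (fun k : ℕ => 2 ^ k - 1) atTop atTop := by
    refine tendsto_atTop_mono (fun k => ?_) tendsto_id
    have := Nat.lt_two_pow_self (n := k)
    simp only [id]; omega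
  have hcont : Continuous fun M : Matrix ι ι ℝ => M.trace := by fun_prop
  have h2 := (hcont.tendsto _).comp (hlim.comp hsub)
  refine le_of_tendsto h2 (Eventually.of_forall fun k => ?_)
  have e : 2 ^ k - 1 + 1 = 2 ^ k := Nat.sub_add_cancel Nat.one_le_two_pow
  simp only [Function.comp_apply, e]
  have hsm : ∀ Z : Matrix ι ι ℝ, NormedSpace.exp ((((2 : ℕ) ^ k : ℕ) : ℝ)⁻¹ • Z) ^ 2 ^ k =
      NormedSpace.exp Z := by
    intro Z
    rw [← Matrix.exp_nsmul, ← Nat.cast_smul_eq_nsmul ℝ, smul_smul,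
      mul_inv_cancel₀ (by positivity), one_smul]
  have h := (abs_trace_pow_le_and_liebThirring k).2 (NormedSpace.exp ((((2 : ℕ) ^ k : ℕ) : ℝ)⁻¹ • A))
    (NormedSpace.exp ((((2 : ℕ) ^ k : ℕ) : ℝ)⁻¹ • B))
    (transpose_exp (by rw [Matrix.transpose_smul, hA]))
    (transpose_exp (by rw [Matrix.transpose_smul, hB]))
  rwa [hsm, hsm] at h

/-- One orthogonal matrix diagonalizes Z and its exponential, so scalar inequalities on eigenvalues
of size at most ‖Z‖ transfer to matrices. -/
lemma exists_orthogonal_diagonalization {Z : Matrix ι ι ℝ} (hZ : Zᵀ = Z) :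
    ∃ (U : Matrix ι ι ℝ) (d : ι → ℝ), U * Uᵀ = 1 ∧ Uᵀ * U = 1 ∧ Z = U * diagonal d * Uᵀ ∧
      NormedSpace.exp Z = U * diagonal (fun i => Real.exp (d i)) * Uᵀ ∧ ∀ i, |d i| ≤ ‖Z‖ := by
  have hH : Z.IsHermitian := by rw [Matrix.IsHermitian, conjTranspose_eq_transpose_of_trivial, hZ]
  set U : Matrix ι ι ℝ := (hH.eigenvectorUnitary : Matrix ι ι ℝ)
  have hU1 : U * Uᵀ = 1 := by
    have := Unitary.mul_star_self_of_mem hH.eigenvectorUnitary.2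
    rwa [star_eq_conjTranspose, conjTranspose_eq_transpose_of_trivial] at this
  have hU2 : Uᵀ * U = 1 := by
    have := Unitary.star_mul_self_of_mem hH.eigenvectorUnitary.2
    rwa [star_eq_conjTranspose, conjTranspose_eq_transpose_of_trivial] at this
  have hZ' : Z = U * diagonal hH.eigenvalues * Uᵀ := by
    have := hH.spectral_theorem
    rw [Unitary.conjStarAlgAut_apply, star_eq_conjTranspose,
      conjTranspose_eq_transpose_of_trivial] at this
    exact this
  have hinv : U⁻¹ = Uᵀ := Matrix.inv_eq_left_inv hU2
  refine ⟨U, hH.eigenvalues, hU1, hU2, hZ', ?_, fun i => ?_⟩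
  · have : NormedSpace.exp (U * diagonal hH.eigenvalues * U⁻¹) =
        U * NormedSpace.exp (diagonal hH.eigenvalues) * U⁻¹ :=
      Matrix.exp_conj U _ (IsUnit.of_mul_eq_one _ hU1)
    rw [hinv, ← hZ', Matrix.exp_diagonal] at this
    rw [this]
    congr 3
    ext i
    rw [Pi.coe_exp, Real.exp_eq_exp_ℝ]
  · cases isEmpty_or_nonempty ι with
    | inl h => exact isEmptyElim i
    | inr h =>
    exact spectrum.norm_le_norm_of_mem (hH.eigenvalues_mem_spectrum_real i)

lemma dotProduct_mulVec_conj_diagonal (U : Matrix ι ι ℝ) (d v : ι → ℝ) :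
    v ⬝ᵥ (U * diagonal d * Uᵀ) *ᵥ v = ∑ i, d i * (Uᵀ *ᵥ v) i ^ 2 := by
  rw [← Matrix.mulVec_mulVec, ← Matrix.mulVec_mulVec, Matrix.dotProduct_mulVec,
    ← Matrix.mulVec_transpose]
  simp only [dotProduct, Matrix.mulVec_diagonal]
  exact Finset.sum_congr rfl fun i _ => by ring

/-- A Rayleigh quotient is a weighted mean of eigenvalues, so some eigenvalue is at least as large,
and its exponential is one of the positive terms of the trace. This turns a large quadratic form
into a large trace exponential. -/
lemma exp_dotProduct_le_trace_exp {Z : Matrix ι ι ℝ} (hZ : Zᵀ = Z) {v : ι → ℝ}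
    (hv : v ⬝ᵥ v = 1) : Real.exp (v ⬝ᵥ Z *ᵥ v) ≤ (NormedSpace.exp Z).trace := by
  obtain ⟨U, d, h1, h2, h3, h4, -⟩ := exists_orthogonal_diagonalization hZ
  set w := Uᵀ *ᵥ v
  have hw : ∑ i, w i ^ 2 = 1 := by
    have : w ⬝ᵥ w = 1 := by
      simp only [w]
      rw [Matrix.dotProduct_mulVec, Matrix.vecMul_transpose, Matrix.mulVec_mulVec, h1,
        Matrix.one_mulVec, hv]
    rw [← this]; simp [dotProduct, pow_two]
  have htr : (NormedSpace.exp Z).trace = ∑ i, Real.exp (d i) := by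
    rw [h4, Matrix.trace_mul_cycle, h2, Matrix.one_mul, Matrix.trace_diagonal]
  have hq : v ⬝ᵥ Z *ᵥ v = ∑ i, d i * w i ^ 2 := by
    conv_lhs => rw [h3]
    exact dotProduct_mulVec_conj_diagonal U d v
  obtain ⟨i, hi⟩ : ∃ i, v ⬝ᵥ Z *ᵥ v ≤ d i := by
    by_contra! hcon
    have hlt : ∑ i, d i * w i ^ 2 ≤ ∑ i, (v ⬝ᵥ Z *ᵥ v) * w i ^ 2 :=
      Finset.sum_le_sum fun i _ => mul_le_mul_of_nonneg_right (hcon i).le (sq_nonneg _)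
    have hstrict : ∑ i, d i * w i ^ 2 < ∑ i, (v ⬝ᵥ Z *ᵥ v) * w i ^ 2 := by
      refine Finset.sum_lt_sum (fun i _ => mul_le_mul_of_nonneg_right (hcon i).le (sq_nonneg _)) ?_
      by_contra! hall
      have : ∀ i, w i ^ 2 = 0 := fun i => by
        have := hall i (Finset.mem_univ i)
        have h5 := hcon i
        have h6 := sq_nonneg (w i)
        nlinarith
      simp [this] at hw
    rw [← Finset.mul_sum, hw, mul_one, ← hq] at hstrict
    exact lt_irrefl _ hstrict
  rw [htr]
  exact (Real.exp_le_exp.mpr hi).trans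
    (Finset.single_le_sum (f := fun i => Real.exp (d i)) (fun i _ => (Real.exp_pos _).le)
      (Finset.mem_univ i))

/-- Diagonalization reduces this to the scalar inequality exp x ≤ 1 + x + x² for |x| ≤ 1, weighted
by the squared entries of S U. -/
lemma trace_conj_exp_le {X : Matrix ι ι ℝ} (hX : Xᵀ = X) (hn : ‖X‖ ≤ 1) (S : Matrix ι ι ℝ) :
    (S * NormedSpace.exp X * Sᵀ).trace ≤ (S * (1 + X + X * X) * Sᵀ).trace := by
  obtain ⟨U, d, h1, h2, h3, h4, h5⟩ := exists_orthogonal_diagonalization hX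
  have hd : 1 + X + X * X = U * diagonal (fun i => 1 + d i + d i ^ 2) * Uᵀ := by
    have hXX : X * X = U * diagonal (fun i => d i ^ 2) * Uᵀ := by
      rw [h3]
      calc U * diagonal d * Uᵀ * (U * diagonal d * Uᵀ)
          = U * diagonal d * (Uᵀ * U) * diagonal d * Uᵀ := by simp only [Matrix.mul_assoc]
        _ = U * (diagonal d * diagonal d) * Uᵀ := by rw [h2]; simp only [Matrix.mul_assoc, Matrix.one_mul]
        _ = _ := by rw [diagonal_mul_diagonal]; simp only [pow_two]
    have hone : (1 : Matrix ι ι ℝ) = U * diagonal (fun _ => (1 : ℝ)) * Uᵀ := by simp [h1]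
    rw [hXX, hone]
    conv_lhs => rw [h3]
    rw [← Matrix.add_mul, ← Matrix.add_mul, ← Matrix.mul_add, ← Matrix.mul_add, diagonal_add,
      diagonal_add]
  rw [hd, h4]
  have key : ∀ c : ι → ℝ, (S * (U * diagonal c * Uᵀ) * Sᵀ).trace = ∑ i, c i * ∑ k, (S * U) k i ^ 2 := by
    intro c
    have : S * (U * diagonal c * Uᵀ) * Sᵀ = (S * U) * diagonal c * (S * U)ᵀ := by
      rw [Matrix.transpose_mul]; simp only [Matrix.mul_assoc]
    rw [this, Matrix.trace]
    simp only [Matrix.diag]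
    simp_rw [Matrix.mul_apply (M := S * U * diagonal c), mul_diagonal, Matrix.transpose_apply]
    rw [Finset.sum_comm]
    refine Finset.sum_congr rfl fun i _ => ?_
    rw [Finset.mul_sum]
    exact Finset.sum_congr rfl fun k _ => by ring
  rw [key, key]
  refine Finset.sum_le_sum fun i _ => mul_le_mul_of_nonneg_right ?_
    (Finset.sum_nonneg fun k _ => sq_nonneg _)
  have := Real.abs_exp_sub_one_sub_id_le ((h5 i).trans hn)
  have := (abs_le.mp this).2
  linarith

lemma exp_eq_mul_transpose {Z : Matrix ι ι ℝ} (hZ : Zᵀ = Z) :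
    NormedSpace.exp Z = (NormedSpace.exp ((2 : ℝ)⁻¹ • Z))ᵀ * NormedSpace.exp ((2 : ℝ)⁻¹ • Z) := by
  rw [transpose_exp (by rw [Matrix.transpose_smul, hZ]), ← pow_two, ← Matrix.exp_nsmul,
    ← Nat.cast_smul_eq_nsmul ℝ, smul_smul]
  norm_num

/-- One step of the matrix Laplace transform method. -/
lemma trace_exp_add_le_of_norm_le_one {Z X : Matrix ι ι ℝ} (hZ : Zᵀ = Z) (hX : Xᵀ = X)
    (hn : ‖X‖ ≤ 1) :
    (NormedSpace.exp (Z + X)).trace ≤ (NormedSpace.exp Z * (1 + X + X * X)).trace := by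
  refine (trace_exp_add_le hZ hX).trans ?_
  -- Writing exp Z = SᵀS with S = exp(Z/2) turns the trace against exp Z into a conjugated trace,
  -- which is monotone in the other factor.
  have h := trace_conj_exp_le hX hn (NormedSpace.exp ((2 : ℝ)⁻¹ • Z))
  rw [exp_eq_mul_transpose hZ]
  set S := NormedSpace.exp ((2 : ℝ)⁻¹ • Z)
  have key : ∀ Y : Matrix ι ι ℝ, (S * Y * Sᵀ).trace = (Sᵀ * S * Y).trace := fun Y =>
    Matrix.trace_mul_cycle S Y Sᵀ
  rwa [key, key] at h

end MatrixExp

end NORST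

end


section

namespace NORST

open scoped Matrix.Norms.L2Operator
open Filter Topology

/-! ### Independence of a new coefficient vector from the past and from all missing sets. -/

section Independence

variable {Ω : Type*}

/-- The intersections A ∩ B form a π-system generating the join, and on it the product rule follows
by using first `h1` and then `h2`. -/
lemma indep_sup_left {mX mY mW : MeasurableSpace Ω} [m : MeasurableSpace Ω] {Pr : Measure Ω}
    [IsProbabilityMeasure Pr] (hX : mX ≤ m) (hY : mY ≤ m) (hW : mW ≤ m)
    (h1 : Indep mX (mY ⊔ mW) Pr) (h2 : Indep mY mW Pr) : Indep (mX ⊔ mY) mW Pr := by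
  let p : Set (Set Ω) := {s | ∃ A B, MeasurableSet[mX] A ∧ MeasurableSet[mY] B ∧ s = A ∩ B}
  have hgen : mX ⊔ mY = MeasurableSpace.generateFrom p := by
    apply le_antisymm
    · refine sup_le (fun A hA => ?_) (fun B hB => ?_)
      · exact MeasurableSpace.measurableSet_generateFrom
          ⟨A, Set.univ, hA, MeasurableSet.univ, by simp⟩
      · exact MeasurableSpace.measurableSet_generateFrom
          ⟨Set.univ, B, MeasurableSet.univ, hB, by simp⟩
    · refine MeasurableSpace.generateFrom_le ?_
      rintro s ⟨A, B, hA, hB, rfl⟩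
      exact @MeasurableSet.inter _ (mX ⊔ mY) _ _ ((le_sup_left : mX ≤ mX ⊔ mY) _ hA)
        ((le_sup_right : mY ≤ mX ⊔ mY) _ hB)
  have hpi : IsPiSystem p := by
    rintro s ⟨A, B, hA, hB, rfl⟩ t ⟨A', B', hA', hB', rfl⟩ -
    refine ⟨A ∩ A', B ∩ B', hA.inter hA', hB.inter hB', ?_⟩
    rw [Set.inter_inter_inter_comm]
  refine IndepSets.indep (sup_le hX hY) hW hpi (@MeasurableSpace.isPiSystem_measurableSet Ω mW)
    hgen (@MeasurableSpace.generateFrom_measurableSet Ω mW).symm ?_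
  rw [IndepSets_iff]
  rintro s C ⟨A, B, hA, hB, rfl⟩ hC
  rw [Indep_iff] at h1 h2
  have hB' : MeasurableSet[mY ⊔ mW] B := (le_sup_left : mY ≤ mY ⊔ mW) _ hB
  have hC' : MeasurableSet[mY ⊔ mW] C := (le_sup_right : mW ≤ mY ⊔ mW) _ hC
  rw [Set.inter_assoc, h1 A (B ∩ C) hA (hB'.inter hC'), h2 B C hB hC, h1 A B hA hB', mul_assoc]

/-- The information in all missing sets and in the coefficients up to time `t`. -/
@[reducible]
def history {r n : ℕ} (d : ℕ) (a : ℕ → Ω → Fin r → ℝ) (T : ℕ → Ω → Finset (Fin n)) (t : ℕ) :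
    MeasurableSpace Ω :=
  MeasurableSpace.comap (fun ω (s : Set.Icc 1 d) => T s ω) inferInstance ⊔
    MeasurableSpace.comap (fun ω (s : {s : Set.Icc 1 d // s ≤ t}) => a s ω) inferInstance

variable {r n d : ℕ} {a : ℕ → Ω → Fin r → ℝ} {T : ℕ → Ω → Finset (Fin n)}

lemma history_mono {s t : ℕ} (h : s ≤ t) : history d a T s ≤ history d a T t := by
  refine sup_le_sup le_rfl ?_
  let g : ({s : Set.Icc 1 d // s ≤ t} → Fin r → ℝ) → ({s' : Set.Icc 1 d // s' ≤ s} → Fin r → ℝ) :=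
    fun x u => x ⟨u.1, u.2.trans h⟩
  have hg : Measurable g := by
    refine measurable_pi_lambda _ fun u => ?_
    exact measurable_pi_apply _
  have : (fun ω (u : {s' : Set.Icc 1 d // s' ≤ s}) => a u ω) =
      g ∘ fun ω (u : {s' : Set.Icc 1 d // s' ≤ t}) => a u ω := rfl
  rw [this, ← MeasurableSpace.comap_comp]
  exact MeasurableSpace.comap_mono hg.comap_le

lemma measurable_history_missing {s t : ℕ} (hs : s ∈ Set.Icc 1 d) :
    Measurable[history d a T t] (T s) := by
  have h : Measurable[MeasurableSpace.comap (fun ω (s : Set.Icc 1 d) => T s ω) inferInstance]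
      (fun ω (s : Set.Icc 1 d) => T s ω) := comap_measurable _
  have := (measurable_pi_apply (⟨s, hs⟩ : Set.Icc 1 d)).comp h
  exact this.mono le_sup_left le_rfl

lemma measurable_history_coeff {s t : ℕ} (hs : s ∈ Set.Icc 1 d) (hst : s ≤ t) :
    Measurable[history d a T t] (a s) := by
  have h : Measurable[MeasurableSpace.comap
      (fun ω (s : {s : Set.Icc 1 d // s ≤ t}) => a s ω) inferInstance]
      (fun ω (s : {s : Set.Icc 1 d // s ≤ t}) => a s ω) := comap_measurable _
  have := (measurable_pi_apply (⟨⟨s, hs⟩, hst⟩ : {s : Set.Icc 1 d // s ≤ t})).comp h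
  exact this.mono le_sup_right le_rfl

variable [m : MeasurableSpace Ω] {Pr : Measure Ω}

lemma history_le (ha : ∀ t ∈ Set.Icc 1 d, Measurable (a t))
    (hT : ∀ t ∈ Set.Icc 1 d, Measurable (T t)) (t : ℕ) : history d a T t ≤ m := by
  refine sup_le ?_ ?_
  · exact (measurable_pi_lambda _ fun s : Set.Icc 1 d => hT s.1 s.2).comap_le
  · exact (measurable_pi_lambda _ fun s : {s : Set.Icc 1 d // s ≤ t} => ha s.1.1 s.1.2).comap_le

/-- The missing sets of all frames, future ones included, may be adjoined to the past because they
are independent of the whole coefficient sequence. The remaining input is independence of the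
coefficients over disjoint sets of frames. -/
lemma indep_history [IsProbabilityMeasure Pr] (ha : ∀ t ∈ Set.Icc 1 d, Measurable (a t))
    (hT : ∀ t ∈ Set.Icc 1 d, Measurable (T t))
    (hind : iIndepFun (fun t : Set.Icc 1 d => a t) Pr)
    (haT : IndepFun (fun ω (t : Set.Icc 1 d) => a t ω) (fun ω (t : Set.Icc 1 d) => T t ω) Pr)
    {t : ℕ} (ht : t + 1 ∈ Set.Icc 1 d) :
    Indep (history d a T t) (MeasurableSpace.comap (a (t + 1)) inferInstance) Pr := by
  have hmT : Measurable (fun ω (t : Set.Icc 1 d) => T t ω) := measurable_pi_lambda _ fun s : Set.Icc 1 d => hT s.1 s.2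
  have hmA : Measurable (fun ω (t : Set.Icc 1 d) => a t ω) := measurable_pi_lambda _ fun s : Set.Icc 1 d => ha s.1 s.2
  refine indep_sup_left hmT.comap_le ?_ (ha _ ht).comap_le ?_ ?_
  · exact (measurable_pi_lambda _ fun s : {s : Set.Icc 1 d // s ≤ t} => ha s.1.1 s.1.2).comap_le
  · have h := haT.symm
    refine indep_of_indep_of_le_right h (sup_le ?_ ?_)
    · let g : (Set.Icc 1 d → Fin r → ℝ) → ({s' : Set.Icc 1 d // s' ≤ t} → Fin r → ℝ) :=
        fun x u => x u.1
      have hg : Measurable g := measurable_pi_lambda _ fun u => measurable_pi_apply _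
      have : (fun ω (u : {s' : Set.Icc 1 d // s' ≤ t}) => a u ω) =
        g ∘ fun ω (u : Set.Icc 1 d) => a u ω := rfl
      rw [this, ← MeasurableSpace.comap_comp]
      exact MeasurableSpace.comap_mono hg.comap_le
    · let g : (Set.Icc 1 d → Fin r → ℝ) → (Fin r → ℝ) := fun x => x ⟨t + 1, ht⟩
      have hg : Measurable g := measurable_pi_apply _
      have : a (t + 1) = g ∘ fun ω (u : Set.Icc 1 d) => a u ω := rfl
      rw [this, ← MeasurableSpace.comap_comp]
      exact MeasurableSpace.comap_mono hg.comap_le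
  · classical
    let S : Finset (Set.Icc 1 d) := Finset.univ.filter fun s => (s : ℕ) ≤ t
    let R : Finset (Set.Icc 1 d) := {⟨t + 1, ht⟩}
    have hSR : Disjoint S R := by
      rw [Finset.disjoint_singleton_right]
      simp [S]
    have h := hind.indepFun_finset S R hSR (fun i => ha i i.2)
    let g₁ : (S → Fin r → ℝ) → ({s' : Set.Icc 1 d // s' ≤ t} → Fin r → ℝ) :=
      fun x u => x ⟨u.1, by simp only [S, Finset.mem_filter, Finset.mem_univ, true_and]; exact u.2⟩
    let g₂ : (R → Fin r → ℝ) → (Fin r → ℝ) := fun x => x ⟨⟨t + 1, ht⟩, by simp [R]⟩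
    exact h.comp (φ := g₁) (ψ := g₂) (measurable_pi_lambda _ fun u => measurable_pi_apply _)
      (measurable_pi_apply _)

/-- Fubini for a function of two independent random variables. -/
lemma lintegral_comp_of_indepFun [IsProbabilityMeasure Pr] {β γ : Type*} [MeasurableSpace β]
    [MeasurableSpace γ] {X : Ω → β} {Y : Ω → γ} (hX : Measurable X) (hY : Measurable Y)
    (h : IndepFun X Y Pr) {g : β × γ → ENNReal} (hg : Measurable g) :
    ∫⁻ ω, g (X ω, Y ω) ∂Pr = ∫⁻ ω, ∫⁻ ω', g (X ω, Y ω') ∂Pr ∂Pr := by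
  have h1 := (indepFun_iff_map_prod_eq_prod_map_map hX.aemeasurable hY.aemeasurable).mp h
  rw [← lintegral_map hg (hX.prodMk hY), h1]
  have := Measure.isProbabilityMeasure_map (μ := Pr) hY.aemeasurable
  rw [lintegral_prod _ hg.aemeasurable, lintegral_map hg.lintegral_prod_right' hX]
  refine lintegral_congr fun ω => ?_
  exact lintegral_map (hg.comp measurable_prodMk_left) hY

end Independence

/-! ### Second moments of a bounded coefficient vector. -/

section Quadratic

variable {Ω : Type*} [MeasurableSpace Ω] {Pr : Measure Ω} [IsProbabilityMeasure Pr] {r : ℕ}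

/-- A bounded random vector with zero mean and diagonal covariance. -/
structure BoundedCoeff (Pr : Measure Ω) (lam : Fin r → ℝ) (R L : ℝ) (x : Ω → Fin r → ℝ) : Prop where
  meas : Measurable x
  cov : ∀ i k, ∫ ω, x ω i * x ω k ∂Pr = if i = k then lam i else 0
  bdd : ∀ᵐ ω ∂Pr, x ω ⬝ᵥ x ω ≤ R
  nonneg : ∀ i, 0 ≤ lam i
  le : ∀ i, lam i ≤ L
  L_le : L ≤ R
  L_nonneg : 0 ≤ L

variable {lam : Fin r → ℝ} {R L : ℝ} {x : Ω → Fin r → ℝ}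

lemma BoundedCoeff.integrable_mul (h : BoundedCoeff Pr lam R L x) (i k : Fin r) :
    Integrable (fun ω => x ω i * x ω k) Pr := by
  have hm : ∀ i, Measurable fun ω => x ω i := fun i => (measurable_pi_apply i).comp h.meas
  refine Integrable.of_bound ((hm i).mul (hm k)).aestronglyMeasurable R ?_
  filter_upwards [h.bdd] with ω hω
  have hs : ∀ j, x ω j ^ 2 ≤ x ω ⬝ᵥ x ω := fun j => by
    rw [pow_two]
    exact Finset.single_le_sum (f := fun j => x ω j * x ω j) (fun j _ => mul_self_nonneg _)
      (Finset.mem_univ j)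
  have h1 := (hs i).trans hω
  have h2 := (hs k).trans hω
  rw [Real.norm_eq_abs, abs_le]
  constructor <;> nlinarith [sq_nonneg (x ω i - x ω k), sq_nonneg (x ω i + x ω k)]

lemma dot_mul_dot (u w y : Fin r → ℝ) :
    (u ⬝ᵥ y) * (w ⬝ᵥ y) = ∑ i, ∑ k, u i * w k * (y i * y k) := by
  simp only [dotProduct, Finset.sum_mul_sum]
  exact Finset.sum_congr rfl fun i _ => Finset.sum_congr rfl fun k _ => by ring

lemma BoundedCoeff.integrable_dot (h : BoundedCoeff Pr lam R L x) (u w : Fin r → ℝ) :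
    Integrable (fun ω => (u ⬝ᵥ x ω) * (w ⬝ᵥ x ω)) Pr := by
  simp only [dot_mul_dot]
  exact integrable_finsetSum _ fun i _ => integrable_finsetSum _ fun k _ =>
    (h.integrable_mul i k).const_mul _

lemma BoundedCoeff.integral_dot (h : BoundedCoeff Pr lam R L x) (u w : Fin r → ℝ) :
    ∫ ω, (u ⬝ᵥ x ω) * (w ⬝ᵥ x ω) ∂Pr = ∑ i, lam i * u i * w i := by
  simp only [dot_mul_dot]
  rw [integral_finsetSum _ fun i _ => integrable_finsetSum _ fun k _ =>
    (h.integrable_mul i k).const_mul _]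
  refine Finset.sum_congr rfl fun i _ => ?_
  rw [integral_finsetSum _ fun k _ => (h.integrable_mul i k).const_mul _]
  simp only [integral_const_mul, h.cov]
  simp
  ring

end Quadratic

end NORST

end


section

namespace NORST

open scoped Matrix.Norms.L2Operator
open Filter Topology

/-! ### Euclidean and operator norms through bilinear and quadratic forms. -/

section EuclideanNorm

set_option linter.unusedSectionVars false

variable {ι κ : Type*} [Fintype ι] [Fintype κ]

/-- The Euclidean norm on vectors indexed by any finite type. -/
def l2norm (v : ι → ℝ) : ℝ := ‖WithLp.toLp 2 v‖

lemma vnorm_eq_l2norm {m : ℕ} (v : Fin m → ℝ) : vnorm v = l2norm v := rfl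

lemma l2norm_nonneg (v : ι → ℝ) : 0 ≤ l2norm v := norm_nonneg _

lemma l2norm_sq (v : ι → ℝ) : l2norm v ^ 2 = v ⬝ᵥ v := by
  rw [l2norm, EuclideanSpace.norm_sq_eq]
  simp [dotProduct, pow_two]

lemma l2norm_zero : l2norm (0 : ι → ℝ) = 0 := by simp [l2norm]

lemma l2norm_add_le (u v : ι → ℝ) : l2norm (u + v) ≤ l2norm u + l2norm v := by
  rw [l2norm, WithLp.toLp_add]; exact norm_add_le _ _

lemma l2norm_smul (c : ℝ) (v : ι → ℝ) : l2norm (c • v) = |c| * l2norm v := by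
  rw [l2norm, WithLp.toLp_smul, norm_smul, Real.norm_eq_abs]; rfl

lemma l2norm_neg (v : ι → ℝ) : l2norm (-v) = l2norm v := by
  rw [l2norm, WithLp.toLp_neg, norm_neg]; rfl

lemma l2norm_eq_zero {v : ι → ℝ} : l2norm v = 0 ↔ v = 0 := by
  rw [l2norm, norm_eq_zero]; exact WithLp.toLp_eq_zero 2

lemma dotProduct_self_nonneg' (v : ι → ℝ) : 0 ≤ v ⬝ᵥ v := by
  rw [← l2norm_sq]; positivity

lemma abs_dotProduct_le (u v : ι → ℝ) : |u ⬝ᵥ v| ≤ l2norm u * l2norm v := by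
  have h := abs_real_inner_le_norm (WithLp.toLp 2 v : EuclideanSpace ℝ ι) (WithLp.toLp 2 u)
  rw [EuclideanSpace.inner_eq_star_dotProduct] at h
  simp only [star_trivial] at h
  rw [mul_comm]; exact h

lemma dotProduct_le (u v : ι → ℝ) : u ⬝ᵥ v ≤ l2norm u * l2norm v :=
  (le_abs_self _).trans (abs_dotProduct_le u v)

variable [DecidableEq ι] [DecidableEq κ]

lemma specNorm_eq_norm {m k : ℕ} (A : Matrix (Fin m) (Fin k) ℝ) : specNorm A = ‖A‖ := by
  rw [l2_opNorm_def]; rfl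

lemma l2norm_mulVec_le (A : Matrix ι κ ℝ) (v : κ → ℝ) : l2norm (A *ᵥ v) ≤ ‖A‖ * l2norm v :=
  l2_opNorm_mulVec A (WithLp.toLp 2 v)

lemma norm_le_of_l2norm_mulVec_le {A : Matrix ι κ ℝ} {c : ℝ} (hc : 0 ≤ c)
    (h : ∀ v, l2norm (A *ᵥ v) ≤ c * l2norm v) : ‖A‖ ≤ c := by
  rw [l2_opNorm_def]
  refine ContinuousLinearMap.opNorm_le_bound _ hc fun v => ?_
  exact h v.ofLp

lemma norm_transpose (A : Matrix ι κ ℝ) : ‖Aᵀ‖ = ‖A‖ := by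
  rw [← conjTranspose_eq_transpose_of_trivial, l2_opNorm_conjTranspose]

lemma norm_le_of_bilinear_le {A : Matrix ι κ ℝ} {c : ℝ} (hc : 0 ≤ c)
    (h : ∀ u v, u ⬝ᵥ A *ᵥ v ≤ c * (l2norm u * l2norm v)) : ‖A‖ ≤ c := by
  refine norm_le_of_l2norm_mulVec_le hc fun v => ?_
  have h1 := h (A *ᵥ v) v
  rw [← l2norm_sq] at h1
  rcases (l2norm_nonneg (A *ᵥ v)).eq_or_lt with h0 | h0
  · rw [← h0]; exact mul_nonneg hc (l2norm_nonneg _)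
  · nlinarith

lemma dotProduct_mulVec_le (A : Matrix ι κ ℝ) (u : ι → ℝ) (v : κ → ℝ) :
    |u ⬝ᵥ A *ᵥ v| ≤ ‖A‖ * (l2norm u * l2norm v) := by
  refine (abs_dotProduct_le _ _).trans ?_
  calc l2norm u * l2norm (A *ᵥ v) ≤ l2norm u * (‖A‖ * l2norm v) :=
        mul_le_mul_of_nonneg_left (l2norm_mulVec_le A v) (l2norm_nonneg u)
    _ = _ := by ring

/-- Polarization bounds 2 uᵀAv by c (‖u‖² + ‖v‖²), and normalizing u and v turns the sum into a
product. -/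
lemma norm_le_of_quadratic_le {A : Matrix ι ι ℝ} (hA : Aᵀ = A) {c : ℝ} (hc : 0 ≤ c)
    (h : ∀ v, |v ⬝ᵥ A *ᵥ v| ≤ c * (v ⬝ᵥ v)) : ‖A‖ ≤ c := by
  have hsym : ∀ u v, u ⬝ᵥ A *ᵥ v = v ⬝ᵥ A *ᵥ u := fun u v => by
    rw [Matrix.dotProduct_mulVec, dotProduct_comm, ← Matrix.mulVec_transpose, hA]
  have key : ∀ u v, 2 * (u ⬝ᵥ A *ᵥ v) ≤ c * (u ⬝ᵥ u + v ⬝ᵥ v) := by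
    intro u v
    have h1 := (abs_le.mp (h (u + v))).2
    have h2 := (abs_le.mp (h (u - v))).1
    simp only [Matrix.mulVec_add, Matrix.mulVec_sub, dotProduct_add, add_dotProduct,
      dotProduct_sub, sub_dotProduct] at h1 h2
    have h3 := hsym u v
    have h4 := dotProduct_comm u v
    nlinarith
  refine norm_le_of_bilinear_le hc fun u v => ?_
  rcases (l2norm_nonneg u).eq_or_lt with hu | hu
  · rw [l2norm_eq_zero.mp hu.symm]; simp [l2norm_zero]
  rcases (l2norm_nonneg v).eq_or_lt with hv | hv
  · rw [l2norm_eq_zero.mp hv.symm]; simp [l2norm_zero]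
  have h1 := key ((l2norm u)⁻¹ • u) ((l2norm v)⁻¹ • v)
  simp only [Matrix.mulVec_smul, dotProduct_smul, smul_dotProduct, smul_eq_mul, ← l2norm_sq] at h1
  have e : (l2norm u)⁻¹ * ((l2norm u)⁻¹ * l2norm u ^ 2) = 1 := by field_simp
  have e' : (l2norm v)⁻¹ * ((l2norm v)⁻¹ * l2norm v ^ 2) = 1 := by field_simp
  rw [e, e'] at h1
  have h2 : (l2norm v)⁻¹ * ((l2norm u)⁻¹ * (u ⬝ᵥ A *ᵥ v)) ≤ c := by linarith
  rw [← mul_assoc, ← mul_inv, ← div_eq_inv_mul, div_le_iff₀ (by positivity)] at h2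
  linarith

lemma vecMulVec_mulVec' (x : ι → ℝ) (y v : κ → ℝ) : vecMulVec x y *ᵥ v = (y ⬝ᵥ v) • x := by
  rw [Matrix.vecMulVec_mulVec]; ext i; simp [mul_comm]

lemma norm_vecMulVec_self_le (x : ι → ℝ) : ‖vecMulVec x x‖ ≤ x ⬝ᵥ x := by
  refine norm_le_of_l2norm_mulVec_le (dotProduct_self_nonneg' x) fun v => ?_
  rw [vecMulVec_mulVec', l2norm_smul, ← l2norm_sq]
  have := mul_le_mul_of_nonneg_right (abs_dotProduct_le x v) (l2norm_nonneg x)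
  linarith

lemma norm_diagonal_le {lam : ι → ℝ} {L : ℝ} (h0 : ∀ i, 0 ≤ lam i) (hL : ∀ i, lam i ≤ L)
    (hL0 : 0 ≤ L) : ‖diagonal lam‖ ≤ L := by
  rw [l2_opNorm_diagonal]
  exact (pi_norm_le_iff_of_nonneg hL0).mpr fun i => by
    rw [Real.norm_eq_abs, abs_of_nonneg (h0 i)]; exact hL i

end EuclideanNorm

/-! ### One step of the matrix Chernoff bound. -/

section MatrixChernoff

set_option linter.unusedSectionVars false

variable {Ω : Type*} [mΩ : MeasurableSpace Ω] {Pr : Measure Ω} [IsProbabilityMeasure Pr] {r : ℕ}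
  {κ : Type*} [Fintype κ] [DecidableEq κ] {lam : Fin r → ℝ} {R L : ℝ} {x : Ω → Fin r → ℝ}

/-- A transformed centered rank-one matrix. -/
def centered (lam : Fin r → ℝ) (M : Matrix κ (Fin r) ℝ) (x : Fin r → ℝ) : Matrix κ κ ℝ :=
  M * (vecMulVec x x - diagonal lam) * Mᵀ

lemma centered_transpose (lam : Fin r → ℝ) (M : Matrix κ (Fin r) ℝ) (x : Fin r → ℝ) :
    (centered lam M x)ᵀ = centered lam M x := by
  simp [centered, Matrix.transpose_mul, Matrix.mul_assoc, Matrix.transpose_vecMulVec]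

lemma centered_quadratic (lam : Fin r → ℝ) (M : Matrix κ (Fin r) ℝ) (x : Fin r → ℝ) (s : κ → ℝ) :
    s ⬝ᵥ centered lam M x *ᵥ s =
      ((Mᵀ *ᵥ s) ⬝ᵥ x) * ((Mᵀ *ᵥ s) ⬝ᵥ x) - ∑ i, lam i * (Mᵀ *ᵥ s) i * (Mᵀ *ᵥ s) i := by
  rw [centered, ← Matrix.mulVec_mulVec, ← Matrix.mulVec_mulVec, Matrix.dotProduct_mulVec,
    ← Matrix.mulVec_transpose]
  set u := Mᵀ *ᵥ s
  rw [Matrix.sub_mulVec, dotProduct_sub, vecMulVec_mulVec', dotProduct_smul, smul_eq_mul,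
    dotProduct_comm x u]
  congr 1
  simp only [dotProduct, Matrix.mulVec_diagonal]
  exact Finset.sum_congr rfl fun i _ => by ring

/-- Replacing the factor y·y by its bound R leaves an expression that is quadratic in y. The
expectation of the squared matrix is thereby controlled by second moments alone, with no fourth
moments. -/
lemma l2norm_centered_sq_le {M : Matrix κ (Fin r) ℝ} (hM : ‖M‖ ^ 2 ≤ 2) {y : Fin r → ℝ}
    (hy : y ⬝ᵥ y ≤ R) (s : κ → ℝ) :
    l2norm (centered lam M y *ᵥ s) ^ 2 ≤ 2 * (R * (((Mᵀ *ᵥ s) ⬝ᵥ y) * ((Mᵀ *ᵥ s) ⬝ᵥ y)) -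
      2 * (((Mᵀ *ᵥ s) ⬝ᵥ y) * ((fun i => lam i * (Mᵀ *ᵥ s) i) ⬝ᵥ y)) +
      ∑ i, (lam i * (Mᵀ *ᵥ s) i) ^ 2) := by
  set u := Mᵀ *ᵥ s with hu
  set w : Fin r → ℝ := fun i => lam i * u i
  have e : centered lam M y *ᵥ s = M *ᵥ ((u ⬝ᵥ y) • y - w) := by
    rw [centered, ← Matrix.mulVec_mulVec, ← Matrix.mulVec_mulVec, Matrix.sub_mulVec,
      vecMulVec_mulVec', ← hu, dotProduct_comm y u]
    congr 2
    ext i; simp [Matrix.mulVec_diagonal, w]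
  have h1 := l2norm_mulVec_le M ((u ⬝ᵥ y) • y - w)
  rw [← e] at h1
  have h2 : l2norm (centered lam M y *ᵥ s) ^ 2 ≤ 2 * l2norm ((u ⬝ᵥ y) • y - w) ^ 2 := by
    have := pow_le_pow_left₀ (l2norm_nonneg _) h1 2
    rw [mul_pow] at this
    exact this.trans (mul_le_mul_of_nonneg_right hM (sq_nonneg _))
  refine h2.trans (mul_le_mul_of_nonneg_left ?_ zero_le_two)
  rw [l2norm_sq]
  simp only [sub_dotProduct, dotProduct_sub, smul_dotProduct, dotProduct_smul, smul_eq_mul]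
  have e1 : w ⬝ᵥ w = ∑ i, (lam i * u i) ^ 2 := by simp [dotProduct, w, pow_two]
  rw [e1, dotProduct_comm y w]
  have h3 : (u ⬝ᵥ y) * ((u ⬝ᵥ y) * (y ⬝ᵥ y)) ≤ R * ((u ⬝ᵥ y) * (u ⬝ᵥ y)) := by
    nlinarith [mul_self_nonneg (u ⬝ᵥ y)]
  linarith

lemma norm_centered_le (h0 : ∀ i, 0 ≤ lam i) (hL : ∀ i, lam i ≤ L) (hL0 : 0 ≤ L) (hLR : L ≤ R)
    {M : Matrix κ (Fin r) ℝ} (hM : ‖M‖ ^ 2 ≤ 2) {y : Fin r → ℝ} (hy : y ⬝ᵥ y ≤ R) :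
    ‖centered lam M y‖ ≤ 4 * R := by
  have h1 : ‖vecMulVec y y - diagonal lam‖ ≤ 2 * R :=
    (norm_sub_le _ _).trans (by
      have := norm_vecMulVec_self_le y
      have := norm_diagonal_le h0 hL hL0
      linarith)
  have h2 : ‖centered lam M y‖ ≤ ‖M‖ * (2 * R) * ‖M‖ := by
    refine (l2_opNorm_mul _ _).trans ?_
    rw [norm_transpose]
    refine mul_le_mul_of_nonneg_right ((l2_opNorm_mul _ _).trans ?_) (norm_nonneg _)
    exact mul_le_mul_of_nonneg_left h1 (norm_nonneg _)
  nlinarith [hL0.trans hLR]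

lemma trace_exp_nonneg {Z : Matrix κ κ ℝ} (hZ : Zᵀ = Z) : 0 ≤ (NormedSpace.exp Z).trace := by
  rw [exp_eq_mul_transpose hZ]; exact trace_transpose_mul_self_nonneg _

lemma trace_mul_mul_transpose (S Y : Matrix κ κ ℝ) :
    (S * Y * Sᵀ).trace = ∑ k, S.row k ⬝ᵥ Y *ᵥ S.row k := by
  simp only [Matrix.trace, Matrix.diag]
  refine Finset.sum_congr rfl fun k _ => ?_
  simp only [Matrix.mul_apply, dotProduct, mulVec, Matrix.row_apply, Matrix.transpose_apply,
    Finset.sum_mul, Finset.mul_sum]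
  rw [Finset.sum_comm]
  exact Finset.sum_congr rfl fun i _ => Finset.sum_congr rfl fun j _ => by ring

lemma integrable_and_integral_affine {p q : Ω → ℝ} (hp : Integrable p Pr) (hq : Integrable q Pr)
    (A B C : ℝ) : Integrable (fun ω => A + B * p ω + C * q ω) Pr ∧
      ∫ ω, (A + B * p ω + C * q ω) ∂Pr = A + B * ∫ ω, p ω ∂Pr + C * ∫ ω, q ω ∂Pr := by
  have h1 : Integrable (fun ω => A + B * p ω) Pr := (integrable_const A).add (hp.const_mul B)
  have h2 : Integrable (fun ω => C * q ω) Pr := hq.const_mul C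
  refine ⟨h1.add h2, ?_⟩
  rw [integral_add h1 h2, integral_add (integrable_const A) (hp.const_mul B), integral_const_mul,
    integral_const_mul]
  simp

/-- In tr(exp Z (1 + θX + θ²X²)) the linear term has mean zero, because X is centered, and the
quadratic one is at most 4θ²RL in mean: a factor 2 from the expansion of X², and a factor 2 from
‖M‖² ≤ 2. -/
lemma lintegral_trace_exp_add_le (h : BoundedCoeff Pr lam R L x) {Z : Matrix κ κ ℝ} (hZ : Zᵀ = Z)
    {M : Matrix κ (Fin r) ℝ} (hM : ‖M‖ ^ 2 ≤ 2) {θ : ℝ} (hθ : |θ| * (4 * R) ≤ 1) :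
    ∫⁻ ω, ENNReal.ofReal (NormedSpace.exp (Z + θ • centered lam M (x ω))).trace ∂Pr ≤
      ENNReal.ofReal ((1 + 4 * θ ^ 2 * R * L) * (NormedSpace.exp Z).trace) := by
  set S := NormedSpace.exp ((2 : ℝ)⁻¹ • Z) with hS
  let u : κ → Fin r → ℝ := fun k => Mᵀ *ᵥ S.row k
  let w : κ → Fin r → ℝ := fun k i => lam i * u k i
  -- Pointwise majorant of the trace, summed over the rows of S = exp(Z/2). It is a quadratic
  -- polynomial in `x ω`, so its integral is computed exactly.
  let φ : Ω → ℝ := fun ω => ∑ k, (S.row k ⬝ᵥ S.row k + θ * (((u k) ⬝ᵥ x ω) * ((u k) ⬝ᵥ x ω) -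
    ∑ i, lam i * u k i * u k i) + θ ^ 2 * (2 * (R * ((u k ⬝ᵥ x ω) * (u k ⬝ᵥ x ω)) -
      2 * ((u k ⬝ᵥ x ω) * (w k ⬝ᵥ x ω)) + ∑ i, (lam i * u k i) ^ 2)))
  have hexp : NormedSpace.exp Z = Sᵀ * S := exp_eq_mul_transpose hZ
  have hpt : ∀ᵐ ω ∂Pr, (NormedSpace.exp (Z + θ • centered lam M (x ω))).trace ≤ φ ω := by
    filter_upwards [h.bdd] with ω hω
    have hXs : (θ • centered lam M (x ω))ᵀ = θ • centered lam M (x ω) := by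
      rw [Matrix.transpose_smul, centered_transpose]
    have hXn : ‖θ • centered lam M (x ω)‖ ≤ 1 := by
      rw [norm_smul, Real.norm_eq_abs]
      exact (mul_le_mul_of_nonneg_left (norm_centered_le h.nonneg h.le h.L_nonneg h.L_le hM hω)
        (abs_nonneg _)).trans hθ
    refine (trace_exp_add_le_of_norm_le_one hZ hXs hXn).trans ?_
    rw [hexp, ← Matrix.trace_mul_cycle S _ Sᵀ, trace_mul_mul_transpose]
    refine Finset.sum_le_sum fun k _ => ?_
    rw [Matrix.add_mulVec, Matrix.add_mulVec, Matrix.one_mulVec, dotProduct_add, dotProduct_add]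
    refine add_le_add (add_le_add le_rfl ?_) ?_
    · rw [Matrix.smul_mulVec, dotProduct_smul, smul_eq_mul, centered_quadratic]
    · have e : S.row k ⬝ᵥ (θ • centered lam M (x ω) * θ • centered lam M (x ω)) *ᵥ S.row k =
          θ ^ 2 * l2norm (centered lam M (x ω) *ᵥ S.row k) ^ 2 := by
        rw [← Matrix.mulVec_mulVec, Matrix.dotProduct_mulVec, ← Matrix.mulVec_transpose, hXs,
          ← l2norm_sq, Matrix.smul_mulVec, l2norm_smul, mul_pow, sq_abs]
      rw [e]
      exact mul_le_mul_of_nonneg_left (l2norm_centered_sq_le hM hω _) (sq_nonneg _)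
  have hi := h.integrable_dot
  have hφe : φ = fun ω => ∑ k, ((S.row k ⬝ᵥ S.row k - θ * (∑ i, lam i * u k i * u k i) +
      2 * θ ^ 2 * ∑ i, (lam i * u k i) ^ 2) + (θ + 2 * θ ^ 2 * R) * ((u k ⬝ᵥ x ω) * (u k ⬝ᵥ x ω)) +
      (-(4 * θ ^ 2)) * ((u k ⬝ᵥ x ω) * (w k ⬝ᵥ x ω))) := by
    funext ω
    exact Finset.sum_congr rfl fun k _ => by ring
  have hφi : Integrable φ Pr := by
    rw [hφe]
    exact integrable_finsetSum _ fun k _ =>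
      (integrable_and_integral_affine (hi (u k) (u k)) (hi (u k) (w k)) _ _ _).1
  have hφ0 : 0 ≤ᵐ[Pr] φ := by
    filter_upwards [hpt] with ω hω
    refine (trace_exp_nonneg ?_).trans hω
    rw [Matrix.transpose_add, hZ, Matrix.transpose_smul, centered_transpose]
  calc ∫⁻ ω, ENNReal.ofReal (NormedSpace.exp (Z + θ • centered lam M (x ω))).trace ∂Pr
      ≤ ∫⁻ ω, ENNReal.ofReal (φ ω) ∂Pr :=
        lintegral_mono_ae (hpt.mono fun ω hω => ENNReal.ofReal_le_ofReal hω)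
    _ = ENNReal.ofReal (∫ ω, φ ω ∂Pr) := (ofReal_integral_eq_lintegral_ofReal hφi hφ0).symm
    _ ≤ _ := by
      refine ENNReal.ofReal_le_ofReal ?_
      have hint : ∫ ω, φ ω ∂Pr = ∑ k, (S.row k ⬝ᵥ S.row k + θ ^ 2 * (2 * (R * (∑ i, lam i * u k i * u k i) -
          2 * (∑ i, lam i * u k i * w k i) + ∑ i, (lam i * u k i) ^ 2))) := by
        rw [hφe, integral_finsetSum _ fun k _ =>
          (integrable_and_integral_affine (hi (u k) (u k)) (hi (u k) (w k)) _ _ _).1]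
        refine Finset.sum_congr rfl fun k _ => ?_
        rw [(integrable_and_integral_affine (hi (u k) (u k)) (hi (u k) (w k)) _ _ _).2,
          h.integral_dot, h.integral_dot]
        ring
      rw [hint, hexp]
      have htr : (Sᵀ * S).trace = ∑ k, S.row k ⬝ᵥ S.row k := by
        have := trace_mul_mul_transpose S 1
        rw [Matrix.mul_one, Matrix.trace_mul_comm] at this
        rw [this]; simp
      rw [htr, Finset.mul_sum]
      refine Finset.sum_le_sum fun k _ => ?_
      have h1 : ∑ i, lam i * u k i * u k i ≤ L * (2 * (S.row k ⬝ᵥ S.row k)) := by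
        have h2 : ∑ i, lam i * u k i * u k i ≤ L * (u k ⬝ᵥ u k) := by
          rw [dotProduct, Finset.mul_sum]
          refine Finset.sum_le_sum fun i _ => ?_
          rw [mul_assoc]
          exact mul_le_mul_of_nonneg_right (h.le i) (mul_self_nonneg _)
        have h3 : u k ⬝ᵥ u k ≤ 2 * (S.row k ⬝ᵥ S.row k) := by
          have := pow_le_pow_left₀ (l2norm_nonneg _) (l2norm_mulVec_le Mᵀ (S.row k)) 2
          rw [mul_pow, norm_transpose, l2norm_sq, l2norm_sq] at this
          exact this.trans (mul_le_mul_of_nonneg_right hM (dotProduct_self_nonneg' _))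
        exact h2.trans (mul_le_mul_of_nonneg_left h3 h.L_nonneg)
      have h4 : ∑ i, lam i * u k i * w k i = ∑ i, (lam i * u k i) ^ 2 :=
        Finset.sum_congr rfl fun i _ => by simp only [w]; ring
      rw [h4]
      have h5 : 0 ≤ ∑ i, (lam i * u k i) ^ 2 := Finset.sum_nonneg fun i _ => sq_nonneg _
      have hR : 0 ≤ R := h.L_nonneg.trans h.L_le
      have h6 := mul_le_mul_of_nonneg_left h1 hR
      have h7 : 2 * (R * (∑ i, lam i * u k i * u k i) - 2 * ∑ i, (lam i * u k i) ^ 2 +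
          ∑ i, (lam i * u k i) ^ 2) ≤ 4 * R * L * (S.row k ⬝ᵥ S.row k) := by linarith
      have h8 := mul_le_mul_of_nonneg_left h7 (sq_nonneg θ)
      linarith

end MatrixChernoff

end NORST

end


section

namespace NORST

open scoped Matrix.Norms.L2Operator
open Filter Topology

/-! ### The matrix Chernoff bound for predictable transformations. -/

section AdaptiveChernoff

set_option linter.unusedSectionVars false

variable {Ω : Type*} [mΩ : MeasurableSpace Ω] {Pr : Measure Ω} [IsProbabilityMeasure Pr] {r : ℕ}
  {κ : Type*} [Fintype κ] [DecidableEq κ] {lam : Fin r → ℝ} {R L : ℝ}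

lemma continuous_centered (lam : Fin r → ℝ) :
    Continuous fun p : Matrix κ (Fin r) ℝ × (Fin r → ℝ) => centered lam p.1 p.2 := by
  unfold centered
  refine Continuous.matrix_mul (Continuous.matrix_mul continuous_fst ?_)
    continuous_fst.matrix_transpose
  refine Continuous.sub ?_ continuous_const
  exact Continuous.matrix_vecMulVec continuous_snd continuous_snd

lemma continuous_trace_exp_add (lam : Fin r → ℝ) (θ : ℝ) :
    Continuous fun p : ((κ → κ → ℝ) × (κ → Fin r → ℝ)) × (Fin r → ℝ) =>
      (NormedSpace.exp (Matrix.of p.1.1 + θ • centered lam (Matrix.of p.1.2) p.2)).trace := by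
  let _ : NormedAlgebra ℚ (Matrix κ κ ℝ) := NormedAlgebra.restrictScalars ℚ ℝ _
  have h1 : Continuous fun p : ((κ → κ → ℝ) × (κ → Fin r → ℝ)) × (Fin r → ℝ) =>
      (Matrix.of p.1.1 + θ • centered lam (Matrix.of p.1.2) p.2 : Matrix κ κ ℝ) := by
    refine Continuous.add (continuous_fst.comp continuous_fst) (Continuous.const_smul ?_ θ)
    exact (continuous_centered lam).comp
      ((continuous_snd.comp continuous_fst).prodMk continuous_snd)
  exact Continuous.matrix_trace (NormedSpace.exp_continuous.comp h1)

lemma measurable_pair_of_apply {Ω : Type*} {m : MeasurableSpace Ω} {Z : Ω → κ → κ → ℝ}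
    {N : Ω → κ → Fin r → ℝ} (hZ : ∀ i j, Measurable fun ω => Z ω i j)
    (hN : ∀ i j, Measurable fun ω => N ω i j) : Measurable fun ω => (Z ω, N ω) :=
  Measurable.prodMk (measurable_pi_lambda _ fun i => measurable_pi_lambda _ fun j => hZ i j)
    (measurable_pi_lambda _ fun i => measurable_pi_lambda _ fun j => hN i j)

/-- The process of partial sums of transformed centered rank-one matrices. -/
def centeredSum (lam : Fin r → ℝ) (M : ℕ → Ω → Matrix κ (Fin r) ℝ) (x : ℕ → Ω → Fin r → ℝ)
    (p q : ℕ) (ω : Ω) : Matrix κ κ ℝ := ∑ t ∈ Finset.Ico p q, centered lam (M t ω) (x t ω)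

lemma centeredSum_transpose (M : ℕ → Ω → Matrix κ (Fin r) ℝ) (x : ℕ → Ω → Fin r → ℝ)
    (p q : ℕ) (ω : Ω) : (centeredSum lam M x p q ω)ᵀ = centeredSum lam M x p q ω := by
  rw [centeredSum, Matrix.transpose_sum]
  exact Finset.sum_congr rfl fun t _ => centered_transpose _ _ _

lemma centered_apply (M : Matrix κ (Fin r) ℝ) (y : Fin r → ℝ) (i j : κ) :
    centered lam M y i j = ∑ k, (∑ l, M i l * (y l * y k - diagonal lam l k)) * M j k := by
  simp [centered, Matrix.mul_apply, vecMulVec_apply]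

/-- The hypotheses of the adaptive matrix Chernoff bound on the frames `[p, q)`. -/
structure AdaptedCoeffs (Pr : Measure Ω) (F : ℕ → MeasurableSpace Ω) (lam : Fin r → ℝ) (R L : ℝ)
    (M : ℕ → Ω → Matrix κ (Fin r) ℝ) (x : ℕ → Ω → Fin r → ℝ) (p q : ℕ) : Prop where
  mono : Monotone F
  le : ∀ t, F t ≤ mΩ
  coeff : ∀ t, p ≤ t → t < q → BoundedCoeff Pr lam R L (x t)
  adapted : ∀ t, p ≤ t → t < q → Measurable[F t] (x t)
  indep : ∀ t, p ≤ t → t < q → Indep (F (t - 1)) (MeasurableSpace.comap (x t) inferInstance) Pr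
  predictable : ∀ t, p ≤ t → t < q → ∀ i k, Measurable[F (t - 1)] fun ω => M t ω i k
  norm_le : ∀ t, p ≤ t → t < q → ∀ ω, ‖M t ω‖ ^ 2 ≤ 2
  pos : 1 ≤ p

lemma AdaptedCoeffs.restrict {F : ℕ → MeasurableSpace Ω} {M : ℕ → Ω → Matrix κ (Fin r) ℝ}
    {x : ℕ → Ω → Fin r → ℝ} {p q q' : ℕ} (h : AdaptedCoeffs Pr F lam R L M x p q) (hq : q' ≤ q) :
    AdaptedCoeffs Pr F lam R L M x p q' where
  mono := h.mono
  le := h.le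
  coeff t h1 h2 := h.coeff t h1 (h2.trans_le hq)
  adapted t h1 h2 := h.adapted t h1 (h2.trans_le hq)
  indep t h1 h2 := h.indep t h1 (h2.trans_le hq)
  predictable t h1 h2 := h.predictable t h1 (h2.trans_le hq)
  norm_le t h1 h2 := h.norm_le t h1 (h2.trans_le hq)
  pos := h.pos

lemma AdaptedCoeffs.measurable_centeredSum {F : ℕ → MeasurableSpace Ω}
    {M : ℕ → Ω → Matrix κ (Fin r) ℝ} {x : ℕ → Ω → Fin r → ℝ} {p q : ℕ}
    (h : AdaptedCoeffs Pr F lam R L M x p q) (i j : κ) :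
    Measurable[F (q - 1)] fun ω => centeredSum lam M x p q ω i j := by
  simp only [centeredSum, Matrix.sum_apply, centered_apply]
  refine Finset.measurable_fun_sum _ fun t ht => ?_
  rw [Finset.mem_Ico] at ht
  have hM : ∀ i k, Measurable[F (q - 1)] fun ω => M t ω i k := fun i k =>
    (h.predictable t ht.1 ht.2 i k).mono (h.mono (by omega)) le_rfl
  have hx : ∀ k, Measurable[F (q - 1)] fun ω => x t ω k := fun k =>
    (measurable_pi_apply k).comp ((h.adapted t ht.1 ht.2).mono (h.mono (by omega)) le_rfl)
  refine Finset.measurable_fun_sum _ fun k _ => Measurable.mul ?_ (hM j k)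
  refine Finset.measurable_fun_sum _ fun l _ => Measurable.mul (hM i l) ?_
  exact ((hx l).mul (hx k)).sub_const _

/-- The last frame is peeled off: conditionally on the past, its transformation and the partial sum
are constants, so the one-step bound applies and contributes one factor 1 + 4θ²RL. -/
theorem AdaptedCoeffs.lintegral_trace_exp_le {F : ℕ → MeasurableSpace Ω}
    {M : ℕ → Ω → Matrix κ (Fin r) ℝ} {x : ℕ → Ω → Fin r → ℝ} {p q : ℕ}
    (h : AdaptedCoeffs Pr F lam R L M x p q) (hpq : p ≤ q) {θ : ℝ} (hR : 0 ≤ R) (hL : 0 ≤ L)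
    (hθ : |θ| * (4 * R) ≤ 1) :
    ∫⁻ ω, ENNReal.ofReal (NormedSpace.exp (θ • centeredSum lam M x p q ω)).trace ∂Pr ≤
      ENNReal.ofReal ((1 + 4 * θ ^ 2 * R * L) ^ (q - p) * Fintype.card κ) := by
  induction q, hpq using Nat.le_induction with
  | base => simp [centeredSum]
  | succ q hpq ih =>
    have ih := ih (h.restrict (Nat.le_succ q))
    have hpos := h.pos
    have hF := h.le (q - 1)
    have h' := h.restrict (Nat.le_succ q)
    -- Everything that the last step sees of the past: the partial sum and the predictable map. `H`
    -- is independent of `x q`, so Fubini freezes it.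
    let H : Ω → (κ → κ → ℝ) × (κ → Fin r → ℝ) :=
      fun ω => (fun i j => (θ • centeredSum lam M x p q ω) i j, fun i k => M q ω i k)
    have hH : Measurable[F (q - 1)] H := measurable_pair_of_apply
      (fun i j => (h'.measurable_centeredSum i j).const_mul θ)
      (h.predictable q hpq (Nat.lt_succ_self q))
    have hind : IndepFun H (x q) Pr :=
      indep_of_indep_of_le_left (h.indep q hpq (Nat.lt_succ_self q)) hH.comap_le
    have hbc := h.coeff q hpq (Nat.lt_succ_self q)
    have hg := ENNReal.measurable_ofReal.comp (continuous_trace_exp_add (κ := κ) lam θ).measurable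
    have hf := lintegral_comp_of_indepFun (hH.mono hF le_rfl) hbc.meas hind hg
    have e : ∀ ω, θ • centeredSum lam M x p (q + 1) ω =
        θ • centeredSum lam M x p q ω + θ • centered lam (M q ω) (x q ω) := fun ω => by
      rw [centeredSum, Finset.sum_Ico_succ_top hpq, smul_add]; rfl
    simp only [e]
    refine (le_of_eq hf).trans ?_
    have hstep : ∀ ω, ∫⁻ ω', (ENNReal.ofReal ∘ fun p : ((κ → κ → ℝ) × (κ → Fin r → ℝ)) ×
        (Fin r → ℝ) => (NormedSpace.exp (Matrix.of p.1.1 + θ • centered lam (Matrix.of p.1.2)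
          p.2)).trace) (H ω, x q ω') ∂Pr ≤ ENNReal.ofReal (1 + 4 * θ ^ 2 * R * L) *
          ENNReal.ofReal (NormedSpace.exp (θ • centeredSum lam M x p q ω)).trace := by
      intro ω
      rw [← ENNReal.ofReal_mul (by positivity)]
      exact lintegral_trace_exp_add_le hbc
        (Z := θ • centeredSum lam M x p q ω) (by rw [Matrix.transpose_smul, centeredSum_transpose])
        (h.norm_le q hpq (Nat.lt_succ_self q) ω) hθ
    refine (lintegral_mono hstep).trans ?_
    rw [lintegral_const_mul' _ _ ENNReal.ofReal_ne_top]
    refine (mul_le_mul_right ih _).trans ?_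
    rw [← ENNReal.ofReal_mul (by positivity), Nat.succ_sub hpq]
    exact ENNReal.ofReal_le_ofReal (le_of_eq (by rw [Nat.succ_eq_add_one, pow_succ _ (q - p)]; ring))

/-- Matrix Chernoff bound with predictable transformations of independent coefficients. -/
theorem AdaptedCoeffs.measure_quadratic_le {F : ℕ → MeasurableSpace Ω}
    {M : ℕ → Ω → Matrix κ (Fin r) ℝ} {x : ℕ → Ω → Fin r → ℝ} {p q α : ℕ}
    (h : AdaptedCoeffs Pr F lam R L M x p q) (hpq : p ≤ q) (hα : q - p ≤ α) (hL : 0 < L)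
    (hLR : L ≤ R) {δ : ℝ} (hδ : 0 < δ) (hδ1 : δ ≤ 1) :
    Pr {ω | ∃ v, δ * α * L * (v ⬝ᵥ v) < |v ⬝ᵥ centeredSum lam M x p q ω *ᵥ v|} ≤
      ENNReal.ofReal (2 * (Fintype.card κ * Real.exp (-(δ ^ 2 * α * L / (16 * R))))) := by
  have hR : 0 < R := hL.trans_le hLR
  set Z := centeredSum lam M x p q
  -- One Markov bound for each sign σ = ±1 of the quadratic form.
  have hside : ∀ σ : ℝ, |σ| = 1 → Pr {ω | ENNReal.ofReal (Real.exp (δ / (8 * R) * (δ * α * L))) ≤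
      ENNReal.ofReal (NormedSpace.exp ((σ * (δ / (8 * R))) • Z ω)).trace} ≤
      ENNReal.ofReal (Fintype.card κ * Real.exp (-(δ ^ 2 * α * L / (16 * R)))) := by
    intro σ hσ
    -- This choice minimizes 4θ²RLα - |θ|δαL, with value -δ²αL/(16R). The requirement |θ| 4R ≤ 1
    -- reads δ ≤ 2.
    set θ := σ * (δ / (8 * R)) with hθ
    have hθa : |θ| = δ / (8 * R) := by rw [hθ, abs_mul, hσ, one_mul, abs_of_pos (by positivity)]
    have hθ1 : |θ| * (4 * R) ≤ 1 := by
      rw [hθa]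
      have : δ / (8 * R) * (4 * R) = δ / 2 := by field_simp; norm_num
      linarith
    have h1 := h.lintegral_trace_exp_le hpq hR.le hL.le hθ1
    have h2 := meas_ge_le_lintegral_div (μ := Pr)
      (f := fun ω => ENNReal.ofReal (NormedSpace.exp (θ • Z ω)).trace)
      (ε := ENNReal.ofReal (Real.exp (δ / (8 * R) * (δ * α * L)))) ?_
      (ENNReal.ofReal_pos.mpr (Real.exp_pos _)).ne' ENNReal.ofReal_ne_top
    · refine h2.trans ((ENNReal.div_le_div_right h1 _).trans ?_)
      rw [← ENNReal.ofReal_div_of_pos (Real.exp_pos _)]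
      refine ENNReal.ofReal_le_ofReal ?_
      have h3 : (1 + 4 * θ ^ 2 * R * L) ^ (q - p) ≤ Real.exp (4 * θ ^ 2 * R * L * α) := by
        have h4 : 1 + 4 * θ ^ 2 * R * L ≤ Real.exp (4 * θ ^ 2 * R * L) := by
          linarith [Real.add_one_le_exp (4 * θ ^ 2 * R * L)]
        refine (pow_le_pow_left₀ (by positivity) h4 _).trans ?_
        rw [← Real.exp_nat_mul]
        refine Real.exp_le_exp.mpr ?_
        rw [mul_comm]
        refine mul_le_mul_of_nonneg_left (by exact_mod_cast hα) (by positivity)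
      rw [div_le_iff₀ (Real.exp_pos _), mul_assoc (Fintype.card κ : ℝ), ← Real.exp_add, mul_comm]
      refine mul_le_mul_of_nonneg_left (h3.trans (Real.exp_le_exp.mpr ?_)) (by positivity)
      have : θ ^ 2 = (δ / (8 * R)) ^ 2 := by rw [← sq_abs, hθa]
      rw [this]
      apply le_of_eq
      field_simp
      ring
    · have hm : Measurable fun ω => (fun i j => Z ω i j : κ → κ → ℝ) :=
        measurable_pi_lambda _ fun i => measurable_pi_lambda _ fun j =>
          (h.measurable_centeredSum i j).mono (h.le _) le_rfl
      let _ : NormedAlgebra ℚ (Matrix κ κ ℝ) := NormedAlgebra.restrictScalars ℚ ℝ _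
      have hc : Continuous fun z : κ → κ → ℝ => (NormedSpace.exp (θ • Matrix.of z)).trace := by
        refine Continuous.matrix_trace (NormedSpace.exp_continuous.comp (Continuous.const_smul ?_ θ))
        exact continuous_id
      exact (ENNReal.measurable_ofReal.comp (hc.measurable.comp hm)).aemeasurable
  have hsub : {ω | ∃ v, δ * α * L * (v ⬝ᵥ v) < |v ⬝ᵥ Z ω *ᵥ v|} ⊆
      {ω | ENNReal.ofReal (Real.exp (δ / (8 * R) * (δ * α * L))) ≤
      ENNReal.ofReal (NormedSpace.exp (((1 : ℝ) * (δ / (8 * R))) • Z ω)).trace} ∪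
      {ω | ENNReal.ofReal (Real.exp (δ / (8 * R) * (δ * α * L))) ≤
      ENNReal.ofReal (NormedSpace.exp (((-1 : ℝ) * (δ / (8 * R))) • Z ω)).trace} := by
    rintro ω ⟨v, hv⟩
    have hv0 : 0 < l2norm v := by
      rcases (l2norm_nonneg v).eq_or_lt with h0 | h0
      · rw [l2norm_eq_zero.mp h0.symm] at hv; simp at hv
      · exact h0
    set w := (l2norm v)⁻¹ • v with hw
    have hw1 : w ⬝ᵥ w = 1 := by
      rw [hw, smul_dotProduct, dotProduct_smul, smul_eq_mul, smul_eq_mul, ← l2norm_sq]; field_simp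
    have hq : w ⬝ᵥ Z ω *ᵥ w = (l2norm v ^ 2)⁻¹ * (v ⬝ᵥ Z ω *ᵥ v) := by
      rw [hw, Matrix.mulVec_smul, smul_dotProduct, dotProduct_smul, smul_eq_mul, smul_eq_mul,
        ← mul_assoc, ← mul_inv, pow_two]
    have hlt : δ * α * L < |w ⬝ᵥ Z ω *ᵥ w| := by
      rw [hq, abs_mul, abs_of_pos (by positivity), ← div_eq_inv_mul, lt_div_iff₀ (by positivity),
        l2norm_sq]
      exact hv
    have key : ∀ σ : ℝ, δ * α * L < σ * (w ⬝ᵥ Z ω *ᵥ w) →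
        ENNReal.ofReal (Real.exp (δ / (8 * R) * (δ * α * L))) ≤
        ENNReal.ofReal (NormedSpace.exp ((σ * (δ / (8 * R))) • Z ω)).trace := by
      intro σ hσ
      refine ENNReal.ofReal_le_ofReal ?_
      refine le_trans ?_ (exp_dotProduct_le_trace_exp
        (by rw [Matrix.transpose_smul, centeredSum_transpose]) hw1)
      refine Real.exp_le_exp.mpr ?_
      rw [Matrix.smul_mulVec, dotProduct_smul, smul_eq_mul]
      have := mul_le_mul_of_nonneg_left hσ.le (show 0 ≤ δ / (8 * R) by positivity)
      linarith
    rcases lt_abs.mp hlt with h1 | h1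
    · exact Or.inl (key 1 (by linarith))
    · exact Or.inr (key (-1) (by linarith))
  refine (measure_mono hsub).trans ((measure_union_le _ _).trans ?_)
  refine (add_le_add (hside 1 (by simp)) (hside (-1) (by simp))).trans (le_of_eq ?_)
  rw [← ENNReal.ofReal_add (by positivity) (by positivity)]
  congr 1; ring

end AdaptiveChernoff

end NORST

end


section

namespace NORST

open scoped Matrix.Norms.L2Operator
open Filter Topology

/-! ### Projectors and the subspace distance. -/

section Subspaces

variable {n r : ℕ}

lemma le_of_sq_le_sq_of_nonneg {a b : ℝ} (h : a ^ 2 ≤ b ^ 2) (hb : 0 ≤ b) : a ≤ b :=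
  (abs_le_of_sq_le_sq' h hb).2

lemma perp_transpose (Q : Matrix (Fin n) (Fin r) ℝ) : (perp Q)ᵀ = perp Q := by
  simp [perp, Matrix.transpose_sub, Matrix.transpose_mul]

/-- Basis matrices, and the zero matrix from which the algorithm starts. -/
def IsEstimate (Q : Matrix (Fin n) (Fin r) ℝ) : Prop := Qᵀ * Q = 1 ∨ Q = 0

lemma IsEstimate.mul_transpose_mul {Q : Matrix (Fin n) (Fin r) ℝ} (h : IsEstimate Q) :
    Q * Qᵀ * Q = Q := by
  rcases h with h | h
  · rw [Matrix.mul_assoc, h, Matrix.mul_one]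
  · simp [h]

lemma IsEstimate.perp_mul {Q : Matrix (Fin n) (Fin r) ℝ} (h : IsEstimate Q) : perp Q * Q = 0 := by
  rw [perp, Matrix.sub_mul, h.mul_transpose_mul, Matrix.one_mul, sub_self]

lemma IsEstimate.perp_mul_perp {Q : Matrix (Fin n) (Fin r) ℝ} (h : IsEstimate Q) :
    perp Q * perp Q = perp Q := by
  conv_lhs => rw [perp, Matrix.mul_sub]
  rw [← perp, ← Matrix.mul_assoc, h.perp_mul]; simp

lemma dotProduct_mulVec_mulVec {ι κ : Type*} [Fintype ι] [Fintype κ] (A : Matrix ι κ ℝ)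
    (u : ι → ℝ) (v : κ → ℝ) : u ⬝ᵥ A *ᵥ v = (Aᵀ *ᵥ u) ⬝ᵥ v := by
  rw [Matrix.dotProduct_mulVec, Matrix.mulVec_transpose]

lemma IsEstimate.l2norm_perp_sq {Q : Matrix (Fin n) (Fin r) ℝ} (h : IsEstimate Q) (v : Fin n → ℝ) :
    l2norm (perp Q *ᵥ v) ^ 2 = l2norm v ^ 2 - l2norm (Qᵀ *ᵥ v) ^ 2 := by
  rw [l2norm_sq, l2norm_sq, l2norm_sq, dotProduct_mulVec_mulVec, perp_transpose,
    Matrix.mulVec_mulVec, h.perp_mul_perp, perp, Matrix.sub_mulVec, Matrix.one_mulVec,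
    sub_dotProduct, ← Matrix.mulVec_mulVec, dotProduct_comm (Q *ᵥ _), dotProduct_mulVec_mulVec]

lemma IsEstimate.l2norm_perp_le {Q : Matrix (Fin n) (Fin r) ℝ} (h : IsEstimate Q) (v : Fin n → ℝ) :
    l2norm (perp Q *ᵥ v) ≤ l2norm v := by
  have h1 := h.l2norm_perp_sq v
  exact le_of_sq_le_sq_of_nonneg (by nlinarith [sq_nonneg (l2norm (Qᵀ *ᵥ v))]) (l2norm_nonneg _)

lemma IsEstimate.l2norm_transpose_le {Q : Matrix (Fin n) (Fin r) ℝ} (h : IsEstimate Q)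
    (v : Fin n → ℝ) : l2norm (Qᵀ *ᵥ v) ≤ l2norm v := by
  have h1 := h.l2norm_perp_sq v
  exact le_of_sq_le_sq_of_nonneg (by nlinarith [sq_nonneg (l2norm (perp Q *ᵥ v))]) (l2norm_nonneg _)

lemma IsEstimate.norm_perp_le {Q : Matrix (Fin n) (Fin r) ℝ} (h : IsEstimate Q) : ‖perp Q‖ ≤ 1 :=
  norm_le_of_l2norm_mulVec_le zero_le_one fun v => by rw [one_mul]; exact h.l2norm_perp_le v

lemma IsEstimate.norm_le {Q : Matrix (Fin n) (Fin r) ℝ} (h : IsEstimate Q) : ‖Q‖ ≤ 1 := by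
  rw [← norm_transpose]
  exact norm_le_of_l2norm_mulVec_le zero_le_one fun v => by rw [one_mul]; exact h.l2norm_transpose_le v

lemma IsBasisMatrix.isEstimate {P : Matrix (Fin n) (Fin r) ℝ} (h : IsBasisMatrix P) :
    IsEstimate P := Or.inl h

lemma IsBasisMatrix.l2norm_mulVec {P : Matrix (Fin n) (Fin r) ℝ} (h : IsBasisMatrix P)
    (x : Fin r → ℝ) : l2norm (P *ᵥ x) = l2norm x := by
  have : l2norm (P *ᵥ x) ^ 2 = l2norm x ^ 2 := by
    rw [l2norm_sq, l2norm_sq, dotProduct_mulVec_mulVec, Matrix.mulVec_mulVec, h, Matrix.one_mulVec]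
  exact (pow_left_inj₀ (l2norm_nonneg _) (l2norm_nonneg _) two_ne_zero).mp this

lemma sinTheta_eq (Q P : Matrix (Fin n) (Fin r) ℝ) : sinTheta Q P = ‖perp Q * P‖ :=
  specNorm_eq_norm _

lemma sinTheta_nonneg (Q P : Matrix (Fin n) (Fin r) ℝ) : 0 ≤ sinTheta Q P := by
  rw [sinTheta_eq]; exact norm_nonneg _

lemma sinTheta_le_one {Q P : Matrix (Fin n) (Fin r) ℝ} (hQ : IsEstimate Q) (hP : IsEstimate P) :
    sinTheta Q P ≤ 1 := by
  rw [sinTheta_eq]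
  refine (l2_opNorm_mul _ _).trans ?_
  have := hQ.norm_perp_le
  have := hP.norm_le
  have := norm_nonneg (perp Q)
  have := norm_nonneg P
  nlinarith

/-- The identity P₁P₁ᵀ + (I - P₁P₁ᵀ) = I is inserted between the two factors; all other factors are
contractions. -/
lemma sinTheta_triangle {Q P₁ P₂ : Matrix (Fin n) (Fin r) ℝ} (hQ : IsEstimate Q)
    (h1 : IsBasisMatrix P₁) (h2 : IsBasisMatrix P₂) :
    sinTheta Q P₂ ≤ sinTheta Q P₁ + sinTheta P₁ P₂ := by
  simp only [sinTheta_eq]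
  have e : perp Q * P₂ = perp Q * P₁ * (P₁ᵀ * P₂) + perp Q * (perp P₁ * P₂) := by
    have : P₁ * P₁ᵀ + perp P₁ = 1 := by simp [perp]
    calc perp Q * P₂ = perp Q * ((P₁ * P₁ᵀ + perp P₁) * P₂) := by rw [this, Matrix.one_mul]
      _ = _ := by rw [Matrix.add_mul, Matrix.mul_add]; simp only [Matrix.mul_assoc]
  rw [e]
  refine (norm_add_le _ _).trans (add_le_add ?_ ?_)
  · refine (l2_opNorm_mul _ _).trans (mul_le_of_le_one_right (norm_nonneg _) ?_)
    refine (l2_opNorm_mul _ _).trans ?_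
    rw [norm_transpose]
    exact mul_le_one₀ h1.isEstimate.norm_le (norm_nonneg _) h2.isEstimate.norm_le
  · refine (l2_opNorm_mul _ _).trans ?_
    exact mul_le_of_le_one_left (norm_nonneg _) hQ.norm_perp_le

/-- Below distance 1, QᵀP is injective and hence, being square, invertible. Its lower bound 1 - s²
on squared lengths then passes to the transpose, and Pythagoras converts it back into a bound for
the complementary part. -/
lemma sinTheta_comm_le {P Q : Matrix (Fin n) (Fin r) ℝ} (hP : IsBasisMatrix P)
    (hQ : IsBasisMatrix Q) : sinTheta P Q ≤ sinTheta Q P := by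
  rcases le_or_gt 1 (sinTheta Q P) with h | h
  · exact (sinTheta_le_one hP.isEstimate hQ.isEstimate).trans h
  set s := sinTheta Q P with hs
  have hs0 : 0 ≤ s := sinTheta_nonneg _ _
  have hs1 : 0 < 1 - s ^ 2 := by nlinarith
  have hB : ∀ x : Fin r → ℝ, (1 - s ^ 2) * l2norm x ^ 2 ≤ l2norm ((Qᵀ * P) *ᵥ x) ^ 2 := by
    intro x
    have h1 := hQ.isEstimate.l2norm_perp_sq (P *ᵥ x)
    rw [hP.l2norm_mulVec, Matrix.mulVec_mulVec, Matrix.mulVec_mulVec] at h1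
    have h2 := pow_le_pow_left₀ (l2norm_nonneg _) (l2norm_mulVec_le (perp Q * P) x) 2
    rw [← sinTheta_eq, ← hs, mul_pow] at h2
    linarith
  have hinj : Function.Injective (Qᵀ * P).mulVec := by
    intro x y hxy
    have h1 := hB (x - y)
    rw [Matrix.mulVec_sub, hxy, sub_self, l2norm_zero] at h1
    have h2 : l2norm (x - y) = 0 := by
      have := sq_nonneg (l2norm (x - y))
      have h3 : l2norm (x - y) ^ 2 = 0 := by nlinarith
      exact pow_eq_zero_iff two_ne_zero |>.mp h3
    exact sub_eq_zero.mp (l2norm_eq_zero.mp h2)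
  have hu : IsUnit (Qᵀ * P) := Matrix.mulVec_injective_iff_isUnit.mp hinj
  rw [sinTheta_eq]
  refine norm_le_of_l2norm_mulVec_le hs0 fun y => ?_
  obtain ⟨x, hx⟩ : ∃ x, (Qᵀ * P) *ᵥ x = y := by
    refine ⟨(Qᵀ * P)⁻¹ *ᵥ y, ?_⟩
    rw [Matrix.mulVec_mulVec, Matrix.mul_nonsing_inv _ ((Matrix.isUnit_iff_isUnit_det _).mp hu),
      Matrix.one_mulVec]
  -- Since y = QᵀPx, ‖y‖² is the pairing of PᵀQy with x. Combined with the lower bound for ‖QᵀPx‖,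
  -- this transfers the estimate to PᵀQ.
  have h1 : l2norm y ^ 2 ≤ l2norm ((Pᵀ * Q) *ᵥ y) * l2norm x := by
    have : y ⬝ᵥ y = ((Pᵀ * Q) *ᵥ y) ⬝ᵥ x := by
      conv_lhs => rw [← hx]
      nth_rewrite 1 [hx]
      rw [dotProduct_mulVec_mulVec, Matrix.transpose_mul, Matrix.transpose_transpose]
    rw [l2norm_sq, this]
    exact dotProduct_le _ _
  have h2 := hB x
  rw [hx] at h2
  have h3 : (1 - s ^ 2) * l2norm y ^ 2 ≤ l2norm ((Pᵀ * Q) *ᵥ y) ^ 2 := by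
    rcases (l2norm_nonneg y).eq_or_lt with h0 | h0
    · rw [← h0]; simp; positivity
    have h4 : (l2norm y ^ 2) ^ 2 ≤ l2norm ((Pᵀ * Q) *ᵥ y) ^ 2 * l2norm x ^ 2 := by
      rw [← mul_pow]; exact pow_le_pow_left₀ (by positivity) h1 2
    have h5 : (1 - s ^ 2) * (l2norm y ^ 2) ^ 2 ≤ l2norm ((Pᵀ * Q) *ᵥ y) ^ 2 * l2norm y ^ 2 := by
      have := mul_le_mul_of_nonneg_left h4 hs1.le
      have := mul_le_mul_of_nonneg_left h2 (sq_nonneg (l2norm ((Pᵀ * Q) *ᵥ y)))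
      linarith
    have h6 : 0 < l2norm y ^ 2 := by positivity
    nlinarith
  have h4 := hP.isEstimate.l2norm_perp_sq (Q *ᵥ y)
  rw [hQ.l2norm_mulVec, Matrix.mulVec_mulVec, Matrix.mulVec_mulVec] at h4
  refine le_of_sq_le_sq_of_nonneg ?_ (mul_nonneg hs0 (l2norm_nonneg _))
  rw [mul_pow]
  linarith

lemma sinTheta_comm {P Q : Matrix (Fin n) (Fin r) ℝ} (hP : IsBasisMatrix P)
    (hQ : IsBasisMatrix Q) : sinTheta P Q = sinTheta Q P :=
  le_antisymm (sinTheta_comm_le hP hQ) (sinTheta_comm_le hQ hP)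

end Subspaces

/-! ### The detection statistic as a squared operator norm. -/

section LargestEigenvalue

variable {n m : ℕ}

lemma IsHermitian.exists_quadratic_eq {ι : Type*} [Fintype ι] [DecidableEq ι] {Z : Matrix ι ι ℝ}
    (hH : Z.IsHermitian) (v : ι → ℝ) : ∃ w : ι → ℝ, w ⬝ᵥ w = v ⬝ᵥ v ∧
      v ⬝ᵥ Z *ᵥ v = ∑ i, hH.eigenvalues i * w i ^ 2 := by
  set U : Matrix ι ι ℝ := (hH.eigenvectorUnitary : Matrix ι ι ℝ)
  have hU1 : U * Uᵀ = 1 := by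
    have := Unitary.mul_star_self_of_mem hH.eigenvectorUnitary.2
    rwa [star_eq_conjTranspose, conjTranspose_eq_transpose_of_trivial] at this
  have hZ' : Z = U * diagonal hH.eigenvalues * Uᵀ := by
    have := hH.spectral_theorem
    rw [Unitary.conjStarAlgAut_apply, star_eq_conjTranspose,
      conjTranspose_eq_transpose_of_trivial] at this
    exact this
  refine ⟨Uᵀ *ᵥ v, ?_, ?_⟩
  · rw [dotProduct_mulVec_mulVec, Matrix.transpose_transpose, Matrix.mulVec_mulVec, hU1,
      Matrix.one_mulVec]
  · conv_lhs => rw [hZ']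
    exact dotProduct_mulVec_conj_diagonal U _ v

/-- As a squared norm the statistic is visibly measurable in B and can be estimated from single test
vectors. -/
lemma lamMaxGram_eq_norm_sq [NeZero n] (B : Matrix (Fin n) (Fin m) ℝ) :
    lamMaxGram B = ‖B‖ ^ 2 := by
  have hH := Matrix.isHermitian_mul_conjTranspose_self B
  have hbdd : BddAbove (Set.range hH.eigenvalues) := Set.finite_range _ |>.bddAbove
  have hq : ∀ v : Fin n → ℝ, v ⬝ᵥ (B * Bᴴ) *ᵥ v = l2norm (Bᵀ *ᵥ v) ^ 2 := fun v => by
    rw [← Matrix.mulVec_mulVec, dotProduct_mulVec_mulVec, conjTranspose_eq_transpose_of_trivial,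
      l2norm_sq]
  apply le_antisymm
  · refine ciSup_le fun i => ?_
    set v : Fin n → ℝ := (hH.eigenvectorBasis i).ofLp
    have h1 : (B * Bᴴ) *ᵥ v = hH.eigenvalues i • v := hH.mulVec_eigenvectorBasis i
    have h2 : v ⬝ᵥ v = 1 := by
      rw [← l2norm_sq]
      have : l2norm v = 1 := hH.eigenvectorBasis.orthonormal.1 i
      rw [this]; norm_num
    have h3 := hq v
    rw [h1, dotProduct_smul, h2, smul_eq_mul, mul_one] at h3
    rw [h3]
    have h4 := l2norm_mulVec_le Bᵀ v
    rw [norm_transpose] at h4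
    have h5 : l2norm v = 1 := hH.eigenvectorBasis.orthonormal.1 i
    rw [h5, mul_one] at h4
    exact pow_le_pow_left₀ (l2norm_nonneg _) h4 2
  · set Λ := lamMaxGram B
    have key : ∀ v : Fin n → ℝ, l2norm (Bᵀ *ᵥ v) ^ 2 ≤ Λ * l2norm v ^ 2 := by
      intro v
      obtain ⟨w, hw1, hw2⟩ := IsHermitian.exists_quadratic_eq hH v
      rw [← hq, hw2, l2norm_sq, ← hw1, dotProduct, Finset.mul_sum]
      refine Finset.sum_le_sum fun i _ => ?_
      rw [← pow_two]
      exact mul_le_mul_of_nonneg_right (le_ciSup hbdd i) (sq_nonneg _)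
    have h0 : 0 ≤ Λ := by
      have h1 := key (Pi.single 0 1)
      have h2 : l2norm (Pi.single (0 : Fin n) (1 : ℝ)) ^ 2 = 1 := by rw [l2norm_sq]; simp
      rw [h2, mul_one] at h1
      exact (sq_nonneg _).trans h1
    have h3 : ‖Bᵀ‖ ≤ Real.sqrt Λ := by
      refine norm_le_of_l2norm_mulVec_le (Real.sqrt_nonneg _) fun v => ?_
      refine le_of_sq_le_sq_of_nonneg ?_ (mul_nonneg (Real.sqrt_nonneg _) (l2norm_nonneg _))
      rw [mul_pow, Real.sq_sqrt h0]
      exact key v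
    rw [norm_transpose] at h3
    calc ‖B‖ ^ 2 ≤ Real.sqrt Λ ^ 2 := pow_le_pow_left₀ (norm_nonneg _) h3 2
      _ = Λ := Real.sq_sqrt h0

end LargestEigenvalue

/-! ### A sin Theta theorem for top left singular vectors. -/

section DavisKahan

variable {n m r : ℕ}

/-- A Weyl inequality by dimension count: the span of the columns of U and of v has dimension r + 1,
so it contains a nonzero vector orthogonal to P. On that span the Gram form is at least its Rayleigh
quotient at v. -/
lemma IsTopLeftSingular.l2norm_transpose_sq_le {M : Matrix (Fin n) (Fin m) ℝ}
    {U P : Matrix (Fin n) (Fin r) ℝ} (hU : IsTopLeftSingular M U) {h : ℝ}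
    (hH : ∀ v : Fin n → ℝ, Pᵀ *ᵥ v = 0 → l2norm (Mᵀ *ᵥ v) ^ 2 ≤ h * l2norm v ^ 2)
    {v : Fin n → ℝ} (hv : Uᵀ *ᵥ v = 0) : l2norm (Mᵀ *ᵥ v) ^ 2 ≤ h * l2norm v ^ 2 := by
  obtain ⟨hUU, σ, hσ0, -, hσ, hstr⟩ := hU
  rcases (l2norm_nonneg v).eq_or_lt with h0 | h0
  · rw [l2norm_eq_zero.mp h0.symm]; simp [l2norm_zero]
  -- A linear map from dimension r + 1 to dimension r; a kernel element gives the vector orthogonal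
  -- to P.
  let φ : ((Fin r → ℝ) × ℝ) →ₗ[ℝ] (Fin r → ℝ) :=
    { toFun := fun p => Pᵀ *ᵥ (U *ᵥ p.1 + p.2 • v)
      map_add' := fun p q => by
        simp only [Prod.fst_add, Prod.snd_add, Matrix.mulVec_add, add_smul]; abel
      map_smul' := fun c p => by
        simp only [Prod.smul_fst, Prod.smul_snd, Matrix.mulVec_add, Matrix.mulVec_smul, smul_eq_mul,
          mul_smul, smul_add, RingHom.id_apply] }
  have hker : LinearMap.ker φ ≠ ⊥ := LinearMap.ker_ne_bot_of_finrank_lt (by simp)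
  obtain ⟨⟨c, β⟩, hmem, hne⟩ := (Submodule.ne_bot_iff _).mp hker
  have hz : Pᵀ *ᵥ (U *ᵥ c + β • v) = 0 := hmem
  have h1 := hH _ hz
  have hcross : (U *ᵥ c) ⬝ᵥ v = 0 := by
    rw [dotProduct_comm, dotProduct_mulVec_mulVec, hv, zero_dotProduct]
  have hUc : (U *ᵥ c) ⬝ᵥ (U *ᵥ c) = c ⬝ᵥ c := by
    rw [dotProduct_mulVec_mulVec, Matrix.mulVec_mulVec, hUU, Matrix.one_mulVec]
  have hzz : l2norm (U *ᵥ c + β • v) ^ 2 = c ⬝ᵥ c + β ^ 2 * l2norm v ^ 2 := by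
    rw [l2norm_sq, l2norm_sq]
    simp only [add_dotProduct, dotProduct_add, smul_dotProduct, dotProduct_smul, smul_eq_mul, hUc,
      hcross, dotProduct_comm v (U *ᵥ c)]
    ring
  have hSU : ∀ y, (Mᵀ *ᵥ (U *ᵥ c)) ⬝ᵥ (Mᵀ *ᵥ y) = ∑ k, σ k ^ 2 * c k * (Uᵀ *ᵥ y) k := by
    intro y
    rw [dotProduct_mulVec_mulVec, Matrix.transpose_transpose, Matrix.mulVec_mulVec,
      Matrix.mulVec_mulVec, hσ, ← Matrix.mulVec_mulVec, dotProduct_comm,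
      dotProduct_mulVec_mulVec, dotProduct]
    refine Finset.sum_congr rfl fun k _ => ?_
    rw [Matrix.mulVec_diagonal]; ring
  have hexp : l2norm (Mᵀ *ᵥ (U *ᵥ c + β • v)) ^ 2 =
      ∑ k, σ k ^ 2 * c k ^ 2 + β ^ 2 * l2norm (Mᵀ *ᵥ v) ^ 2 := by
    have e1 := hSU v
    rw [hv] at e1
    have e2 := hSU (U *ᵥ c)
    rw [Matrix.mulVec_mulVec _ Uᵀ U, hUU, Matrix.one_mulVec] at e2
    simp only [Pi.zero_apply, mul_zero, Finset.sum_const_zero] at e1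
    rw [l2norm_sq, l2norm_sq]
    simp only [Matrix.mulVec_add, Matrix.mulVec_smul, add_dotProduct, dotProduct_add,
      smul_dotProduct, dotProduct_smul, smul_eq_mul]
    rw [dotProduct_comm (Mᵀ *ᵥ v) (Mᵀ *ᵥ (U *ᵥ c)), e1, e2]
    have : ∑ k, σ k ^ 2 * c k * c k = ∑ k, σ k ^ 2 * c k ^ 2 :=
      Finset.sum_congr rfl fun k _ => by ring
    rw [this]; ring
  -- The Rayleigh quotient at v is at most every σ k ^ 2, by the extremality clause of
  -- `IsTopLeftSingular`.
  set ρ := l2norm (Mᵀ *ᵥ v) ^ 2 / l2norm v ^ 2 with hρ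
  have hρk : ∀ k, ρ ≤ σ k ^ 2 := fun k => by
    rw [hρ, div_le_iff₀ (by positivity), ← mul_pow]
    exact pow_le_pow_left₀ (l2norm_nonneg _) (hstr v hv k) 2
  have hMv : l2norm (Mᵀ *ᵥ v) ^ 2 = ρ * l2norm v ^ 2 := by rw [hρ]; field_simp
  have h2 : ρ * (c ⬝ᵥ c + β ^ 2 * l2norm v ^ 2) ≤ h * (c ⬝ᵥ c + β ^ 2 * l2norm v ^ 2) := by
    rw [← hzz]
    refine le_trans ?_ h1
    rw [hexp, hzz, hMv, mul_add]
    refine add_le_add ?_ (le_of_eq (by ring))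
    rw [dotProduct, Finset.mul_sum]
    refine Finset.sum_le_sum fun k _ => ?_
    rw [← pow_two]
    exact mul_le_mul_of_nonneg_right (hρk k) (sq_nonneg _)
  have hpos : 0 < c ⬝ᵥ c + β ^ 2 * l2norm v ^ 2 := by
    by_cases hβ : β = 0
    · have hc : c ≠ 0 := fun hc => hne (by rw [hc, hβ]; rfl)
      have : 0 < l2norm c := lt_of_le_of_ne (l2norm_nonneg _) fun h => hc (l2norm_eq_zero.mp h.symm)
      rw [← l2norm_sq]; positivity
    · have := dotProduct_self_nonneg' c
      have : 0 < β ^ 2 * l2norm v ^ 2 := by positivity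
      linarith
  rw [hMv]
  exact mul_le_mul_of_nonneg_right (le_of_mul_le_mul_right h2 hpos) (sq_nonneg _)

/-- A sin Theta theorem for the top left singular vectors of a perturbed matrix. -/
theorem IsTopLeftSingular.sinTheta_le {M : Matrix (Fin n) (Fin m) ℝ}
    {U P : Matrix (Fin n) (Fin r) ℝ} (hU : IsTopLeftSingular M U) (hP : IsBasisMatrix P)
    {A : Matrix (Fin r) (Fin r) ℝ} {H : Matrix (Fin n) (Fin n) ℝ} {l h : ℝ}
    (hS : M * Mᵀ = P * A * Pᵀ + H) (hA : ∀ x, l * (x ⬝ᵥ x) ≤ x ⬝ᵥ A *ᵥ x) (hH : ‖H‖ ≤ h)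
    (hlh : h < l) : sinTheta U P ≤ h / (l - h) := by
  have hh : 0 ≤ h := (norm_nonneg _).trans hH
  have hUb : IsEstimate U := Or.inl hU.1
  -- On the complement of P only the perturbation H contributes to the Gram form.
  have hweyl : ∀ v : Fin n → ℝ, Pᵀ *ᵥ v = 0 → l2norm (Mᵀ *ᵥ v) ^ 2 ≤ h * l2norm v ^ 2 := by
    intro v hv
    have e : l2norm (Mᵀ *ᵥ v) ^ 2 = v ⬝ᵥ H *ᵥ v := by
      rw [l2norm_sq, dotProduct_mulVec_mulVec, Matrix.transpose_transpose, Matrix.mulVec_mulVec,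
        hS, Matrix.add_mulVec, ← Matrix.mulVec_mulVec, hv, Matrix.mulVec_zero, zero_add,
        dotProduct_comm]
    rw [e, pow_two]
    refine (le_abs_self _).trans ((dotProduct_mulVec_le H v v).trans ?_)
    exact mul_le_mul_of_nonneg_right hH (mul_nonneg (l2norm_nonneg _) (l2norm_nonneg _))
  set Ũ := perp U
  -- The columns of U are eigenvectors, so the complementary projector commutes with the Gram matrix
  -- and the restricted Gram matrix has norm at most h.
  have hcomm : Ũ * (M * Mᵀ) = M * Mᵀ * Ũ := by
    obtain ⟨hUU, σ, -, -, hσ, -⟩ := hU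
    have h1 : M * Mᵀ * (U * Uᵀ) = U * diagonal (fun k => σ k ^ 2) * Uᵀ := by
      rw [← Matrix.mul_assoc, hσ]
    have h2 : (U * Uᵀ) * (M * Mᵀ) = U * diagonal (fun k => σ k ^ 2) * Uᵀ := by
      have := congrArg Matrix.transpose h1
      simpa [Matrix.transpose_mul, Matrix.mul_assoc] using this
    simp only [Ũ, perp, Matrix.sub_mul, Matrix.mul_sub, Matrix.one_mul, Matrix.mul_one, h1, h2]
  set X := Pᵀ * Ũ with hX
  have hXn : ‖X‖ = sinTheta U P := by
    rw [sinTheta_eq, ← norm_transpose, hX, Matrix.transpose_mul, perp_transpose,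
      Matrix.transpose_transpose]
  have hSU : M * Mᵀ * Ũ = Ũ * (M * Mᵀ) * Ũ := by
    rw [hcomm, Matrix.mul_assoc _ Ũ Ũ, hUb.perp_mul_perp]
  have hSn : ‖M * Mᵀ * Ũ‖ ≤ h := by
    rw [hSU]
    refine norm_le_of_quadratic_le ?_ hh fun v => ?_
    · simp only [Matrix.transpose_mul, Matrix.transpose_transpose, Ũ, perp_transpose,
        Matrix.mul_assoc]
    · have e : v ⬝ᵥ (Ũ * (M * Mᵀ) * Ũ) *ᵥ v = l2norm (Mᵀ *ᵥ (Ũ *ᵥ v)) ^ 2 := by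
        rw [← Matrix.mulVec_mulVec, ← Matrix.mulVec_mulVec, dotProduct_mulVec_mulVec,
          perp_transpose, ← Matrix.mulVec_mulVec, dotProduct_mulVec_mulVec, l2norm_sq]
      have h0 : Uᵀ *ᵥ (Ũ *ᵥ v) = 0 := by
        have : Uᵀ * Ũ = 0 := by
          have := congrArg Matrix.transpose hUb.perp_mul
          simpa [Matrix.transpose_mul, perp_transpose] using this
        rw [Matrix.mulVec_mulVec, this, Matrix.zero_mulVec]
      rw [e, abs_of_nonneg (sq_nonneg _), ← l2norm_sq]
      refine (hU.l2norm_transpose_sq_le hweyl h0).trans (mul_le_mul_of_nonneg_left ?_ hh)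
      exact pow_le_pow_left₀ (l2norm_nonneg _) (hUb.l2norm_perp_le v) 2
  -- A Sylvester equation for X = PᵀŨ. The coefficient A is bounded below by l and the one on the
  -- right has norm at most h, so l‖X‖ ≤ h‖X‖ + h.
  have hAX : A * X = X * (M * Mᵀ * Ũ) - Pᵀ * H * Ũ := by
    have h1 : Pᵀ * (M * Mᵀ) = A * Pᵀ + Pᵀ * H := by
      rw [hS, Matrix.mul_add, ← Matrix.mul_assoc, ← Matrix.mul_assoc, hP, Matrix.one_mul]
    have h2 : X * (M * Mᵀ * Ũ) = Pᵀ * (M * Mᵀ) * Ũ := by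
      rw [hX, Matrix.mul_assoc, ← Matrix.mul_assoc Ũ, ← hSU, ← Matrix.mul_assoc]
    rw [h2, h1, Matrix.add_mul, hX, Matrix.mul_assoc A]; abel
  have hAXn : ‖A * X‖ ≤ ‖X‖ * h + h := by
    rw [hAX]
    refine (norm_sub_le _ _).trans (add_le_add ?_ ?_)
    · exact (l2_opNorm_mul _ _).trans (mul_le_mul_of_nonneg_left hSn (norm_nonneg _))
    · have h1 : ‖Pᵀ * H‖ ≤ h := by
        refine (l2_opNorm_mul _ _).trans ?_
        rw [norm_transpose]
        exact (mul_le_of_le_one_left (norm_nonneg _) hP.isEstimate.norm_le).trans hH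
      exact (l2_opNorm_mul _ _).trans ((mul_le_of_le_one_right (norm_nonneg _)
        hUb.norm_perp_le).trans h1)
  have hl : 0 < l := hh.trans_lt hlh
  have hXle : ‖X‖ ≤ (‖X‖ * h + h) / l := by
    refine norm_le_of_l2norm_mulVec_le (by positivity) fun y => ?_
    have h1 := hA (X *ᵥ y)
    have h2 := dotProduct_le (X *ᵥ y) (A *ᵥ (X *ᵥ y))
    rw [Matrix.mulVec_mulVec] at h1 h2
    have h3 := (l2norm_mulVec_le (A * X) y).trans (mul_le_mul_of_nonneg_right hAXn (l2norm_nonneg y))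
    rw [← l2norm_sq] at h1
    rw [div_mul_eq_mul_div, le_div_iff₀ hl]
    rcases (l2norm_nonneg (X *ᵥ y)).eq_or_lt with h0 | h0
    · rw [← h0, zero_mul]
      exact mul_nonneg (by positivity) (l2norm_nonneg _)
    · have h4 : l * l2norm (X *ᵥ y) ^ 2 ≤ l2norm (X *ᵥ y) * ((‖X‖ * h + h) * l2norm y) :=
        h1.trans (h2.trans (mul_le_mul_of_nonneg_left h3 h0.le))
      nlinarith
  rw [le_div_iff₀ hl] at hXle
  rw [← hXn, le_div_iff₀ (by linarith)]
  linarith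

end DavisKahan

end NORST

end


section

namespace NORST

open scoped Matrix.Norms.L2Operator
open Filter Topology

/-! ### Projected least squares: the error map and its conditioning. -/

section LeastSquares

variable {n r : ℕ}

/-- The columns of the identity indexed by `T`. -/
def selCols (T : Finset (Fin n)) : Matrix (Fin n) {i // i ∈ T} ℝ :=
  (1 : Matrix (Fin n) (Fin n) ℝ).submatrix id Subtype.val

lemma selCols_transpose_mulVec (T : Finset (Fin n)) (v : Fin n → ℝ) :
    (selCols T)ᵀ *ᵥ v = fun i : {i // i ∈ T} => v i := by
  ext i
  simp [selCols, Matrix.mulVec, dotProduct, Matrix.one_apply]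

lemma selCols_mulVec (T : Finset (Fin n)) (w : {i // i ∈ T} → ℝ) (i : Fin n) :
    (selCols T *ᵥ w) i = if h : i ∈ T then w ⟨i, h⟩ else 0 := by
  simp only [selCols, Matrix.mulVec, dotProduct, Matrix.submatrix_apply, id, Matrix.one_apply,
    ite_mul, one_mul, zero_mul]
  split_ifs with h
  · rw [Finset.sum_eq_single ⟨i, h⟩]
    · simp
    · intro b _ hb
      rw [if_neg]; intro hib; exact hb (Subtype.ext hib.symm)
    · simp
  · refine Finset.sum_eq_zero fun b _ => ?_
    rw [if_neg]; intro hib; exact h (hib ▸ b.2)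

lemma selCols_transpose_mul_self (T : Finset (Fin n)) : (selCols T)ᵀ * selCols T = 1 := by
  ext i j
  simp only [selCols, Matrix.mul_apply, Matrix.transpose_apply, Matrix.submatrix_apply, id,
    Matrix.one_apply]
  simp only [ite_mul, one_mul, zero_mul, Finset.sum_ite_eq', Finset.mem_univ, if_true]
  by_cases h : i = j
  · rw [h]; simp
  · rw [if_neg h, if_neg fun hij => h (Subtype.ext hij)]

lemma l2norm_selCols_mulVec (T : Finset (Fin n)) (w : {i // i ∈ T} → ℝ) :
    l2norm (selCols T *ᵥ w) = l2norm w := by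
  have : l2norm (selCols T *ᵥ w) ^ 2 = l2norm w ^ 2 := by
    rw [l2norm_sq, l2norm_sq, dotProduct_mulVec_mulVec, Matrix.mulVec_mulVec,
      selCols_transpose_mul_self, Matrix.one_mulVec]
  exact (pow_left_inj₀ (l2norm_nonneg _) (l2norm_nonneg _) two_ne_zero).mp this

lemma psiCols_eq (Q : Matrix (Fin n) (Fin r) ℝ) (T : Finset (Fin n)) :
    psiCols Q T = perp Q * selCols T := by
  ext i j
  simp [psiCols, selCols, Matrix.mul_apply, Matrix.one_apply]

lemma IsEstimate.psiCols_transpose_mul_perp {Q : Matrix (Fin n) (Fin r) ℝ} (hQ : IsEstimate Q)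
    (T : Finset (Fin n)) : (psiCols Q T)ᵀ * perp Q = (psiCols Q T)ᵀ := by
  rw [psiCols_eq, Matrix.transpose_mul, perp_transpose, Matrix.mul_assoc, hQ.perp_mul_perp]

lemma IsEstimate.psiCols_transpose_mul_selCols {Q : Matrix (Fin n) (Fin r) ℝ} (hQ : IsEstimate Q)
    (T : Finset (Fin n)) : (psiCols Q T)ᵀ * selCols T = lsGram Q T := by
  rw [lsGram]
  conv_rhs => rw [psiCols_eq Q T, ← Matrix.mul_assoc]
  rw [← psiCols_eq, hQ.psiCols_transpose_mul_perp]

lemma projLS_eq (Q : Matrix (Fin n) (Fin r) ℝ) (T : Finset (Fin n)) (y : Fin n → ℝ) :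
    projLS Q T y = y - selCols T *ᵥ ((lsGram Q T)⁻¹ *ᵥ ((psiCols Q T)ᵀ *ᵥ (perp Q *ᵥ y))) := by
  ext i
  rw [projLS, Pi.sub_apply, selCols_mulVec]

lemma mask_eq (T : Finset (Fin n)) (v : Fin n → ℝ) :
    mask T v = v - selCols T *ᵥ ((selCols T)ᵀ *ᵥ v) := by
  ext i
  rw [Pi.sub_apply, selCols_mulVec, selCols_transpose_mulVec, mask]
  split_ifs <;> simp

/-- The linear map from coefficients to the error of projected least squares. -/
def lsErr (Q : Matrix (Fin n) (Fin r) ℝ) (T : Finset (Fin n)) (P : Matrix (Fin n) (Fin r) ℝ) :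
    Matrix (Fin n) (Fin r) ℝ :=
  -(selCols T * ((lsGram Q T)⁻¹ * ((psiCols Q T)ᵀ * P)))

/-- Masking subtracts a vector supported on T, which least squares restores exactly. What remains is
the part of the signal outside the range of Q, so the error is a linear function of the
coefficients. -/
lemma IsEstimate.projLS_mask {Q : Matrix (Fin n) (Fin r) ℝ} (hQ : IsEstimate Q)
    {T : Finset (Fin n)} (hdet : IsUnit (lsGram Q T).det) (P : Matrix (Fin n) (Fin r) ℝ)
    (x : Fin r → ℝ) : projLS Q T (mask T (P *ᵥ x)) = P *ᵥ x + lsErr Q T P *ᵥ x := by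
  set v := P *ᵥ x with hv
  have h1 : (psiCols Q T)ᵀ *ᵥ (perp Q *ᵥ mask T v) =
      (psiCols Q T)ᵀ *ᵥ v - lsGram Q T *ᵥ ((selCols T)ᵀ *ᵥ v) := by
    rw [Matrix.mulVec_mulVec, hQ.psiCols_transpose_mul_perp, mask_eq, Matrix.mulVec_sub,
      ← hQ.psiCols_transpose_mul_selCols, ← Matrix.mulVec_mulVec]
  rw [projLS_eq, h1, Matrix.mulVec_sub, Matrix.mulVec_mulVec _ (lsGram Q T)⁻¹ (lsGram Q T),
    Matrix.nonsing_inv_mul _ hdet, Matrix.one_mulVec, Matrix.mulVec_sub, lsErr, Matrix.neg_mulVec]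
  simp only [← Matrix.mulVec_mulVec]
  rw [← hv, mask_eq]
  abel

/-- The estimate is incoherent enough on `T` for projected least squares to be well posed. -/
def IsIncoherentOn (Q : Matrix (Fin n) (Fin r) ℝ) (T : Finset (Fin n)) : Prop :=
  ∀ w : {i // i ∈ T} → ℝ, l2norm (Qᵀ *ᵥ (selCols T *ᵥ w)) ^ 2 ≤ 1 / 6 * l2norm w ^ 2

/-- The quadratic form of the matrix is ‖w‖² minus the energy captured by Q on T, hence at least 5/6
‖w‖². This is the origin of the factor 1.2 = 6/5 in the theorem. -/
lemma IsIncoherentOn.lsGram_bound {Q : Matrix (Fin n) (Fin r) ℝ} (hQ : IsEstimate Q)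
    {T : Finset (Fin n)} (h : IsIncoherentOn Q T) :
    IsUnit (lsGram Q T).det ∧ ‖(lsGram Q T)⁻¹‖ ≤ 6 / 5 := by
  have hcoer : ∀ w, 5 / 6 * l2norm w ≤ l2norm (lsGram Q T *ᵥ w) := by
    intro w
    have h1 : w ⬝ᵥ lsGram Q T *ᵥ w = l2norm (perp Q *ᵥ (selCols T *ᵥ w)) ^ 2 := by
      rw [lsGram, ← Matrix.mulVec_mulVec, dotProduct_mulVec_mulVec, Matrix.transpose_transpose,
        psiCols_eq, l2norm_sq, Matrix.mulVec_mulVec]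
    rw [hQ.l2norm_perp_sq, l2norm_selCols_mulVec] at h1
    have h2 := h w
    have h3 := dotProduct_le w (lsGram Q T *ᵥ w)
    rcases (l2norm_nonneg w).eq_or_lt with h0 | h0
    · rw [← h0, mul_zero]; exact l2norm_nonneg _
    · nlinarith
  have hinj : Function.Injective (lsGram Q T).mulVec := by
    intro x y hxy
    have h1 := hcoer (x - y)
    rw [Matrix.mulVec_sub, hxy, sub_self, l2norm_zero] at h1
    have h2 : l2norm (x - y) = 0 := le_antisymm (by linarith) (l2norm_nonneg _)
    exact sub_eq_zero.mp (l2norm_eq_zero.mp h2)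
  have hdet : IsUnit (lsGram Q T).det :=
    (Matrix.isUnit_iff_isUnit_det _).mp (Matrix.mulVec_injective_iff_isUnit.mp hinj)
  refine ⟨hdet, norm_le_of_l2norm_mulVec_le (by norm_num) fun y => ?_⟩
  have h1 := hcoer ((lsGram Q T)⁻¹ *ᵥ y)
  rw [Matrix.mulVec_mulVec, Matrix.mul_nonsing_inv _ hdet, Matrix.one_mulVec] at h1
  linarith

/-- Only the restriction of u to T enters, because the error is supported there. This localization
is what makes rarely missing rows give small cross terms. -/
lemma IsIncoherentOn.abs_dotProduct_lsErr_le {Q P : Matrix (Fin n) (Fin r) ℝ} (hQ : IsEstimate Q)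
    {T : Finset (Fin n)} (h : IsIncoherentOn Q T) (u : Fin n → ℝ) (x : Fin r → ℝ) :
    |u ⬝ᵥ lsErr Q T P *ᵥ x| ≤ 1.2 * sinTheta Q P * (l2norm ((selCols T)ᵀ *ᵥ u) * l2norm x) := by
  obtain ⟨-, hinv⟩ := h.lsGram_bound hQ
  rw [lsErr, Matrix.neg_mulVec, dotProduct_neg, abs_neg, ← Matrix.mulVec_mulVec,
    dotProduct_mulVec_mulVec, ← Matrix.mulVec_mulVec]
  have h1 : l2norm (((psiCols Q T)ᵀ * P) *ᵥ x) ≤ sinTheta Q P * l2norm x := by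
    have e : (psiCols Q T)ᵀ * P = (selCols T)ᵀ * (perp Q * P) := by
      rw [psiCols_eq, Matrix.transpose_mul, perp_transpose, Matrix.mul_assoc]
    rw [e, ← Matrix.mulVec_mulVec, sinTheta_eq]
    refine le_trans ?_ (l2norm_mulVec_le (perp Q * P) x)
    set z := (perp Q * P) *ᵥ x
    have hz : l2norm ((selCols T)ᵀ *ᵥ z) ^ 2 ≤ l2norm z * l2norm ((selCols T)ᵀ *ᵥ z) := by
      rw [l2norm_sq, dotProduct_comm, ← Matrix.transpose_transpose (selCols T),
        ← dotProduct_mulVec_mulVec, Matrix.transpose_transpose]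
      refine (dotProduct_le _ _).trans (le_of_eq ?_)
      rw [l2norm_selCols_mulVec]
    rcases (l2norm_nonneg ((selCols T)ᵀ *ᵥ z)).eq_or_lt with h0 | h0
    · rw [← h0]; exact l2norm_nonneg _
    · nlinarith
  have h2 := (l2norm_mulVec_le (lsGram Q T)⁻¹ (((psiCols Q T)ᵀ * P) *ᵥ x)).trans
    (mul_le_mul hinv h1 (l2norm_nonneg _) (by norm_num))
  refine (abs_dotProduct_le _ _).trans ?_
  refine (mul_le_mul_of_nonneg_left h2 (l2norm_nonneg _)).trans (le_of_eq ?_)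
  ring

lemma IsIncoherent.l2norm_transpose_sq_le {μ : ℝ} {P : Matrix (Fin n) (Fin r) ℝ}
    (h : IsIncoherent μ P) (T : Finset (Fin n)) (w : {i // i ∈ T} → ℝ) :
    l2norm (Pᵀ *ᵥ (selCols T *ᵥ w)) ^ 2 ≤ T.card * (μ * r / n) * l2norm w ^ 2 := by
  have e : ∀ k, (Pᵀ *ᵥ (selCols T *ᵥ w)) k = ∑ i : {i // i ∈ T}, P i k * w i := by
    intro k
    have : Pᵀ * selCols T = Matrix.of fun k (i : {i // i ∈ T}) => P i k := by
      ext k i; simp [selCols, Matrix.mul_apply, Matrix.one_apply]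
    rw [Matrix.mulVec_mulVec, this]
    rfl
  have h1 : l2norm (Pᵀ *ᵥ (selCols T *ᵥ w)) ^ 2 ≤
      ∑ k, (∑ i : {i // i ∈ T}, P i k ^ 2) * ∑ i, w i ^ 2 := by
    rw [l2norm_sq, dotProduct]
    refine Finset.sum_le_sum fun k _ => ?_
    rw [e, ← pow_two]
    exact Finset.sum_mul_sq_le_sq_mul_sq _ _ _
  have h2 : l2norm w ^ 2 = ∑ i, w i ^ 2 := by rw [l2norm_sq]; simp [dotProduct, pow_two]
  rw [← Finset.sum_mul, ← h2, Finset.sum_comm] at h1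
  refine h1.trans (mul_le_mul_of_nonneg_right ?_ (sq_nonneg _))
  refine (Finset.sum_le_sum fun (i : {i // i ∈ T}) _ => h i).trans (le_of_eq ?_)
  simp

/-- The column fraction 1/(100 μ r) gives norm at most 0.1 for P on T, and the distance adds 0.3;
finally 0.4² = 0.16 < 1/6. -/
lemma isIncoherentOn_of_sinTheta_le {μ : ℝ} (hμ : 0 < μ) (hr : 1 ≤ r) (hn : 1 ≤ n)
    {P Q : Matrix (Fin n) (Fin r) ℝ} (hP : IsBasisMatrix P) (hinc : IsIncoherent μ P)
    {T : Finset (Fin n)} (hT : (T.card : ℝ) / n ≤ (1 / 100) / (μ * r)) (hQ : IsBasisMatrix Q)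
    (hs : sinTheta Q P ≤ 0.3) : IsIncoherentOn Q T := by
  intro w
  have hr' : (0 : ℝ) < r := by exact_mod_cast hr
  have hn' : (0 : ℝ) < n := by exact_mod_cast hn
  have h1 : l2norm (Pᵀ *ᵥ (selCols T *ᵥ w)) ^ 2 ≤ (0.1 * l2norm w) ^ 2 := by
    refine (hinc.l2norm_transpose_sq_le T w).trans ?_
    rw [mul_pow]
    refine mul_le_mul_of_nonneg_right ?_ (sq_nonneg _)
    rw [le_div_iff₀ (by positivity)] at hT
    calc (T.card : ℝ) * (μ * r / n) = T.card / n * (μ * r) := by ring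
      _ ≤ 1 / 100 := hT
      _ = 0.1 ^ 2 := by norm_num
  have h1' := le_of_sq_le_sq_of_nonneg h1 (by have := l2norm_nonneg w; positivity)
  set v := selCols T *ᵥ w with hv
  have hvn : l2norm v = l2norm w := l2norm_selCols_mulVec T w
  have e : Qᵀ *ᵥ v = (Qᵀ * P) *ᵥ (Pᵀ *ᵥ v) + (perp P * Q)ᵀ *ᵥ v := by
    have : Qᵀ = Qᵀ * P * Pᵀ + (perp P * Q)ᵀ := by
      rw [Matrix.transpose_mul, perp_transpose, perp, Matrix.mul_sub, Matrix.mul_assoc]; simp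
    conv_lhs => rw [this]
    rw [Matrix.add_mulVec, ← Matrix.mulVec_mulVec]
  have h2 : l2norm ((Qᵀ * P) *ᵥ (Pᵀ *ᵥ v)) ≤ 0.1 * l2norm w := by
    refine (l2norm_mulVec_le _ _).trans (le_trans (mul_le_of_le_one_left (l2norm_nonneg _) ?_) h1')
    refine (l2_opNorm_mul _ _).trans ?_
    rw [norm_transpose]
    exact mul_le_one₀ hQ.isEstimate.norm_le (norm_nonneg _) hP.isEstimate.norm_le
  have h3 : l2norm ((perp P * Q)ᵀ *ᵥ v) ≤ 0.3 * l2norm w := by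
    refine (l2norm_mulVec_le _ _).trans ?_
    rw [norm_transpose, ← sinTheta_eq, hvn]
    exact mul_le_mul_of_nonneg_right ((sinTheta_comm_le hP hQ).trans hs) (l2norm_nonneg _)
  have h4 : l2norm (Qᵀ *ᵥ v) ≤ 0.4 * l2norm w := by
    rw [e]; refine (l2norm_add_le _ _).trans ?_; linarith
  have h5 := pow_le_pow_left₀ (l2norm_nonneg _) h4 2
  rw [mul_pow] at h5
  have := sq_nonneg (l2norm w)
  linarith

lemma isIncoherentOn_zero (T : Finset (Fin n)) :
    IsIncoherentOn (0 : Matrix (Fin n) (Fin r) ℝ) T := by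
  intro w
  simp only [Matrix.transpose_zero, Matrix.zero_mulVec, l2norm_zero]
  nlinarith [sq_nonneg (l2norm w)]

/-- The error of projected least squares. -/
lemma IsIncoherentOn.vnorm_projLS_sub_le {Q P : Matrix (Fin n) (Fin r) ℝ} (hQ : IsEstimate Q)
    (hP : IsBasisMatrix P) {T : Finset (Fin n)} (h : IsIncoherentOn Q T) (x : Fin r → ℝ) :
    vnorm (projLS Q T (mask T (P *ᵥ x)) - P *ᵥ x) ≤ 1.2 * sinTheta Q P * vnorm (P *ᵥ x) := by
  rw [hQ.projLS_mask (h.lsGram_bound hQ).1, add_sub_cancel_left, vnorm_eq_l2norm, vnorm_eq_l2norm,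
    hP.l2norm_mulVec]
  set z := lsErr Q T P *ᵥ x with hz
  have h1 := h.abs_dotProduct_lsErr_le (P := P) hQ z x
  rw [← hz, ← l2norm_sq, abs_of_nonneg (sq_nonneg _)] at h1
  have h2 : l2norm ((selCols T)ᵀ *ᵥ z) ≤ l2norm z := by
    refine le_of_sq_le_sq_of_nonneg ?_ (l2norm_nonneg _)
    rw [selCols_transpose_mulVec, l2norm_sq, l2norm_sq]
    simp only [dotProduct]
    rw [Finset.sum_coe_sort T (fun i => z i * z i)]
    exact Finset.sum_le_sum_of_subset_of_nonneg (Finset.subset_univ _)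
      fun i _ _ => mul_self_nonneg _
  have hs := sinTheta_nonneg Q P
  have h3 : l2norm z ^ 2 ≤ 1.2 * sinTheta Q P * (l2norm z * l2norm x) :=
    h1.trans (mul_le_mul_of_nonneg_left (mul_le_mul_of_nonneg_right h2 (l2norm_nonneg _))
      (by positivity))
  rcases (l2norm_nonneg z).eq_or_lt with h0 | h0
  · rw [← h0]; have := l2norm_nonneg x; positivity
  · nlinarith

end LeastSquares

end NORST

end


section

namespace NORST

open scoped Matrix.Norms.L2Operator
open Filter Topology

/-! ### Contraction and detection on a single regular window. -/

section Window

variable {n r : ℕ}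

/-- The weighted inner product given by the diagonal covariance. -/
def covForm (lam : Fin r → ℝ) (x y : Fin r → ℝ) : ℝ := ∑ i, lam i * x i * y i

lemma abs_covForm_le {lam : Fin r → ℝ} {L : ℝ} (h0 : ∀ i, 0 ≤ lam i) (hL : ∀ i, lam i ≤ L)
    (hL0 : 0 ≤ L) (x y : Fin r → ℝ) : |covForm lam x y| ≤ L * (l2norm x * l2norm y) := by
  have e : covForm lam x y = x ⬝ᵥ diagonal lam *ᵥ y := by
    simp only [covForm, dotProduct, Matrix.mulVec_diagonal]
    exact Finset.sum_congr rfl fun i _ => by ring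
  rw [e]
  exact (dotProduct_mulVec_le _ x y).trans (mul_le_mul_of_nonneg_right (norm_diagonal_le h0 hL hL0)
    (mul_nonneg (l2norm_nonneg _) (l2norm_nonneg _)))

lemma le_covForm_self {lam : Fin r → ℝ} {l : ℝ} (hl : ∀ i, l ≤ lam i) (x : Fin r → ℝ) :
    l * l2norm x ^ 2 ≤ covForm lam x x := by
  rw [l2norm_sq, dotProduct, Finset.mul_sum]
  refine Finset.sum_le_sum fun i _ => ?_
  rw [mul_assoc]
  exact mul_le_mul_of_nonneg_right (hl i) (mul_self_nonneg _)

/-- A window of frames in which the empirical second moments of the coefficients, and of their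
images under the least squares error maps, are close to their expectations. -/
structure RegularWindow (α : ℕ) (W : Finset ℕ) (lam : Fin r → ℝ) (L l c : ℝ)
    (a : ℕ → Fin r → ℝ) (E : ℕ → Matrix (Fin n) (Fin r) ℝ) (T : ℕ → Finset (Fin n)) : Prop where
  l_pos : 0 < l
  l_le : ∀ i, l ≤ lam i
  le_L : ∀ i, lam i ≤ L
  l_le_L : l ≤ L
  c_nonneg : 0 ≤ c
  conc : ∀ (x : Fin r → ℝ) (u : Fin n → ℝ), |∑ t ∈ W, (((x + (E t)ᵀ *ᵥ u) ⬝ᵥ a t) ^ 2 -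
    covForm lam (x + (E t)ᵀ *ᵥ u) (x + (E t)ᵀ *ᵥ u))| ≤
      α * l / 1000 * (l2norm x ^ 2 + c ^ 2 * l2norm u ^ 2)
  err : ∀ t ∈ W, ∀ (u : Fin n → ℝ) (x : Fin r → ℝ),
    |u ⬝ᵥ E t *ᵥ x| ≤ c * (l2norm ((selCols (T t))ᵀ *ᵥ u) * l2norm x)
  freq : ∀ i, (((W.filter fun t => i ∈ T t).card : ℕ) : ℝ) * (1000 * L) ^ 2 ≤ α * l ^ 2
  card_le : W.card ≤ α

namespace RegularWindow

variable {α : ℕ} {W : Finset ℕ} {lam : Fin r → ℝ} {L l c : ℝ} {a : ℕ → Fin r → ℝ}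
  {E : ℕ → Matrix (Fin n) (Fin r) ℝ} {T : ℕ → Finset (Fin n)}

lemma lam_nonneg (h : RegularWindow α W lam L l c a E T) (i : Fin r) : 0 ≤ lam i :=
  h.l_pos.le.trans (h.l_le i)

lemma L_pos (h : RegularWindow α W lam L l c a E T) : 0 < L := h.l_pos.trans_le h.l_le_L

lemma l2norm_transpose_le (h : RegularWindow α W lam L l c a E T) {t : ℕ} (ht : t ∈ W)
    (u : Fin n → ℝ) : l2norm ((E t)ᵀ *ᵥ u) ≤ c * l2norm ((selCols (T t))ᵀ *ᵥ u) := by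
  have h1 := (le_abs_self _).trans (h.err t ht u ((E t)ᵀ *ᵥ u))
  rw [dotProduct_mulVec_mulVec, ← l2norm_sq] at h1
  have hc := h.c_nonneg
  rcases (l2norm_nonneg ((E t)ᵀ *ᵥ u)).eq_or_lt with h0 | h0
  · rw [← h0]; exact mul_nonneg hc (l2norm_nonneg _)
  · nlinarith

/-- Interchanging the sums over frames and rows leaves, for each row, the number of frames in which
it is missing. -/
lemma sum_sq_le (h : RegularWindow α W lam L l c a E T) (u : Fin n → ℝ) :
    (1000 * L) ^ 2 * ∑ t ∈ W, l2norm ((selCols (T t))ᵀ *ᵥ u) ^ 2 ≤ α * l ^ 2 * l2norm u ^ 2 := by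
  have e : ∑ t ∈ W, l2norm ((selCols (T t))ᵀ *ᵥ u) ^ 2 =
      ∑ i, ((W.filter fun t => i ∈ T t).card : ℝ) * u i ^ 2 := by
    have h1 : ∀ t, l2norm ((selCols (T t))ᵀ *ᵥ u) ^ 2 = ∑ i, if i ∈ T t then u i ^ 2 else 0 := by
      intro t
      rw [selCols_transpose_mulVec, l2norm_sq, dotProduct,
        Finset.sum_coe_sort (T t) (fun i => u i * u i), ← Finset.sum_filter]
      simp [pow_two]
    simp only [h1]
    rw [Finset.sum_comm]
    refine Finset.sum_congr rfl fun i _ => ?_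
    rw [← Finset.sum_filter, Finset.sum_const, nsmul_eq_mul]
  rw [e, l2norm_sq, dotProduct, Finset.mul_sum, Finset.mul_sum]
  refine Finset.sum_le_sum fun i _ => ?_
  have := mul_le_mul_of_nonneg_right (h.freq i) (sq_nonneg (u i))
  nlinarith

/-- Cauchy-Schwarz over the frames costs a square root of the row fraction. With a fraction of
1/(1000 f)² this still compensates the factor L against l. -/
lemma sum_le (h : RegularWindow α W lam L l c a E T) (u : Fin n → ℝ) :
    L * ∑ t ∈ W, l2norm ((selCols (T t))ᵀ *ᵥ u) ≤ α * l / 1000 * l2norm u := by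
  have hl := h.l_pos
  have hL := h.L_pos
  refine le_of_sq_le_sq_of_nonneg ?_ (by have := l2norm_nonneg u; positivity)
  have h1 : (∑ t ∈ W, l2norm ((selCols (T t))ᵀ *ᵥ u)) ^ 2 ≤
      α * ∑ t ∈ W, l2norm ((selCols (T t))ᵀ *ᵥ u) ^ 2 := by
    refine sq_sum_le_card_mul_sum_sq.trans (mul_le_mul_of_nonneg_right ?_
      (Finset.sum_nonneg fun _ _ => sq_nonneg _))
    exact_mod_cast h.card_le
  have h2 := mul_le_mul_of_nonneg_left (h.sum_sq_le u) (Nat.cast_nonneg (α := ℝ) α)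
  have h3 := mul_le_mul_of_nonneg_left h1 (sq_nonneg (1000 * L))
  nlinarith

lemma sum_sq_dot (h : RegularWindow α W lam L l c a E T) (x : Fin r → ℝ) :
    |∑ t ∈ W, (x ⬝ᵥ a t) ^ 2 - W.card * covForm lam x x| ≤ α * l / 1000 * l2norm x ^ 2 := by
  have h1 := h.conc x 0
  simp only [Matrix.mulVec_zero, add_zero, l2norm_zero] at h1
  rw [Finset.sum_sub_distrib, Finset.sum_const, nsmul_eq_mul] at h1
  refine h1.trans (le_of_eq (by ring))

/-- One thousandth comes from the fluctuation and one from the mean, which is small by the row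
frequencies. -/
lemma sum_err_sq_le (h : RegularWindow α W lam L l c a E T) (u : Fin n → ℝ) :
    ∑ t ∈ W, (u ⬝ᵥ E t *ᵥ a t) ^ 2 ≤ 2 / 1000 * c ^ 2 * (α * l) * l2norm u ^ 2 := by
  have h1 := (abs_le.mp (h.conc 0 u)).2
  simp only [zero_add, l2norm_zero] at h1
  rw [Finset.sum_sub_distrib] at h1
  have e : ∀ t, u ⬝ᵥ E t *ᵥ a t = ((E t)ᵀ *ᵥ u) ⬝ᵥ a t := fun t => dotProduct_mulVec_mulVec _ _ _
  simp only [e]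
  have hl := h.l_pos
  have hL := h.L_pos
  have h2 : ∑ t ∈ W, covForm lam ((E t)ᵀ *ᵥ u) ((E t)ᵀ *ᵥ u) ≤
      L * c ^ 2 * ∑ t ∈ W, l2norm ((selCols (T t))ᵀ *ᵥ u) ^ 2 := by
    rw [Finset.mul_sum]
    refine Finset.sum_le_sum fun t ht => ?_
    have h3 := (le_abs_self _).trans
      (abs_covForm_le h.lam_nonneg h.le_L hL.le ((E t)ᵀ *ᵥ u) ((E t)ᵀ *ᵥ u))
    have h4 := pow_le_pow_left₀ (l2norm_nonneg _) (h.l2norm_transpose_le ht u) 2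
    rw [mul_pow] at h4
    have h5 := mul_le_mul_of_nonneg_left h4 hL.le
    nlinarith
  have h3 : L * ∑ t ∈ W, l2norm ((selCols (T t))ᵀ *ᵥ u) ^ 2 ≤ α * l / 1000 * l2norm u ^ 2 := by
    have h4 := h.sum_sq_le u
    set s := ∑ t ∈ W, l2norm ((selCols (T t))ᵀ *ᵥ u) ^ 2
    have hs : 0 ≤ s := Finset.sum_nonneg fun _ _ => sq_nonneg _
    have h5 : l * (L * s) * 1000 ≤ l * (α * l / 1000 * l2norm u ^ 2) * 1000 := by
      have h6 : l * (L * s) ≤ L * (L * s) :=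
        mul_le_mul_of_nonneg_right h.l_le_L (by positivity)
      have : 0 ≤ L * (L * s) := by positivity
      nlinarith
    have h7 := le_of_mul_le_mul_right h5 (by norm_num)
    exact le_of_mul_le_mul_left h7 hl
  have h4 := mul_le_mul_of_nonneg_left h3 (sq_nonneg c)
  nlinarith

/-- The cross term is split into its fluctuation `B`, obtained from the quadratic concentration by
polarization, and its mean, which is small by `sum_le`. Each contributes one thousandth. -/
lemma abs_sum_cross_le (h : RegularWindow α W lam L l c a E T) (x : Fin r → ℝ) (u : Fin n → ℝ) :
    |∑ t ∈ W, (x ⬝ᵥ a t) * (u ⬝ᵥ E t *ᵥ a t)| ≤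
      2 / 1000 * c * (α * l) * (l2norm x * l2norm u) := by
  have hl := h.l_pos
  have hL := h.L_pos
  have hc := h.c_nonneg
  let B : (Fin r → ℝ) → (Fin n → ℝ) → ℝ := fun x u =>
    ∑ t ∈ W, ((x ⬝ᵥ a t) * (((E t)ᵀ *ᵥ u) ⬝ᵥ a t) - covForm lam x ((E t)ᵀ *ᵥ u))
  have hcomm : ∀ x y, covForm lam x y = covForm lam y x := fun x y =>
    Finset.sum_congr rfl fun i _ => by ring
  have hadd : ∀ x y z, covForm lam (x + y) z = covForm lam x z + covForm lam y z := fun x y z => by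
    simp only [covForm, Pi.add_apply, ← Finset.sum_add_distrib]
    exact Finset.sum_congr rfl fun i _ => by ring
  have hsmul : ∀ (s : ℝ) x y, covForm lam (s • x) y = s * covForm lam x y := fun s x y => by
    simp only [covForm, Pi.smul_apply, smul_eq_mul, Finset.mul_sum]
    exact Finset.sum_congr rfl fun i _ => by ring
  -- The concentration bounds for (x, u) and (x, -u) are subtracted, and the difference of the two
  -- quadratic forms is 4 `B x u`.
  have hpol : ∀ x u, |B x u| ≤ α * l / 1000 / 2 * (l2norm x ^ 2 + c ^ 2 * l2norm u ^ 2) := by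
    intro x u
    have h1 := abs_le.mp (h.conc x u)
    have h2 := abs_le.mp (h.conc x (-u))
    rw [l2norm_neg] at h2
    have e : (∑ t ∈ W, (((x + (E t)ᵀ *ᵥ u) ⬝ᵥ a t) ^ 2 -
        covForm lam (x + (E t)ᵀ *ᵥ u) (x + (E t)ᵀ *ᵥ u))) -
        (∑ t ∈ W, (((x + (E t)ᵀ *ᵥ (-u)) ⬝ᵥ a t) ^ 2 -
        covForm lam (x + (E t)ᵀ *ᵥ (-u)) (x + (E t)ᵀ *ᵥ (-u)))) = 4 * B x u := by
      rw [← Finset.sum_sub_distrib, Finset.mul_sum]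
      refine Finset.sum_congr rfl fun t _ => ?_
      have e1 : (E t)ᵀ *ᵥ (-u) = (-1 : ℝ) • ((E t)ᵀ *ᵥ u) := by rw [Matrix.mulVec_neg]; simp
      rw [e1]
      set y := (E t)ᵀ *ᵥ u
      have e2 : ∀ z, covForm lam z (x + y) = covForm lam z x + covForm lam z y := fun z => by
        rw [hcomm, hadd, hcomm x, hcomm y]
      have e3 : ∀ z, covForm lam z (x + (-1 : ℝ) • y) = covForm lam z x - covForm lam z y :=
        fun z => by rw [hcomm, hadd, hsmul, hcomm x, hcomm y]; ring
      rw [e2, e3, hadd, hadd, hadd, hadd, hsmul, hsmul, hcomm y x]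
      simp only [add_dotProduct, smul_dotProduct, smul_eq_mul]
      ring
    rw [abs_le]
    constructor <;> linarith [h1.1, h1.2, h2.1, h2.2]
  -- Rescaling x and c u to unit length turns the sum of squares into a product. If either length
  -- vanishes, so does every term of `B`.
  have hB : |B x u| ≤ 1 / 1000 * c * (α * l) * (l2norm x * l2norm u) := by
    by_cases h0 : l2norm x = 0 ∨ c * l2norm u = 0
    · have hz : B x u = 0 := by
        refine Finset.sum_eq_zero fun t ht => ?_
        rcases h0 with h0 | h0
        · rw [l2norm_eq_zero.mp h0]; simp [covForm]
        · have h1 := h.l2norm_transpose_le ht u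
          have h2 : l2norm ((selCols (T t))ᵀ *ᵥ u) ≤ l2norm u := by
            refine le_of_sq_le_sq_of_nonneg ?_ (l2norm_nonneg _)
            rw [selCols_transpose_mulVec, l2norm_sq, l2norm_sq]
            simp only [dotProduct]
            rw [Finset.sum_coe_sort (T t) (fun i => u i * u i)]
            exact Finset.sum_le_sum_of_subset_of_nonneg (Finset.subset_univ _)
              fun i _ _ => mul_self_nonneg _
          have h3 := mul_le_mul_of_nonneg_left h2 hc
          have h4 : l2norm ((E t)ᵀ *ᵥ u) = 0 := le_antisymm (by linarith) (l2norm_nonneg _)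
          rw [l2norm_eq_zero.mp h4]; simp [covForm]
      rw [hz, abs_zero]
      have := l2norm_nonneg x
      have := l2norm_nonneg u
      positivity
    · push Not at h0
      have hx : 0 < l2norm x := lt_of_le_of_ne (l2norm_nonneg _) h0.1.symm
      have hcu : 0 < c * l2norm u :=
        lt_of_le_of_ne (mul_nonneg hc (l2norm_nonneg _)) h0.2.symm
      have h1 := hpol ((l2norm x)⁻¹ • x) ((c * l2norm u)⁻¹ • u)
      have e : B ((l2norm x)⁻¹ • x) ((c * l2norm u)⁻¹ • u) =
          ((l2norm x)⁻¹ * (c * l2norm u)⁻¹) * B x u := by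
        simp only [B, Finset.mul_sum]
        refine Finset.sum_congr rfl fun t _ => ?_
        simp only [Matrix.mulVec_smul, smul_dotProduct, smul_eq_mul, hsmul, hcomm x]
        ring
      rw [e, abs_mul, abs_of_pos (by positivity), l2norm_smul, l2norm_smul,
        abs_of_pos (inv_pos.mpr hx), abs_of_pos (inv_pos.mpr hcu), inv_mul_cancel₀ hx.ne'] at h1
      have e2 : c ^ 2 * ((c * l2norm u)⁻¹ * l2norm u) ^ 2 = 1 := by
        rw [← mul_pow, mul_comm _ (l2norm u), ← mul_assoc, mul_inv_cancel₀ hcu.ne', one_pow]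
      rw [e2, ← mul_inv, ← div_eq_inv_mul, div_le_iff₀ (by positivity)] at h1
      refine h1.trans (le_of_eq ?_)
      ring
  have hcov : |∑ t ∈ W, covForm lam x ((E t)ᵀ *ᵥ u)| ≤
      1 / 1000 * c * (α * l) * (l2norm x * l2norm u) := by
    refine (Finset.abs_sum_le_sum_abs _ _).trans ?_
    have h1 : ∑ t ∈ W, |covForm lam x ((E t)ᵀ *ᵥ u)| ≤
        l2norm x * c * (L * ∑ t ∈ W, l2norm ((selCols (T t))ᵀ *ᵥ u)) := by
      rw [Finset.mul_sum, Finset.mul_sum]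
      refine Finset.sum_le_sum fun t ht => ?_
      refine (abs_covForm_le h.lam_nonneg h.le_L hL.le _ _).trans ?_
      have := mul_le_mul_of_nonneg_left (h.l2norm_transpose_le ht u)
        (mul_nonneg hL.le (l2norm_nonneg x))
      linarith
    refine h1.trans ?_
    have := mul_le_mul_of_nonneg_left (h.sum_le u) (mul_nonneg (l2norm_nonneg x) hc)
    linarith
  have e : ∑ t ∈ W, (x ⬝ᵥ a t) * (u ⬝ᵥ E t *ᵥ a t) =
      B x u + ∑ t ∈ W, covForm lam x ((E t)ᵀ *ᵥ u) := by
    simp only [B]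
    rw [← Finset.sum_add_distrib]
    refine Finset.sum_congr rfl fun t _ => ?_
    rw [dotProduct_mulVec_mulVec]; ring
  rw [e]
  refine (abs_add_le _ _).trans ((add_le_add hB hcov).trans (le_of_eq (by ring)))

variable {m : ℕ} {P Q U : Matrix (Fin n) (Fin r) ℝ} {M : Matrix (Fin n) (Fin m) ℝ}

lemma sum_estimate_sq (x : Fin r → ℝ) (u v : Fin n → ℝ) (hv : Pᵀ *ᵥ v = x) (huv : u = v) :
    ∑ t ∈ W, (v ⬝ᵥ (P *ᵥ a t + E t *ᵥ a t)) ^ 2 = ∑ t ∈ W, (x ⬝ᵥ a t) ^ 2 +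
      2 * ∑ t ∈ W, (x ⬝ᵥ a t) * (u ⬝ᵥ E t *ᵥ a t) + ∑ t ∈ W, (u ⬝ᵥ E t *ᵥ a t) ^ 2 := by
  subst huv
  rw [Finset.mul_sum, ← Finset.sum_add_distrib, ← Finset.sum_add_distrib]
  refine Finset.sum_congr rfl fun t _ => ?_
  rw [dotProduct_add, dotProduct_mulVec_mulVec P, hv]
  ring

/-- Contraction of the subspace error by re-estimation from a regular window. -/
theorem sinTheta_le (h : RegularWindow α W lam L l c a E T) (hP : IsBasisMatrix P)
    (hM : ∀ v, l2norm (Mᵀ *ᵥ v) ^ 2 = ∑ t ∈ W, (v ⬝ᵥ (P *ᵥ a t + E t *ᵥ a t)) ^ 2)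
    (hU : IsTopLeftSingular M U) (hcard : (α : ℝ) ≤ 2 * W.card) (hα : 0 < α) {q : ℝ}
    (hq : c = 1.2 * q) (hq1 : q ≤ 1) : sinTheta U P ≤ 0.02 * q := by
  have hc := h.c_nonneg
  have hl := h.l_pos
  have hα' : (0 : ℝ) < α := by exact_mod_cast hα
  have hαl : 0 < α * l := by positivity
  have hq0 : 0 ≤ q := by linarith
  set A : Matrix (Fin r) (Fin r) ℝ := ∑ t ∈ W, vecMulVec (a t) (a t)
  have hAq : ∀ x, x ⬝ᵥ A *ᵥ x = ∑ t ∈ W, (x ⬝ᵥ a t) ^ 2 := by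
    intro x
    rw [Matrix.sum_mulVec, dotProduct_sum]
    refine Finset.sum_congr rfl fun t _ => ?_
    rw [vecMulVec_mulVec', dotProduct_smul, smul_eq_mul, dotProduct_comm (a t) x, pow_two]
  have hAT : Aᵀ = A := by
    rw [Matrix.transpose_sum]
    exact Finset.sum_congr rfl fun t _ => Matrix.transpose_vecMulVec _ _
  set H := M * Mᵀ - P * A * Pᵀ with hHdef
  have hS : M * Mᵀ = P * A * Pᵀ + H := by rw [hHdef]; abel
  -- At least half of the α frames are present, so the constant is 0.5 minus the fluctuation 0.001,
  -- rounded down.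
  have hA : ∀ x, (0.49 * (α * l)) * (x ⬝ᵥ x) ≤ x ⬝ᵥ A *ᵥ x := by
    intro x
    have h1 := (abs_le.mp (h.sum_sq_dot x)).1
    have h2 := mul_le_mul_of_nonneg_left (le_covForm_self h.l_le x) (Nat.cast_nonneg (α := ℝ) W.card)
    rw [hAq, ← l2norm_sq]
    have h3 : (α : ℝ) * l * l2norm x ^ 2 ≤ 2 * W.card * l * l2norm x ^ 2 := by
      have : 0 ≤ l * l2norm x ^ 2 := by positivity
      nlinarith
    have : 0 ≤ α * l * l2norm x ^ 2 := by positivity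
    linarith
  -- Twice the cross term gives 0.0048 q and the squared errors 0.00288 q², with q² ≤ q. The
  -- resulting ratio 0.008 / (0.49 - 0.008) is below 0.02.
  have hH : ‖H‖ ≤ 0.008 * q * (α * l) := by
    refine norm_le_of_quadratic_le ?_ (by positivity) fun v => ?_
    · simp [hHdef, Matrix.transpose_sub, Matrix.transpose_mul, hAT, Matrix.mul_assoc]
    · have e : v ⬝ᵥ H *ᵥ v = 2 * ∑ t ∈ W, ((Pᵀ *ᵥ v) ⬝ᵥ a t) * (v ⬝ᵥ E t *ᵥ a t) +
          ∑ t ∈ W, (v ⬝ᵥ E t *ᵥ a t) ^ 2 := by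
        have e1 : v ⬝ᵥ (M * Mᵀ) *ᵥ v = l2norm (Mᵀ *ᵥ v) ^ 2 := by
          rw [← Matrix.mulVec_mulVec, dotProduct_mulVec_mulVec, l2norm_sq]
        have e2 : v ⬝ᵥ (P * A * Pᵀ) *ᵥ v = ∑ t ∈ W, ((Pᵀ *ᵥ v) ⬝ᵥ a t) ^ 2 := by
          rw [← Matrix.mulVec_mulVec, ← Matrix.mulVec_mulVec, dotProduct_mulVec_mulVec, hAq]
        rw [hHdef, Matrix.sub_mulVec, dotProduct_sub, e1, e2, hM, sum_estimate_sq _ v v rfl rfl]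
        ring
      have h1 := h.abs_sum_cross_le (Pᵀ *ᵥ v) v
      have h2 := h.sum_err_sq_le v
      have h3 : 0 ≤ ∑ t ∈ W, (v ⬝ᵥ E t *ᵥ a t) ^ 2 := Finset.sum_nonneg fun _ _ => sq_nonneg _
      have h4 := mul_le_mul_of_nonneg_right (hP.isEstimate.l2norm_transpose_le v) (l2norm_nonneg v)
      have h5 : 2 / 1000 * c * (α * l) * (l2norm (Pᵀ *ᵥ v) * l2norm v) ≤
          2 / 1000 * c * (α * l) * (l2norm v * l2norm v) :=
        mul_le_mul_of_nonneg_left h4 (by positivity)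
      have h6 : c ^ 2 * (α * l) * l2norm v ^ 2 ≤ 1.2 * c * (α * l) * l2norm v ^ 2 := by
        have : 0 ≤ α * l * l2norm v ^ 2 := by positivity
        have : c ≤ 1.2 := by linarith
        have : c ^ 2 ≤ 1.2 * c := by nlinarith
        nlinarith
      rw [e, ← l2norm_sq]
      refine (abs_add_le _ _).trans ?_
      rw [abs_mul, abs_of_nonneg h3, abs_two]
      have : 0 ≤ q * (α * l) * l2norm v ^ 2 := by positivity
      rw [hq] at h1 h2 h5 h6
      nlinarith
  have h8 : 0.008 * q * (α * l) < 0.49 * (α * l) := by nlinarith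
  refine (hU.sinTheta_le hP hS hA hH h8).trans ?_
  rw [div_le_iff₀ (by linarith)]
  have : 0 ≤ q * (α * l) := by positivity
  have : q * (q * (α * l)) ≤ 1 * (q * (α * l)) := mul_le_mul_of_nonneg_right hq1 this
  nlinarith

lemma l2norm_transpose_perp_mul (Q : Matrix (Fin n) (Fin r) ℝ) (M : Matrix (Fin n) (Fin m) ℝ)
    (w : Fin n → ℝ) : (perp Q * M)ᵀ *ᵥ w = Mᵀ *ᵥ (perp Q *ᵥ w) := by
  rw [Matrix.transpose_mul, perp_transpose, Matrix.mulVec_mulVec]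

lemma l2norm_transpose_mulVec_perp_le (P Q : Matrix (Fin n) (Fin r) ℝ) (w : Fin n → ℝ) :
    l2norm (Pᵀ *ᵥ (perp Q *ᵥ w)) ≤ sinTheta Q P * l2norm w := by
  have : Pᵀ *ᵥ (perp Q *ᵥ w) = (perp Q * P)ᵀ *ᵥ w := by
    rw [Matrix.transpose_mul, perp_transpose, Matrix.mulVec_mulVec]
  rw [this, sinTheta_eq, ← norm_transpose]
  exact l2norm_mulVec_le _ _

/-- A regular window without a change does not raise an alarm. -/
theorem lamMaxGram_lt [NeZero n] (h : RegularWindow α W lam L l c a E T) (hQ : IsEstimate Q)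
    (hM : ∀ v, l2norm (Mᵀ *ᵥ v) ^ 2 = ∑ t ∈ W, (v ⬝ᵥ (P *ᵥ a t + E t *ᵥ a t)) ^ 2)
    (hα : 0 < α) (hc : c = 1.2 * sinTheta Q P) {ε : ℝ} (hε : 0 < ε) (hq : sinTheta Q P ≤ ε) :
    lamMaxGram (perp Q * M) < α * (2 * ε ^ 2 * L) := by
  have hc0 := h.c_nonneg
  have hl := h.l_pos
  have hL := h.L_pos
  have hα' : (0 : ℝ) < α := by exact_mod_cast hα
  set q := sinTheta Q P
  have hq0 : 0 ≤ q := sinTheta_nonneg _ _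
  rw [lamMaxGram_eq_norm_sq, ← norm_transpose]
  -- The signal part contributes α L ε² and the rest less than one percent of that, which leaves a
  -- margin below the threshold 2.
  have hle : ‖(perp Q * M)ᵀ‖ ≤ Real.sqrt (1.5 * α * L) * ε := by
    refine norm_le_of_l2norm_mulVec_le (by positivity) fun w => ?_
    refine le_of_sq_le_sq_of_nonneg ?_ (by have := l2norm_nonneg w; positivity)
    rw [l2norm_transpose_perp_mul, hM, sum_estimate_sq _ _ _ rfl rfl, mul_pow, mul_pow,
      Real.sq_sqrt (by positivity)]
    set v := perp Q *ᵥ w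
    set x := Pᵀ *ᵥ v
    have hv : l2norm v ≤ l2norm w := hQ.l2norm_perp_le w
    have hx : l2norm x ≤ q * l2norm w := l2norm_transpose_mulVec_perp_le P Q w
    have hw0 := l2norm_nonneg w
    have h1 := (abs_le.mp (h.sum_sq_dot x)).2
    have h2 := (abs_le.mp (h.abs_sum_cross_le x v)).2
    have h3 := h.sum_err_sq_le v
    have h4 : (W.card : ℝ) * covForm lam x x ≤ α * (L * l2norm x ^ 2) := by
      have h5 := (le_abs_self _).trans (abs_covForm_le h.lam_nonneg h.le_L hL.le x x)
      rw [← pow_two] at h5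
      have h6 : (W.card : ℝ) ≤ α := by exact_mod_cast h.card_le
      exact (mul_le_mul_of_nonneg_left h5 (Nat.cast_nonneg _)).trans
        (mul_le_mul_of_nonneg_right h6 (by positivity))
    have hx2 : l2norm x ^ 2 ≤ ε ^ 2 * l2norm w ^ 2 := by
      rw [← mul_pow]
      exact pow_le_pow_left₀ (l2norm_nonneg _)
        (hx.trans (mul_le_mul_of_nonneg_right hq hw0)) 2
    have hxv : l2norm x * l2norm v ≤ ε * l2norm w ^ 2 := by
      have := mul_le_mul (hx.trans (mul_le_mul_of_nonneg_right hq hw0)) hv (l2norm_nonneg _)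
        (by positivity)
      nlinarith
    have hv2 : l2norm v ^ 2 ≤ l2norm w ^ 2 := pow_le_pow_left₀ (l2norm_nonneg _) hv 2
    have hcε : c ≤ 1.2 * ε := by linarith
    have hlL : α * l ≤ α * L := mul_le_mul_of_nonneg_left h.l_le_L hα'.le
    have b1 : α * l / 1000 * l2norm x ^ 2 ≤ α * L / 1000 * (ε ^ 2 * l2norm w ^ 2) :=
      mul_le_mul (by linarith) hx2 (sq_nonneg _) (by positivity)
    have b2 : 2 / 1000 * c * (α * l) * (l2norm x * l2norm v) ≤
        2 / 1000 * (1.2 * ε) * (α * L) * (ε * l2norm w ^ 2) := by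
      refine mul_le_mul ?_ hxv (mul_nonneg (l2norm_nonneg _) (l2norm_nonneg _)) (by positivity)
      exact mul_le_mul (by linarith) hlL (by positivity) (by positivity)
    have b3 : 2 / 1000 * c ^ 2 * (α * l) * l2norm v ^ 2 ≤
        2 / 1000 * (1.2 * ε) ^ 2 * (α * L) * l2norm w ^ 2 := by
      refine mul_le_mul ?_ hv2 (sq_nonneg _) (by positivity)
      refine mul_le_mul ?_ hlL (by positivity) (by positivity)
      exact mul_le_mul_of_nonneg_left (pow_le_pow_left₀ hc0 hcε 2) (by norm_num)
    have b4 : α * (L * l2norm x ^ 2) ≤ α * L * (ε ^ 2 * l2norm w ^ 2) := by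
      rw [← mul_assoc]; exact mul_le_mul_of_nonneg_left hx2 (by positivity)
    have : 0 ≤ α * L * (ε ^ 2 * l2norm w ^ 2) := by positivity
    nlinarith
  have h1 := pow_le_pow_left₀ (norm_nonneg _) hle 2
  rw [mul_pow, Real.sq_sqrt (by positivity)] at h1
  have : 0 < α * L * ε ^ 2 := by positivity
  nlinarith

/-- A regular window after a change raises an alarm. -/
theorem le_lamMaxGram [NeZero n] (h : RegularWindow α W lam L l c a E T) (hQ : IsEstimate Q)
    (hM : ∀ v, l2norm (Mᵀ *ᵥ v) ^ 2 = ∑ t ∈ W, (v ⬝ᵥ (P *ᵥ a t + E t *ᵥ a t)) ^ 2)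
    (hcard : W.card = α) (hc : c = 1.2 * sinTheta Q P) :
    0.9 * (α * l) * sinTheta Q P ^ 2 ≤ lamMaxGram (perp Q * M) := by
  have hc0 := h.c_nonneg
  have hl := h.l_pos
  set q := sinTheta Q P with hqdef
  have hq0 : 0 ≤ q := sinTheta_nonneg _ _
  rw [lamMaxGram_eq_norm_sq]
  rcases hq0.eq_or_lt with h0 | h0
  · rw [← h0]; simp
  -- An almost maximizing vector replaces an attained maximum; its image y is the test vector, and
  -- the constant 0.9 absorbs 0.99² and the error terms.
  obtain ⟨x, hx⟩ : ∃ x, 0.99 * q * l2norm x < l2norm ((perp Q * P) *ᵥ x) := by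
    by_contra! hcon
    have := norm_le_of_l2norm_mulVec_le (by positivity) hcon
    rw [← sinTheta_eq, ← hqdef] at this
    linarith
  set y := (perp Q * P) *ᵥ x with hy
  have hx0 : 0 < l2norm x := by
    rcases (l2norm_nonneg x).eq_or_lt with h1 | h1
    · rw [hy, l2norm_eq_zero.mp h1.symm] at hx; simp [l2norm_zero] at hx
    · exact h1
  have hy0 : 0 < l2norm y := lt_of_le_of_lt (by positivity) hx
  have hperp : perp Q *ᵥ y = y := by
    rw [hy, Matrix.mulVec_mulVec, ← Matrix.mul_assoc, hQ.perp_mul_perp]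
  have hnorm := l2norm_mulVec_le (perp Q * M)ᵀ y
  rw [norm_transpose, l2norm_transpose_perp_mul, hperp] at hnorm
  have hsq := pow_le_pow_left₀ (l2norm_nonneg _) hnorm 2
  rw [hM, sum_estimate_sq _ _ _ rfl rfl, mul_pow] at hsq
  set z := Pᵀ *ᵥ y with hz
  have hzl : 0.99 * q * l2norm y ≤ l2norm z := by
    have h1 : l2norm y ^ 2 ≤ l2norm z * l2norm x := by
      have : y ⬝ᵥ y = z ⬝ᵥ x := by
        calc y ⬝ᵥ y = y ⬝ᵥ (perp Q *ᵥ (P *ᵥ x)) := by rw [Matrix.mulVec_mulVec]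
          _ = (perp Q *ᵥ y) ⬝ᵥ (P *ᵥ x) := by rw [dotProduct_mulVec_mulVec, perp_transpose]
          _ = z ⬝ᵥ x := by rw [hperp, dotProduct_mulVec_mulVec]
      rw [l2norm_sq, this]; exact dotProduct_le _ _
    have h2 : l2norm y * (0.99 * q * l2norm x) ≤ l2norm y ^ 2 := by
      rw [pow_two]; exact mul_le_mul_of_nonneg_left hx.le hy0.le
    have h3 : (0.99 * q * l2norm y) * l2norm x ≤ l2norm z * l2norm x := by linarith
    exact le_of_mul_le_mul_right h3 hx0
  have hzu : l2norm z ≤ q * l2norm y := by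
    have := l2norm_transpose_mulVec_perp_le P Q y
    rwa [hperp] at this
  have h1 := (abs_le.mp (h.sum_sq_dot z)).1
  have h2 := (abs_le.mp (h.abs_sum_cross_le z y)).1
  have h3 : 0 ≤ ∑ t ∈ W, (y ⬝ᵥ E t *ᵥ a t) ^ 2 := Finset.sum_nonneg fun _ _ => sq_nonneg _
  have h4 := mul_le_mul_of_nonneg_left (le_covForm_self h.l_le z) (Nat.cast_nonneg (α := ℝ) W.card)
  rw [hcard] at h1 h4
  have hαl : 0 ≤ α * l := by positivity
  have h5 : 2 / 1000 * c * (α * l) * (l2norm z * l2norm y) ≤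
      2 / 1000 * (1.2 * q) * (α * l) * (q * l2norm y * l2norm y) := by
    rw [hc]
    exact mul_le_mul_of_nonneg_left (mul_le_mul_of_nonneg_right hzu hy0.le) (by positivity)
  have h6 : (0.99 * q * l2norm y) ^ 2 ≤ l2norm z ^ 2 := pow_le_pow_left₀ (by positivity) hzl 2
  have h7 := mul_le_mul_of_nonneg_left h6 hαl
  have h8 : (0.9 * (α * l) * q ^ 2) * l2norm y ^ 2 ≤ ‖perp Q * M‖ ^ 2 * l2norm y ^ 2 := by
    refine le_trans ?_ hsq
    have : 0 ≤ α * l * (q ^ 2 * l2norm y ^ 2) := by positivity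
    nlinarith
  exact le_of_mul_le_mul_right h8 (by positivity)

end RegularWindow

end Window

end NORST

end


section

namespace NORST

open scoped Matrix.Norms.L2Operator
open Filter Topology

/-! ### Stacking coefficients and normalized errors. -/

section StackedError

variable {n r : ℕ}

/-- The least squares error map, set to zero where its norm is not controlled. -/
def truncErr (Q : Matrix (Fin n) (Fin r) ℝ) (T : Finset (Fin n)) (P : Matrix (Fin n) (Fin r) ℝ) :
    Matrix (Fin n) (Fin r) ℝ :=
  if ‖lsErr Q T P‖ ≤ 1.2 * ‖perp Q * P‖ then lsErr Q T P else 0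

/-- The identity stacked on the normalized error map. -/
def stackedErr (Q : Matrix (Fin n) (Fin r) ℝ) (T : Finset (Fin n))
    (P : Matrix (Fin n) (Fin r) ℝ) : Matrix (Fin r ⊕ Fin n) (Fin r) ℝ :=
  Matrix.fromRows 1 ((1.2 * ‖perp Q * P‖)⁻¹ • truncErr Q T P)

lemma norm_truncErr_le (Q : Matrix (Fin n) (Fin r) ℝ) (T : Finset (Fin n))
    (P : Matrix (Fin n) (Fin r) ℝ) : ‖truncErr Q T P‖ ≤ 1.2 * ‖perp Q * P‖ := by
  unfold truncErr
  split_ifs with h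
  · exact h
  · rw [norm_zero]; positivity

lemma sum_elim_dotProduct_sum_elim' {ι κ : Type*} [Fintype ι] [Fintype κ] (x x' : ι → ℝ)
    (y y' : κ → ℝ) : Sum.elim x y ⬝ᵥ Sum.elim x' y' = x ⬝ᵥ x' + y ⬝ᵥ y' := by
  simp [dotProduct, Fintype.sum_sum_type]

/-- The truncation makes this hold for every realization, as the Chernoff bound requires, even where
the least squares problem is ill conditioned. -/
lemma norm_stackedErr_sq_le (Q : Matrix (Fin n) (Fin r) ℝ) (T : Finset (Fin n))
    (P : Matrix (Fin n) (Fin r) ℝ) : ‖stackedErr Q T P‖ ^ 2 ≤ 2 := by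
  have h1 : ‖stackedErr Q T P‖ ≤ Real.sqrt 2 := by
    refine norm_le_of_l2norm_mulVec_le (Real.sqrt_nonneg _) fun v => ?_
    refine le_of_sq_le_sq_of_nonneg ?_ (mul_nonneg (Real.sqrt_nonneg _) (l2norm_nonneg _))
    rw [mul_pow, Real.sq_sqrt zero_le_two, stackedErr, Matrix.fromRows_mulVec, l2norm_sq,
      sum_elim_dotProduct_sum_elim', Matrix.one_mulVec, ← l2norm_sq, ← l2norm_sq]
    set c := 1.2 * ‖perp Q * P‖
    have h2 : l2norm ((c⁻¹ • truncErr Q T P) *ᵥ v) ≤ l2norm v := by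
      refine (l2norm_mulVec_le _ _).trans (mul_le_of_le_one_left (l2norm_nonneg _) ?_)
      have hc : 0 ≤ c := by positivity
      rw [norm_smul, norm_inv, Real.norm_eq_abs, abs_of_nonneg hc]
      refine (mul_le_mul_of_nonneg_left (norm_truncErr_le Q T P) (inv_nonneg.mpr hc)).trans ?_
      exact inv_mul_le_one
    have := pow_le_pow_left₀ (l2norm_nonneg _) h2 2
    linarith
  calc ‖stackedErr Q T P‖ ^ 2 ≤ Real.sqrt 2 ^ 2 := pow_le_pow_left₀ (norm_nonneg _) h1 2
    _ = 2 := Real.sq_sqrt zero_le_two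

/-- The normalization by 1.2 q is undone by scaling the second block of the test vector. A deviation
bound for the stacked form therefore carries a factor (1.2 q)² on the error component. -/
lemma stackedErr_transpose_mulVec (Q : Matrix (Fin n) (Fin r) ℝ) (T : Finset (Fin n))
    (P : Matrix (Fin n) (Fin r) ℝ) (x : Fin r → ℝ) (u : Fin n → ℝ) :
    (stackedErr Q T P)ᵀ *ᵥ (Sum.elim x ((1.2 * ‖perp Q * P‖) • u)) =
      x + (truncErr Q T P)ᵀ *ᵥ u := by
  set c := 1.2 * ‖perp Q * P‖ with hc
  rw [stackedErr, Matrix.transpose_fromRows, Matrix.fromCols_mulVec, Matrix.transpose_one]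
  simp only [Sum.elim_comp_inl, Sum.elim_comp_inr, Matrix.one_mulVec]
  congr 1
  rw [Matrix.transpose_smul, Matrix.mulVec_smul, Matrix.smul_mulVec, smul_smul]
  -- For c = 0 the inverse is 0 by convention, and the truncated error map vanishes as well.
  rcases eq_or_ne c 0 with h0 | h0
  · have h1 := norm_truncErr_le Q T P
    rw [← hc, h0] at h1
    have h2 : truncErr Q T P = 0 := norm_le_zero_iff.mp h1
    rw [h2]; simp
  · rw [← hc, mul_inv_cancel₀ h0, one_smul]

lemma IsIncoherentOn.truncErr_eq {Q P : Matrix (Fin n) (Fin r) ℝ} (hQ : IsEstimate Q)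
    {T : Finset (Fin n)} (h : IsIncoherentOn Q T) : truncErr Q T P = lsErr Q T P := by
  rw [truncErr, if_pos]
  have hs := sinTheta_nonneg Q P
  rw [← sinTheta_eq]
  refine norm_le_of_bilinear_le (by positivity) fun u x => ?_
  refine (le_abs_self _).trans ((h.abs_dotProduct_lsErr_le hQ u x).trans ?_)
  refine mul_le_mul_of_nonneg_left (mul_le_mul_of_nonneg_right ?_ (l2norm_nonneg _)) (by positivity)
  refine le_of_sq_le_sq_of_nonneg ?_ (l2norm_nonneg _)
  rw [selCols_transpose_mulVec, l2norm_sq, l2norm_sq]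
  simp only [dotProduct]
  rw [Finset.sum_coe_sort T (fun i => u i * u i)]
  exact Finset.sum_le_sum_of_subset_of_nonneg (Finset.subset_univ _) fun i _ _ => mul_self_nonneg _

end StackedError

/-! ### Measurability of the least squares step. -/

section Measurability

variable {n r : ℕ}

lemma continuous_perp : Continuous fun Q : Fin n → Fin r → ℝ => perp (Matrix.of Q) := by
  unfold perp
  refine continuous_const.sub (Continuous.matrix_mul ?_ (Continuous.matrix_transpose ?_)) <;>
  exact continuous_id

lemma continuous_psiCols (T : Finset (Fin n)) :
    Continuous fun Q : Fin n → Fin r → ℝ => psiCols (Matrix.of Q) T :=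
  continuous_perp.matrix_submatrix _ _

lemma continuous_lsGram (T : Finset (Fin n)) :
    Continuous fun Q : Fin n → Fin r → ℝ => lsGram (Matrix.of Q) T :=
  (continuous_psiCols T).matrix_transpose.matrix_mul (continuous_psiCols T)

/-- The matrix inverse is the inverse of the determinant times the adjugate, so it is measurable
everywhere although it is discontinuous at singular matrices. -/
lemma measurable_lsGram_inv (T : Finset (Fin n)) (i j : {i // i ∈ T}) :
    Measurable fun Q : Fin n → Fin r → ℝ => (lsGram (Matrix.of Q) T)⁻¹ i j := by
  simp only [Matrix.inv_def, Ring.inverse_eq_inv', Matrix.smul_apply, smul_eq_mul]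
  refine Measurable.mul ?_ ?_
  · exact ((continuous_lsGram T).matrix_det.measurable).inv
  · exact ((continuous_lsGram T).matrix_adjugate.matrix_elem i j).measurable

lemma measurable_lsErr (T : Finset (Fin n)) (P : Matrix (Fin n) (Fin r) ℝ) (i : Fin n) (k : Fin r) :
    Measurable fun Q : Fin n → Fin r → ℝ => lsErr (Matrix.of Q) T P i k := by
  simp only [lsErr, Matrix.neg_apply, Matrix.mul_apply (M := selCols T)]
  refine Measurable.neg (Finset.measurable_fun_sum _ fun j _ => Measurable.const_mul ?_ _)
  simp only [Matrix.mul_apply (M := (lsGram _ _)⁻¹)]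
  refine Finset.measurable_fun_sum _ fun j' _ => (measurable_lsGram_inv T j j').mul ?_
  exact (((continuous_psiCols T).matrix_transpose.matrix_mul continuous_const).matrix_elem
    j' k).measurable

lemma continuous_norm_of {m k : ℕ} :
    Continuous fun M : Fin m → Fin k → ℝ => ‖(Matrix.of M : Matrix (Fin m) (Fin k) ℝ)‖ := by
  have h : Continuous fun M : Matrix (Fin m) (Fin k) ℝ => ‖M‖ := continuous_norm
  exact h

lemma measurable_truncErr (T : Finset (Fin n)) (P : Matrix (Fin n) (Fin r) ℝ) (i : Fin n)
    (k : Fin r) : Measurable fun Q : Fin n → Fin r → ℝ => truncErr (Matrix.of Q) T P i k := by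
  have h1 : Measurable fun Q : Fin n → Fin r → ℝ => ‖lsErr (Matrix.of Q) T P‖ := by
    have h2 : Measurable fun Q : Fin n → Fin r → ℝ =>
        (fun i k => lsErr (Matrix.of Q) T P i k : Fin n → Fin r → ℝ) :=
      measurable_pi_lambda _ fun i => measurable_pi_lambda _ fun k => measurable_lsErr T P i k
    exact continuous_norm_of.measurable.comp h2
  have h2 : Measurable fun Q : Fin n → Fin r → ℝ => 1.2 * ‖perp (Matrix.of Q) * P‖ := by
    have : Continuous fun Q : Fin n → Fin r → ℝ => perp (Matrix.of Q) * P :=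
      continuous_perp.matrix_mul continuous_const
    exact (continuous_const.mul (continuous_norm.comp this)).measurable
  have e : (fun Q : Fin n → Fin r → ℝ => truncErr (Matrix.of Q) T P i k) = fun Q =>
      if ‖lsErr (Matrix.of Q) T P‖ ≤ 1.2 * ‖perp (Matrix.of Q) * P‖ then
        lsErr (Matrix.of Q) T P i k else 0 := by
    funext Q; unfold truncErr; split_ifs <;> rfl
  rw [e]
  exact Measurable.ite (measurableSet_le h1 h2) (measurable_lsErr T P i k) measurable_const

lemma measurable_stackedErr (T : Finset (Fin n)) (P : Matrix (Fin n) (Fin r) ℝ)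
    (i : Fin r ⊕ Fin n) (k : Fin r) :
    Measurable fun Q : Fin n → Fin r → ℝ => stackedErr (Matrix.of Q) T P i k := by
  have h2 : Measurable fun Q : Fin n → Fin r → ℝ => 1.2 * ‖perp (Matrix.of Q) * P‖ := by
    have : Continuous fun Q : Fin n → Fin r → ℝ => perp (Matrix.of Q) * P :=
      continuous_perp.matrix_mul continuous_const
    exact (continuous_const.mul (continuous_norm.comp this)).measurable
  cases i with
  | inl i => exact measurable_const
  | inr i => exact h2.inv.mul (measurable_truncErr T P i k)

lemma measurable_projLS (T : Finset (Fin n)) (i : Fin n) :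
    Measurable fun p : (Fin n → Fin r → ℝ) × (Fin n → ℝ) => projLS (Matrix.of p.1) T p.2 i := by
  simp only [projLS_eq, Pi.sub_apply, Matrix.mulVec, dotProduct]
  refine Measurable.sub ((measurable_pi_apply i).comp measurable_snd) ?_
  refine Finset.measurable_fun_sum _ fun j _ => Measurable.const_mul ?_ _
  refine Finset.measurable_fun_sum _ fun j' _ => Measurable.mul
    ((measurable_lsGram_inv T j j').comp measurable_fst) ?_
  refine Finset.measurable_fun_sum _ fun k _ => Measurable.mul
    ((((continuous_psiCols T).matrix_transpose.matrix_elem j' k).measurable).comp measurable_fst) ?_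
  refine Finset.measurable_fun_sum _ fun k' _ => Measurable.mul
    (((continuous_perp.matrix_elem k k').measurable).comp measurable_fst)
    ((measurable_pi_apply k').comp measurable_snd)

/-- Only finitely many missing sets are possible, so the composition is a finite sum over the events
T = S. -/
lemma measurable_comp_finset {Ω X : Type*} {m : MeasurableSpace Ω} [MeasurableSpace X]
    {f : Finset (Fin n) → X → ℝ} (hf : ∀ T, Measurable (f T)) {T : Ω → Finset (Fin n)}
    (hT : Measurable T) {g : Ω → X} (hg : Measurable g) : Measurable fun ω => f (T ω) (g ω) := by
  have e : (fun ω => f (T ω) (g ω)) = fun ω => ∑ S, if T ω = S then f S (g ω) else 0 := by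
    funext ω; simp
  rw [e]
  refine Finset.measurable_fun_sum _ fun S _ => Measurable.ite ?_ ((hf S).comp hg) measurable_const
  exact hT (measurableSet_singleton S)

end Measurability

/-! ### Measurability of the state of the algorithm with respect to the past. -/

section RunMeasurability

variable {Ω : Type*} {n r : ℕ} {m : MeasurableSpace Ω}

/-- Measurability of a random state of the algorithm, component by component. -/
structure MeasurableState (m : MeasurableSpace Ω) (S : Ω → State n r) : Prop where
  Phat : ∀ i k, Measurable[m] fun ω => (S ω).Phat i k
  lhat : ∀ t i, Measurable[m] fun ω => (S ω).lhat t i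
  updating : ∀ b, MeasurableSet[m] {ω | (S ω).updating = b}
  j : ∀ j, MeasurableSet[m] {ω | (S ω).j = j}
  that : ∀ j o, MeasurableSet[m] {ω | (S ω).that j = o}
  tfin : ∀ t, MeasurableSet[m] {ω | (S ω).tfin = t}
  Pfin : ∀ i k, Measurable[m] fun ω => (S ω).Pfin i k

lemma measurableSet_ite_eq {X : Type*} {c : Ω → Prop} [DecidablePred c]
    (hc : MeasurableSet {ω | c ω}) {f g : Ω → X} {x : X} (hf : MeasurableSet {ω | f ω = x})
    (hg : MeasurableSet {ω | g ω = x}) : MeasurableSet {ω | (if c ω then f ω else g ω) = x} := by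
  have e : {ω | (if c ω then f ω else g ω) = x} =
      ({ω | c ω} ∩ {ω | f ω = x}) ∪ ({ω | c ω}ᶜ ∩ {ω | g ω = x}) := by
    ext ω
    by_cases h : c ω <;> simp [h]
  rw [e]
  exact (hc.inter hf).union (hc.compl.inter hg)

lemma MeasurableState.ite {c : Ω → Prop} {_ : DecidablePred c} (hc : MeasurableSet {ω | c ω})
    {A B : Ω → State n r} (hA : MeasurableState m A) (hB : MeasurableState m B) :
    MeasurableState m fun ω => if c ω then A ω else B ω where
  Phat i k := by
    have e : (fun ω => (if c ω then A ω else B ω).Phat i k) =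
      fun ω => if c ω then (A ω).Phat i k else (B ω).Phat i k := by funext ω; split_ifs <;> rfl
    rw [e]; exact Measurable.ite hc (hA.Phat i k) (hB.Phat i k)
  lhat t i := by
    have e : (fun ω => (if c ω then A ω else B ω).lhat t i) =
      fun ω => if c ω then (A ω).lhat t i else (B ω).lhat t i := by funext ω; split_ifs <;> rfl
    rw [e]; exact Measurable.ite hc (hA.lhat t i) (hB.lhat t i)
  Pfin i k := by
    have e : (fun ω => (if c ω then A ω else B ω).Pfin i k) =
      fun ω => if c ω then (A ω).Pfin i k else (B ω).Pfin i k := by funext ω; split_ifs <;> rfl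
    rw [e]; exact Measurable.ite hc (hA.Pfin i k) (hB.Pfin i k)
  updating b := by
    simp only [apply_ite State.updating]
    exact measurableSet_ite_eq hc (hA.updating b) (hB.updating b)
  j b := by
    simp only [apply_ite State.j]
    exact measurableSet_ite_eq hc (hA.j b) (hB.j b)
  tfin b := by
    simp only [apply_ite State.tfin]
    exact measurableSet_ite_eq hc (hA.tfin b) (hB.tfin b)
  that j o := by
    simp only [apply_ite (fun S : State n r => S.that j)]
    exact measurableSet_ite_eq hc (hA.that j o) (hB.that j o)

lemma MeasurableState.measurableSet_that {S : Ω → State n r} (h : MeasurableState m S)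
    (p : ℕ → Prop) : MeasurableSet {ω | ∃ τ, (S ω).that (S ω).j = some τ ∧ p τ} := by
  have e : {ω | ∃ τ, (S ω).that (S ω).j = some τ ∧ p τ} =
      ⋃ j, ⋃ τ, {ω | (S ω).j = j} ∩ {ω | (S ω).that j = some τ} ∩ {_ω | p τ} := by
    ext ω
    simp only [Set.mem_ofPred_eq, Set.mem_iUnion, Set.mem_inter_iff]
    constructor
    · rintro ⟨τ, h1, h2⟩; exact ⟨_, τ, ⟨rfl, h1⟩, h2⟩
    · rintro ⟨j, τ, ⟨rfl, h1⟩, h2⟩; exact ⟨τ, h1, h2⟩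
  rw [e]
  refine MeasurableSet.iUnion fun j => MeasurableSet.iUnion fun τ => ?_
  exact ((h.j j).inter (h.that j _)).inter (MeasurableSet.const _)

lemma MeasurableState.measurable_Phat {S : Ω → State n r} (h : MeasurableState m S) :
    Measurable fun ω => (fun i k => (S ω).Phat i k : Fin n → Fin r → ℝ) :=
  measurable_pi_lambda _ fun i => measurable_pi_lambda _ fun k => h.Phat i k

lemma MeasurableState.stepLS {S : Ω → State n r} (h : MeasurableState m S) (t : ℕ)
    {y : Ω → Fin n → ℝ} (hy : Measurable y) {T : Ω → Finset (Fin n)} (hT : Measurable T) :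
    MeasurableState m fun ω => stepLS t (y ω) (T ω) (S ω) where
  Phat := h.Phat
  lhat s i := by
    by_cases hs : s = t
    · subst hs
      have e : (fun ω => (NORST.stepLS s (y ω) (T ω) (S ω)).lhat s i) =
          fun ω => projLS (S ω).Phat (T ω) (y ω) i := by
        funext ω; simp [NORST.stepLS]
      rw [e]
      exact measurable_comp_finset (fun T => measurable_projLS T i) hT
        (h.measurable_Phat.prodMk hy)
    · have e : (fun ω => (NORST.stepLS t (y ω) (T ω) (S ω)).lhat s i) =
          fun ω => (S ω).lhat s i := by
        funext ω; simp [NORST.stepLS, hs]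
      rw [e]; exact h.lhat s i
  updating := h.updating
  j := h.j
  that := h.that
  tfin := h.tfin
  Pfin := h.Pfin

lemma MeasurableState.measurable_window {S : Ω → State n r} (h : MeasurableState m S) (α t : ℕ) :
    Measurable fun ω => (fun i k => window α (S ω).lhat t i k : Fin n → Fin α → ℝ) :=
  measurable_pi_lambda _ fun i => measurable_pi_lambda _ fun _ => h.lhat _ i

lemma MeasurableState.stepUpdate {S : Ω → State n r} (h : MeasurableState m S) {α : ℕ} (t : ℕ)
    {svd : Matrix (Fin n) (Fin α) ℝ → Matrix (Fin n) (Fin r) ℝ} (hsvd : IsMeasurableRSVD svd) :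
    MeasurableState m fun ω => stepUpdate α svd t (S ω) := by
  unfold NORST.stepUpdate
  refine MeasurableState.ite ?_ ⟨fun i k => ?_, h.lhat, h.updating, h.j, h.that, h.tfin, h.Pfin⟩ h
  · have h1 := h.measurableSet_that fun τ => ∃ u, 1 ≤ u ∧ t + 1 = τ + u * α
    have h2 := (h.updating true).inter h1
    convert h2 using 1
    ext ω
    simp
  · exact (hsvd i k).comp (h.measurable_window α t)

lemma MeasurableState.stepFinish {S : Ω → State n r} (h : MeasurableState m S) (α K t : ℕ) :
    MeasurableState m fun ω => stepFinish α K t (S ω) := by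
  unfold NORST.stepFinish
  refine MeasurableState.ite ?_ ⟨h.Phat, h.lhat, fun b => MeasurableSet.const (false = b), fun j => ?_,
    h.that, fun b => MeasurableSet.const (t = b), h.Phat⟩ h
  · exact (h.updating true).inter (h.measurableSet_that fun τ => t + 1 = τ + K * α)
  · cases j with
    | zero => simp
    | succ j => simpa using h.j j

lemma measurable_norm_perp_mul {α : ℕ} {A : Ω → Matrix (Fin n) (Fin r) ℝ}
    {B : Ω → Matrix (Fin n) (Fin α) ℝ} (hA : ∀ i k, Measurable fun ω => A ω i k)
    (hB : ∀ i k, Measurable fun ω => B ω i k) : Measurable fun ω => ‖perp (A ω) * B ω‖ := by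
  have h1 : Measurable fun ω => ((fun i k => A ω i k : Fin n → Fin r → ℝ),
      (fun i k => B ω i k : Fin n → Fin α → ℝ)) :=
    (measurable_pi_lambda _ fun i => measurable_pi_lambda _ fun k => hA i k).prodMk
      (measurable_pi_lambda _ fun i => measurable_pi_lambda _ fun k => hB i k)
  have h2 : Continuous fun p : (Fin n → Fin r → ℝ) × (Fin n → Fin α → ℝ) =>
      (perp (Matrix.of p.1) * Matrix.of p.2 : Matrix (Fin n) (Fin α) ℝ) :=
    (continuous_perp.comp continuous_fst).matrix_mul continuous_snd
  have h3 : Continuous fun p : (Fin n → Fin r → ℝ) × (Fin n → Fin α → ℝ) =>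
      ‖perp (Matrix.of p.1) * Matrix.of p.2‖ := by
    exact continuous_norm_of.comp h2
  have h4 := h3.measurable
  clear h3 h2
  have h5 := h4.comp h1
  exact h5

lemma MeasurableState.stepDetect [NeZero n] {S : Ω → State n r} (h : MeasurableState m S) (α : ℕ)
    (thr : ℝ) (t : ℕ) : MeasurableState m fun ω => stepDetect α thr t (S ω) := by
  unfold NORST.stepDetect
  refine MeasurableState.ite ?_ ⟨h.Phat, h.lhat, fun b => MeasurableSet.const (true = b), h.j,
    fun j o => ?_, h.tfin, h.Pfin⟩ h
  · have hA : MeasurableSet {ω | ∃ u, 1 ≤ u ∧ t = (S ω).tfin + u * α} := by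
      have e : {ω | ∃ u, 1 ≤ u ∧ t = (S ω).tfin + u * α} =
          ⋃ τ, ⋃ u, {ω | (S ω).tfin = τ} ∩ {_ω | 1 ≤ u ∧ t = τ + u * α} := by
        ext ω
        simp
      rw [e]
      exact MeasurableSet.iUnion fun τ => MeasurableSet.iUnion fun u =>
        (h.tfin τ).inter (MeasurableSet.const _)
    have hB : MeasurableSet {ω | α * thr ≤
        lamMaxGram (perp (S ω).Pfin * window α (S ω).lhat t)} := by
      simp only [lamMaxGram_eq_norm_sq]
      exact measurableSet_le measurable_const
        ((measurable_norm_perp_mul h.Pfin fun i k => h.lhat _ i).pow_const 2)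
    exact (h.updating false).inter (hA.inter hB)
  · have e : {ω | (Function.update (S ω).that (S ω).j (some t)) j = o} =
        ({ω | (S ω).j = j} ∩ {_ω | some t = o}) ∪ ({ω | (S ω).j = j}ᶜ ∩ {ω | (S ω).that j = o}) := by
      ext ω
      by_cases hj : (S ω).j = j
      · simp [hj]
      · simp [hj, Function.update_of_ne (Ne.symm hj)]
    rw [e]
    exact ((h.j j).inter (MeasurableSet.const _)).union ((h.j j).compl.inter (h.that j o))

lemma MeasurableState.mono {m' : MeasurableSpace Ω} (hm : m ≤ m') {S : Ω → State n r}
    (h : MeasurableState m S) : MeasurableState m' S where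
  Phat i k := (h.Phat i k).mono hm le_rfl
  lhat t i := (h.lhat t i).mono hm le_rfl
  updating b := hm _ (h.updating b)
  j b := hm _ (h.j b)
  that j o := hm _ (h.that j o)
  tfin b := hm _ (h.tfin b)
  Pfin i k := (h.Pfin i k).mono hm le_rfl

lemma measurable_mask {T : Ω → Finset (Fin n)} (hT : Measurable T) {v : Ω → Fin n → ℝ}
    (hv : Measurable v) : Measurable fun ω => mask (T ω) (v ω) := by
  refine measurable_pi_lambda _ fun i => ?_
  refine measurable_comp_finset (f := fun T v => mask T v i) (fun T => ?_) hT hv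
  unfold mask
  split_ifs
  · exact measurable_const
  · exact measurable_pi_apply i

/-- The estimate after frame t depends only on missing sets and on coefficients up to t. This is the
predictability needed by the Chernoff bound. -/
theorem measurableState_run [NeZero n] {d α K : ℕ} {thr : ℝ}
    {svd : Matrix (Fin n) (Fin α) ℝ → Matrix (Fin n) (Fin r) ℝ} (hsvd : IsMeasurableRSVD svd)
    (a : ℕ → Ω → Fin r → ℝ) (T : ℕ → Ω → Finset (Fin n)) (Pt : ℕ → Matrix (Fin n) (Fin r) ℝ)
    {t : ℕ} (ht : t ≤ d) :
    MeasurableState (history d a T t) fun ω => run α K thr svd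
      (fun t => mask (T t ω) (Pt t *ᵥ a t ω)) (fun t => T t ω) t := by
  induction t with
  | zero =>
    exact ⟨fun _ _ => measurable_const, fun _ _ => measurable_const, fun b => MeasurableSet.const (true = b),
      fun j => MeasurableSet.const (0 = j),
      fun j o => MeasurableSet.const ((if j = 0 then some 0 else none) = o),
      fun t => MeasurableSet.const (0 = t), fun _ _ => measurable_const⟩
  | succ t ih =>
    have ih := (ih (Nat.le_of_succ_le ht)).mono (history_mono (Nat.le_succ t))
    have hmem : t + 1 ∈ Set.Icc 1 d := ⟨by omega, ht⟩
    have hT : Measurable[history d a T (t + 1)] (T (t + 1)) := measurable_history_missing hmem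
    have ha : Measurable[history d a T (t + 1)] (a (t + 1)) :=
      measurable_history_coeff hmem le_rfl
    have hv : Measurable[history d a T (t + 1)] fun ω => Pt (t + 1) *ᵥ a (t + 1) ω := by
      have : Continuous fun x : Fin r → ℝ => Pt (t + 1) *ᵥ x :=
        Continuous.matrix_mulVec continuous_const continuous_id
      exact this.measurable.comp ha
    exact ((((ih.stepLS (t + 1) (measurable_mask hT hv) hT).stepUpdate (t + 1) hsvd).stepFinish
      α K (t + 1)).stepDetect α thr (t + 1))

end RunMeasurability

end NORST

end


section

namespace NORST

open scoped Matrix.Norms.L2Operator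
open Filter Topology

/-! ### Good realizations. -/

section RegularPath

variable {n r : ℕ}

lemma quadratic_sum_centered (lam : Fin r → ℝ) {κ : Type*} [Fintype κ] [DecidableEq κ]
    (W : Finset ℕ) (M : ℕ → Matrix κ (Fin r) ℝ) (a : ℕ → Fin r → ℝ) (v : κ → ℝ) :
    v ⬝ᵥ (∑ t ∈ W, centered lam (M t) (a t)) *ᵥ v =
      ∑ t ∈ W, ((((M t)ᵀ *ᵥ v) ⬝ᵥ a t) ^ 2 - covForm lam ((M t)ᵀ *ᵥ v) ((M t)ᵀ *ᵥ v)) := by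
  rw [Matrix.sum_mulVec, dotProduct_sum]
  refine Finset.sum_congr rfl fun t _ => ?_
  rw [centered_quadratic, pow_two, covForm]

/-- Concentration of the stacked quadratic forms gives a regular window. -/
lemma regularWindow_of_quadratic_le {α : ℕ} {W : Finset ℕ} {lam : Fin r → ℝ} {L l : ℝ}
    {a : ℕ → Fin r → ℝ} {T : ℕ → Finset (Fin n)} {Q P : Matrix (Fin n) (Fin r) ℝ}
    (hl : 0 < l) (hlam : ∀ i, l ≤ lam i) (hL : ∀ i, lam i ≤ L) (hlL : l ≤ L)
    (hQ : IsEstimate Q) (hinc : ∀ t ∈ W, IsIncoherentOn Q (T t))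
    (hconc : ∀ v : Fin r ⊕ Fin n → ℝ,
      |v ⬝ᵥ (∑ t ∈ W, centered lam (stackedErr Q (T t) P) (a t)) *ᵥ v| ≤
        l / 1000 * α * (v ⬝ᵥ v))
    (hfreq : ∀ i, (((W.filter fun t => i ∈ T t).card : ℕ) : ℝ) * (1000 * L) ^ 2 ≤ α * l ^ 2)
    (hW : W.card ≤ α) :
    RegularWindow α W lam L l (1.2 * sinTheta Q P) a (fun t => lsErr Q (T t) P) T where
  l_pos := hl
  l_le := hlam
  le_L := hL
  l_le_L := hlL
  c_nonneg := mul_nonneg (by norm_num) (sinTheta_nonneg _ _)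
  conc x u := by
    -- The second block is scaled by 1.2 q, so the stacked map sends the test vector to x + Eᵀu and
    -- its squared length is the right-hand side required by `RegularWindow.conc`.
    have h := hconc (Sum.elim x ((1.2 * ‖perp Q * P‖) • u))
    rw [quadratic_sum_centered, sum_elim_dotProduct_sum_elim', ← l2norm_sq, ← l2norm_sq, l2norm_smul,
      mul_pow, sq_abs, ← sinTheta_eq] at h
    refine (le_of_eq ?_).trans (h.trans (le_of_eq (by ring)))
    congr 1
    refine Finset.sum_congr rfl fun t ht => ?_
    rw [sinTheta_eq, stackedErr_transpose_mulVec, (hinc t ht).truncErr_eq hQ]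
  err t ht u x := (hinc t ht).abs_dotProduct_lsErr_le hQ u x
  freq := hfreq
  card_le := hW

/-- Realizations of the coefficients and missing sets for which every window concentrates and
neither rows nor columns miss too many entries. -/
structure RegularPath (d α : ℕ) (lam : Fin r → ℝ) (L l μ : ℝ) (Phat : ℕ → Matrix (Fin n) (Fin r) ℝ)
    (Pt : ℕ → Matrix (Fin n) (Fin r) ℝ) (a : ℕ → Fin r → ℝ) (T : ℕ → Finset (Fin n)) : Prop where
  conc : ∀ p q, 1 ≤ p → p ≤ q → q ≤ d + 1 → (q = p + α ∨ (p = 1 ∧ q = α)) →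
    ∀ v : Fin r ⊕ Fin n → ℝ,
      |v ⬝ᵥ (∑ t ∈ Finset.Ico p q, centered lam (stackedErr (Phat (p - 1)) (T t) (Pt t)) (a t)) *ᵥ v|
        ≤ l / 1000 * α * (v ⬝ᵥ v)
  col : ∀ t, 1 ≤ t → t ≤ d → ((T t).card : ℝ) / n ≤ (1 / 100) / (μ * r)
  row : ∀ p, 1 ≤ p → p + α ≤ d + 1 → ∀ i,
    ((((Finset.Ico p (p + α)).filter fun t => i ∈ T t).card : ℕ) : ℝ) * (1000 * L) ^ 2 ≤ α * l ^ 2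

lemma le_maxMissFracCol {d t : ℕ} (T : ℕ → Finset (Fin n)) (h1 : 1 ≤ t) (h2 : t ≤ d) :
    ((T t).card : ℝ) / n ≤ maxMissFracCol d T :=
  le_ciSup (f := fun t : Set.Icc 1 d => ((T t).card : ℝ) / n) (Set.finite_range _).bddAbove
    ⟨t, h1, h2⟩

lemma le_maxMissFracRow {d α p : ℕ} (T : ℕ → Finset (Fin n)) (h1 : 1 ≤ p) (h2 : p + α ≤ d + 1)
    (i : Fin n) : (((Finset.Ico p (p + α)).filter fun t => i ∈ T t).card : ℝ) / α ≤
      maxMissFracRow d α T := by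
  have hfin : Finite {s : ℕ // 1 ≤ s ∧ s + α ≤ d + 1} :=
    Set.Finite.to_subtype ((Set.finite_Iic (d + 1)).subset fun s hs => by
      have := hs.2; simp only [Set.mem_Iic]; omega)
  refine le_trans ?_ (le_ciSup (f := fun s : {s : ℕ // 1 ≤ s ∧ s + α ≤ d + 1} =>
    missFracWindow α s T) (Set.finite_range _).bddAbove ⟨p, h1, h2⟩)
  exact le_ciSup (f := fun i : Fin n =>
    (((Finset.Ico p (p + α)).filter fun t => i ∈ T t).card : ℝ) / α) (Set.finite_range _).bddAbove i

/-- Needed to bound the dimension r + n of the stacked space by 2n. -/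
lemma IsBasisMatrix.le {P : Matrix (Fin n) (Fin r) ℝ} (h : IsBasisMatrix P) : r ≤ n := by
  have h1 : (Pᵀ * P).rank = r := by
    rw [show Pᵀ * P = 1 from h, Matrix.rank_one, Fintype.card_fin]
  have h2 := (Matrix.rank_mul_le_right Pᵀ P).trans (Matrix.rank_le_height P)
  omega

end RegularPath

/-! ### Good realizations have high probability. -/

section Probability

variable {Ω : Type*} [MeasurableSpace Ω] {Pr : Measure Ω} [IsProbabilityMeasure Pr] {n r : ℕ}

lemma StatRightIncoherent.boundedCoeff {d : ℕ} {μ L : ℝ} {lam : Fin r → ℝ}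
    {a : ℕ → Ω → Fin r → ℝ} (h : StatRightIncoherent Pr d μ lam a) (hμ : 1 ≤ μ) (hr : 1 ≤ r)
    (hL : L = ⨆ k, lam k) (hlam : ∀ i, 0 < lam i) {t : ℕ} (ht : t ∈ Set.Icc 1 d) :
    BoundedCoeff Pr lam (μ * r * L) L (a t) where
  meas := h.meas t ht
  cov := h.cov t ht
  bdd := by
    have h1 : ∀ᵐ ω ∂Pr, ∀ i, a t ω i ^ 2 ≤ μ * ⨆ k, lam k := ae_all_iff.mpr (h.bdd t ht)
    filter_upwards [h1] with ω hω
    calc a t ω ⬝ᵥ a t ω ≤ ∑ _i : Fin r, μ * L :=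
          Finset.sum_le_sum fun i _ => by rw [← pow_two, hL]; exact hω i
      _ = μ * r * L := by simp; ring
  nonneg i := (hlam i).le
  le i := by rw [hL]; exact le_ciSup (Set.finite_range lam).bddAbove i
  L_le := by
    have i : Fin r := ⟨0, hr⟩
    have h0 : 0 < L := (hlam i).trans_le (by
      rw [hL]; exact le_ciSup (Set.finite_range lam).bddAbove i)
    have hr' : (1 : ℝ) ≤ r := by exact_mod_cast hr
    nlinarith [mul_le_mul hμ hr' zero_le_one (by linarith)]
  L_nonneg := by
    have i : Fin r := ⟨0, hr⟩
    exact (hlam i).le.trans (by rw [hL]; exact le_ciSup (Set.finite_range lam).bddAbove i)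

variable {d α K : ℕ} {thr : ℝ} {svd : Matrix (Fin n) (Fin α) ℝ → Matrix (Fin n) (Fin r) ℝ}
  {a : ℕ → Ω → Fin r → ℝ} {T : ℕ → Ω → Finset (Fin n)} {Pt : ℕ → Matrix (Fin n) (Fin r) ℝ}
  {lam : Fin r → ℝ} {μ L : ℝ}

/-- The estimate is frozen at frame p - 1, before the window starts, so the error maps of all frames
of the window are predictable whatever the algorithm does inside it. -/
lemma adaptedCoeffs_run [NeZero n] (hsvd : IsMeasurableRSVD svd)
    (ha : StatRightIncoherent Pr d μ lam a) (hμ : 1 ≤ μ) (hr : 1 ≤ r) (hL : L = ⨆ k, lam k)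
    (hlam : ∀ i, 0 < lam i) (hT : ∀ t ∈ Set.Icc 1 d, Measurable (T t))
    (haT : IndepFun (fun ω (t : Set.Icc 1 d) => a t ω) (fun ω (t : Set.Icc 1 d) => T t ω) Pr)
    {p q : ℕ} (hp : 1 ≤ p) (hq : q ≤ d + 1) :
    AdaptedCoeffs Pr (history d a T) lam (μ * r * L) L
      (fun t ω => stackedErr (run α K thr svd (fun t => mask (T t ω) (Pt t *ᵥ a t ω))
        (fun t => T t ω) (p - 1)).Phat (T t ω) (Pt t)) a p q where
  mono _ _ h := history_mono h
  le := history_le ha.meas hT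
  coeff t h1 h2 := ha.boundedCoeff hμ hr hL hlam ⟨by omega, by omega⟩
  adapted t h1 h2 := measurable_history_coeff ⟨by omega, by omega⟩ le_rfl
  indep t h1 h2 := by
    obtain ⟨t, rfl⟩ : ∃ s, t = s + 1 := ⟨t - 1, by omega⟩
    exact indep_history ha.meas hT ha.indep haT ⟨by omega, by omega⟩
  predictable t h1 h2 i k := by
    have hS := (measurableState_run (α := α) (K := K) (thr := thr) hsvd a T Pt
      (show p - 1 ≤ d by omega)).mono (history_mono (show p - 1 ≤ t - 1 by omega))
    have hTm : Measurable[history d a T (t - 1)] (T t) :=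
      measurable_history_missing ⟨by omega, by omega⟩
    exact measurable_comp_finset (m := history d a T (t - 1))
      (fun T => measurable_stackedErr T (Pt t) i k) hTm hS.measurable_Phat
  norm_le t h1 h2 ω := norm_stackedErr_sq_le _ _ _
  pos := hp

/-- The concentration and missingness conditions hold with high probability. -/
theorem measure_not_regularPath_le [NeZero n] (hsvd : IsMeasurableRSVD svd)
    (ha : StatRightIncoherent Pr d μ lam a) (hμ : 1 ≤ μ) (hr : 1 ≤ r) (hL : L = ⨆ k, lam k)
    {l f : ℝ} (hl : 0 < l) (hlam : ∀ i, l ≤ lam i) (hf : f = L / l)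
    (hT : ∀ t ∈ Set.Icc 1 d, Measurable (T t))
    (haT : IndepFun (fun ω (t : Set.Icc 1 d) => a t ω) (fun ω (t : Set.Icc 1 d) => T t ω) Pr)
    (hn : 2 ≤ n) (hrn : r ≤ n) (hα2 : 2 ≤ α)
    (hα : 176000000 * μ * f ^ 2 * r * Real.log n ≤ α)
    (hcol : ∀ᵐ ω ∂Pr, maxMissFracCol d (fun t => T t ω) ≤ (1 / 100) / (μ * r))
    (hrow : ∀ᵐ ω ∂Pr, maxMissFracRow d α (fun t => T t ω) ≤ (1 / 1000000) / f ^ 2) :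
    Pr {ω | ¬ RegularPath d α lam L l μ (fun t => (run α K thr svd
      (fun t => mask (T t ω) (Pt t *ᵥ a t ω)) (fun t => T t ω) t).Phat) Pt
      (fun t => a t ω) (fun t => T t ω)} ≤ ENNReal.ofReal (10 * d / (n : ℝ) ^ 10) := by
  set M : ℕ → ℕ → Ω → Matrix (Fin r ⊕ Fin n) (Fin r) ℝ := fun p t ω =>
    stackedErr (run α K thr svd (fun t => mask (T t ω) (Pt t *ᵥ a t ω))
        (fun t => T t ω) (p - 1)).Phat (T t ω) (Pt t) with hM
  have hlL : l ≤ L := (hlam ⟨0, hr⟩).trans (by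
    rw [hL]; exact le_ciSup (Set.finite_range lam).bddAbove _)
  have hL0 : 0 < L := hl.trans_le hlL
  have hn0 : (0 : ℝ) < n := by positivity
  have hr' : (1 : ℝ) ≤ r := by exact_mod_cast hr
  have hα0 : (0 : ℝ) < α := by positivity
  -- The index s = 0 stands for the shortened initial window [1, α), any s ≥ 1 for [s, s + α). As α
  -- ≥ 2, windows ending by frame d have s < d.
  let bad : ℕ → Set Ω := fun s => {ω | s + α ≤ d + 1 ∧ ∃ v : Fin r ⊕ Fin n → ℝ,
    l / (1000 * L) * α * L * (v ⬝ᵥ v) <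
      |v ⬝ᵥ centeredSum lam (M (max s 1)) a (max s 1) (s + α) ω *ᵥ v|}
  have hbad : ∀ s, Pr (bad s) ≤ ENNReal.ofReal (4 / (n : ℝ) ^ 10) := by
    intro s
    by_cases hs : s + α ≤ d + 1
    · refine (measure_mono (t := {ω | ∃ v : Fin r ⊕ Fin n → ℝ,
        l / (1000 * L) * α * L * (v ⬝ᵥ v) <
          |v ⬝ᵥ centeredSum lam (M (max s 1)) a (max s 1) (s + α) ω *ᵥ v|}) fun ω h => h.2).trans ?_
      have hA := adaptedCoeffs_run (α := α) (K := K) (thr := thr) (Pt := Pt) hsvd ha hμ hr hL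
        (fun i => hl.trans_le (hlam i)) hT haT (le_max_right s 1) hs
      have hδ : 0 < l / (1000 * L) := by positivity
      have hδ1 : l / (1000 * L) ≤ 1 := by rw [div_le_one (by positivity)]; linarith
      have hLR : L ≤ μ * r * L := by
        have := mul_le_mul hμ hr' zero_le_one (by linarith)
        nlinarith
      refine (hA.measure_quadratic_le (α := α) (by omega) (by omega) hL0 hLR hδ hδ1).trans ?_
      refine ENNReal.ofReal_le_ofReal ?_
      -- With δ = l/(1000L) and R = μ r L the exponent is α / (16 · 10⁶ μ f² r), which is at least
      -- 11 log n because 176 = 16 · 11. The dimension factor 2(r + n) ≤ 4n then leaves 4/n¹⁰ per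
      -- window.
      have hexp : Real.exp (-((l / (1000 * L)) ^ 2 * α * L / (16 * (μ * r * L)))) ≤
          1 / (n : ℝ) ^ 11 := by
        have e1 : 1 / (n : ℝ) ^ 11 = Real.exp (-(11 * Real.log n)) := by
          rw [Real.exp_neg, one_div]
          congr 1
          rw [← Real.exp_log (pow_pos hn0 11), Real.log_pow]
          norm_num
        rw [e1]
        refine Real.exp_le_exp.mpr (neg_le_neg ?_)
        rw [le_div_iff₀ (by positivity)]
        rw [hf] at hα
        have e2 : (l / (1000 * L)) ^ 2 * α * L = (l / (1000 * L)) ^ 2 * L * α := by ring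
        rw [e2]
        refine le_trans (le_of_eq ?_)
          (mul_le_mul_of_nonneg_left hα (by positivity : 0 ≤ (l / (1000 * L)) ^ 2 * L))
        field_simp
        ring
      have hcard : (Fintype.card (Fin r ⊕ Fin n) : ℝ) ≤ 2 * n := by
        rw [Fintype.card_sum, Fintype.card_fin, Fintype.card_fin]
        push_cast
        have : (r : ℝ) ≤ n := by exact_mod_cast hrn
        linarith
      calc 2 * ((Fintype.card (Fin r ⊕ Fin n) : ℝ) *
            Real.exp (-((l / (1000 * L)) ^ 2 * α * L / (16 * (μ * r * L)))))
          ≤ 2 * ((2 * n) * (1 / (n : ℝ) ^ 11)) := by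
            refine mul_le_mul_of_nonneg_left (mul_le_mul hcard hexp (Real.exp_nonneg _)
              (by positivity)) zero_le_two
        _ = 4 / (n : ℝ) ^ 10 := by field_simp; ring
    · have : bad s = ∅ := by
        ext ω; simp only [bad, Set.mem_ofPred_eq, Set.mem_empty_iff_false, iff_false]
        exact fun h => hs h.1
      rw [this, measure_empty]; exact zero_le
  have hnull : Pr ({ω | ¬ maxMissFracCol d (fun t => T t ω) ≤ (1 / 100) / (μ * r)} ∪
      {ω | ¬ maxMissFracRow d α (fun t => T t ω) ≤ (1 / 1000000) / f ^ 2}) = 0 :=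
    measure_union_null (ae_iff.mp hcol) (ae_iff.mp hrow)
  have hsub : {ω | ¬ RegularPath d α lam L l μ (fun t => (run α K thr svd
      (fun t => mask (T t ω) (Pt t *ᵥ a t ω)) (fun t => T t ω) t).Phat) Pt
      (fun t => a t ω) (fun t => T t ω)} ⊆
      ({ω | ¬ maxMissFracCol d (fun t => T t ω) ≤ (1 / 100) / (μ * r)} ∪
      {ω | ¬ maxMissFracRow d α (fun t => T t ω) ≤ (1 / 1000000) / f ^ 2}) ∪
      ⋃ s ∈ Finset.range d, bad s := by
    intro ω hω
    by_contra hcon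
    simp only [Set.mem_union, Set.mem_iUnion, Set.mem_ofPred_eq, not_or, not_not, not_exists] at hcon
    obtain ⟨⟨h1, h2⟩, h3⟩ := hcon
    refine hω ⟨?_, ?_, ?_⟩
    · intro p q hp hpq hq hcase v
      have key : ∀ s, s + α = q → max s 1 = p → s ∈ Finset.range d → _ := fun s hs hs1 hsd => by
        have h4 := h3 s hsd
        simp only [bad, Set.mem_ofPred_eq, not_and, not_exists, not_lt] at h4
        have h5 := h4 (by omega) v
        rw [hs1, hs] at h5
        have e : l / (1000 * L) * α * L * (v ⬝ᵥ v) = l / 1000 * α * (v ⬝ᵥ v) := by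
          field_simp
        rw [e] at h5
        exact h5
      rcases hcase with h | ⟨h, h'⟩
      · exact key p h.symm (by omega) (Finset.mem_range.mpr (by omega))
      · exact key 0 (by omega) (by omega) (Finset.mem_range.mpr (by omega))
    · intro t ht1 ht2
      exact (le_maxMissFracCol (fun t => T t ω) ht1 ht2).trans h1
    · intro p hp hpd i
      have h4 := (le_maxMissFracRow (fun t => T t ω) hp hpd i).trans h2
      rw [div_le_iff₀ hα0, hf] at h4
      have h5 := mul_le_mul_of_nonneg_right h4 (sq_nonneg (1000 * L))
      refine h5.trans (le_of_eq ?_)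
      field_simp
      norm_num
  refine (measure_mono hsub).trans ((measure_union_le _ _).trans ?_)
  rw [hnull, zero_add]
  refine (measure_biUnion_finset_le _ _).trans ?_
  refine (Finset.sum_le_sum fun s _ => hbad s).trans ?_
  rw [Finset.sum_const, Finset.card_range, nsmul_eq_mul, ← ENNReal.ofReal_natCast,
    ← ENNReal.ofReal_mul (Nat.cast_nonneg d)]
  refine ENNReal.ofReal_le_ofReal ?_
  rw [mul_div_assoc', div_le_div_iff_of_pos_right (by positivity)]
  have : (0 : ℝ) ≤ d := Nat.cast_nonneg d
  linarith

end Probability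

end NORST

end


section

namespace NORST

open scoped Matrix.Norms.L2Operator
open Filter Topology

/-! ### Phase transitions of the algorithm. -/

section Phases

variable {n r : ℕ}

/-- The state is in the update phase of the `j`-th subspace, with detection times `θ` and current
estimate `Q`. -/
structure IsUpdating (S : State n r) (j : ℕ) (θ : ℕ → Option ℕ) (Q : Matrix (Fin n) (Fin r) ℝ) :
    Prop where
  updating : S.updating = true
  j_eq : S.j = j
  that_eq : S.that = θ
  Phat_eq : S.Phat = Q

/-- The state is in the detect phase preceding the `j`-th change, since time `s`. -/
structure IsDetecting (S : State n r) (j : ℕ) (θ : ℕ → Option ℕ) (Q : Matrix (Fin n) (Fin r) ℝ)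
    (s : ℕ) : Prop where
  updating : S.updating = false
  j_eq : S.j = j
  that_eq : S.that = θ
  Phat_eq : S.Phat = Q
  Pfin_eq : S.Pfin = Q
  tfin_eq : S.tfin = s

variable {α K : ℕ} {thr : ℝ} {svd : Matrix (Fin n) (Fin α) ℝ → Matrix (Fin n) (Fin r) ℝ}
  {y : ℕ → Fin n → ℝ} {T : ℕ → Finset (Fin n)} {t j τ s u : ℕ} {θ : ℕ → Option ℕ}
  {Q : Matrix (Fin n) (Fin r) ℝ}

lemma stepUpdate_lhat (S : State n r) : (stepUpdate α svd t S).lhat = S.lhat := by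
  unfold stepUpdate; split_ifs <;> rfl

lemma stepFinish_lhat (S : State n r) : (stepFinish α K t S).lhat = S.lhat := by
  unfold stepFinish; split_ifs <;> rfl

lemma stepDetect_lhat (S : State n r) : (stepDetect α thr t S).lhat = S.lhat := by
  unfold stepDetect; split_ifs <;> rfl

lemma run_succ_lhat : (run α K thr svd y T (t + 1)).lhat = Function.update
    (run α K thr svd y T t).lhat (t + 1) (projLS (run α K thr svd y T t).Phat (T (t + 1)) (y (t + 1))) := by
  rw [run, stepDetect_lhat, stepFinish_lhat, stepUpdate_lhat]; rfl

lemma run_succ_lhat_self : (run α K thr svd y T (t + 1)).lhat (t + 1) =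
    projLS (run α K thr svd y T t).Phat (T (t + 1)) (y (t + 1)) := by
  rw [run_succ_lhat, Function.update_self]

lemma run_lhat_of_le (h : s ≤ t) :
    (run α K thr svd y T t).lhat s = (run α K thr svd y T s).lhat s := by
  induction t, h using Nat.le_induction with
  | base => rfl
  | succ t h ih => rw [run_succ_lhat, Function.update_of_ne (by omega), ih]

/-- Frame 0 carries no data. The first estimation window, which ends at α - 1, contains this zero
column and only α - 1 genuine frames. -/
lemma run_lhat_zero : (run α K thr svd y T t).lhat 0 = 0 := by
  rw [run_lhat_of_le (Nat.zero_le t)]; rfl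

lemma isUpdating_init : IsUpdating (run α K thr svd y T 0) 0 (State.init n r).that 0 :=
  ⟨rfl, rfl, rfl, rfl⟩

lemma IsUpdating.stepLS {S : State n r} (h : IsUpdating S j θ Q) (v : Fin n → ℝ)
    (A : Finset (Fin n)) : IsUpdating (stepLS t v A S) j θ Q :=
  ⟨h.updating, h.j_eq, h.that_eq, h.Phat_eq⟩

lemma IsDetecting.stepLS {S : State n r} (h : IsDetecting S j θ Q s) (v : Fin n → ℝ)
    (A : Finset (Fin n)) : IsDetecting (stepLS t v A S) j θ Q s :=
  ⟨h.updating, h.j_eq, h.that_eq, h.Phat_eq, h.Pfin_eq, h.tfin_eq⟩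

lemma IsUpdating.stepUpdate_idle {S : State n r} (h : IsUpdating S j θ Q) (hθ : θ j = some τ)
    (hu : ∀ u, 1 ≤ u → t + 1 ≠ τ + u * α) : stepUpdate α svd t S = S := by
  unfold stepUpdate
  rw [if_neg]
  rintro ⟨-, τ', u, h1, h2, h3⟩
  rw [h.that_eq, h.j_eq, hθ] at h1
  cases h1
  exact hu u h2 h3

lemma IsUpdating.stepUpdate {S : State n r} (h : IsUpdating S j θ Q) (hθ : θ j = some τ)
    (hu : 1 ≤ u) (ht : t + 1 = τ + u * α) :
    stepUpdate α svd t S = { S with Phat := svd (window α S.lhat t) } := by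
  unfold NORST.stepUpdate
  rw [if_pos]
  exact ⟨h.updating, τ, u, by rw [h.that_eq, h.j_eq, hθ], hu, ht⟩

lemma IsUpdating.stepFinish_idle {S : State n r} (h : IsUpdating S j θ Q) (hθ : θ j = some τ)
    (ht : t + 1 ≠ τ + K * α) : stepFinish α K t S = S := by
  unfold stepFinish
  rw [if_neg]
  rintro ⟨-, τ', h1, h2⟩
  rw [h.that_eq, h.j_eq, hθ] at h1
  cases h1
  exact ht h2

lemma IsUpdating.stepFinish {S : State n r} (h : IsUpdating S j θ Q) (hθ : θ j = some τ)
    (ht : t + 1 = τ + K * α) : IsDetecting (stepFinish α K t S) (j + 1) θ Q t := by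
  unfold NORST.stepFinish
  rw [if_pos ⟨h.updating, τ, by rw [h.that_eq, h.j_eq, hθ], ht⟩]
  exact ⟨rfl, congrArg (· + 1) h.j_eq, h.that_eq, h.Phat_eq, h.Phat_eq, rfl⟩

lemma IsUpdating.stepDetect_idle {S : State n r} (h : IsUpdating S j θ Q) :
    stepDetect α thr t S = S := by
  unfold stepDetect
  rw [if_neg]
  rintro ⟨h1, -⟩
  rw [h.updating] at h1
  cases h1

lemma IsDetecting.stepUpdate_idle {S : State n r} (h : IsDetecting S j θ Q s) :
    stepUpdate α svd t S = S := by
  unfold stepUpdate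
  rw [if_neg]
  rintro ⟨h1, -⟩
  rw [h.updating] at h1
  cases h1

lemma IsDetecting.stepFinish_idle {S : State n r} (h : IsDetecting S j θ Q s) :
    stepFinish α K t S = S := by
  unfold stepFinish
  rw [if_neg]
  rintro ⟨h1, -⟩
  rw [h.updating] at h1
  cases h1

lemma IsDetecting.stepDetect_idle {S : State n r} (h : IsDetecting S j θ Q s)
    (hq : ∀ u, 1 ≤ u → t = s + u * α → lamMaxGram (perp Q * window α S.lhat t) < α * thr) :
    stepDetect α thr t S = S := by
  unfold stepDetect
  rw [if_neg]
  rintro ⟨-, ⟨u, h1, h2⟩, h3⟩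
  rw [h.tfin_eq] at h2
  rw [h.Pfin_eq] at h3
  exact absurd h3 (not_le.mpr (hq u h1 h2))

lemma IsDetecting.stepDetect {S : State n r} (h : IsDetecting S j θ Q s) (hu : 1 ≤ u)
    (ht : t = s + u * α) (hq : α * thr ≤ lamMaxGram (perp Q * window α S.lhat t)) :
    IsUpdating (stepDetect α thr t S) j (Function.update θ j (some t)) Q := by
  unfold NORST.stepDetect
  rw [if_pos ⟨h.updating, ⟨u, hu, by rw [h.tfin_eq]; exact ht⟩, by rw [h.Pfin_eq]; exact hq⟩]
  exact ⟨rfl, h.j_eq, by rw [← h.that_eq, ← h.j_eq], h.Phat_eq⟩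

lemma IsUpdating.run_succ_idle (h : IsUpdating (run α K thr svd y T t) j θ Q) (hθ : θ j = some τ)
    (hK : 1 ≤ K) (hu : ∀ u, 1 ≤ u → t + 2 ≠ τ + u * α) :
    IsUpdating (run α K thr svd y T (t + 1)) j θ Q := by
  have h1 := h.stepLS (t := t + 1) (y (t + 1)) (T (t + 1))
  rw [run, h1.stepUpdate_idle hθ hu, h1.stepFinish_idle hθ (hu K hK), h1.stepDetect_idle]
  exact h1

lemma window_stepLS : window α (NORST.stepLS (t + 1) (y (t + 1)) (T (t + 1))
    (run α K thr svd y T t)).lhat (t + 1) = window α (run α K thr svd y T (t + 1)).lhat (t + 1) := by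
  rw [run_succ_lhat]; rfl

lemma IsUpdating.run_succ_update (h : IsUpdating (run α K thr svd y T t) j θ Q)
    (hθ : θ j = some τ) (hα : 1 ≤ α) (hu : 1 ≤ u) (huK : u ≠ K) (ht : t + 2 = τ + u * α) :
    IsUpdating (run α K thr svd y T (t + 1)) j θ
      (svd (window α (run α K thr svd y T (t + 1)).lhat (t + 1))) := by
  have h1 := h.stepLS (t := t + 1) (y (t + 1)) (T (t + 1))
  rw [← window_stepLS, run, h1.stepUpdate hθ hu ht]
  have h2 : IsUpdating { NORST.stepLS (t + 1) (y (t + 1)) (T (t + 1)) (run α K thr svd y T t) with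
      Phat := svd (window α (NORST.stepLS (t + 1) (y (t + 1)) (T (t + 1))
        (run α K thr svd y T t)).lhat (t + 1)) } j θ _ := ⟨h1.updating, h1.j_eq, h1.that_eq, rfl⟩
  rw [h2.stepFinish_idle hθ, h2.stepDetect_idle]
  · exact h2
  · intro hK
    have : u * α = K * α := by omega
    exact huK (Nat.eq_of_mul_eq_mul_right hα this)

lemma IsUpdating.run_succ_finish (h : IsUpdating (run α K thr svd y T t) j θ Q)
    (hθ : θ j = some τ) (hα : 1 ≤ α) (hK : 1 ≤ K) (ht : t + 2 = τ + K * α) :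
    IsDetecting (run α K thr svd y T (t + 1)) (j + 1) θ
      (svd (window α (run α K thr svd y T (t + 1)).lhat (t + 1))) (t + 1) := by
  have h1 := h.stepLS (t := t + 1) (y (t + 1)) (T (t + 1))
  rw [← window_stepLS, run, h1.stepUpdate hθ hK ht]
  have h2 : IsUpdating { NORST.stepLS (t + 1) (y (t + 1)) (T (t + 1)) (run α K thr svd y T t) with
      Phat := svd (window α (NORST.stepLS (t + 1) (y (t + 1)) (T (t + 1))
        (run α K thr svd y T t)).lhat (t + 1)) } j θ _ := ⟨h1.updating, h1.j_eq, h1.that_eq, rfl⟩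
  have h3 := h2.stepFinish hθ ht
  rw [h3.stepDetect_idle]
  · exact h3
  -- No test takes place in the frame that ends the update phase, since tests come at least one full
  -- window later.
  · intro u hu hc
    have : 1 * 1 ≤ u * α := Nat.mul_le_mul hu hα
    omega

lemma IsDetecting.run_succ_idle (h : IsDetecting (run α K thr svd y T t) j θ Q s)
    (hq : ∀ u, 1 ≤ u → t + 1 = s + u * α →
      lamMaxGram (perp Q * window α (run α K thr svd y T (t + 1)).lhat (t + 1)) < α * thr) :
    IsDetecting (run α K thr svd y T (t + 1)) j θ Q s := by
  have h1 := h.stepLS (t := t + 1) (y (t + 1)) (T (t + 1))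
  rw [← window_stepLS] at hq
  rw [run, h1.stepUpdate_idle, h1.stepFinish_idle, h1.stepDetect_idle hq]
  exact h1

lemma IsDetecting.run_succ_alarm (h : IsDetecting (run α K thr svd y T t) j θ Q s)
    (hu : 1 ≤ u) (ht : t + 1 = s + u * α)
    (hq : α * thr ≤
      lamMaxGram (perp Q * window α (run α K thr svd y T (t + 1)).lhat (t + 1))) :
    IsUpdating (run α K thr svd y T (t + 1)) j (Function.update θ j (some (t + 1))) Q := by
  have h1 := h.stepLS (t := t + 1) (y (t + 1)) (T (t + 1))
  rw [← window_stepLS] at hq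
  rw [run, h1.stepUpdate_idle, h1.stepFinish_idle]
  exact h1.stepDetect hu ht hq

lemma IsUpdating.run_idle (h : IsUpdating (run α K thr svd y T s) j θ Q) (hθ : θ j = some τ)
    (hK : 1 ≤ K) {k : ℕ} (h1 : τ + k * α ≤ s + 1) (hst : s ≤ t) (h2 : t + 1 < τ + (k + 1) * α) :
    IsUpdating (run α K thr svd y T t) j θ Q := by
  induction t, hst using Nat.le_induction with
  | base => exact h
  | succ t hst ih =>
    refine (ih (by omega)).run_succ_idle hθ hK fun u hu hc => ?_
    have h3 : k * α < u * α := by omega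
    have h4 : u * α < (k + 1) * α := by omega
    have h5 := Nat.lt_of_mul_lt_mul_right h3
    have h6 := Nat.lt_of_mul_lt_mul_right h4
    omega

lemma IsDetecting.run_idle {p : ℕ} (h : IsDetecting (run α K thr svd y T p) j θ Q s) {k : ℕ}
    (h1 : s + k * α ≤ p) (hst : p ≤ t) (h2 : t < s + (k + 1) * α) :
    IsDetecting (run α K thr svd y T t) j θ Q s := by
  induction t, hst using Nat.le_induction with
  | base => exact h
  | succ t hst ih =>
    refine (ih (by omega)).run_succ_idle fun u hu hc => ?_
    have h3 : k * α < u * α := by omega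
    have h4 : u * α < (k + 1) * α := by omega
    have h5 := Nat.lt_of_mul_lt_mul_right h3
    have h6 := Nat.lt_of_mul_lt_mul_right h4
    omega

/-- The Gram form of the estimation window. -/
lemma l2norm_window_transpose_sq (lhat : ℕ → Fin n → ℝ) {q : ℕ} (hq : α ≤ q + 1) (v : Fin n → ℝ) :
    l2norm ((window α lhat q)ᵀ *ᵥ v) ^ 2 =
      ∑ t ∈ Finset.Ico (q + 1 - α) (q + 1), (v ⬝ᵥ lhat t) ^ 2 := by
  rw [Finset.sum_Ico_eq_sum_range, l2norm_sq, dotProduct,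
    show q + 1 - (q + 1 - α) = α by omega, Finset.sum_range]
  refine Finset.sum_congr rfl fun k _ => ?_
  rw [← pow_two]
  congr 1
  rw [Matrix.mulVec, dotProduct, dotProduct]
  refine Finset.sum_congr rfl fun i _ => ?_
  rw [Matrix.transpose_apply, window, Matrix.of_apply, mul_comm,
    show q + 1 + (k : ℕ) - α = q + 1 - α + k by omega]

end Phases

end NORST

end


section

namespace NORST

open scoped Matrix.Norms.L2Operator
open Filter Topology

/-! ### The tracking guarantee on a good path. -/

section Tracking

variable {n r : ℕ}

/-- An estimate for which the least squares problems of all frames are well conditioned. -/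
def IsReliable (d : ℕ) (T : ℕ → Finset (Fin n)) (Q : Matrix (Fin n) (Fin r) ℝ) : Prop :=
  IsEstimate Q ∧ ∀ s, 1 ≤ s → s ≤ d → IsIncoherentOn Q (T s)

/-- A run of the algorithm on a regular path, with the standing assumptions of the tracking
guarantee. -/
structure TrackingModel (d J α K : ℕ) (ε L l μ : ℝ) (lam : Fin r → ℝ)
    (P Pt : ℕ → Matrix (Fin n) (Fin r) ℝ) (tc : ℕ → ℕ) (a : ℕ → Fin r → ℝ)
    (T : ℕ → Finset (Fin n)) (svd : Matrix (Fin n) (Fin α) ℝ → Matrix (Fin n) (Fin r) ℝ)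
    (S : ℕ → State n r) : Prop where
  S_eq : ∀ t, S t = run α K (2 * ε ^ 2 * L) svd (fun t => mask (T t) (Pt t *ᵥ a t)) T t
  r_pos : 1 ≤ r
  n_pos : 1 ≤ n
  svd_spec : IsRSVD svd
  l_pos : 0 < l
  l_le : ∀ i, l ≤ lam i
  le_L : ∀ i, lam i ≤ L
  l_le_L : l ≤ L
  μ_pos : 0 < μ
  ε_pos : 0 < ε
  ε_le : ε ≤ 0.01
  dif_large : ∀ j < J, ε ≤ 0.03 * sinTheta (P j) (P (j + 1)) ^ 2 / (L / l)
  two_le_α : 2 ≤ α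
  K_pos : 1 ≤ K
  pow_K_le : (0.02 : ℝ) ^ K ≤ ε
  basis : ∀ j ≤ J, IsBasisMatrix (P j)
  incoherent : ∀ j ≤ J, IsIncoherent μ (P j)
  tc_zero : tc 0 = 1
  tc_last : tc (J + 1) = d + 1
  Pt_eq : ∀ j ≤ J, ∀ t, tc j ≤ t → t < tc (j + 1) → Pt t = P j
  gap : ∀ j ≤ J, tc j + (K + 3) * α ≤ tc (j + 1)
  path : RegularPath d α lam L l μ (fun t => (S t).Phat) Pt a T

/-- The algorithm has just entered the update phase of the `j`-th subspace at time `τ`. -/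
structure CycleStart (d α : ℕ) (ε : ℝ) (P : ℕ → Matrix (Fin n) (Fin r) ℝ) (tc : ℕ → ℕ)
    (T : ℕ → Finset (Fin n)) (S : ℕ → State n r) (j : ℕ) (θ : ℕ → Option ℕ) (τ : ℕ)
    (Q : Matrix (Fin n) (Fin r) ℝ) : Prop where
  updating : IsUpdating (S τ) j θ Q
  that_eq : θ j = some τ
  prev : (S (τ - 1)).Phat = Q
  reliable : IsReliable d T Q
  change_le : tc j ≤ max τ 1
  le_change : τ ≤ tc j + 2 * α
  sinTheta_le : sinTheta Q (P j) ≤ ε + dif P j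

/-- The guarantees of the theorem for the `j`-th subspace with detection time `τ`. -/
structure IsTracked (α K : ℕ) (ε : ℝ) (P Pt : ℕ → Matrix (Fin n) (Fin r) ℝ) (tc : ℕ → ℕ)
    (S : ℕ → State n r) (j τ : ℕ) : Prop where
  delay : 1 ≤ j → tc j ≤ τ ∧ τ ≤ tc j + 2 * α
  recovery : ∀ k, 1 ≤ k → k ≤ K → ∀ t, τ + k * α ≤ t → t < τ + (k + 1) * α →
    sinTheta (S t).Phat (Pt t) ≤ 0.3 ^ (k - 1) * (ε + dif P j)
  final : ∀ t, τ + (K + 1) * α ≤ t → t < tc (j + 1) → sinTheta (S t).Phat (Pt t) ≤ ε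

namespace TrackingModel

variable {d J α K : ℕ} {ε L l μ : ℝ} {lam : Fin r → ℝ} {P Pt : ℕ → Matrix (Fin n) (Fin r) ℝ}
  {tc : ℕ → ℕ} {a : ℕ → Fin r → ℝ} {T : ℕ → Finset (Fin n)}
  {svd : Matrix (Fin n) (Fin α) ℝ → Matrix (Fin n) (Fin r) ℝ} {S : ℕ → State n r}

lemma tc_mono (h : TrackingModel d J α K ε L l μ lam P Pt tc a T svd S) {i j : ℕ} (hij : i ≤ j)
    (hj : j ≤ J + 1) : tc i ≤ tc j := by
  induction j, hij using Nat.le_induction with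
  | base => exact le_rfl
  | succ j hij ih =>
    have := h.gap j (by omega)
    have := ih (by omega)
    omega

lemma one_le_tc (h : TrackingModel d J α K ε L l μ lam P Pt tc a T svd S) {j : ℕ}
    (hj : j ≤ J + 1) : 1 ≤ tc j := h.tc_zero ▸ h.tc_mono (Nat.zero_le j) hj

lemma tc_le (h : TrackingModel d J α K ε L l μ lam P Pt tc a T svd S) {j : ℕ}
    (hj : j ≤ J + 1) : tc j ≤ d + 1 := h.tc_last ▸ h.tc_mono hj le_rfl

lemma isReliable (h : TrackingModel d J α K ε L l μ lam P Pt tc a T svd S) {j : ℕ} (hj : j ≤ J)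
    {Q : Matrix (Fin n) (Fin r) ℝ} (hQ : IsBasisMatrix Q) (hs : sinTheta Q (P j) ≤ 0.3) :
    IsReliable d T Q :=
  ⟨hQ.isEstimate, fun s h1 h2 => isIncoherentOn_of_sinTheta_le h.μ_pos h.r_pos h.n_pos
    (h.basis j hj) (h.incoherent j hj) (h.path.col s h1 h2) hQ hs⟩

lemma lhat_eq (h : TrackingModel d J α K ε L l μ lam P Pt tc a T svd S) {t s : ℕ} (hs : 1 ≤ s)
    (hst : s ≤ t) : (S t).lhat s = projLS (S (s - 1)).Phat (T s) (mask (T s) (Pt s *ᵥ a s)) := by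
  obtain ⟨s, rfl⟩ : ∃ s', s = s' + 1 := ⟨s - 1, by omega⟩
  rw [h.S_eq t, run_lhat_of_le hst, run_succ_lhat_self, h.S_eq (s + 1 - 1)]
  rfl

/-- The good event is phrased with the estimate of frame p - 1. When estimate and true subspace are
constant over the window, these are the error maps that actually occur. -/
lemma regularWindow (h : TrackingModel d J α K ε L l μ lam P Pt tc a T svd S) {j p q : ℕ}
    (hj : j ≤ J) (hp : 1 ≤ p) (hcase : q = p + α ∨ (p = 1 ∧ q = α)) (hseg : tc j ≤ p)
    (hq : q ≤ tc (j + 1)) {Q : Matrix (Fin n) (Fin r) ℝ} (hQ : IsReliable d T Q)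
    (hPhat : ∀ t, p ≤ t + 1 → t + 1 < q → (S t).Phat = Q) :
    RegularWindow α (Finset.Ico p q) lam L l (1.2 * sinTheta Q (P j)) a
      (fun t => lsErr Q (T t) (P j)) T := by
  have h2 := h.two_le_α
  have hqd := h.tc_le (show j + 1 ≤ J + 1 by omega)
  have hpq : p < q := by omega
  refine regularWindow_of_quadratic_le h.l_pos h.l_le h.le_L h.l_le_L hQ.1
    (fun t ht => ?_) (fun v => ?_) (fun i => ?_) ?_
  · rw [Finset.mem_Ico] at ht
    exact hQ.2 t (by omega) (by omega)
  · have h1 := h.path.conc p q hp hpq.le (by omega) hcase v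
    have e : ∑ t ∈ Finset.Ico p q, centered lam (stackedErr (S (p - 1)).Phat (T t) (Pt t)) (a t) =
        ∑ t ∈ Finset.Ico p q, centered lam (stackedErr Q (T t) (P j)) (a t) := by
      refine Finset.sum_congr rfl fun t ht => ?_
      rw [Finset.mem_Ico] at ht
      rw [hPhat (p - 1) (by omega) (by omega), h.Pt_eq j hj t (by omega) (by omega)]
    rwa [← e]
  -- Row frequencies are assumed for full windows only. For the shortened window [1, α) they are
  -- taken from [1, 1 + α), which fits before frame d by the first gap condition.
  · have hg := h.gap 0 (Nat.zero_le J)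
    have ht1 := h.tc_le (show 0 + 1 ≤ J + 1 by omega)
    rw [h.tc_zero] at hg
    have hK3 : α ≤ (K + 3) * α := Nat.le_mul_of_pos_left _ (by omega)
    refine le_trans (mul_le_mul_of_nonneg_right ?_ (sq_nonneg _))
      (h.path.row p hp (by rcases hcase with hc | ⟨hc, hc'⟩ <;> omega) i)
    norm_cast
    refine Finset.card_le_card (Finset.filter_subset_filter _ ?_)
    exact Finset.Ico_subset_Ico_right (by rcases hcase with hc | ⟨hc, hc'⟩ <;> omega)
  · rw [Nat.card_Ico]; omega

lemma window_gram (h : TrackingModel d J α K ε L l μ lam P Pt tc a T svd S) {j p t : ℕ}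
    (hj : j ≤ J) (hp : 1 ≤ p) (hcase : t + 1 = p + α ∨ (p = 1 ∧ t + 1 = α)) (hseg : tc j ≤ p)
    (hq : t + 1 ≤ tc (j + 1)) {Q : Matrix (Fin n) (Fin r) ℝ} (hQ : IsReliable d T Q)
    (hPhat : ∀ s, p ≤ s + 1 → s + 1 < t + 1 → (S s).Phat = Q) (v : Fin n → ℝ) :
    l2norm ((window α (S t).lhat t)ᵀ *ᵥ v) ^ 2 = ∑ s ∈ Finset.Ico p (t + 1),
      (v ⬝ᵥ (P j *ᵥ a s + lsErr Q (T s) (P j) *ᵥ a s)) ^ 2 := by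
  have h2 := h.two_le_α
  have hqd := h.tc_le (show j + 1 ≤ J + 1 by omega)
  rw [l2norm_window_transpose_sq _ (by omega)]
  have e : ∑ s ∈ Finset.Ico (t + 1 - α) (t + 1), (v ⬝ᵥ (S t).lhat s) ^ 2 =
      ∑ s ∈ Finset.Ico p (t + 1), (v ⬝ᵥ (S t).lhat s) ^ 2 := by
    rcases hcase with hc | ⟨rfl, hc⟩
    · rw [hc, Nat.add_sub_cancel]
    -- The shortened first window: the extra column of frame 0 is zero and drops out.
    · rw [hc, Nat.sub_self, Finset.sum_eq_sum_Ico_succ_bot (by omega), h.S_eq t, run_lhat_zero]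
      simp
  rw [e]
  refine Finset.sum_congr rfl fun s hs => ?_
  rw [Finset.mem_Ico] at hs
  rw [h.lhat_eq (by omega) (by omega), hPhat (s - 1) (by omega) (by omega),
    h.Pt_eq j hj s (by omega) (by omega), hQ.1.projLS_mask]
  exact ((hQ.2 s (by omega) (by omega)).lsGram_bound hQ.1).1

lemma sinTheta_svd_le (h : TrackingModel d J α K ε L l μ lam P Pt tc a T svd S) {j p t : ℕ}
    (hj : j ≤ J) (hp : 1 ≤ p) (hcase : t + 1 = p + α ∨ (p = 1 ∧ t + 1 = α)) (hseg : tc j ≤ p)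
    (hq : t + 1 ≤ tc (j + 1)) {Q : Matrix (Fin n) (Fin r) ℝ} (hQ : IsReliable d T Q)
    (hPhat : ∀ s, p ≤ s + 1 → s + 1 < t + 1 → (S s).Phat = Q) :
    sinTheta (svd (window α (S t).lhat t)) (P j) ≤ 0.02 * sinTheta Q (P j) := by
  have h2 := h.two_le_α
  refine (h.regularWindow hj hp hcase hseg hq hQ hPhat).sinTheta_le (h.basis j hj)
    (h.window_gram hj hp hcase hseg hq hQ hPhat) (h.svd_spec _) ?_ (by omega) rfl
    (sinTheta_le_one hQ.1 (h.basis j hj).isEstimate)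
  rw [Nat.card_Ico]
  norm_cast
  omega

lemma isBasisMatrix_svd (h : TrackingModel d J α K ε L l μ lam P Pt tc a T svd S)
    (M : Matrix (Fin n) (Fin α) ℝ) : IsBasisMatrix (svd M) := (h.svd_spec M).1

/-- The update phase contracts the subspace error geometrically. -/
lemma update_phase (h : TrackingModel d J α K ε L l μ lam P Pt tc a T svd S) {j τ : ℕ}
    (hj : j ≤ J) {θ : ℕ → Option ℕ} {Q₀ : Matrix (Fin n) (Fin r) ℝ}
    (hc : CycleStart d α ε P tc T S j θ τ Q₀) (k : ℕ) (hk : k ≤ K) :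
    ∃ Q, (k < K → IsUpdating (S (τ + (k * α - 1))) j θ Q) ∧
      (k = K → IsDetecting (S (τ + (k * α - 1))) (j + 1) θ Q (τ + (k * α - 1))) ∧
      IsReliable d T Q ∧ sinTheta Q (P j) ≤ 0.02 ^ k * sinTheta Q₀ (P j) ∧
      (1 ≤ k → IsBasisMatrix Q) ∧ (k = 0 → Q = Q₀) ∧
      ∀ t, τ ≤ t → t ≤ τ + (k * α - 1) → IsReliable d T (S t).Phat ∧
        ∀ i, τ + i * α ≤ t + 1 → sinTheta (S t).Phat (P j) ≤ 0.02 ^ i * sinTheta Q₀ (P j) := by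
  have h2 := h.two_le_α
  have hK := h.K_pos
  have hq0 := sinTheta_nonneg Q₀ (P j)
  have hpow : ∀ {i k : ℕ}, i ≤ k →
      (0.02 : ℝ) ^ k * sinTheta Q₀ (P j) ≤ 0.02 ^ i * sinTheta Q₀ (P j) := fun hik =>
    mul_le_mul_of_nonneg_right (pow_le_pow_of_le_one (by norm_num) (by norm_num) hik) hq0
  induction k with
  | zero =>
    -- For k = 0 the truncated subtraction makes τ + (k α - 1) equal to τ, the frame at which the
    -- cycle starts.
    refine ⟨Q₀, fun _ => ?_, fun h0 => by omega, hc.reliable, by simp, fun h0 => by omega,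
      fun _ => rfl, fun t h1 h2 => ?_⟩
    · simpa using hc.updating
    · obtain rfl : t = τ := by omega
      rw [hc.updating.Phat_eq]
      refine ⟨hc.reliable, fun i hi => ?_⟩
      have : i * α < 1 * α := by omega
      have := Nat.lt_of_mul_lt_mul_right this
      obtain rfl : i = 0 := by omega
      simp
  | succ k ih =>
    obtain ⟨Q, hupd, -, hrel, hsin, hbas, hQ0, hall⟩ := ih (by omega)
    have hupd := hupd (by omega)
    have hgap := h.gap j hj
    have hchange := hc.le_change
    have hkK : (k + 1) * α ≤ K * α := Nat.mul_le_mul_right _ hk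
    have hK3 : (K + 3) * α = K * α + 3 * α := by ring
    have hk1 : (k + 1) * α = k * α + α := by ring
    have hstart : τ + k * α ≤ τ + (k * α - 1) + 1 := by omega
    have hs_le : τ + (k * α - 1) ≤ τ + (k + 1) * α - 2 := by
      rcases Nat.eq_zero_or_pos k with rfl | hk0
      · simp only [Nat.zero_mul]; omega
      · have : 1 * α ≤ k * α := Nat.mul_le_mul_right _ hk0
        omega
    have hidle : ∀ t, τ + (k * α - 1) ≤ t → t + 1 < τ + (k + 1) * α → IsUpdating (S t) j θ Q := by
      intro t h3 h4
      rw [h.S_eq] at hupd ⊢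
      exact hupd.run_idle hc.that_eq hK hstart h3 h4
    set t₀ := τ + (k + 1) * α - 2 with ht₀
    have ht₀2 : t₀ + 2 = τ + (k + 1) * α := by omega
    have hend : τ + ((k + 1) * α - 1) = t₀ + 1 := by omega
    have hup := hidle t₀ hs_le (by omega)
    set U := svd (window α (S (t₀ + 1)).lhat (t₀ + 1)) with hU
    have hUbas : IsBasisMatrix U := h.isBasisMatrix_svd _
    have hPhat : ∀ s, max (τ + k * α) 1 ≤ s + 1 → s + 1 < t₀ + 1 + 1 → (S s).Phat = Q := by
      intro s h3 h4
      by_cases h5 : τ + (k * α - 1) ≤ s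
      · exact (hidle s h5 (by omega)).Phat_eq
      · rcases Nat.eq_zero_or_pos k with rfl | hk0
        -- Frame τ belongs to the first update window but was estimated with the subspace held at τ
        -- - 1, which is why `CycleStart` records it.
        · obtain rfl : s = τ - 1 := by omega
          rw [hc.prev, hQ0 rfl]
        · have : 1 * α ≤ k * α := Nat.mul_le_mul_right _ hk0
          omega
    have hcl := hc.change_le
    have hUsin : sinTheta U (P j) ≤ 0.02 * sinTheta Q (P j) := by
      -- The maximum matters only for τ = k = 0, where the window starts at frame 1 instead of 0.
      refine h.sinTheta_svd_le hj (p := max (τ + k * α) 1) (by omega) ?_ (by omega) (by omega)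
        hrel hPhat
      rcases Nat.eq_zero_or_pos (τ + k * α) with h0 | h0
      · right; constructor <;> omega
      · left; omega
    have hQ1 := sinTheta_le_one hrel.1 (h.basis j hj).isEstimate
    -- After one update the error is at most 0.02, well below the 0.3 that preserves good
    -- conditioning.
    have hUrel : IsReliable d T U := h.isReliable hj hUbas (by linarith)
    have hUsin' : sinTheta U (P j) ≤ 0.02 ^ (k + 1) * sinTheta Q₀ (P j) := by
      rw [pow_succ]; nlinarith
    have hphase : (k + 1 < K → IsUpdating (S (t₀ + 1)) j θ U) ∧
        (k + 1 = K → IsDetecting (S (t₀ + 1)) (j + 1) θ U (t₀ + 1)) := by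
      rw [hU]
      rw [h.S_eq t₀] at hup
      rw [h.S_eq (t₀ + 1)]
      constructor
      · intro hlt
        exact hup.run_succ_update hc.that_eq (by omega) (by omega) (by omega) ht₀2
      · intro heq
        exact hup.run_succ_finish hc.that_eq (by omega) (by omega) (by rw [← heq]; exact ht₀2)
    have hUPhat : (S (t₀ + 1)).Phat = U := by
      rcases (show k + 1 < K ∨ k + 1 = K by omega) with hlt | heq
      · exact (hphase.1 hlt).Phat_eq
      · exact (hphase.2 heq).Phat_eq
    rw [hend]
    refine ⟨U, hphase.1, hphase.2, hUrel, hUsin', fun _ => hUbas, fun h0 => by omega,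
      fun t h3 h4 => ?_⟩
    by_cases h5 : t ≤ τ + (k * α - 1)
    · exact hall t h3 h5
    · by_cases h6 : t = t₀ + 1
      · rw [h6, hUPhat]
        refine ⟨hUrel, fun i hi => hUsin'.trans (hpow ?_)⟩
        have : i * α ≤ (k + 1) * α := by omega
        exact Nat.le_of_mul_le_mul_right this (by omega)
      · rw [(hidle t (by omega) (by omega)).Phat_eq]
        refine ⟨hrel, fun i hi => hsin.trans (hpow ?_)⟩
        have : i * α < (k + 1) * α := by omega
        exact Nat.le_of_lt_succ (Nat.lt_of_mul_lt_mul_right this)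

/-- No alarm is raised before the next change. -/
lemma detect_phase (h : TrackingModel d J α K ε L l μ lam P Pt tc a T svd S) {j s : ℕ}
    (hj : j ≤ J) {θ : ℕ → Option ℕ} {Q : Matrix (Fin n) (Fin r) ℝ}
    (hdet : IsDetecting (S s) (j + 1) θ Q s) (hQ : IsReliable d T Q) (hsin : sinTheta Q (P j) ≤ ε)
    (hseg : tc j ≤ s + 1) (t : ℕ) (hst : s ≤ t) (ht : t + 1 ≤ tc (j + 1)) :
    IsDetecting (S t) (j + 1) θ Q s := by
  have h2 := h.two_le_α
  have : NeZero n := ⟨by have := h.n_pos; omega⟩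
  -- Absence of an alarm at t uses that the estimate was unchanged over the whole preceding window,
  -- hence strong induction.
  induction t using Nat.strong_induction_on with
  | _ t ih =>
    rcases Nat.eq_or_lt_of_le hst with rfl | hlt
    · exact hdet
    obtain ⟨t, rfl⟩ : ∃ t', t = t' + 1 := ⟨t - 1, by omega⟩
    have hprev := ih t (by omega) (by omega) (by omega)
    rw [h.S_eq] at hprev ⊢
    refine hprev.run_succ_idle fun u hu hut => ?_
    rw [← h.S_eq]
    have hu1 : u * α = (u - 1) * α + α := by
      obtain ⟨u, rfl⟩ : ∃ u', u = u' + 1 := ⟨u - 1, by omega⟩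
      simp only [Nat.add_sub_cancel]; ring
    have hPhat : ∀ s', s + (u - 1) * α + 1 ≤ s' + 1 → s' + 1 < t + 1 + 1 → (S s').Phat = Q :=
      fun s' h3 h4 => (ih s' (by omega) (by omega) (by omega)).Phat_eq
    exact (h.regularWindow hj (by omega) (Or.inl (by omega)) (by omega) ht hQ hPhat).lamMaxGram_lt
      hQ.1 (h.window_gram hj (by omega) (Or.inl (by omega)) (by omega) ht hQ hPhat) (by omega) rfl
      h.ε_pos hsin

/-- The smallness of ε relative to D²/f is used twice: it gives ε ≤ 0.03 D, so q ≥ 0.97 D, and it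
bounds ε L by 0.03 D² l. Together with ε ≤ 0.01 the threshold is at most 0.0006 D² l. -/
lemma threshold_le_aux {ε L l D q : ℝ} (hε : 0 < ε) (hε1 : ε ≤ 0.01) (hl : 0 < l) (hlL : l ≤ L)
    (hD0 : 0 ≤ D) (hD1 : D ≤ 1) (h2 : ε ≤ 0.03 * D ^ 2 / (L / l)) (h1 : D ≤ ε + q) :
    2 * ε ^ 2 * L ≤ 0.9 * l * q ^ 2 := by
  have hL : 0 < L := hl.trans_le hlL
  rw [div_div_eq_mul_div, le_div_iff₀ hL] at h2
  have h3 : ε ≤ 0.03 * D := by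
    have h4 : ε * l ≤ 0.03 * D ^ 2 * l := (mul_le_mul_of_nonneg_left hlL hε.le).trans h2
    have h5 := le_of_mul_le_mul_right h4 hl
    have h6 : D ^ 2 ≤ D := by rw [pow_two]; exact mul_le_of_le_one_left hD0 hD1
    linarith
  have h6 : 97 / 100 * D ≤ q := by linarith
  have h7 : 9 / 10 * D ^ 2 ≤ q ^ 2 := by
    have h8 := pow_le_pow_left₀ (by positivity) h6 2
    have h9 : (97 / 100 * D) ^ 2 = 9409 / 10000 * D ^ 2 := by ring
    have h10 := sq_nonneg D
    linarith
  have h9 : ε * (ε * L) ≤ 0.01 * (0.03 * D ^ 2 * l) :=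
    mul_le_mul hε1 h2 (by positivity) (by norm_num)
  have h10 := mul_le_mul_of_nonneg_left h7 hl.le
  have h11 : 0 ≤ D ^ 2 * l := by positivity
  have h12 : 2 * ε ^ 2 * L = 2 * (ε * (ε * L)) := by ring
  rw [h12]
  norm_num at *
  linarith

lemma threshold_le (h : TrackingModel d J α K ε L l μ lam P Pt tc a T svd S) {j : ℕ} (hj : j < J)
    {Q : Matrix (Fin n) (Fin r) ℝ} (hQ : IsBasisMatrix Q) (hsin : sinTheta Q (P j) ≤ ε) :
    α * (2 * ε ^ 2 * L) ≤ 0.9 * (α * l) * sinTheta Q (P (j + 1)) ^ 2 := by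
  have hl := h.l_pos
  have hL : 0 < L := hl.trans_le h.l_le_L
  have hε := h.ε_pos
  have hε1 := h.ε_le
  have hb := h.basis j (by omega)
  have hb' := h.basis (j + 1) (by omega)
  have h1 := sinTheta_triangle hb.isEstimate hQ hb'
  rw [sinTheta_comm hb hQ] at h1
  have h2 := h.dif_large j hj
  have hD1 := sinTheta_le_one hb.isEstimate hb'.isEstimate
  have hD0 := sinTheta_nonneg (P j) (P (j + 1))
  have h8 := threshold_le_aux hε hε1 hl h.l_le_L hD0 hD1 h2 (h1.trans (add_le_add_left hsin _))
  have := mul_le_mul_of_nonneg_left h8 (Nat.cast_nonneg (α := ℝ) α)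
  linarith

/-- The change is detected with a delay of at most two windows. -/
lemma exists_alarm (h : TrackingModel d J α K ε L l μ lam P Pt tc a T svd S) {j s : ℕ}
    (hj : j < J) {θ : ℕ → Option ℕ} {Q : Matrix (Fin n) (Fin r) ℝ}
    (hdet : IsDetecting (S s) (j + 1) θ Q s) (hQ : IsReliable d T Q) (hQb : IsBasisMatrix Q)
    (hsin : sinTheta Q (P j) ≤ ε) (hseg : tc j ≤ s + 1) (hs : s + 1 ≤ tc (j + 1)) :
    ∃ τ, tc (j + 1) ≤ τ ∧ τ ≤ tc (j + 1) + 2 * α ∧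
      IsUpdating (S τ) (j + 1) (Function.update θ (j + 1) (some τ)) Q ∧
      ∀ t, s ≤ t → t ≤ τ → (S t).Phat = Q := by
  have h2 := h.two_le_α
  have : NeZero n := ⟨by have := h.n_pos; omega⟩
  have hquiet := h.detect_phase hj.le hdet hQ hsin hseg
  set c := tc (j + 1) with hc
  have hgap := h.gap (j + 1) (by omega)
  have hK3 : (K + 3) * α = K * α + 3 * α := by ring
  -- u counts the tests that precede the change; test u + 1 is the first one at or after it.
  obtain ⟨u, hdm, hml⟩ : ∃ u, u * α ≤ c - 1 - s ∧ c - 1 - s < u * α + α := by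
    have h3 := Nat.div_add_mod (c - 1 - s) α
    have h4 := Nat.mod_lt (c - 1 - s) (show 0 < α by omega)
    rw [mul_comm] at h3
    exact ⟨(c - 1 - s) / α, by omega, by omega⟩
  have hu1 : (u + 1) * α = u * α + α := by ring
  have hu2 : (u + 1 + 1) * α = u * α + 2 * α := by ring
  have hidle1 : ∀ t, s ≤ t → t < s + (u + 1) * α → IsDetecting (S t) (j + 1) θ Q s := by
    intro t h3 h4
    by_cases h5 : t + 1 ≤ c
    · exact hquiet t h3 h5
    · have h6 := hquiet (c - 1) (by omega) (by omega)
      rw [h.S_eq] at h6 ⊢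
      exact h6.run_idle (k := u) (by omega) (by omega) h4
  obtain ⟨t₁, ht₁⟩ : ∃ t₁, t₁ + 1 = s + (u + 1) * α := ⟨s + (u + 1) * α - 1, by omega⟩
  have hd1 := hidle1 t₁ (by omega) (by omega)
  -- The window of test u + 1 may mix both subspaces, so both outcomes are allowed. If it stays
  -- silent, the window of test u + 2 lies after the change and must raise the alarm.
  by_cases hal : α * (2 * ε ^ 2 * L) ≤
      lamMaxGram (perp Q * window α (S (t₁ + 1)).lhat (t₁ + 1))
  · have hup : IsUpdating (S (t₁ + 1)) (j + 1) (Function.update θ (j + 1) (some (t₁ + 1))) Q := by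
      rw [h.S_eq] at hd1 hal ⊢
      exact hd1.run_succ_alarm (u := u + 1) (by omega) ht₁ hal
    refine ⟨t₁ + 1, by omega, by omega, hup, fun t h3 h4 => ?_⟩
    by_cases h5 : t = t₁ + 1
    · rw [h5, hup.Phat_eq]
    · exact (hidle1 t h3 (by omega)).Phat_eq
  · have hd2 : IsDetecting (S (t₁ + 1)) (j + 1) θ Q s := by
      rw [h.S_eq] at hd1 hal ⊢
      exact hd1.run_succ_idle fun _ _ _ => not_le.mp hal
    have hidle2 : ∀ t, s ≤ t → t < s + (u + 1 + 1) * α → IsDetecting (S t) (j + 1) θ Q s := by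
      intro t h3 h4
      by_cases h5 : t < s + (u + 1) * α
      · exact hidle1 t h3 h5
      · rw [h.S_eq] at hd2 ⊢
        exact hd2.run_idle (k := u + 1) (by omega) (by omega) h4
    obtain ⟨t₂, ht₂⟩ : ∃ t₂, t₂ + 1 = s + (u + 1 + 1) * α := ⟨s + (u + 1 + 1) * α - 1, by omega⟩
    have hd3 := hidle2 t₂ (by omega) (by omega)
    have hPhat : ∀ s', t₁ + 2 ≤ s' + 1 → s' + 1 < t₂ + 1 + 1 → (S s').Phat = Q :=
      fun s' h3 h4 => (hidle2 s' (by omega) (by omega)).Phat_eq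
    have hend : t₂ + 1 + 1 ≤ tc (j + 1 + 1) := by omega
    have hal2 : α * (2 * ε ^ 2 * L) ≤
        lamMaxGram (perp Q * window α (S (t₂ + 1)).lhat (t₂ + 1)) := by
      refine (h.threshold_le hj hQb hsin).trans ?_
      refine (h.regularWindow (j := j + 1) (by omega) (by omega) (Or.inl (by omega)) (by omega) hend
        hQ hPhat).le_lamMaxGram hQ.1 (h.window_gram (j := j + 1) (by omega) (by omega)
          (Or.inl (by omega)) (by omega) hend hQ hPhat) ?_ rfl
      rw [Nat.card_Ico]; omega
    have hup : IsUpdating (S (t₂ + 1)) (j + 1) (Function.update θ (j + 1) (some (t₂ + 1))) Q := by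
      rw [h.S_eq] at hd3 hal2 ⊢
      exact hd3.run_succ_alarm (u := u + 1 + 1) (by omega) ht₂ hal2
    refine ⟨t₂ + 1, by omega, by omega, hup, fun t h3 h4 => ?_⟩
    by_cases h5 : t = t₂ + 1
    · rw [h5, hup.Phat_eq]
    · exact (hidle2 t h3 (by omega)).Phat_eq

/-- One cycle of the algorithm: update phase, detect phase, and detection of the next change. -/
lemma cycle (h : TrackingModel d J α K ε L l μ lam P Pt tc a T svd S) {j τ : ℕ}
    (hj : j ≤ J) {θ : ℕ → Option ℕ} {Q₀ : Matrix (Fin n) (Fin r) ℝ}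
    (hc : CycleStart d α ε P tc T S j θ τ Q₀) :
    IsTracked α K ε P Pt tc S j τ ∧
      (j = J → (S d).that = θ ∧ ∀ t, τ ≤ t → t ≤ d → IsReliable d T (S t).Phat) ∧
      (j < J → ∃ τ' Q, CycleStart d α ε P tc T S (j + 1) (Function.update θ (j + 1) (some τ')) τ' Q ∧
        ∀ t, τ ≤ t → t ≤ τ' → IsReliable d T (S t).Phat) := by
  have h2 := h.two_le_α
  have hK := h.K_pos
  have hgap := h.gap j hj
  have hK3 : (K + 3) * α = K * α + 3 * α := by ring
  have hKα : 1 * α ≤ K * α := Nat.mul_le_mul_right _ hK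
  have hcl := hc.change_le
  have hle := hc.le_change
  obtain ⟨Q, -, hdet, hrel, hsin, hbas, -, hall⟩ := h.update_phase hj hc K le_rfl
  have hdet := hdet rfl
  have hbas := hbas hK
  set s := τ + (K * α - 1) with hs
  have hq1 := sinTheta_le_one hc.reliable.1 (h.basis j hj).isEstimate
  have hq0 := sinTheta_nonneg Q₀ (P j)
  have hsinε : sinTheta Q (P j) ≤ ε := by
    have hp : (0 : ℝ) ≤ 0.02 ^ K := by positivity
    have := h.pow_K_le
    nlinarith
  have hquiet := h.detect_phase hj hdet hrel hsinε (by omega)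
  refine ⟨⟨fun hj1 => ⟨?_, hle⟩, fun k hk1 hkK t h3 h4 => ?_, fun t h3 h4 => ?_⟩, fun hJ => ?_,
    fun hJ => ?_⟩
  -- For j ≥ 1 the change time exceeds 1, so the maximum in `change_le` is τ itself.
  · have h3 := h.gap (j - 1) (by omega)
    have h4 := h.one_le_tc (show j - 1 ≤ J + 1 by omega)
    rw [Nat.sub_add_cancel hj1] at h3
    omega
  · have hk : (k + 1) * α = k * α + α := by ring
    have hkK' : k * α ≤ K * α := Nat.mul_le_mul_right _ hkK
    have hk1' : 1 * α ≤ k * α := Nat.mul_le_mul_right _ hk1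
    rw [h.Pt_eq j hj t (by omega) (by omega)]
    have hmain : sinTheta (S t).Phat (P j) ≤ 0.02 ^ k * sinTheta Q₀ (P j) := by
      by_cases h5 : t ≤ s
      · exact (hall t (by omega) h5).2 k (by omega)
      · rw [(hquiet t (by omega) (by omega)).Phat_eq]
        exact hsin.trans (mul_le_mul_of_nonneg_right
          (pow_le_pow_of_le_one (by norm_num) (by norm_num) hkK) hq0)
    refine hmain.trans (mul_le_mul ?_ hc.sinTheta_le hq0 (by positivity))
    calc (0.02 : ℝ) ^ k ≤ 0.3 ^ k := pow_le_pow_left₀ (by norm_num) (by norm_num) k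
      _ ≤ 0.3 ^ (k - 1) := pow_le_pow_of_le_one (by norm_num) (by norm_num) (by omega)
  · have hk : (K + 1) * α = K * α + α := by ring
    rw [h.Pt_eq j hj t (by omega) h4, (hquiet t (by omega) (by omega)).Phat_eq]
    exact hsinε
  · have htl := h.tc_last
    rw [← hJ] at htl
    refine ⟨(hquiet d (by omega) (by omega)).that_eq, fun t h3 h4 => ?_⟩
    by_cases h5 : t ≤ s
    · exact (hall t h3 h5).1
    · rw [(hquiet t (by omega) (by omega)).Phat_eq]; exact hrel
  · obtain ⟨τ', h3, h4, hup, hP⟩ := h.exists_alarm hJ hdet hrel hbas hsinε (by omega) (by omega)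
    refine ⟨τ', Q, ⟨hup, by simp, hP _ (by omega) (by omega), hrel, by omega, h4, ?_⟩,
      fun t h5 h6 => ?_⟩
    · refine (sinTheta_triangle hrel.1 (h.basis j hj) (h.basis (j + 1) (by omega))).trans ?_
      exact add_le_add hsinε le_rfl
    · by_cases h7 : t ≤ s
      · exact (hall t h5 h7).1
      · rw [hP t (by omega) h6]; exact hrel

/-- Induction over the changes, with `cycle` as step. The initial cycle starts from the zero matrix,
which is trivially incoherent on every set. Later cycles change only later detection times, so
earlier guarantees survive. -/
lemma exists_cycleStart (h : TrackingModel d J α K ε L l μ lam P Pt tc a T svd S) (j : ℕ)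
    (hj : j ≤ J) : ∃ θ τ Q, CycleStart d α ε P tc T S j θ τ Q ∧
      (∀ t, t ≤ τ → IsReliable d T (S t).Phat) ∧
      ∀ i < j, ∃ σ, θ i = some σ ∧ IsTracked α K ε P Pt tc S i σ := by
  induction j with
  | zero =>
    have h0 : IsUpdating (S 0) 0 (State.init n r).that 0 := by rw [h.S_eq]; exact isUpdating_init
    have hrel : IsReliable d T (0 : Matrix (Fin n) (Fin r) ℝ) :=
      ⟨Or.inr rfl, fun s _ _ => isIncoherentOn_zero _⟩
    refine ⟨(State.init n r).that, 0, 0, ⟨h0, rfl, h0.Phat_eq, hrel, ?_, Nat.zero_le _, ?_⟩,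
      fun t ht => ?_, fun i hi => by omega⟩
    · rw [h.tc_zero]; simp
    · exact le_add_of_nonneg_left h.ε_pos.le
    · obtain rfl : t = 0 := by omega
      rw [h0.Phat_eq]; exact hrel
  | succ j ih =>
    obtain ⟨θ, τ, Q, hc, hrel, hprev⟩ := ih (by omega)
    obtain ⟨htr, -, hnext⟩ := h.cycle (by omega) hc
    obtain ⟨τ', Q', hc', hrel'⟩ := hnext (by omega)
    refine ⟨_, τ', Q', hc', fun t ht => ?_, fun i hi => ?_⟩
    · rcases Nat.le_total t τ with h1 | h1
      · exact hrel t h1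
      · exact hrel' t h1 ht
    · rw [Function.update_of_ne (by omega)]
      rcases Nat.lt_succ_iff_lt_or_eq.mp hi with h1 | rfl
      · exact hprev i h1
      · exact ⟨τ, hc.that_eq, htr⟩

/-- The tracking guarantee on a regular path. -/
theorem tracking (h : TrackingModel d J α K ε L l μ lam P Pt tc a T svd S) :
    ∃ that : ℕ → ℕ, (∀ j ≤ J, (S d).that j = some (that j)) ∧
      (∀ j ≤ J, IsTracked α K ε P Pt tc S j (that j)) ∧
      ∀ t ≤ d, IsReliable d T (S t).Phat := by
  obtain ⟨θ, τ, Q, hc, hrel, hprev⟩ := h.exists_cycleStart J le_rfl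
  obtain ⟨htr, hlast, -⟩ := h.cycle le_rfl hc
  obtain ⟨hθ, hrel'⟩ := hlast rfl
  have hall : ∀ j ≤ J, ∃ σ, θ j = some σ ∧ IsTracked α K ε P Pt tc S j σ := fun j hj => by
    rcases Nat.eq_or_lt_of_le hj with rfl | hlt
    · exact ⟨τ, hc.that_eq, htr⟩
    · exact hprev j hlt
  refine ⟨fun j => (θ j).getD 0, fun j hj => ?_, fun j hj => ?_, fun t ht => ?_⟩
  · obtain ⟨σ, h1, -⟩ := hall j hj
    simp [hθ, h1]
  · obtain ⟨σ, h1, h3⟩ := hall j hj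
    simpa [h1] using h3
  · rcases Nat.le_total t τ with h1 | h1
    · exact hrel t h1
    · exact hrel' t h1 ht

lemma data_recovery (h : TrackingModel d J α K ε L l μ lam P Pt tc a T svd S) {t : ℕ} (ht : 1 ≤ t)
    (htd : t ≤ d) (hrel : IsReliable d T (S (t - 1)).Phat) :
    IsUnit (lsGram (S (t - 1)).Phat (T t)).det ∧
      vnorm ((S t).lhat t - Pt t *ᵥ a t) ≤
        1.2 * (sinTheta (S (t - 1)).Phat (Pt t) + ε) * vnorm (Pt t *ᵥ a t) := by
  have hinc := hrel.2 t ht htd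
  refine ⟨(hinc.lsGram_bound hrel.1).1, ?_⟩
  -- Every frame lies in one of the intervals between consecutive change times.
  have hseg : ∀ j, j ≤ J → t < tc (j + 1) → ∃ i ≤ J, tc i ≤ t ∧ t < tc (i + 1) := by
    intro j
    induction j with
    | zero => exact fun h1 h2 => ⟨0, h1, by rw [h.tc_zero]; exact ht, h2⟩
    | succ j ih =>
      intro h1 h2
      by_cases h3 : t < tc (j + 1)
      · exact ih (by omega) h3
      · exact ⟨j + 1, h1, not_lt.mp h3, h2⟩
  obtain ⟨i, hi, h1, h2⟩ := hseg J le_rfl (by rw [h.tc_last]; omega)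
  rw [h.lhat_eq ht le_rfl, h.Pt_eq i hi t h1 h2]
  refine (hinc.vnorm_projLS_sub_le hrel.1 (h.basis i hi) (a t)).trans ?_
  have hv : 0 ≤ vnorm (P i *ᵥ a t) := norm_nonneg _
  have hε := h.ε_pos
  exact mul_le_mul_of_nonneg_right (by linarith) hv

end TrackingModel

end Tracking

end NORST

end


section

namespace NORST

open scoped Matrix.Norms.L2Operator
open Filter Topology

/-! ### Choice of the numerical constants. -/

section Parameters

lemma half_le_log_natCast {n : ℕ} (hn : 2 ≤ n) : 1 / 2 ≤ Real.log n := by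
  have h1 : Real.log 2 ≤ Real.log n :=
    Real.log_le_log (by norm_num) (by exact_mod_cast hn)
  have := Real.log_two_gt_d9
  linarith

lemma one_le_log_one_div {ε : ℝ} (hε : 0 < ε) (hε1 : ε ≤ 0.01) : 1 ≤ Real.log (1 / ε) := by
  rw [Real.le_log_iff_exp_le (by positivity), le_div_iff₀ hε]
  have h1 := Real.exp_one_lt_d9
  nlinarith

/-- The number of updates suffices to reach the target accuracy. -/
lemma pow_ceil_log_le {ε : ℝ} (hε : 0 < ε) : (0.02 : ℝ) ^ ⌈Real.log (1 / ε)⌉₊ ≤ ε := by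
  set K := ⌈Real.log (1 / ε)⌉₊ with hK
  have h1 : Real.log (1 / ε) ≤ K := Nat.le_ceil _
  -- The contraction factor beats 1/e, so ⌈log(1/ε)⌉ updates are enough.
  have h2 : (0.02 : ℝ) ≤ Real.exp (-1) := by
    rw [Real.exp_neg, le_inv_comm₀ (by norm_num) (Real.exp_pos _)]
    have := Real.exp_one_lt_d9
    norm_num
    linarith
  calc (0.02 : ℝ) ^ K ≤ Real.exp (-1) ^ K := pow_le_pow_left₀ (by norm_num) h2 K
    _ = Real.exp (-K) := by rw [← Real.exp_nat_mul]; congr 1; ring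
    _ ≤ Real.exp (-Real.log (1 / ε)) := Real.exp_le_exp.mpr (neg_le_neg h1)
    _ = ε := by rw [Real.log_div one_ne_zero hε.ne', Real.log_one, zero_sub, neg_neg, Real.exp_log hε]

lemma one_le_ceil_log {ε : ℝ} (hε : 0 < ε) (hε1 : ε ≤ 0.01) : 1 ≤ ⌈Real.log (1 / ε)⌉₊ :=
  Nat.one_le_iff_ne_zero.mpr fun h => by
    have := Nat.ceil_eq_zero.mp h
    linarith [one_le_log_one_div hε hε1]

lemma windowLength_base {μ f : ℝ} {n r : ℕ} (hμ : 1 ≤ μ) (hf : 1 ≤ f) (hr : 1 ≤ r) (hn : 2 ≤ n) :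
    2 ≤ 176000000 * μ * f ^ 2 * r * Real.log n := by
  have h1 := half_le_log_natCast hn
  have hr' : (1 : ℝ) ≤ r := by exact_mod_cast hr
  have hf2 : 1 ≤ f ^ 2 := one_le_pow₀ hf
  have h2 : 1 ≤ μ * f ^ 2 := one_le_mul_of_one_le_of_one_le hμ hf2
  have h3 : 1 ≤ μ * f ^ 2 * r := one_le_mul_of_one_le_of_one_le h2 hr'
  have h4 : 1 / 2 ≤ μ * f ^ 2 * r * Real.log n := h1.trans (le_mul_of_one_le_left (by linarith) h3)
  linarith

/-- One cycle needs K update windows and at most three more. With log(1/ε) ≥ 1 and x ≥ 2 the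
ceilings cost factors 5 and 2, which makes the gap constant ten times the window constant. -/
lemma gap_le {x ε : ℝ} (hx : 2 ≤ x) (hε : 0 < ε) (hε1 : ε ≤ 0.01) :
    ((⌈Real.log (1 / ε)⌉₊ : ℝ) + 3) * (⌈x⌉₊ : ℝ) ≤ 10 * x * Real.log (1 / ε) := by
  have h1 := one_le_log_one_div hε hε1
  have h2 := (Nat.ceil_lt_add_one (by linarith : 0 ≤ Real.log (1 / ε))).le
  have h3 := (Nat.ceil_lt_add_one (by linarith : 0 ≤ x)).le
  calc ((⌈Real.log (1 / ε)⌉₊ : ℝ) + 3) * (⌈x⌉₊ : ℝ)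
      ≤ (5 * Real.log (1 / ε)) * (2 * x) :=
        mul_le_mul (by linarith) (by linarith) (Nat.cast_nonneg _) (by linarith)
    _ = 10 * x * Real.log (1 / ε) := by ring

end Parameters

/-- The tracking guarantee. -/
theorem measure_not_tracked_le {μ : ℝ} (hμ : 1 ≤ μ) {Ω : Type*} [MeasurableSpace Ω] (Pr : Measure Ω)
    [IsProbabilityMeasure Pr] (n r d J α K : ℕ) (ε lamP lamM f : ℝ) (lam : Fin r → ℝ)
    (P : ℕ → Matrix (Fin n) (Fin r) ℝ) (Pt : ℕ → Matrix (Fin n) (Fin r) ℝ) (tc : ℕ → ℕ)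
    (a : ℕ → Ω → Fin r → ℝ) (T : ℕ → Ω → Finset (Fin n))
    (svd : Matrix (Fin n) (Fin α) ℝ → Matrix (Fin n) (Fin r) ℝ)
    (hn : 2 ≤ n) (hr : 1 ≤ r) (hsvd : IsRSVD svd) (hsvdm : IsMeasurableRSVD svd)
    (hP : lamP = ⨆ k, lam k) (hM : lamM = ⨅ k, lam k) (hM0 : 0 < lamM) (hf : f = lamP / lamM)
    (hε : 0 < ε) (hε1 : ε ≤ 0.01)
    (hdif : ∀ j < J, ε ≤ 0.03 * sinTheta (P j) (P (j + 1)) ^ 2 / f)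
    (hα : α = ⌈176000000 * μ * f ^ 2 * r * Real.log n⌉₊) (hK : K = ⌈1 * Real.log (1 / ε)⌉₊)
    (hbasis : ∀ j ≤ J, IsBasisMatrix (P j) ∧ IsIncoherent μ (P j))
    (ha : StatRightIncoherent Pr d μ lam a) (hT : ∀ t ∈ Set.Icc 1 d, Measurable (T t))
    (hcol : ∀ᵐ ω ∂Pr, maxMissFracCol d (fun t => T t ω) ≤ (1 / 100) / (μ * r))
    (hrow : ∀ᵐ ω ∂Pr, maxMissFracRow d α (fun t => T t ω) ≤ (1 / 1000000) / f ^ 2)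
    (htc0 : tc 0 = 1) (htcJ : tc (J + 1) = d + 1)
    (hPt : ∀ j ≤ J, ∀ t, tc j ≤ t → t < tc (j + 1) → Pt t = P j)
    (hgap : ∀ j ≤ J, (tc j : ℝ) + 1760000000 * μ * f ^ 2 * r * Real.log n * Real.log (1 / ε) <
      tc (j + 1))
    (haT : IndepFun (fun ω (t : Set.Icc 1 d) => a t ω) (fun ω (t : Set.Icc 1 d) => T t ω) Pr) :
    Pr {ω | ¬ (
      let S := run α K (2 * ε ^ 2 * lamP) svd
        (fun t => mask (T t ω) (Pt t *ᵥ a t ω)) (fun t => T t ω)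
      ∃ that : ℕ → ℕ, (∀ j ≤ J, (S d).that j = some (that j)) ∧
        (∀ j, 1 ≤ j → j ≤ J → tc j ≤ that j ∧ that j ≤ tc j + 2 * α) ∧
        (∀ j ≤ J, ∀ k, 1 ≤ k → k ≤ K → ∀ t, that j + k * α ≤ t → t < that j + (k + 1) * α →
          sinTheta (S t).Phat (Pt t) ≤ 0.3 ^ (k - 1) * (ε + dif P j)) ∧
        (∀ j ≤ J, ∀ t, that j + (K + 1) * α ≤ t → t < tc (j + 1) →
          sinTheta (S t).Phat (Pt t) ≤ ε) ∧
        (∀ t, 1 ≤ t → t ≤ d →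
          IsUnit (lsGram (S (t - 1)).Phat (T t ω)).det ∧
          vnorm ((S t).lhat t - Pt t *ᵥ a t ω) ≤
            1.2 * (sinTheta (S (t - 1)).Phat (Pt t) + ε) * vnorm (Pt t *ᵥ a t ω)))} ≤
      ENNReal.ofReal (10 * d / (n : ℝ) ^ 10) := by
  have : NeZero n := ⟨by omega⟩
  have hl_le : ∀ i, lamM ≤ lam i := fun i => by
    rw [hM]; exact ciInf_le (Set.finite_range lam).bddBelow i
  have hle_L : ∀ i, lam i ≤ lamP := fun i => by
    rw [hP]; exact le_ciSup (Set.finite_range lam).bddAbove i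
  have hML : lamM ≤ lamP := (hl_le ⟨0, hr⟩).trans (hle_L _)
  have hf1 : 1 ≤ f := by rw [hf, le_div_iff₀ hM0]; linarith
  have hx := windowLength_base hμ hf1 hr hn
  have hα2 : 2 ≤ α := by
    have h1 := Nat.le_ceil (176000000 * μ * f ^ 2 * r * Real.log n)
    rw [← hα] at h1
    exact_mod_cast hx.trans h1
  rw [one_mul] at hK
  refine (measure_mono ?_).trans (measure_not_regularPath_le (K := K) (thr := 2 * ε ^ 2 * lamP)
    (Pt := Pt) hsvdm ha hμ hr hP hM0 hl_le hf hT haT hn (hbasis 0 (Nat.zero_le J)).1.le hα2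
    (by rw [hα]; exact Nat.le_ceil _) hcol hrow)
  intro ω hω hreg
  refine hω ?_
  have hmodel : TrackingModel d J α K ε lamP lamM μ lam P Pt tc (fun t => a t ω) (fun t => T t ω)
      svd (run α K (2 * ε ^ 2 * lamP) svd
        (fun t => mask (T t ω) (Pt t *ᵥ a t ω)) (fun t => T t ω)) :=
    { S_eq := fun _ => rfl
      r_pos := hr
      n_pos := by omega
      svd_spec := hsvd
      l_pos := hM0
      l_le := hl_le
      le_L := hle_L
      l_le_L := hML
      μ_pos := by linarith
      ε_pos := hε
      ε_le := hε1
      dif_large := fun j hj => by rw [← hf]; exact hdif j hj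
      two_le_α := hα2
      K_pos := by rw [hK]; exact one_le_ceil_log hε hε1
      pow_K_le := by rw [hK]; exact pow_ceil_log_le hε
      basis := fun j hj => (hbasis j hj).1
      incoherent := fun j hj => (hbasis j hj).2
      tc_zero := htc0
      tc_last := htcJ
      Pt_eq := hPt
      gap := fun j hj => by
        have h1 := hgap j hj
        have h2 := gap_le hx hε hε1
        rw [← hα, ← hK] at h2
        have h3 : (tc j : ℝ) + (K + 3) * α ≤ tc (j + 1) := by linarith
        exact_mod_cast h3
      path := hreg }
  obtain ⟨that, h1, h2, h3⟩ := hmodel.tracking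
  exact ⟨that, h1, fun j hj1 hj => (h2 j hj).delay hj1, fun j hj => (h2 j hj).recovery,
    fun j hj => (h2 j hj).final,
    fun t ht htd => hmodel.data_recovery ht htd (h3 (t - 1) (by omega))⟩

end NORST

end


section

namespace NORST

/-! ### Structured programs and their compilation. -/

section CodeLanguage

/-- Structured programs with registers named by `R`. -/
inductive Code (n r α : ℕ) (R : Type)
  | skip
  | const (dst : R) (c : ℝ)
  | copy (dst a : R)
  | load (dst : R) (i : Fin n)
  | add (dst a b : R)
  | sub (dst a b : R)
  | mul (dst a b : R)
  | div (dst a b : R)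
  | svd (src : Fin n → Fin α → R) (dst : Fin n × Fin r ↪ R)
  | seq (p q : Code n r α R)
  | ifLE (a b : R) (p q : Code n r α R)

namespace Code

variable {n r α : ℕ} {R : Type}

open Classical in
/-- Final registers of a structured program. -/
def eval (f : Matrix (Fin n) (Fin α) ℝ → Matrix (Fin n) (Fin r) ℝ) (y : Fin n → ℝ) :
    Code n r α R → (R → ℝ) → R → ℝ
  | skip, m => m
  | const dst c, m => Function.update m dst c
  | copy dst a, m => Function.update m dst (m a)
  | load dst i, m => Function.update m dst (y i)
  | add dst a b, m => Function.update m dst (m a + m b)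
  | sub dst a b, m => Function.update m dst (m a - m b)
  | mul dst a b, m => Function.update m dst (m a * m b)
  | div dst a b, m => Function.update m dst (m a / m b)
  | svd src dst, m =>
    Function.extend dst (fun p => f (Matrix.of fun i k => m (src i k)) p.1 p.2) m
  | seq p q, m => eval f y q (eval f y p m)
  | ifLE a b p q, m => if m a ≤ m b then eval f y p m else eval f y q m

open Classical in
/-- Number of steps of a structured program. -/
def time (f : Matrix (Fin n) (Fin α) ℝ → Matrix (Fin n) (Fin r) ℝ) (ε : ℝ) (y : Fin n → ℝ) :
    Code n r α R → (R → ℝ) → ℕ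
  | skip, _ => 0
  | svd _ _, _ => n * α * r * ⌈Real.log (1 / ε)⌉₊
  | seq p q, m => time f ε y p m + time f ε y q (eval f y p m)
  | ifLE a b p q, m => 1 + if m a ≤ m b then time f ε y p m else time f ε y q m
  | _, _ => 1

/-- A bound for the number of steps that does not depend on the registers. -/
def cost (ε : ℝ) : Code n r α R → ℕ
  | skip => 0
  | svd _ _ => n * α * r * ⌈Real.log (1 / ε)⌉₊
  | seq p q => cost ε p + cost ε q
  | ifLE _ _ p q => 1 + max (cost ε p) (cost ε q)
  | _ => 1

/-- The registers to which a structured program may write. -/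
def Writes : Code n r α R → R → Prop
  | skip, _ => False
  | const dst _, x => x = dst
  | copy dst _, x => x = dst
  | load dst _, x => x = dst
  | add dst _ _, x => x = dst
  | sub dst _ _, x => x = dst
  | mul dst _ _, x => x = dst
  | div dst _ _, x => x = dst
  | svd _ dst, x => ∃ p, dst p = x
  | seq p q, x => Writes p x ∨ Writes q x
  | ifLE _ _ p q, x => Writes p x ∨ Writes q x

/-- Translation to programs with numbered registers, followed by a continuation. -/
def compile {s : ℕ} (e : R ≃ Fin s) : Code n r α R → Prog n r α s → Prog n r α s
  | skip, k => k
  | const dst c, k => .seq (.const (e dst) c) k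
  | copy dst a, k => .seq (.copy (e dst) (e a)) k
  | load dst i, k => .seq (.load (e dst) i) k
  | add dst a b, k => .seq (.add (e dst) (e a) (e b)) k
  | sub dst a b, k => .seq (.sub (e dst) (e a) (e b)) k
  | mul dst a b, k => .seq (.mul (e dst) (e a) (e b)) k
  | div dst a b, k => .seq (.div (e dst) (e a) (e b)) k
  | svd src dst, k => .seq (.svd (fun i j => e (src i j)) (dst.trans e.toEmbedding)) k
  | seq p q, k => compile e p (compile e q k)
  | ifLE a b p q, k => .branch (e a) (e b) (compile e p k) (compile e q k)

variable (f : Matrix (Fin n) (Fin α) ℝ → Matrix (Fin n) (Fin r) ℝ) (ε : ℝ) (y : Fin n → ℝ)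

lemma time_le_cost (c : Code n r α R) (m : R → ℝ) : c.time f ε y m ≤ c.cost ε := by
  induction c generalizing m with
  | seq p q hp hq => exact add_le_add (hp _) (hq _)
  | ifLE a b p q hp hq =>
    simp only [time, cost]
    have h1 := hp m
    have h2 := hq m
    split_ifs <;> omega
  | _ => exact le_rfl

lemma eval_of_not_writes {c : Code n r α R} {x : R} (h : ¬ c.Writes x) (m : R → ℝ) :
    c.eval f y m x = m x := by
  classical
  induction c generalizing m with
  | skip => rfl
  | seq p q hp hq =>
    simp only [Writes, not_or] at h
    simp only [eval]
    rw [hq h.2, hp h.1]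
  | ifLE a b p q hp hq =>
    simp only [Writes, not_or] at h
    simp only [eval]
    split_ifs
    · exact hp h.1 m
    · exact hq h.2 m
  | svd src dst =>
    simp only [Writes] at h
    simp only [eval]
    rw [Function.extend_apply' _ _ _ h]
  | _ => exact Function.update_of_ne h _ _

lemma update_comp_symm {s : ℕ} [DecidableEq R] (e : R ≃ Fin s) (m : R → ℝ) (x : R) (v : ℝ) :
    Function.update (m ∘ e.symm) (e x) v = Function.update m x v ∘ e.symm := by
  rw [Function.update_comp_equiv, Equiv.symm_symm]

lemma extend_comp_symm {s : ℕ} {ι : Type*} (e : R ≃ Fin s) (m : R → ℝ) (dst : ι ↪ R) (g : ι → ℝ) :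
    Function.extend (dst.trans e.toEmbedding) g (m ∘ e.symm) = Function.extend dst g m ∘ e.symm := by
  funext x
  obtain ⟨x, rfl⟩ := e.surjective x
  simp only [Function.comp_apply, Equiv.symm_apply_apply]
  by_cases h : ∃ p, dst p = x
  · obtain ⟨p, rfl⟩ := h
    rw [dst.injective.extend_apply]
    exact (dst.trans e.toEmbedding).injective.extend_apply g _ p
  · rw [Function.extend_apply' _ _ _ h, Function.extend_apply']
    · simp
    · rintro ⟨p, hp⟩
      exact h ⟨p, e.injective hp⟩

/-- Compilation passes a continuation, which is duplicated into both arms of a branch. This enlarges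
the program tree but not the number of executed steps, so the times add up exactly. -/
theorem exec_compile {s : ℕ} (e : R ≃ Fin s) (c : Code n r α R) (k : Prog n r α s) (m : R → ℝ) :
    (c.compile e k).exec f ε y (m ∘ e.symm) =
      ((k.exec f ε y (c.eval f y m ∘ e.symm)).1,
        c.time f ε y m + (k.exec f ε y (c.eval f y m ∘ e.symm)).2) := by
  classical
  induction c generalizing k m with
  | skip => simp [compile, eval, time]
  | seq p q hp hq =>
    simp only [compile, eval, time]
    rw [hp, hq]
    simp only [add_assoc]
  | ifLE a b p q hp hq =>
    simp only [compile, eval, time, Prog.exec, Function.comp_apply, Equiv.symm_apply_apply]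
    split_ifs
    · rw [hp]; simp only [add_assoc]
    · rw [hq]; simp only [add_assoc]
  | svd src dst =>
    simp only [compile, eval, time, Prog.exec, Instr.exec, Instr.cost, extend_comp_symm,
      Function.comp_apply, Equiv.symm_apply_apply]
  | _ =>
    simp only [compile, eval, time, Prog.exec, Instr.exec, Instr.cost, Function.comp_apply,
      Equiv.symm_apply_apply]
    rw [← update_comp_symm]

/-- Sequential execution over a list. -/
def forList {ι : Type} (body : ι → Code n r α R) : List ι → Code n r α R
  | [] => skip
  | a :: l => seq (body a) (forList body l)

/-- Sequential execution over a finite set. -/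
def forEach {ι : Type} (s : Finset ι) (body : ι → Code n r α R) : Code n r α R :=
  forList body s.toList

variable {f y ε} {ι κ : Type}

lemma writes_forList {body : ι → Code n r α R} {l : List ι} {x : R} :
    (forList body l).Writes x ↔ ∃ a ∈ l, (body a).Writes x := by
  induction l with
  | nil => simp [forList, Writes]
  | cons a l ih => simp [forList, Writes, ih]

@[simp]
lemma writes_forEach {body : ι → Code n r α R} {s : Finset ι} {x : R} :
    (forEach s body).Writes x ↔ ∃ a ∈ s, (body a).Writes x := by
  simp [forEach, writes_forList]

lemma cost_forEach_le {body : ι → Code n r α R} {s : Finset ι} {c : ℕ}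
    (h : ∀ a ∈ s, (body a).cost ε ≤ c) : (forEach s body).cost ε ≤ s.card * c := by
  have key : ∀ l : List ι, (∀ a ∈ l, (body a).cost ε ≤ c) → (forList body l).cost ε ≤ l.length * c := by
    intro l
    induction l with
    | nil => simp [forList, cost]
    | cons a l ih =>
      intro h
      have h1 := h a (by simp)
      have h2 := ih fun b hb => h b (by simp [hb])
      simp only [forList, cost, List.length_cons, Nat.add_mul, Nat.one_mul]
      omega
  have := key s.toList fun a ha => h a (Finset.mem_toList.mp ha)
  rwa [Finset.length_toList] at this

/-- The order in which a finite set is enumerated is unspecified, so the loop invariant is indexed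
by the set of indices already processed. -/
lemma eval_forEach_induction [DecidableEq ι] {body : ι → Code n r α R} {s : Finset ι}
    {p : Finset ι → (R → ℝ) → Prop}
    (hstep : ∀ a ∈ s, ∀ A ⊆ s, a ∉ A → ∀ m, p A m → p (insert a A) ((body a).eval f y m))
    {m : R → ℝ} (h0 : p ∅ m) : p s ((forEach s body).eval f y m) := by
  have key : ∀ (l : List ι) (A : Finset ι), l.Nodup → (∀ a ∈ l, a ∈ s ∧ a ∉ A) → A ⊆ s → ∀ m, p A m →
      p (A ∪ l.toFinset) ((forList body l).eval f y m) := by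
    intro l
    induction l with
    | nil => intro A _ _ _ m hm; simpa [forList, eval] using hm
    | cons a l ih =>
      intro A hnd hl hA m hm
      rw [List.nodup_cons] at hnd
      have h1 := hstep a (hl a (by simp)).1 A hA (hl a (by simp)).2 m hm
      have h2 := ih (insert a A) hnd.2 (fun b hb => ⟨(hl b (by simp [hb])).1, by
        rw [Finset.mem_insert, not_or]
        exact ⟨fun h => hnd.1 (h ▸ hb), (hl b (by simp [hb])).2⟩⟩)
        (Finset.insert_subset (hl a (by simp)).1 hA) _ h1
      rw [List.toFinset_cons, Finset.union_insert, ← Finset.insert_union]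
      exact h2
  have := key s.toList ∅ s.nodup_toList (fun a ha => ⟨Finset.mem_toList.mp ha, by simp⟩)
    (Finset.empty_subset _) m h0
  simpa [forEach] using this

/-- A loop that sets one register per round, from registers that the other rounds leave alone. -/
lemma eval_forEach_apply {body : ι → Code n r α R} {s : Finset ι} {dst : ι → R}
    {val : ι → (R → ℝ) → ℝ} {scratch : R → Prop}
    (hval : ∀ a m, (body a).eval f y m (dst a) = val a m)
    (hw : ∀ a x, (body a).Writes x → x = dst a ∨ scratch x)
    (hdep : ∀ a m m', (∀ x, ¬ scratch x → (∀ b, b ≠ a → x ≠ dst b) → m x = m' x) →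
      val a m = val a m')
    (hinj : Function.Injective dst) (hds : ∀ a, ¬ scratch (dst a)) (m : R → ℝ) {a : ι} (ha : a ∈ s) :
    (forEach s body).eval f y m (dst a) = val a m := by
  classical
  let p : Finset ι → (R → ℝ) → Prop := fun A m' => (∀ a ∈ A, m' (dst a) = val a m) ∧
    ∀ x, ¬ scratch x → (∀ a ∈ A, x ≠ dst a) → m' x = m x
  have hp : p s ((forEach s body).eval f y m) := by
    refine eval_forEach_induction ?_ ⟨by simp, fun _ _ _ => rfl⟩
    rintro b hb A hA hbA m' ⟨h1, h2⟩
    refine ⟨fun c hc => ?_, fun x hx hxA => ?_⟩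
    · rcases Finset.mem_insert.mp hc with rfl | hc
      · rw [hval]
        refine hdep _ _ _ fun x hx hx' => h2 x hx fun d hd => hx' d ?_
        rintro rfl
        exact hbA hd
      · rw [eval_of_not_writes, h1 c hc]
        intro hwc
        rcases hw _ _ hwc with h3 | h3
        · exact hbA (hinj h3 ▸ hc)
        · exact hds _ h3
    · rw [eval_of_not_writes, h2 x hx fun d hd => hxA d (Finset.mem_insert_of_mem hd)]
      intro hwc
      rcases hw _ _ hwc with h3 | h3
      · exact hxA b (Finset.mem_insert_self _ _) h3
      · exact hx h3
  exact hp.1 a ha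

/-- Dot product of two families of registers. -/
def dot (dst tmp : R) (s : Finset κ) (u v : κ → R) : Code n r α R :=
  seq (const dst 0) (forEach s fun b => seq (mul tmp (u b) (v b)) (add dst dst tmp))

lemma writes_dot {dst tmp : R} {s : Finset κ} {u v : κ → R} {x : R} :
    (dot (n := n) (r := r) (α := α) dst tmp s u v).Writes x → x = dst ∨ x = tmp := by
  simp only [dot, Writes, writes_forEach]
  rintro (h | ⟨_, _, h | h⟩)
  exacts [Or.inl h, Or.inr h, Or.inl h]

lemma cost_dot_le (dst tmp : R) (s : Finset κ) (u v : κ → R) :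
    (dot (n := n) (r := r) (α := α) dst tmp s u v).cost ε ≤ 1 + 2 * s.card := by
  simp only [dot, cost]
  have := cost_forEach_le (n := n) (r := r) (α := α) (ε := ε) (s := s) (c := 2)
    (body := fun b => seq (mul tmp (u b) (v b)) (add dst dst tmp)) fun a _ => by simp [cost]
  omega

lemma eval_dot {dst tmp : R} {s : Finset κ} {u v : κ → R} (hdt : dst ≠ tmp)
    (hu : ∀ b, u b ≠ dst ∧ u b ≠ tmp) (hv : ∀ b, v b ≠ dst ∧ v b ≠ tmp) (m : R → ℝ) :
    (dot dst tmp s u v).eval f y m dst = ∑ b ∈ s, m (u b) * m (v b) := by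
  classical
  let p : Finset κ → (R → ℝ) → Prop := fun A m' => m' dst = ∑ b ∈ A, m (u b) * m (v b) ∧
    ∀ x, x ≠ dst → x ≠ tmp → m' x = m x
  have hp : p s ((dot dst tmp s u v).eval f y m) := by
    simp only [dot, eval]
    refine eval_forEach_induction ?_ ⟨by simp, fun x hx _ => Function.update_of_ne hx _ _⟩
    rintro b hb A hA hbA m' ⟨h1, h2⟩
    refine ⟨?_, fun x hx hx' => ?_⟩
    · simp only [eval, Function.update_self, Function.update_of_ne hdt]
      rw [h1, h2 _ (hu b).1 (hu b).2, h2 _ (hv b).1 (hv b).2, Finset.sum_insert hbA, add_comm]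
    · simp only [eval, Function.update_of_ne hx, Function.update_of_ne hx']
      exact h2 x hx hx'
  exact hp.1

/-- A family of dot products. -/
def dots (s : Finset ι) (dst : ι → R) (tmp : R) (t : Finset κ) (u v : ι → κ → R) : Code n r α R :=
  forEach s fun a => dot (dst a) tmp t (u a) (v a)

lemma writes_dots {s : Finset ι} {dst : ι → R} {tmp : R} {t : Finset κ} {u v : ι → κ → R} {x : R} :
    (dots (n := n) (r := r) (α := α) s dst tmp t u v).Writes x → (∃ a, x = dst a) ∨ x = tmp := by
  simp only [dots, writes_forEach]
  rintro ⟨a, -, h⟩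
  rcases writes_dot h with h | h
  exacts [Or.inl ⟨a, h⟩, Or.inr h]

lemma cost_dots_le (s : Finset ι) (dst : ι → R) (tmp : R) (t : Finset κ) (u v : ι → κ → R) :
    (dots (n := n) (r := r) (α := α) s dst tmp t u v).cost ε ≤ s.card * (1 + 2 * t.card) :=
  cost_forEach_le fun _ _ => cost_dot_le _ _ _ _ _

lemma eval_dots {s : Finset ι} {dst : ι → R} {tmp : R} {t : Finset κ} {u v : ι → κ → R}
    (hinj : Function.Injective dst) (hdt : ∀ a, dst a ≠ tmp)
    (hu : ∀ a b, (∀ c, u a b ≠ dst c) ∧ u a b ≠ tmp) (hv : ∀ a b, (∀ c, v a b ≠ dst c) ∧ v a b ≠ tmp)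
    (m : R → ℝ) {a : ι} (ha : a ∈ s) :
    (dots s dst tmp t u v).eval f y m (dst a) = ∑ b ∈ t, m (u a b) * m (v a b) := by
  refine eval_forEach_apply (dst := dst) (val := fun a m => ∑ b ∈ t, m (u a b) * m (v a b))
    (scratch := fun x => x = tmp) (fun a m => ?_) (fun a x h => ?_) (fun a m m' h => ?_) hinj hdt m ha
  · exact eval_dot (hdt a) (fun b => ⟨(hu a b).1 a, (hu a b).2⟩)
      (fun b => ⟨(hv a b).1 a, (hv a b).2⟩) m
  · exact writes_dot h
  · refine Finset.sum_congr rfl fun b _ => ?_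
    rw [h _ (hu a b).2 fun c _ => (hu a b).1 c, h _ (hv a b).2 fun c _ => (hv a b).1 c]

end Code

end CodeLanguage

end NORST

end


section

namespace NORST

open scoped Matrix.Norms.L2Operator

/-! ### Reduction of least squares to an r × r system. -/

section RowGram

variable {n r : ℕ}

/-- The `r × r` counterpart of the least squares matrix. -/
def rowGram (Q : Matrix (Fin n) (Fin r) ℝ) (A : Finset (Fin n)) : Matrix (Fin r) (Fin r) ℝ :=
  1 - ∑ i ∈ A, vecMulVec (Q i) (Q i)

lemma rowGram_insert (Q : Matrix (Fin n) (Fin r) ℝ) {A : Finset (Fin n)} {i : Fin n} (hi : i ∉ A) :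
    rowGram Q (insert i A) = rowGram Q A - vecMulVec (Q i) (Q i) := by
  rw [rowGram, rowGram, Finset.sum_insert hi]; abel

lemma rowGram_quadratic (Q : Matrix (Fin n) (Fin r) ℝ) (A : Finset (Fin n)) (x : Fin r → ℝ) :
    x ⬝ᵥ rowGram Q A *ᵥ x = x ⬝ᵥ x - ∑ i ∈ A, (Q i ⬝ᵥ x) ^ 2 := by
  rw [rowGram, Matrix.sub_mulVec, Matrix.one_mulVec, dotProduct_sub, Matrix.sum_mulVec,
    dotProduct_sum]
  congr 1
  refine Finset.sum_congr rfl fun i _ => ?_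
  rw [vecMulVec_mulVec', dotProduct_smul, smul_eq_mul, dotProduct_comm x, pow_two]

lemma rowGram_transpose (Q : Matrix (Fin n) (Fin r) ℝ) (A : Finset (Fin n)) :
    (rowGram Q A)ᵀ = rowGram Q A := by
  rw [rowGram, Matrix.transpose_sub, Matrix.transpose_one, Matrix.transpose_sum]
  congr 1
  exact Finset.sum_congr rfl fun i _ => Matrix.transpose_vecMulVec _ _

lemma IsEstimate.rowGram_quadratic_nonneg {Q : Matrix (Fin n) (Fin r) ℝ} (hQ : IsEstimate Q)
    (A : Finset (Fin n)) (x : Fin r → ℝ) : 0 ≤ x ⬝ᵥ rowGram Q A *ᵥ x := by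
  rw [rowGram_quadratic, sub_nonneg]
  have h1 : ∑ i ∈ A, (Q i ⬝ᵥ x) ^ 2 ≤ l2norm (Q *ᵥ x) ^ 2 := by
    rw [l2norm_sq, dotProduct]
    simp only [← pow_two]
    exact Finset.sum_le_sum_of_subset_of_nonneg (Finset.subset_univ _) fun i _ _ => sq_nonneg _
  have h2 : l2norm (Q *ᵥ x) ≤ l2norm x :=
    (l2norm_mulVec_le Q x).trans (mul_le_of_le_one_left (l2norm_nonneg _) hQ.norm_le)
  rw [← l2norm_sq]
  exact h1.trans (pow_le_pow_left₀ (l2norm_nonneg _) h2 2)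

/-- The Sherman-Morrison update of an inverse. -/
lemma rowGram_insert_mul {Q : Matrix (Fin n) (Fin r) ℝ} {A : Finset (Fin n)} {i : Fin n}
    (hi : i ∉ A) {W : Matrix (Fin r) (Fin r) ℝ} (hW : rowGram Q A * W = 1) (hWt : Wᵀ = W)
    {z : Fin r → ℝ} (hz : z = W *ᵥ Q i) {p : ℝ} (hp : p = 1 - Q i ⬝ᵥ z) (hp0 : p ≠ 0) :
    rowGram Q (insert i A) * (W + p⁻¹ • vecMulVec z z) = 1 := by
  have h1 : rowGram Q A *ᵥ z = Q i := by rw [hz, Matrix.mulVec_mulVec, hW, Matrix.one_mulVec]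
  have h2 : vecMulVec (Q i) (Q i) * W = vecMulVec (Q i) z := by
    rw [Matrix.vecMulVec_mul, hz, ← Matrix.mulVec_transpose, hWt]
  have h3 : vecMulVec (Q i) (Q i) * vecMulVec z z = (1 - p) • vecMulVec (Q i) z := by
    rw [Matrix.vecMulVec_mul_vecMulVec, hp, sub_sub_cancel]
    ext a b
    simp [vecMulVec_apply]
    try ring
  have h4 : rowGram Q A * vecMulVec z z = vecMulVec (Q i) z := by
    rw [Matrix.mul_vecMulVec, h1]
  rw [rowGram_insert Q hi, Matrix.sub_mul, Matrix.mul_add, Matrix.mul_add, Matrix.mul_smul,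
    Matrix.mul_smul, hW, h2, h3, h4, smul_smul]
  have h5 : p⁻¹ * (1 - p) = p⁻¹ - 1 := by field_simp
  rw [h5, sub_smul, one_smul]
  abel

/-- At z the form of the enlarged matrix is (1 - p) p ≤ 0, and enlarging the set further can only
decrease it. Since these matrices are positive semidefinite, z lies in the kernel. A nonpositive
pivot therefore certifies that the final system is singular. -/
lemma IsEstimate.det_rowGram_eq_zero {Q : Matrix (Fin n) (Fin r) ℝ} (hQ : IsEstimate Q)
    {A B : Finset (Fin n)} {i : Fin n} (hi : i ∉ A) (hB : insert i A ⊆ B)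
    {W : Matrix (Fin r) (Fin r) ℝ} (hW : rowGram Q A * W = 1) {z : Fin r → ℝ} (hz : z = W *ᵥ Q i)
    {p : ℝ} (hp : p = 1 - Q i ⬝ᵥ z) (hp0 : p ≤ 0) : (rowGram Q B).det = 0 := by
  have h1 : rowGram Q A *ᵥ z = Q i := by rw [hz, Matrix.mulVec_mulVec, hW, Matrix.one_mulVec]
  have hz0 : z ≠ 0 := by
    rintro rfl
    rw [dotProduct_zero] at hp
    linarith
  have h2 : z ⬝ᵥ rowGram Q B *ᵥ z ≤ 0 := by
    have h3 : z ⬝ᵥ rowGram Q B *ᵥ z ≤ z ⬝ᵥ rowGram Q (insert i A) *ᵥ z := by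
      rw [rowGram_quadratic, rowGram_quadratic]
      exact sub_le_sub_left (Finset.sum_le_sum_of_subset_of_nonneg hB fun _ _ _ => sq_nonneg _) _
    have h4 : z ⬝ᵥ rowGram Q (insert i A) *ᵥ z = (1 - p) * p := by
      rw [rowGram_insert Q hi, Matrix.sub_mulVec, h1, vecMulVec_mulVec', dotProduct_sub,
        dotProduct_smul, smul_eq_mul, dotProduct_comm z, hp]
      ring
    rw [h4] at h3
    exact h3.trans (mul_nonpos_of_nonneg_of_nonpos (by linarith) hp0)
  have hpsd : (rowGram Q B).PosSemidef := by
    refine Matrix.PosSemidef.of_dotProduct_mulVec_nonneg ?_ fun x => ?_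
    · rw [Matrix.IsHermitian, Matrix.conjTranspose_eq_transpose_of_trivial, rowGram_transpose]
    · simpa using hQ.rowGram_quadratic_nonneg B x
  have h5 : z ⬝ᵥ rowGram Q B *ᵥ z = 0 := le_antisymm h2 (hQ.rowGram_quadratic_nonneg B z)
  have h6 := (hpsd.dotProduct_mulVec_zero_iff z).mp (by simpa using h5)
  exact Matrix.exists_mulVec_eq_zero_iff.mp ⟨z, hz0, h6⟩

/-- The rows of `Q` in `T`. -/
def rowsOn (Q : Matrix (Fin n) (Fin r) ℝ) (T : Finset (Fin n)) : Matrix {i // i ∈ T} (Fin r) ℝ :=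
  Q.submatrix Subtype.val id

lemma selCols_transpose_mul (Q : Matrix (Fin n) (Fin r) ℝ) (T : Finset (Fin n)) :
    (selCols T)ᵀ * Q = rowsOn Q T := by
  ext i a
  simp [selCols, rowsOn, Matrix.mul_apply, Matrix.one_apply]

lemma rowGram_eq (Q : Matrix (Fin n) (Fin r) ℝ) (T : Finset (Fin n)) :
    rowGram Q T = 1 - (rowsOn Q T)ᵀ * rowsOn Q T := by
  rw [rowGram]
  congr 1
  ext a b
  rw [Matrix.sum_apply, Matrix.mul_apply]
  simp only [vecMulVec_apply, rowsOn, Matrix.transpose_apply, Matrix.submatrix_apply, id]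
  rw [Finset.sum_coe_sort T (fun i => Q i a * Q i b)]

lemma IsEstimate.lsGram_eq {Q : Matrix (Fin n) (Fin r) ℝ} (hQ : IsEstimate Q) (T : Finset (Fin n)) :
    lsGram Q T = 1 - rowsOn Q T * (rowsOn Q T)ᵀ := by
  rw [← hQ.psiCols_transpose_mul_selCols, psiCols_eq, Matrix.transpose_mul, perp_transpose, perp,
    Matrix.mul_sub, Matrix.sub_mul, Matrix.mul_one, selCols_transpose_mul_self,
    ← selCols_transpose_mul, Matrix.transpose_mul, Matrix.transpose_transpose]
  simp only [Matrix.mul_assoc]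

/-- With R the rows of Q in T, the matrices 1 - RRᵀ and 1 - RᵀR have the same determinant, so both
systems are singular together. -/
lemma IsEstimate.det_lsGram {Q : Matrix (Fin n) (Fin r) ℝ} (hQ : IsEstimate Q)
    (T : Finset (Fin n)) : (lsGram Q T).det = (rowGram Q T).det := by
  rw [hQ.lsGram_eq, rowGram_eq, Matrix.det_one_sub_mul_comm]

lemma projLS_of_notMem (Q : Matrix (Fin n) (Fin r) ℝ) {T : Finset (Fin n)} (y : Fin n → ℝ)
    {i : Fin n} (hi : i ∉ T) : projLS Q T y i = y i := by
  rw [projLS, dif_neg hi, sub_zero]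

/-- The inverse of a singular matrix is 0 by convention, so the algorithm returns the observation
unchanged; the machine has to reproduce this case too. -/
lemma IsEstimate.projLS_of_det_eq_zero {Q : Matrix (Fin n) (Fin r) ℝ} (hQ : IsEstimate Q)
    {T : Finset (Fin n)} (h : (rowGram Q T).det = 0) (y : Fin n → ℝ) : projLS Q T y = y := by
  have h1 : (lsGram Q T)⁻¹ = 0 :=
    Matrix.nonsing_inv_apply_not_isUnit _ (by rw [hQ.det_lsGram, h]; exact not_isUnit_zero)
  ext i
  simp [projLS, h1]

/-- The least squares estimate of the missing entries through the `r × r` system. -/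
lemma IsEstimate.projLS_of_mul_eq_one {Q : Matrix (Fin n) (Fin r) ℝ} (hQ : IsEstimate Q)
    {T : Finset (Fin n)} {W : Matrix (Fin r) (Fin r) ℝ} (hW : rowGram Q T * W = 1) (y : Fin n → ℝ)
    {i : Fin n} (hi : i ∈ T) :
    projLS Q T y i = Q i ⬝ᵥ (W *ᵥ fun a => ∑ i ∈ Tᶜ, Q i a * y i) := by
  set d : Fin r → ℝ := fun a => ∑ i ∈ Tᶜ, Q i a * y i with hd
  set yT : {i // i ∈ T} → ℝ := fun i => y i with hyT
  have hunit : IsUnit (lsGram Q T).det := by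
    rw [hQ.det_lsGram]
    have h1 := congrArg Matrix.det hW
    rw [Matrix.det_mul, Matrix.det_one] at h1
    exact IsUnit.of_mul_eq_one _ h1
  have hQy : Qᵀ *ᵥ y = (rowsOn Q T)ᵀ *ᵥ yT + d := by
    ext a
    simp only [Matrix.mulVec, dotProduct, Matrix.transpose_apply, Pi.add_apply, rowsOn,
      Matrix.submatrix_apply, id, hyT, hd]
    rw [Finset.sum_coe_sort T (fun i => Q i a * y i), Finset.sum_add_sum_compl]
  have hrhs : (psiCols Q T)ᵀ *ᵥ (perp Q *ᵥ y) = yT - rowsOn Q T *ᵥ (Qᵀ *ᵥ y) := by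
    rw [Matrix.mulVec_mulVec, hQ.psiCols_transpose_mul_perp, psiCols_eq, Matrix.transpose_mul,
      perp_transpose, perp, Matrix.mul_sub, Matrix.mul_one, Matrix.sub_mulVec, ← Matrix.mul_assoc,
      selCols_transpose_mul, ← Matrix.mulVec_mulVec, selCols_transpose_mulVec]
  -- The push-through identity (1 - RRᵀ) R = R (1 - RᵀR) carries the solution of the small system
  -- over to the large one.
  have hsol : lsGram Q T *ᵥ (yT - rowsOn Q T *ᵥ (W *ᵥ d)) = yT - rowsOn Q T *ᵥ (Qᵀ *ᵥ y) := by
    have h1 : lsGram Q T * rowsOn Q T = rowsOn Q T * rowGram Q T := by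
      rw [hQ.lsGram_eq, rowGram_eq, Matrix.sub_mul, Matrix.mul_sub, Matrix.one_mul, Matrix.mul_one,
        Matrix.mul_assoc]
    have h2 : lsGram Q T *ᵥ (rowsOn Q T *ᵥ (W *ᵥ d)) = rowsOn Q T *ᵥ d := by
      rw [Matrix.mulVec_mulVec, h1, ← Matrix.mulVec_mulVec, Matrix.mulVec_mulVec _ (rowGram Q T), hW,
        Matrix.one_mulVec]
    rw [Matrix.mulVec_sub, h2, hQ.lsGram_eq, Matrix.sub_mulVec, Matrix.one_mulVec,
      ← Matrix.mulVec_mulVec, hQy, Matrix.mulVec_add]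
    abel
  have hinv : (lsGram Q T)⁻¹ *ᵥ ((psiCols Q T)ᵀ *ᵥ (perp Q *ᵥ y)) =
      yT - rowsOn Q T *ᵥ (W *ᵥ d) := by
    rw [hrhs, ← hsol, Matrix.mulVec_mulVec, Matrix.nonsing_inv_mul _ hunit, Matrix.one_mulVec]
  rw [projLS, dif_pos hi, hinv, Pi.sub_apply, hyT, sub_sub_cancel]
  rfl

end RowGram

/-! ### Reading the largest eigenvalue off a singular value decomposition. -/

section TopSingular

variable {n r m : ℕ}

/-- The largest eigenvalue of the Gram matrix is attained at the first left singular vector. -/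
lemma IsTopLeftSingular.lamMaxGram_eq [NeZero n] [NeZero r] {B : Matrix (Fin n) (Fin m) ℝ}
    {U : Matrix (Fin n) (Fin r) ℝ} (hU : IsTopLeftSingular B U) :
    lamMaxGram B = l2norm (Bᵀ *ᵥ fun i => U i 0) ^ 2 := by
  obtain ⟨hUU, σ, hσ0, hanti, hσ, hstr⟩ := hU
  have hUE : IsEstimate U := Or.inl hUU
  set e : Fin r → ℝ := Pi.single 0 1 with he
  have hcol : (fun i => U i 0) = U *ᵥ e := by
    ext i; simp [he]
  have hgram : ∀ v : Fin n → ℝ, l2norm (Bᵀ *ᵥ v) ^ 2 = v ⬝ᵥ (B * Bᵀ) *ᵥ v := fun v => by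
    rw [l2norm_sq, dotProduct_mulVec_mulVec, Matrix.transpose_transpose, Matrix.mulVec_mulVec,
      dotProduct_comm]
  have hsym : ∀ v w : Fin n → ℝ, v ⬝ᵥ (B * Bᵀ) *ᵥ w = w ⬝ᵥ (B * Bᵀ) *ᵥ v := fun v w => by
    rw [dotProduct_mulVec_mulVec, Matrix.transpose_mul, Matrix.transpose_transpose, dotProduct_comm]
  have hUx : ∀ x : Fin r → ℝ, (B * Bᵀ) *ᵥ (U *ᵥ x) = U *ᵥ (fun k => σ k ^ 2 * x k) := fun x => by
    rw [Matrix.mulVec_mulVec, hσ, ← Matrix.mulVec_mulVec]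
    congr 1
    ext k
    rw [Matrix.mulVec_diagonal]
  have hnorm : l2norm (U *ᵥ e) = 1 := by
    rw [IsBasisMatrix.l2norm_mulVec hUU]
    have : l2norm e ^ 2 = 1 := by rw [l2norm_sq]; simp [he]
    exact (pow_eq_one_iff_of_nonneg (l2norm_nonneg _) two_ne_zero).mp this
  have hval : l2norm (Bᵀ *ᵥ (U *ᵥ e)) ^ 2 = σ 0 ^ 2 := by
    rw [hgram, hUx, dotProduct_comm, dotProduct_mulVec_mulVec, ← dotProduct_mulVec_mulVec]
    rw [dotProduct_comm, dotProduct_mulVec_mulVec, Matrix.mulVec_mulVec, hUU, Matrix.one_mulVec]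
    simp [he]
  rw [hcol, hval, lamMaxGram_eq_norm_sq]
  -- A vector is split along U and its complement. The Gram form has no cross term, and each part is
  -- stretched by at most σ 0, the largest value since σ is decreasing.
  have hle : ‖Bᵀ‖ ≤ σ 0 := by
    refine norm_le_of_l2norm_mulVec_le (hσ0 0) fun v => ?_
    refine le_of_sq_le_sq_of_nonneg ?_ (mul_nonneg (hσ0 0) (l2norm_nonneg _))
    set x := Uᵀ *ᵥ v with hx
    set w := perp U *ᵥ v with hw
    have hv : v = U *ᵥ x + w := by
      rw [hw, perp, Matrix.sub_mulVec, Matrix.one_mulVec, hx, Matrix.mulVec_mulVec]; abel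
    have hUw : Uᵀ *ᵥ w = 0 := by
      have := hUE.perp_mul
      have h2 := congrArg Matrix.transpose this
      rw [Matrix.transpose_mul, perp_transpose, Matrix.transpose_zero] at h2
      rw [hw, Matrix.mulVec_mulVec, h2, Matrix.zero_mulVec]
    have hpyth := hUE.l2norm_perp_sq v
    rw [← hw, ← hx] at hpyth
    have h1 : v ⬝ᵥ (B * Bᵀ) *ᵥ (U *ᵥ x) = ∑ k, σ k ^ 2 * x k * x k := by
      rw [hUx, dotProduct_mulVec_mulVec, ← hx, dotProduct]
      exact Finset.sum_congr rfl fun k _ => by ring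
    have h2 : v ⬝ᵥ (B * Bᵀ) *ᵥ w = l2norm (Bᵀ *ᵥ w) ^ 2 := by
      rw [hgram, hsym v w]
      conv_lhs => rw [hv]
      rw [Matrix.mulVec_add, dotProduct_add, hUx, dotProduct_mulVec_mulVec, hUw, zero_dotProduct,
        zero_add]
    have h3 : ∑ k, σ k ^ 2 * x k * x k ≤ σ 0 ^ 2 * l2norm x ^ 2 := by
      rw [l2norm_sq, dotProduct, Finset.mul_sum]
      refine Finset.sum_le_sum fun k _ => ?_
      rw [mul_assoc]
      exact mul_le_mul_of_nonneg_right
        (pow_le_pow_left₀ (hσ0 k) (hanti (Fin.zero_le k)) 2) (mul_self_nonneg _)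
    have h4 : l2norm (Bᵀ *ᵥ w) ^ 2 ≤ σ 0 ^ 2 * l2norm w ^ 2 := by
      rw [← mul_pow]
      exact pow_le_pow_left₀ (l2norm_nonneg _) (hstr w hUw 0) 2
    calc l2norm (Bᵀ *ᵥ v) ^ 2 = v ⬝ᵥ (B * Bᵀ) *ᵥ (U *ᵥ x) + v ⬝ᵥ (B * Bᵀ) *ᵥ w := by
          rw [hgram, ← dotProduct_add, ← Matrix.mulVec_add, ← hv]
      _ ≤ σ 0 ^ 2 * l2norm x ^ 2 + σ 0 ^ 2 * l2norm w ^ 2 := by rw [h1, h2]; exact add_le_add h3 h4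
      _ = (σ 0 * l2norm v) ^ 2 := by rw [hpyth]; ring
  refine le_antisymm ?_ ?_
  · rw [← norm_transpose]
    exact pow_le_pow_left₀ (norm_nonneg _) hle 2
  · rw [← hval, ← norm_transpose]
    have := l2norm_mulVec_le Bᵀ (U *ᵥ e)
    rw [hnorm, mul_one] at this
    exact pow_le_pow_left₀ (l2norm_nonneg _) this 2

end TopSingular

end NORST

end


section

namespace NORST

open scoped Matrix.Norms.L2Operator

/-! ### The program of a frame and its least squares part. -/

section Programs

/-- The registers of the machine. -/
inductive Reg (n r α : ℕ) : Type
  | buf (i : Fin n) (k : Fin α)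
  | res (i : Fin n) (k : Fin α)
  | coef (a : Fin r) (k : Fin α)
  | basis (i : Fin n) (a : Fin r)
  | sing (i : Fin n) (a : Fin r)
  | inv (a b : Fin r)
  | sol (a : Fin r)
  | rhs (a : Fin r)
  | wt (a : Fin r)
  | est (i : Fin n)
  | proj (k : Fin α)
  | tmp
  | ref
  | pivot
  | gain
  | flag
  | next
  | phase
  | upd

open Reg Code

variable {n r α : ℕ}

/-- One Sherman-Morrison update, with a flag for a non-positive pivot. -/
def pivotCode (i : Fin n) : Code n r α (Reg n r α) :=
  seq (dots Finset.univ sol tmp Finset.univ (fun a b => inv a b) (fun _ b => basis i b)) <|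
  seq (dot pivot tmp Finset.univ (fun a => basis i a) sol) <|
  seq (const ref 1) <| seq (Code.sub pivot ref pivot) <| seq (const ref 0) <|
  seq (ifLE pivot ref (const flag 1) skip) <|
  forEach Finset.univ fun p : Fin r × Fin r =>
    seq (Code.mul tmp (sol p.1) (sol p.2)) <| seq (Code.div tmp tmp pivot) <|
    Code.add (inv p.1 p.2) (inv p.1 p.2) tmp

/-- Projected least squares. -/
def lsCode (T : Finset (Fin n)) : Code n r α (Reg n r α) :=
  seq (forEach Finset.univ fun i => load (est i) i) <|
  seq (forEach Finset.univ fun p : Fin r × Fin r =>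
    const (inv p.1 p.2) ((1 : Matrix (Fin r) (Fin r) ℝ) p.1 p.2)) <|
  seq (const flag 0) <|
  seq (forEach T pivotCode) <|
  seq (dots Finset.univ rhs tmp Tᶜ (fun a i => basis i a) (fun _ i => est i)) <|
  seq (dots Finset.univ wt tmp Finset.univ (fun a b => inv a b) (fun _ b => rhs b)) <|
  seq (const ref 0) <|
  ifLE flag ref (dots T est tmp Finset.univ (fun i a => basis i a) (fun _ a => wt a)) skip

/-- Storing the estimate in the next free column of the buffer. -/
def storeCode : List (Fin α) → Code n r α (Reg n r α)
  | [] => skip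
  | k :: l => seq (const ref ((k : ℕ) - 1)) <|
    ifLE next ref (ifLE ref next (forEach Finset.univ fun i => copy (buf i k) (est i)) (storeCode l))
      (storeCode l)

/-- The registers of the subspace estimate. -/
def basisEmb : Fin n × Fin r ↪ Reg n r α :=
  ⟨fun p => basis p.1 p.2, fun p q h => by
    simp only [basis.injEq] at h
    exact Prod.ext h.1 h.2⟩

/-- The registers of the singular vectors used for detection. -/
def singEmb : Fin n × Fin r ↪ Reg n r α :=
  ⟨fun p => sing p.1 p.2, fun p q h => by
    simp only [sing.injEq] at h
    exact Prod.ext h.1 h.2⟩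

/-- Re-estimation of the subspace. -/
def updateCode (K : ℕ) : Code n r α (Reg n r α) :=
  seq (svd buf basisEmb) <|
  seq (const ref 1) <| seq (Code.add upd upd ref) <| seq (const next (-1)) <|
  seq (const ref K) <| ifLE ref upd (const phase 1) skip

/-- The last column of the buffer. -/
def lastCol (α : ℕ) [NeZero α] : Fin α := ⟨α - 1, Nat.sub_lt (NeZero.pos α) one_pos⟩

/-- Return to the update phase, keeping the last estimate as the first column of the buffer. -/
def alarmCode [NeZero α] : Code n r α (Reg n r α) :=
  seq (forEach Finset.univ fun i => copy (buf i 0) (buf i (lastCol α))) <|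
  seq (const next 0) <| seq (const upd 0) <| const phase 0

/-- The energy of the buffer outside the estimated subspace. -/
def gainCode [NeZero r] : Code n r α (Reg n r α) :=
  seq (dots Finset.univ (fun p : Fin r × Fin α => coef p.1 p.2) tmp Finset.univ
    (fun p i => basis i p.1) (fun p i => buf i p.2)) <|
  seq (dots Finset.univ (fun p : Fin n × Fin α => res p.1 p.2) tmp Finset.univ
    (fun p a => basis p.1 a) (fun p a => coef a p.2)) <|
  seq (forEach Finset.univ fun p : Fin n × Fin α =>
    Code.sub (res p.1 p.2) (buf p.1 p.2) (res p.1 p.2)) <|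
  seq (svd res singEmb) <|
  seq (dots Finset.univ proj tmp Finset.univ (fun k i => res i k) (fun _ i => sing i 0)) <|
  dot gain tmp Finset.univ proj proj

/-- The test for a change. -/
def detectCode [NeZero r] [NeZero α] (thr : ℝ) : Code n r α (Reg n r α) :=
  seq gainCode <| seq (const ref thr) <| ifLE ref gain alarmCode (const next (-1))

/-- Processing of a full buffer. -/
def blockCode [NeZero r] [NeZero α] (K : ℕ) (thr : ℝ) : Code n r α (Reg n r α) :=
  seq (const ref 0) <| ifLE phase ref (updateCode K) (detectCode thr)

/-- Projected least squares and storage of the estimate. -/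
def estimateCode (T : Finset (Fin n)) : Code n r α (Reg n r α) :=
  seq (lsCode T) <| seq (storeCode (List.finRange α)) <| seq (const ref 1) <|
  seq (Code.add next next ref) <| const ref (α - 1)

/-- The program of a frame. -/
def frameCode [NeZero r] [NeZero α] (K : ℕ) (thr : ℝ) (T : Finset (Fin n)) :
    Code n r α (Reg n r α) :=
  seq (estimateCode T) <| ifLE ref next (blockCode K thr) skip

variable {f : Matrix (Fin n) (Fin α) ℝ → Matrix (Fin n) (Fin r) ℝ} {y : Fin n → ℝ}

lemma eval_seq (p q : Code n r α (Reg n r α)) (m : Reg n r α → ℝ) :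
    (seq p q).eval f y m = q.eval f y (p.eval f y m) := rfl

lemma eval_ifLE_of_le {a b : Reg n r α} {m : Reg n r α → ℝ} (h : m a ≤ m b)
    (p q : Code n r α (Reg n r α)) : (ifLE a b p q).eval f y m = p.eval f y m := if_pos h

lemma eval_ifLE_of_lt {a b : Reg n r α} {m : Reg n r α → ℝ} (h : m b < m a)
    (p q : Code n r α (Reg n r α)) : (ifLE a b p q).eval f y m = q.eval f y m :=
  if_neg (not_le.mpr h)

/-- The flag is only ever raised. The update of the inverse is described even for a bad pivot, when
the numbers have lost their meaning. -/
lemma eval_pivotCode (i : Fin n) (m : Reg n r α → ℝ) {W : Matrix (Fin r) (Fin r) ℝ}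
    (hW : ∀ a b, m (inv a b) = W a b) {q : Fin r → ℝ} (hq : ∀ a, m (basis i a) = q a)
    {z : Fin r → ℝ} (hz : z = W *ᵥ q) {p : ℝ} (hp : p = 1 - q ⬝ᵥ z) :
    (∀ a b, (pivotCode i).eval f y m (inv a b) = (W + p⁻¹ • vecMulVec z z) a b) ∧
      (pivotCode i).eval f y m flag = if p ≤ 0 then 1 else m flag := by
  classical
  simp only [pivotCode, eval_seq]
  set m1 := (dots Finset.univ sol tmp Finset.univ (fun a b => inv a b)
    (fun _ b => basis i b)).eval f y m with hm1
  have h1 : ∀ a, m1 (sol a) = z a := fun a => by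
    rw [hm1, eval_dots (fun a b h => by simpa using h) (by simp) (by simp) (by simp) m
      (Finset.mem_univ a), hz]
    simp only [hW, hq]
    rfl
  have h1' : ∀ x, (∀ a, x ≠ sol a) → x ≠ tmp → m1 x = m x := fun x hx hx' =>
    eval_of_not_writes f y (fun h => (writes_dots h).elim (fun ⟨a, h⟩ => hx a h) hx') m
  set m2 := (dot pivot tmp Finset.univ (fun a => basis i a) sol).eval f y m1 with hm2
  have h2 : m2 pivot = q ⬝ᵥ z := by
    rw [hm2, eval_dot (by simp) (by simp) (by simp)]
    simp only [h1]
    exact Finset.sum_congr rfl fun a _ => by rw [h1' _ (by simp) (by simp), hq]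
  have h2' : ∀ x, x ≠ pivot → x ≠ tmp → m2 x = m1 x := fun x hx hx' =>
    eval_of_not_writes f y (fun h => (writes_dot h).elim hx hx') m1
  generalize hm3 : (const (n := n) (r := r) (α := α) ref 0).eval f y
    ((Code.sub pivot ref pivot).eval f y ((const ref 1).eval f y m2)) = m3
  simp only [Code.eval] at hm3
  have h3p : m3 pivot = p := by
    rw [← hm3, hp]
    simp [h2]
  have h3r : m3 ref = 0 := by rw [← hm3]; simp
  have h3' : ∀ x, x ≠ ref → x ≠ pivot → m3 x = m2 x := fun x hx hx' => by
    rw [← hm3]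
    simp [Function.update_of_ne hx, Function.update_of_ne hx']
  generalize hm4 : (ifLE pivot ref (const flag 1) skip).eval f y m3 = m4
  have h4f : m4 flag = if p ≤ 0 then 1 else m flag := by
    rw [← hm4]
    split_ifs with hp0
    · rw [eval_ifLE_of_le (by rw [h3p, h3r]; exact hp0)]
      simp [Code.eval]
    · rw [eval_ifLE_of_lt (by rw [h3p, h3r]; exact not_le.mp hp0), Code.eval, h3' _ (by simp) (by simp), h2' _ (by simp) (by simp), h1' _ (by simp) (by simp)]
  have h4' : ∀ x, x ≠ flag → m4 x = m3 x := fun x hx => by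
    rw [← hm4]
    exact eval_of_not_writes f y (by simpa [Code.Writes] using hx) m3
  refine ⟨fun a b => ?_, ?_⟩
  · have key := eval_forEach_apply (n := n) (r := r) (α := α) (R := Reg n r α) (f := f) (y := y)
      (s := Finset.univ) (body := fun p : Fin r × Fin r =>
        seq (Code.mul tmp (sol p.1) (sol p.2)) <| seq (Code.div tmp tmp pivot) <|
        Code.add (inv p.1 p.2) (inv p.1 p.2) tmp) (dst := fun p => inv p.1 p.2)
      (val := fun p m => m (inv p.1 p.2) + m (sol p.1) * m (sol p.2) / m pivot)
      (scratch := fun x => x = tmp) (fun p m => by simp [Code.eval])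
      (fun p x h => by simp only [Code.Writes] at h; tauto) (fun p m m' h => by
        rw [h _ (by simp) (fun b hb => by simpa [Prod.ext_iff, eq_comm] using hb),
          h (sol p.1) (by simp) (by simp), h (sol p.2) (by simp) (by simp),
          h pivot (by simp) (by simp)])
      (fun p q h => by simpa [Prod.ext_iff] using h) (by simp) m4 (Finset.mem_univ (a, b))
    rw [key]
    simp only [h4' _ (show inv a b ≠ flag by simp), h4' _ (show sol a ≠ flag by simp),
      h4' _ (show sol b ≠ flag by simp), h4' _ (show pivot ≠ flag by simp), h3p,
      h3' _ (show inv a b ≠ ref by simp) (by simp), h3' _ (show sol a ≠ ref by simp) (by simp),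
      h3' _ (show sol b ≠ ref by simp) (by simp), h2' _ (show inv a b ≠ pivot by simp) (by simp),
      h2' _ (show sol a ≠ pivot by simp) (by simp), h2' _ (show sol b ≠ pivot by simp) (by simp),
      h1, h1' _ (show ∀ c, inv a b ≠ sol c by simp) (by simp), hW]
    simp only [Matrix.add_apply, Matrix.smul_apply, vecMulVec_apply, smul_eq_mul]
    ring
  · rw [eval_of_not_writes, h4f]
    simp [Code.Writes]

lemma eval_basis_pivotCode (i j : Fin n) (a : Fin r) (m : Reg n r α → ℝ) :
    (pivotCode j).eval f y m (basis i a) = m (basis i a) := by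
  refine eval_of_not_writes f y ?_ m
  simp [pivotCode, dots, dot, Code.Writes]

/-- Loop invariant: either the flag is down and the registers hold a symmetric inverse for the rows
processed so far, or it is up and the full system is singular. Symmetry is carried along because the
rank-one update needs it. -/
lemma eval_forEach_pivotCode {Q : Matrix (Fin n) (Fin r) ℝ} (hQ : IsEstimate Q)
    (T : Finset (Fin n)) (m : Reg n r α → ℝ) (hm : ∀ i a, m (basis i a) = Q i a)
    (hinv : ∀ a b, m (inv a b) = (1 : Matrix (Fin r) (Fin r) ℝ) a b) (hflag : m flag = 0) :
    (((forEach T pivotCode).eval f y m flag = 0 ∧ ∃ W : Matrix (Fin r) (Fin r) ℝ,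
      (∀ a b, (forEach T pivotCode).eval f y m (inv a b) = W a b) ∧ rowGram Q T * W = 1) ∨
      ((forEach T pivotCode).eval f y m flag = 1 ∧ (rowGram Q T).det = 0)) := by
  classical
  let p : Finset (Fin n) → (Reg n r α → ℝ) → Prop := fun A m =>
    (∀ i a, m (basis i a) = Q i a) ∧
    ((m flag = 0 ∧ ∃ W : Matrix (Fin r) (Fin r) ℝ, (∀ a b, m (inv a b) = W a b) ∧
      rowGram Q A * W = 1 ∧ Wᵀ = W) ∨ (m flag = 1 ∧ (rowGram Q T).det = 0))
  have hp : p T ((forEach T pivotCode).eval f y m) := by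
    refine eval_forEach_induction ?_ ⟨hm, Or.inl ⟨hflag, 1, hinv, ?_, Matrix.transpose_one⟩⟩
    · rintro i hi A hA hiA m' ⟨h1, h2⟩
      refine ⟨fun j a => by rw [eval_basis_pivotCode, h1], ?_⟩
      have hspec := eval_pivotCode (f := f) (y := y) i m' (W := Matrix.of fun a b => m' (inv a b))
        (fun _ _ => rfl) (h1 i) rfl rfl
      rcases h2 with ⟨h3, W, h4, h5, h6⟩ | ⟨h3, h4⟩
      · have hWe : (Matrix.of fun a b => m' (inv a b)) = W := by ext a b; exact h4 a b
        rw [hWe] at hspec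
        set z := W *ᵥ Q i with hz
        set pv := 1 - Q i ⬝ᵥ z with hpv
        by_cases hle : pv ≤ 0
        · right
          refine ⟨by rw [hspec.2, if_pos hle], ?_⟩
          exact hQ.det_rowGram_eq_zero hiA (Finset.insert_subset hi hA) h5 hz hpv hle
        · left
          refine ⟨by rw [hspec.2, if_neg hle, h3], _, hspec.1, ?_, ?_⟩
          · exact rowGram_insert_mul hiA h5 h6 hz hpv (by linarith : pv > 0).ne'
          · rw [Matrix.transpose_add, Matrix.transpose_smul, Matrix.transpose_vecMulVec, h6]
      -- Singularity concerns the full set T, so it persists, and later rounds cannot lower the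
      -- flag.
      · right
        refine ⟨?_, h4⟩
        rw [hspec.2, h3, ite_self]
    · simp [rowGram]
  rcases hp.2 with ⟨h1, W, h2, h3, -⟩ | h
  · exact Or.inl ⟨h1, W, h2, h3⟩
  · exact Or.inr h

theorem eval_lsCode {Q : Matrix (Fin n) (Fin r) ℝ} (hQ : IsEstimate Q) (T : Finset (Fin n))
    (m : Reg n r α → ℝ) (hm : ∀ i a, m (basis i a) = Q i a) (i : Fin n) :
    (lsCode T).eval f y m (est i) = projLS Q T y i := by
  classical
  simp only [lsCode, eval_seq]
  set m1 := (forEach Finset.univ fun i => load (est i) i).eval f y m with hm1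
  have h1 : ∀ i, m1 (est i) = y i := fun i =>
    eval_forEach_apply (dst := est) (val := fun i _ => y i) (scratch := fun _ => False)
      (fun i m => by simp [Code.eval]) (fun i x h => by simpa [Code.Writes] using h)
      (fun _ _ _ _ => rfl) (fun i j h => by simpa using h) (by simp) m (Finset.mem_univ i)
  have h1b : ∀ i a, m1 (basis i a) = Q i a := fun i a => by
    rw [hm1, eval_of_not_writes f y (by simp [Code.Writes]), hm]
  set m2 := (forEach Finset.univ fun p : Fin r × Fin r =>
    const (inv p.1 p.2) ((1 : Matrix (Fin r) (Fin r) ℝ) p.1 p.2)).eval f y m1 with hm2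
  have h2 : ∀ a b, m2 (inv a b) = (1 : Matrix (Fin r) (Fin r) ℝ) a b := fun a b =>
    eval_forEach_apply (dst := fun p : Fin r × Fin r => inv p.1 p.2)
      (val := fun p _ => (1 : Matrix (Fin r) (Fin r) ℝ) p.1 p.2) (scratch := fun _ => False)
      (fun i m => by simp [Code.eval]) (fun i x h => by simpa [Code.Writes] using h)
      (fun _ _ _ _ => rfl) (fun i j h => by simpa [Prod.ext_iff] using h) (by simp) m1
      (Finset.mem_univ (a, b))
  have h2' : ∀ x, (∀ a b, x ≠ inv a b) → m2 x = m1 x := fun x hx =>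
    eval_of_not_writes f y (by simpa [Code.Writes] using hx) m1
  set m3 := (const flag 0).eval f y m2 with hm3
  have h3' : ∀ x, x ≠ flag → m3 x = m2 x := fun x hx => Function.update_of_ne hx _ _
  have hcases := eval_forEach_pivotCode (f := f) (y := y) hQ T m3
    (fun i a => by rw [h3' _ (by simp), h2' _ (by simp), h1b])
    (fun a b => by rw [h3' _ (by simp), h2]) (by simp [hm3, Code.eval])
  set m4 := (forEach T pivotCode).eval f y m3 with hm4
  have h4' : ∀ x, ¬ (forEach T (pivotCode (n := n) (r := r) (α := α))).Writes x → m4 x = m3 x :=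
    fun x hx => eval_of_not_writes f y hx m3
  have h4e : ∀ i, m4 (est i) = y i := fun i => by
    rw [h4' _ (by simp [pivotCode, dots, dot, Code.Writes]), h3' _ (by simp), h2' _ (by simp), h1]
  have h4b : ∀ i a, m4 (basis i a) = Q i a := fun i a => by
    rw [h4' _ (by simp [pivotCode, dots, dot, Code.Writes]), h3' _ (by simp), h2' _ (by simp), h1b]
  set m5 := (dots Finset.univ rhs tmp Tᶜ (fun a i => basis i a) (fun _ i => est i)).eval f y m4
    with hm5
  have h5 : ∀ a, m5 (rhs a) = ∑ i ∈ Tᶜ, Q i a * y i := fun a => by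
    rw [hm5, eval_dots (fun a b h => by simpa using h) (by simp) (by simp) (by simp) m4
      (Finset.mem_univ a)]
    simp only [h4e, h4b]
  have h5' : ∀ x, (∀ a, x ≠ rhs a) → x ≠ tmp → m5 x = m4 x := fun x hx hx' =>
    eval_of_not_writes f y (fun h => (writes_dots h).elim (fun ⟨a, h⟩ => hx a h) hx') m4
  set m6 := (dots Finset.univ wt tmp Finset.univ (fun a b => inv a b) (fun _ b => rhs b)).eval f y m5
    with hm6
  have h6 : ∀ a, m6 (wt a) = ∑ b, m4 (inv a b) * ∑ i ∈ Tᶜ, Q i b * y i := fun a => by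
    rw [hm6, eval_dots (fun a b h => by simpa using h) (by simp) (by simp) (by simp) m5
      (Finset.mem_univ a)]
    simp only [h5]
    exact Finset.sum_congr rfl fun b _ => by rw [h5' _ (by simp) (by simp)]
  have h6' : ∀ x, (∀ a, x ≠ wt a) → x ≠ tmp → m6 x = m5 x := fun x hx hx' =>
    eval_of_not_writes f y (fun h => (writes_dots h).elim (fun ⟨a, h⟩ => hx a h) hx') m5
  set m7 := (const ref 0).eval f y m6 with hm7
  have h7' : ∀ x, x ≠ ref → m7 x = m6 x := fun x hx => Function.update_of_ne hx _ _
  have h7r : m7 ref = 0 := by simp [hm7, Code.eval]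
  have h7f : m7 flag = m4 flag := by
    rw [h7' _ (by simp), h6' _ (by simp) (by simp), h5' _ (by simp) (by simp)]
  have h7e : m7 (est i) = y i := by
    rw [h7' _ (by simp), h6' _ (by simp) (by simp), h5' _ (by simp) (by simp), h4e]
  rcases hcases with ⟨hf, W, hW, hWinv⟩ | ⟨hf, hdet⟩
  · rw [eval_ifLE_of_le (by rw [h7r, h7f, hf])]
    by_cases hi : i ∈ T
    · rw [eval_dots (fun a b h => by simpa using h) (by simp) (by simp) (by simp) m7 hi,
        hQ.projLS_of_mul_eq_one hWinv y hi, dotProduct]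
      refine Finset.sum_congr rfl fun a _ => ?_
      rw [h7' _ (by simp), h6' _ (by simp) (by simp), h5' _ (by simp) (by simp), h4b,
        h7' _ (by simp), h6]
      simp only [hW]
      rfl
    · rw [eval_of_not_writes, h7e, projLS_of_notMem Q y hi]
      simp only [dots, writes_forEach, dot, Code.Writes]
      rintro ⟨j, hj, h | ⟨_, _, h | h⟩⟩
      · simp only [est.injEq] at h; exact hi (h ▸ hj)
      · simp at h
      · simp only [est.injEq] at h; exact hi (h ▸ hj)
  · rw [eval_ifLE_of_lt (by rw [h7r, h7f, hf]; exact one_pos), Code.eval, h7e, hQ.projLS_of_det_eq_zero hdet]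

/-- There is no indirect addressing, so the target column is found by comparing the counter with
every possible index. The shift by 1 matches the convention that `next` holds the column count minus
1. -/
lemma eval_storeCode (l : List (Fin α)) {x : Fin α} (hx : x ∈ l) (m : Reg n r α → ℝ)
    (hm : m next = (x : ℕ) - 1) :
    (∀ i, (storeCode l).eval f y m (buf i x) = m (est i)) ∧
      ∀ i k, k ≠ x → (storeCode l).eval f y m (buf i k) = m (buf i k) := by
  classical
  induction l generalizing m with
  | nil => simp at hx
  | cons k l ih =>
    simp only [storeCode, eval_seq]
    set m1 := (const ref (((k : ℕ) : ℝ) - 1)).eval f y m with hm1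
    have h1' : ∀ z, z ≠ ref → m1 z = m z := fun z hz => Function.update_of_ne hz _ _
    have h1n : m1 next = (x : ℕ) - 1 := by rw [h1' _ (by simp), hm]
    have h1r : m1 ref = (k : ℕ) - 1 := by simp [hm1, Code.eval]
    by_cases hkx : k = x
    · subst hkx
      rw [eval_ifLE_of_le (by rw [h1n, h1r]), eval_ifLE_of_le (by rw [h1n, h1r])]
      refine ⟨fun i => ?_, fun i k' hk' => ?_⟩
      · rw [eval_forEach_apply (dst := fun i => buf i k) (val := fun i m => m (est i))
          (scratch := fun _ => False) (fun i m => by simp [Code.eval])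
          (fun i x h => by simpa [Code.Writes] using h) (fun i m m' h => h _ (by simp) (by simp))
          (fun i j h => by simpa using h) (by simp) m1 (Finset.mem_univ i), h1' _ (by simp)]
      · rw [eval_of_not_writes, h1' _ (by simp)]
        simp [Code.Writes, hk']
    · have hx' : x ∈ l := by
        rcases List.mem_cons.mp hx with h | h
        · exact absurd h.symm hkx
        · exact h
      have h2 := ih hx' m1 h1n
      have hne : ¬ (m1 next ≤ m1 ref ∧ m1 ref ≤ m1 next) := by
        rintro ⟨h3, h4⟩
        have h5 := le_antisymm h3 h4
        rw [h1n, h1r] at h5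
        have h6 : ((x : ℕ) : ℝ) = (k : ℕ) := by linarith
        exact hkx (Fin.ext (by exact_mod_cast h6.symm))
      have h3 : (ifLE next ref (ifLE ref next (forEach Finset.univ fun i => copy (buf i k) (est i))
          (storeCode l)) (storeCode l)).eval f y m1 = (storeCode l).eval f y m1 := by
        rcases le_or_gt (m1 next) (m1 ref) with h4 | h4
        · rw [eval_ifLE_of_le h4, eval_ifLE_of_lt (not_le.mp fun h5 => hne ⟨h4, h5⟩)]
        · rw [eval_ifLE_of_lt h4]
      rw [h3]
      refine ⟨fun i => by rw [h2.1, h1' _ (by simp)], fun i k' hk' => by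
        rw [h2.2 i k' hk', h1' _ (by simp)]⟩

lemma not_writes_storeCode (l : List (Fin α)) {x : Reg n r α} (h1 : x ≠ ref)
    (h2 : ∀ i k, x ≠ buf i k) : ¬ (storeCode l).Writes x := by
  induction l with
  | nil => simp [storeCode, Code.Writes]
  | cons k l ih => simp [storeCode, Code.Writes, h1, h2, ih]

end Programs

end NORST

end


section

namespace NORST

open scoped Matrix.Norms.L2Operator

/-! ### Simulation of the algorithm frame by frame. -/

section Frames

open Reg Code

variable {n r α : ℕ} {f : Matrix (Fin n) (Fin α) ℝ → Matrix (Fin n) (Fin r) ℝ} {y : Fin n → ℝ}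

lemma eval_svd_apply (src : Fin n → Fin α → Reg n r α) (dst : Fin n × Fin r ↪ Reg n r α)
    (m : Reg n r α → ℝ) (i : Fin n) (a : Fin r) :
    (svd src dst).eval f y m (dst (i, a)) = f (Matrix.of fun i k => m (src i k)) i a := by
  simp only [Code.eval]
  rw [dst.injective.extend_apply]

lemma eval_updateCode (K : ℕ) (m : Reg n r α → ℝ) {M : Matrix (Fin n) (Fin α) ℝ}
    (hM : ∀ i k, m (buf i k) = M i k) :
    (∀ i a, (updateCode K).eval f y m (basis i a) = f M i a) ∧
      (updateCode K).eval f y m upd = m upd + 1 ∧ (updateCode K).eval f y m next = -1 ∧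
      (updateCode K).eval f y m phase = if (K : ℝ) ≤ m upd + 1 then 1 else m phase := by
  have hMe : (Matrix.of fun i k => m (buf i k)) = M := by ext i k; exact hM i k
  simp only [updateCode, eval_seq]
  set m1 := (svd buf basisEmb).eval f y m with hm1
  have h1 : ∀ i a, m1 (basis i a) = f M i a := fun i a => by
    rw [← hMe]; exact eval_svd_apply buf basisEmb m i a
  have h1' : ∀ x, (∀ i a, x ≠ basis i a) → m1 x = m x := fun x hx =>
    eval_of_not_writes f y (by
      simp only [Code.Writes]
      rintro ⟨⟨i, a⟩, h⟩
      exact hx i a h.symm) m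
  generalize hm2 : (const ref (K : ℝ)).eval f y ((const next (-1)).eval f y
    ((Code.add upd upd ref).eval f y ((const ref 1).eval f y m1))) = m2
  simp only [Code.eval] at hm2
  have h2u : m2 upd = m upd + 1 := by rw [← hm2]; simp [h1']
  have h2r : m2 ref = K := by rw [← hm2]; simp
  have h2n : m2 next = -1 := by rw [← hm2]; simp
  have h2' : ∀ x, x ≠ ref → x ≠ upd → x ≠ next → m2 x = m1 x := fun x h3 h4 h5 => by
    rw [← hm2]; simp [h3, h4, h5]
  refine ⟨fun i a => ?_, ?_, ?_, ?_⟩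
  · rw [eval_of_not_writes f y (by simp [Code.Writes]), h2' _ (by simp) (by simp) (by simp), h1]
  · rw [eval_of_not_writes f y (by simp [Code.Writes]), h2u]
  · rw [eval_of_not_writes f y (by simp [Code.Writes]), h2n]
  · split_ifs with h
    · rw [eval_ifLE_of_le (by rw [h2r, h2u]; exact h)]
      simp [Code.eval]
    · rw [eval_ifLE_of_lt (by rw [h2r, h2u]; exact not_le.mp h), Code.eval,
        h2' _ (by simp) (by simp) (by simp), h1' _ (by simp)]

/-- QᵀM is computed before Q(QᵀM), so the n × n projector is never formed and the cost stays of
order n r α. The first singular vector of the residual then attains the largest eigenvalue. -/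
lemma eval_gainCode [NeZero n] [NeZero r] (hf : IsRSVD f) (m : Reg n r α → ℝ)
    {M : Matrix (Fin n) (Fin α) ℝ} (hM : ∀ i k, m (buf i k) = M i k) {Q : Matrix (Fin n) (Fin r) ℝ}
    (hQ : ∀ i a, m (basis i a) = Q i a) :
    gainCode.eval f y m gain = lamMaxGram (perp Q * M) := by
  simp only [gainCode, eval_seq]
  set m1 := (dots Finset.univ (fun p : Fin r × Fin α => coef p.1 p.2) tmp Finset.univ
    (fun p i => basis i p.1) (fun p i => buf i p.2)).eval f y m with hm1
  have h1 : ∀ a k, m1 (coef a k) = (Qᵀ * M) a k := fun a k => by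
    have := eval_dots (n := n) (r := r) (α := α) (R := Reg n r α) (f := f) (y := y) (κ := Fin n)
      (s := Finset.univ) (t := Finset.univ) (tmp := tmp)
      (dst := fun p : Fin r × Fin α => coef p.1 p.2) (u := fun p i => basis i p.1)
      (v := fun p i => buf i p.2) (fun p q h => by simpa [Prod.ext_iff] using h) (by simp)
      (by simp) (by simp) m (Finset.mem_univ (a, k))
    rw [hm1, this, Matrix.mul_apply]
    exact Finset.sum_congr rfl fun i _ => by rw [hQ, hM, Matrix.transpose_apply]
  have h1' : ∀ x, (∀ a k, x ≠ coef a k) → x ≠ tmp → m1 x = m x := fun x hx hx' =>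
    eval_of_not_writes f y
      (fun h => (writes_dots h).elim (fun ⟨p, h⟩ => hx p.1 p.2 h) hx') m
  set m2 := (dots Finset.univ (fun p : Fin n × Fin α => res p.1 p.2) tmp Finset.univ
    (fun p a => basis p.1 a) (fun p a => coef a p.2)).eval f y m1 with hm2
  have h2 : ∀ i k, m2 (res i k) = (Q * (Qᵀ * M)) i k := fun i k => by
    have := eval_dots (n := n) (r := r) (α := α) (R := Reg n r α) (f := f) (y := y) (κ := Fin r)
      (s := Finset.univ) (t := Finset.univ) (tmp := tmp)
      (dst := fun p : Fin n × Fin α => res p.1 p.2) (u := fun p a => basis p.1 a)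
      (v := fun p a => coef a p.2) (fun p q h => by simpa [Prod.ext_iff] using h) (by simp)
      (by simp) (by simp) m1 (Finset.mem_univ (i, k))
    rw [hm2, this, Matrix.mul_apply]
    exact Finset.sum_congr rfl fun a _ => by rw [h1, h1' _ (by simp) (by simp), hQ]
  have h2' : ∀ x, (∀ i k, x ≠ res i k) → x ≠ tmp → m2 x = m1 x := fun x hx hx' =>
    eval_of_not_writes f y
      (fun h => (writes_dots h).elim (fun ⟨p, h⟩ => hx p.1 p.2 h) hx') m1
  set m3 := (forEach Finset.univ fun p : Fin n × Fin α =>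
    Code.sub (res p.1 p.2) (buf p.1 p.2) (res p.1 p.2)).eval f y m2 with hm3
  have h3 : (Matrix.of fun i k => m3 (res i k)) = perp Q * M := by
    ext i k
    have := eval_forEach_apply (n := n) (r := r) (α := α) (R := Reg n r α) (f := f) (y := y)
      (s := Finset.univ) (body := fun p : Fin n × Fin α =>
        Code.sub (res p.1 p.2) (buf p.1 p.2) (res p.1 p.2)) (dst := fun p => res p.1 p.2)
      (val := fun p m => m (buf p.1 p.2) - m (res p.1 p.2)) (scratch := fun _ => False)
      (fun p m => by simp [Code.eval]) (fun p x h => by simpa [Code.Writes] using h)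
      (fun p m m' h => by
        rw [h (buf p.1 p.2) (by simp) (by simp),
          h _ (by simp) (fun b hb => by simpa [Prod.ext_iff, eq_comm] using hb)])
      (fun p q h => by simpa [Prod.ext_iff] using h) (by simp) m2 (Finset.mem_univ (i, k))
    rw [Matrix.of_apply, hm3, this, h2, h2' _ (by simp) (by simp), h1' _ (by simp) (by simp), hM,
      perp, Matrix.sub_mul, Matrix.one_mul, Matrix.sub_apply, Matrix.mul_assoc]
  set m4 := (svd res singEmb).eval f y m3 with hm4
  have h4 : ∀ i a, m4 (sing i a) = f (perp Q * M) i a := fun i a => by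
    rw [← h3]; exact eval_svd_apply res singEmb m3 i a
  have h4' : ∀ i k, m4 (res i k) = (perp Q * M) i k := fun i k => by
    rw [← h3, Matrix.of_apply]
    refine eval_of_not_writes f y ?_ m3
    simp only [Code.Writes]
    rintro ⟨p, h⟩
    cases h
  set m5 := (dots Finset.univ proj tmp Finset.univ (fun k i => res i k)
    (fun _ i => sing i 0)).eval f y m4 with hm5
  have h5 : ∀ k, m5 (proj k) = ((perp Q * M)ᵀ *ᵥ fun i => f (perp Q * M) i 0) k := fun k => by
    rw [hm5, eval_dots (fun a b h => by simpa using h) (by simp) (by simp) (by simp) m4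
      (Finset.mem_univ k), Matrix.mulVec, dotProduct]
    exact Finset.sum_congr rfl fun i _ => by rw [h4, h4', Matrix.transpose_apply]
  rw [eval_dot (by simp) (by simp) (by simp), (hf (perp Q * M)).lamMaxGram_eq, l2norm_sq,
    dotProduct]
  exact Finset.sum_congr rfl fun k _ => by rw [h5]

lemma not_writes_gainCode [NeZero r] {x : Reg n r α} (h1 : ∀ i k, x ≠ res i k)
    (h2 : ∀ a k, x ≠ coef a k) (h3 : ∀ i a, x ≠ sing i a) (h4 : ∀ k, x ≠ proj k) (h5 : x ≠ tmp)
    (h6 : x ≠ gain) : ¬ (gainCode (n := n) (r := r) (α := α)).Writes x := by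
  simp only [gainCode, Code.Writes, writes_forEach]
  rintro (h | h | ⟨p, -, h⟩ | ⟨p, h⟩ | h | h)
  · exact (writes_dots h).elim (fun ⟨p, h⟩ => h2 p.1 p.2 h) h5
  · exact (writes_dots h).elim (fun ⟨p, h⟩ => h1 p.1 p.2 h) h5
  · exact h1 _ _ h
  · exact h3 p.1 p.2 h.symm
  · exact (writes_dots h).elim (fun ⟨p, h⟩ => h4 p h) h5
  · exact (writes_dot h).elim h6 h5

lemma eval_alarmCode [NeZero α] (m : Reg n r α → ℝ) :
    (∀ i, alarmCode.eval f y m (buf i 0) = m (buf i (lastCol α))) ∧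
      alarmCode.eval f y m next = 0 ∧ alarmCode.eval f y m upd = 0 ∧
      alarmCode.eval f y m phase = 0 := by
  refine ⟨fun i => ?_, ?_, ?_, ?_⟩
  · have h := eval_forEach_apply (n := n) (r := r) (α := α) (R := Reg n r α) (f := f) (y := y)
      (s := Finset.univ) (body := fun i => copy (buf i 0) (buf i (lastCol α)))
      (dst := fun i => buf i 0) (val := fun i m => m (buf i (lastCol α)))
      (scratch := fun _ => False) (fun i m => by simp [Code.eval])
      (fun i x h => by simpa [Code.Writes] using h)
      (fun i m m' h => h _ (by simp) (fun b hb => by simp [Ne.symm hb]))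
      (fun i j h => by simpa using h) (by simp) m (Finset.mem_univ i)
    simp only [alarmCode, eval_seq]
    rw [← h]
    simp [Code.eval]
  all_goals simp [alarmCode, Code.eval]

/-- The registers hold the state of the algorithm after frame `t`, with `c` columns of the current
block of estimates in the buffer. -/
structure Represents (K t c : ℕ) (m : Reg n r α → ℝ) (S : State n r) : Prop where
  c_lt : c < α
  c_le : c ≤ t + 1
  basis : ∀ i a, m (Reg.basis i a) = S.Phat i a
  next : m Reg.next = c - 1
  buf : ∀ i (k : Fin α), (k : ℕ) < c → m (Reg.buf i k) = S.lhat (t + 1 - c + k) i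
  isEstimate : IsEstimate S.Phat
  mode : (∃ j θ τ u, IsUpdating S j θ S.Phat ∧ θ j = some τ ∧ u < K ∧ t + 1 = τ + u * α + c ∧
      m Reg.phase = 0 ∧ m Reg.upd = u) ∨
    (∃ j θ s u, IsDetecting S j θ S.Phat s ∧ t = s + u * α + c ∧ m Reg.phase = 1)

lemma eval_estimateCode {Q : Matrix (Fin n) (Fin r) ℝ} (hQ : IsEstimate Q) (T : Finset (Fin n))
    (m : Reg n r α → ℝ) (hm : ∀ i a, m (basis i a) = Q i a) {c : ℕ} (hc : c < α)
    (hnext : m next = c - 1) :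
    (∀ i, (estimateCode T).eval f y m (est i) = projLS Q T y i) ∧
    (∀ i, (estimateCode T).eval f y m (buf i ⟨c, hc⟩) = projLS Q T y i) ∧
    (∀ i k, k ≠ ⟨c, hc⟩ → (estimateCode T).eval f y m (buf i k) = m (buf i k)) ∧
    (estimateCode T).eval f y m next = c ∧ (estimateCode T).eval f y m ref = α - 1 ∧
    ∀ x, x = phase ∨ x = upd ∨ (∃ i a, x = basis i a) → (estimateCode T).eval f y m x = m x := by
  simp only [estimateCode, eval_seq]
  set m1 := (lsCode T).eval f y m with hm1
  have h1 : ∀ i, m1 (est i) = projLS Q T y i := eval_lsCode hQ T m hm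
  have h1' : ∀ x, ¬ (lsCode (n := n) (r := r) (α := α) T).Writes x → m1 x = m x := fun x hx =>
    eval_of_not_writes f y hx m
  have h1n : m1 next = c - 1 := by
    rw [h1' _ (by simp [lsCode, pivotCode, dots, dot, Code.Writes]), hnext]
  obtain ⟨h2, h3⟩ := eval_storeCode (f := f) (y := y) (List.finRange α)
    (List.mem_finRange ⟨c, hc⟩) m1 h1n
  set m2 := (storeCode (List.finRange α)).eval f y m1 with hm2
  have h2' : ∀ x, x ≠ ref → (∀ i k, x ≠ buf i k) → m2 x = m1 x := fun x hx hx' =>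
    eval_of_not_writes f y (not_writes_storeCode _ hx hx') m1
  generalize hm3 : (const (n := n) (r := r) (α := α) ref ((α : ℝ) - 1)).eval f y
    ((Code.add next next ref).eval f y ((const ref 1).eval f y m2)) = m3
  simp only [Code.eval] at hm3
  have h3' : ∀ x, x ≠ ref → x ≠ next → m3 x = m2 x := fun x hx hx' => by
    rw [← hm3]; simp [hx, hx']
  refine ⟨fun i => ?_, fun i => ?_, fun i k hk => ?_, ?_, ?_, fun x hx => ?_⟩
  · rw [h3' _ (by simp) (by simp), h2' _ (by simp) (by simp), h1]
  · rw [h3' _ (by simp) (by simp), h2, h1]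
  · rw [h3' _ (by simp) (by simp), h3 i k hk,
      h1' _ (by simp [lsCode, pivotCode, dots, dot, Code.Writes])]
  · rw [← hm3]; simp [h2', h1n]
  · rw [← hm3]; simp
  · have hx1 : x ≠ ref := by rintro rfl; simp at hx
    have hx2 : x ≠ next := by rintro rfl; simp at hx
    have hx3 : ∀ i k, x ≠ buf i k := by rintro i k rfl; simp at hx
    rw [h3' _ hx1 hx2, h2' _ hx1 hx3, h1']
    rcases hx with rfl | rfl | ⟨i, a, rfl⟩ <;>
      simp [lsCode, pivotCode, dots, dot, Code.Writes]

variable {K : ℕ} {thr : ℝ} {Y : ℕ → Fin n → ℝ} {T : ℕ → Finset (Fin n)}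

/-- One frame of the machine simulates one frame of the algorithm. -/
theorem Represents.frame [NeZero n] [NeZero r] [NeZero α] (hf : IsRSVD f) (hα : 2 ≤ α) (hK : 1 ≤ K)
    (ε : ℝ) {t c : ℕ} {m : Reg n r α → ℝ} (h : Represents K t c m (run α K thr f Y T t)) :
    (∀ i, (frameCode K (α * thr) (T (t + 1))).eval f (Y (t + 1)) m (est i) =
      (run α K thr f Y T (t + 1)).lhat (t + 1) i) ∧
    ∃ c', Represents K (t + 1) c' ((frameCode K (α * thr) (T (t + 1))).eval f (Y (t + 1)) m)
        (run α K thr f Y T (t + 1)) ∧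
      ((c' = c + 1 ∧ (frameCode K (α * thr) (T (t + 1))).time f ε (Y (t + 1)) m ≤
          (estimateCode (n := n) (r := r) (α := α) (T (t + 1))).cost ε + 1) ∨
        (c + 1 = α ∧ c' ≤ 1 ∧ (frameCode K (α * thr) (T (t + 1))).time f ε (Y (t + 1)) m ≤
          (estimateCode (n := n) (r := r) (α := α) (T (t + 1))).cost ε + 1 +
            (blockCode (n := n) (r := r) (α := α) K (α * thr)).cost ε)) := by
  classical
  obtain ⟨h1, h2, h3, h4, h5, h6⟩ := eval_estimateCode (f := f) (y := Y (t + 1)) h.isEstimate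
    (T (t + 1)) m h.basis h.c_lt h.next
  have hlhat : ∀ i, (run α K thr f Y T (t + 1)).lhat (t + 1) i =
      projLS (run α K thr f Y T t).Phat (T (t + 1)) (Y (t + 1)) i := fun i => by
    rw [run_succ_lhat_self]
  have hcost := time_le_cost f ε (Y (t + 1)) (estimateCode (n := n) (r := r) (α := α) (T (t + 1))) m
  set m1 := (estimateCode (T (t + 1))).eval f (Y (t + 1)) m with hm1
  have hbuf : ∀ i (k : Fin α), (k : ℕ) < c + 1 → m1 (Reg.buf i k) =
      (run α K thr f Y T (t + 1)).lhat (t + 1 + 1 - (c + 1) + k) i := by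
    intro i k hk
    have hcl := h.c_le
    rw [show t + 1 + 1 - (c + 1) = t + 1 - c by omega]
    by_cases hkc : (k : ℕ) = c
    · have hk' : k = ⟨c, h.c_lt⟩ := Fin.ext hkc
      rw [hkc, show t + 1 - c + c = t + 1 by omega, hlhat, hk', h2]
    · rw [h3 i k (fun hk' => hkc (by rw [hk'])), h.buf i k (by omega), run_succ_lhat,
        Function.update_of_ne (by omega)]
  have hbasis : ∀ i a, m1 (Reg.basis i a) = (run α K thr f Y T t).Phat i a := fun i a => by
    rw [h6 _ (Or.inr (Or.inr ⟨i, a, rfl⟩)), h.basis]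
  have hphase : m1 Reg.phase = m Reg.phase := h6 _ (Or.inl rfl)
  have hupd : m1 Reg.upd = m Reg.upd := h6 _ (Or.inr (Or.inl rfl))
  have hest : ∀ i, m1 (Reg.est i) = (run α K thr f Y T (t + 1)).lhat (t + 1) i := fun i => by
    rw [h1, hlhat]
  have hcα := h.c_lt
  have hcl := h.c_le
  have heval : (frameCode K (α * thr) (T (t + 1))).eval f (Y (t + 1)) m =
      (ifLE Reg.ref Reg.next (blockCode K (α * thr)) skip).eval f (Y (t + 1)) m1 := rfl
  have htime : (frameCode K (α * thr) (T (t + 1))).time f ε (Y (t + 1)) m =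
      (estimateCode (T (t + 1))).time f ε (Y (t + 1)) m +
        (ifLE Reg.ref Reg.next (blockCode K (α * thr)) skip).time f ε (Y (t + 1)) m1 := rfl
  rw [heval, htime]
  by_cases hfull : c + 1 < α
  · have hlt : m1 Reg.next < m1 Reg.ref := by
      rw [h4, h5]
      have : ((c + 1 : ℕ) : ℝ) < α := by exact_mod_cast hfull
      push_cast at this
      linarith
    rw [eval_ifLE_of_lt hlt]
    -- Updates and tests occur only when a block is complete, that is, for c + 1 = α.
    have hoff : ∀ u v, u * α + c + 1 ≠ v * α := fun u v hc => by
      have h7 : u * α < v * α := by omega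
      have h8 : v * α < (u + 1) * α := by rw [Nat.add_mul]; omega
      have h9 := Nat.lt_of_mul_lt_mul_right h7
      have h10 := Nat.lt_of_mul_lt_mul_right h8
      omega
    have hmode : (run α K thr f Y T (t + 1)).Phat = (run α K thr f Y T t).Phat ∧
        ((∃ j θ τ u, IsUpdating (run α K thr f Y T (t + 1)) j θ (run α K thr f Y T t).Phat ∧
          θ j = some τ ∧ u < K ∧ t + 1 + 1 = τ + u * α + (c + 1) ∧ m1 Reg.phase = 0 ∧
          m1 Reg.upd = u) ∨
        ∃ j θ s u, IsDetecting (run α K thr f Y T (t + 1)) j θ (run α K thr f Y T t).Phat s ∧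
          t + 1 = s + u * α + (c + 1) ∧ m1 Reg.phase = 1) := by
      rw [hphase, hupd]
      rcases h.mode with ⟨j, θ, τ, u, hu, hθ, huK, hu2, hp⟩ | ⟨j, θ, s, u, hu, hu2, hp⟩
      · have h7 := hu.run_succ_idle hθ hK fun v _ hc => hoff u v (by omega)
        exact ⟨h7.Phat_eq, Or.inl ⟨j, θ, τ, u, h7, hθ, huK, by omega, hp⟩⟩
      · have h7 := hu.run_succ_idle fun v _ hc => absurd (by omega) (hoff u v)
        exact ⟨h7.Phat_eq, Or.inr ⟨j, θ, s, u, h7, by omega, hp⟩⟩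
    refine ⟨hest, c + 1, ⟨hfull, by omega, ?_, ?_, hbuf, ?_, ?_⟩, Or.inl ⟨rfl, ?_⟩⟩
    · rw [hmode.1]; exact hbasis
    · simp only [Code.eval]; rw [h4]; push_cast; ring
    · rw [hmode.1]; exact h.isEstimate
    · rw [hmode.1]; exact hmode.2
    · simp only [Code.time]
      rw [if_neg (not_le.mpr hlt)]
      omega
  · have hcα' : c + 1 = α := by omega
    have hge : m1 Reg.ref ≤ m1 Reg.next := by
      rw [h4, h5, ← hcα']
      push_cast
      linarith
    have hwin : ∀ i k, m1 (Reg.buf i k) =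
        window α (run α K thr f Y T (t + 1)).lhat (t + 1) i k := fun i k => by
      rw [hbuf i k (by omega), window, Matrix.of_apply]
      congr 1
      omega
    have htime' : (estimateCode (T (t + 1))).time f ε (Y (t + 1)) m +
        (ifLE Reg.ref Reg.next (blockCode K (α * thr)) skip).time f ε (Y (t + 1)) m1 ≤
          (estimateCode (n := n) (r := r) (α := α) (T (t + 1))).cost ε + 1 +
            (blockCode (n := n) (r := r) (α := α) K (α * thr)).cost ε := by
      have h7 := time_le_cost f ε (Y (t + 1))
        (blockCode (n := n) (r := r) (α := α) K (α * thr)) m1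
      have h8 : (ifLE Reg.ref Reg.next (blockCode (n := n) (r := r) (α := α) K (α * thr))
          skip).time f ε (Y (t + 1)) m1 = 1 + (blockCode K (α * thr)).time f ε (Y (t + 1)) m1 := by
        simp only [Code.time]
        rw [if_pos hge]
      omega
    rw [eval_ifLE_of_le hge, blockCode, eval_seq]
    set m2 := (const ref 0).eval f (Y (t + 1)) m1 with hm2
    have h7 : ∀ x, x ≠ ref → m2 x = m1 x := fun x hx => Function.update_of_ne hx _ _
    have h7r : m2 ref = 0 := by simp [hm2, Code.eval]
    set W := window α (run α K thr f Y T (t + 1)).lhat (t + 1) with hW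
    have h7b : ∀ i k, m2 (Reg.buf i k) = W i k := fun i k => by rw [h7 _ (by simp), hwin]
    have hmul : ∀ u, u * α + c + 1 = (u + 1) * α := fun u => by rw [Nat.add_mul]; omega
    rcases h.mode with ⟨j, θ, τ, u, hu, hθ, huK, hu2, hp, hq⟩ | ⟨j, θ, s, u, hu, hu2, hp⟩
    · rw [eval_ifLE_of_le (by rw [h7 _ (by simp), hphase, hp, h7r])]
      obtain ⟨h8, h9, h10, h11⟩ := eval_updateCode (f := f) (y := Y (t + 1)) K m2 h7b
      rw [h7 _ (by simp), hupd, hq] at h9 h11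
      have hle : ∀ i, (updateCode K).eval f (Y (t + 1)) m2 (est i) = m1 (est i) := by
        intro i
        rw [eval_of_not_writes, h7 _ (by simp)]
        simp [updateCode, Code.Writes, basisEmb]
      have hu3 : t + 2 = τ + (u + 1) * α := by have := hmul u; omega
      have hmode : (run α K thr f Y T (t + 1)).Phat = f W ∧
          ((∃ j θ τ v, IsUpdating (run α K thr f Y T (t + 1)) j θ (f W) ∧
            θ j = some τ ∧ v < K ∧ t + 1 + 1 = τ + v * α + 0 ∧
            (updateCode K).eval f (Y (t + 1)) m2 Reg.phase = 0 ∧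
            (updateCode K).eval f (Y (t + 1)) m2 Reg.upd = v) ∨
          ∃ j θ s v, IsDetecting (run α K thr f Y T (t + 1)) j θ (f W) s ∧
            t + 1 = s + v * α + 0 ∧ (updateCode K).eval f (Y (t + 1)) m2 Reg.phase = 1) := by
        by_cases huK' : u + 1 = K
        · have h12 := hu.run_succ_finish hθ (by omega) hK (by rw [← huK']; exact hu3)
          refine ⟨h12.Phat_eq, Or.inr ⟨_, _, _, 0, h12, by omega, ?_⟩⟩
          rw [h11, if_pos (by rw [← huK']; push_cast; exact le_rfl)]
        · have h12 := hu.run_succ_update hθ (by omega) (by omega) huK' hu3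
          refine ⟨h12.Phat_eq, Or.inl ⟨_, _, _, u + 1, h12, hθ, by omega, by omega, ?_, ?_⟩⟩
          · rw [h11, if_neg, h7 _ (by simp), hphase, hp]
            intro hc
            have : K ≤ u + 1 := by exact_mod_cast hc
            omega
          · rw [h9]; push_cast; ring
      refine ⟨fun i => by rw [hle, hest], 0, ⟨by omega, by omega, ?_, ?_, ?_, ?_, ?_⟩,
        Or.inr ⟨hcα', by omega, htime'⟩⟩
      · rw [hmode.1]; exact h8
      · rw [h10]; norm_num
      · intro i k hk; omega
      · rw [hmode.1]; exact Or.inl (hf W).1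
      · rw [hmode.1]; exact hmode.2
    · rw [eval_ifLE_of_lt (by rw [h7r, h7 phase (by simp), hphase, hp]; exact one_pos), detectCode,
        eval_seq, eval_seq]
      have h8 := eval_gainCode (y := Y (t + 1)) hf m2 h7b fun i a => by
        rw [h7 _ (by simp)]; exact hbasis i a
      set m3 := gainCode.eval f (Y (t + 1)) m2 with hm3
      have h9 : ∀ x, (∀ i k, x ≠ res i k) → (∀ a k, x ≠ coef a k) → (∀ i a, x ≠ sing i a) →
          (∀ k, x ≠ proj k) → x ≠ tmp → x ≠ gain → m3 x = m2 x := fun x a1 a2 a3 a4 a5 a6 =>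
        eval_of_not_writes f (Y (t + 1)) (not_writes_gainCode a1 a2 a3 a4 a5 a6) m2
      set m4 := (const ref (α * thr)).eval f (Y (t + 1)) m3 with hm4
      have h10 : ∀ x, x ≠ ref → m4 x = m3 x := fun x hx => Function.update_of_ne hx _ _
      have h10r : m4 ref = α * thr := by simp [hm4, Code.eval]
      have h10g : m4 gain = lamMaxGram (perp (run α K thr f Y T t).Phat * W) := by
        rw [h10 _ (by simp), h8]
      have h11 : ∀ i, m4 (est i) = m1 (est i) := fun i => by
        rw [h10 _ (by simp), h9 _ (by simp) (by simp) (by simp) (by simp) (by simp) (by simp),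
          h7 _ (by simp)]
      have h11b : ∀ i a, m4 (Reg.basis i a) = m1 (Reg.basis i a) := fun i a => by
        rw [h10 _ (by simp), h9 _ (by simp) (by simp) (by simp) (by simp) (by simp) (by simp),
          h7 _ (by simp)]
      have h11u : ∀ i k, m4 (Reg.buf i k) = m1 (Reg.buf i k) := fun i k => by
        rw [h10 _ (by simp), h9 _ (by simp) (by simp) (by simp) (by simp) (by simp) (by simp),
          h7 _ (by simp)]
      have h11p : m4 Reg.phase = m1 Reg.phase := by
        rw [h10 _ (by simp), h9 _ (by simp) (by simp) (by simp) (by simp) (by simp) (by simp),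
          h7 _ (by simp)]
      have hu3 : t + 1 = s + (u + 1) * α := by have := hmul u; omega
      rcases le_or_gt (α * thr) (lamMaxGram (perp (run α K thr f Y T t).Phat * W)) with hq | hq
      · rw [eval_ifLE_of_le (by rw [h10r, h10g]; exact hq)]
        have h12 := hu.run_succ_alarm (by omega) hu3 hq
        obtain ⟨h13, h14, h15, h16⟩ := eval_alarmCode (f := f) (y := Y (t + 1)) m4
        -- The column count restarts at 1: the alarm frame closes the test window and also opens the
        -- first update window, so its estimate is kept.
        refine ⟨fun i => ?_, 1, ⟨by omega, by omega, ?_, ?_, ?_, ?_, ?_⟩,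
          Or.inr ⟨hcα', le_rfl, htime'⟩⟩
        · rw [eval_of_not_writes, h11, hest]
          simp [alarmCode, Code.Writes]
        · intro i a
          rw [eval_of_not_writes, h11b, hbasis, h12.Phat_eq]
          simp [alarmCode, Code.Writes]
        · rw [h14]; norm_num
        · intro i k hk
          have hk0 : k = 0 := Fin.ext (by rw [Fin.val_zero]; omega)
          have hl : ((lastCol α : Fin α) : ℕ) = c := by simp only [lastCol]; omega
          rw [hk0, h13, h11u, hbuf i _ (by omega), hl]
          congr 1
          simp only [Fin.val_zero]
          omega
        · rw [h12.Phat_eq]; exact h.isEstimate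
        · rw [h12.Phat_eq]
          exact Or.inl ⟨j, _, t + 1, 0, h12, Function.update_self .., by omega, by omega, h16,
            by rw [h15]; norm_num⟩
      · rw [eval_ifLE_of_lt (by rw [h10r, h10g]; exact hq)]
        have h12 := hu.run_succ_idle fun v _ _ => hq
        set m5 := (const Reg.next (-1)).eval f (Y (t + 1)) m4 with hm5
        have h13 : ∀ x, x ≠ Reg.next → m5 x = m4 x := fun x hx => Function.update_of_ne hx _ _
        refine ⟨fun i => ?_, 0, ⟨by omega, by omega, ?_, ?_, ?_, ?_, ?_⟩,
          Or.inr ⟨hcα', by omega, htime'⟩⟩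
        · rw [h13 _ (by simp), h11, hest]
        · intro i a
          rw [h13 _ (by simp), h11b, hbasis, h12.Phat_eq]
        · simp [hm5, Code.eval]
        · intro i k hk; omega
        · rw [h12.Phat_eq]; exact h.isEstimate
        · rw [h12.Phat_eq]
          exact Or.inr ⟨j, θ, s, u + 1, h12, by omega, by
            rw [h13 _ (by simp), h11p, hphase, hp]⟩

end Frames

end NORST

end


section

namespace NORST

open scoped Matrix.Norms.L2Operator

/-! ### Step counts of the programs. -/

section Costs

open Reg Code

variable {n r α : ℕ} {ε : ℝ}

lemma cost_seq (p q : Code n r α (Reg n r α)) : (seq p q).cost ε = p.cost ε + q.cost ε := rfl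

lemma cost_ifLE (a b : Reg n r α) (p q : Code n r α (Reg n r α)) :
    (ifLE a b p q).cost ε = 1 + max (p.cost ε) (q.cost ε) := rfl

lemma cost_const (a : Reg n r α) (c : ℝ) : (const a c : Code n r α (Reg n r α)).cost ε = 1 := rfl

lemma cost_sub (a b c : Reg n r α) : (Code.sub a b c : Code n r α (Reg n r α)).cost ε = 1 := rfl

lemma cost_add (a b c : Reg n r α) : (Code.add a b c : Code n r α (Reg n r α)).cost ε = 1 := rfl

lemma cost_skip : (skip : Code n r α (Reg n r α)).cost ε = 0 := rfl

lemma cost_svd (a : Fin n → Fin α → Reg n r α) (b : Fin n × Fin r ↪ Reg n r α) :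
    (svd a b).cost ε = n * α * r * ⌈Real.log (1 / ε)⌉₊ := rfl

lemma cost_pivotCode_le (hr : 1 ≤ r) (i : Fin n) :
    (pivotCode (n := n) (r := r) (α := α) i).cost ε ≤ 14 * (r * r) := by
  have h1 := cost_dots_le (n := n) (r := r) (α := α) (ε := ε) (R := Reg n r α) Finset.univ sol tmp
    Finset.univ (fun a b => inv a b) (fun _ b => basis i b)
  have h2 := cost_dot_le (n := n) (r := r) (α := α) (ε := ε) (R := Reg n r α) pivot tmp Finset.univ
    (fun a => basis i a) sol
  have h3 := cost_forEach_le (n := n) (r := r) (α := α) (ε := ε) (R := Reg n r α)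
    (s := Finset.univ) (c := 3) (body := fun p : Fin r × Fin r =>
      seq (Code.mul tmp (sol p.1) (sol p.2)) <| seq (Code.div tmp tmp pivot) <|
      Code.add (inv p.1 p.2) (inv p.1 p.2) tmp) fun p _ => le_rfl
  simp only [Finset.card_univ, Fintype.card_prod, Fintype.card_fin] at h1 h2 h3
  simp only [pivotCode, cost_seq, cost_ifLE, cost_const, cost_sub, cost_skip]
  have h4 : r * (1 + 2 * r) = r + 2 * (r * r) := by ring
  have h5 : r ≤ r * r := Nat.le_mul_of_pos_right _ hr
  omega

/-- The dominant loop performs |T| rank-one updates at r² each, and |T| r ≤ n turns this into n r.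
-/
lemma cost_lsCode_le (hr : 1 ≤ r) (hrn : r ≤ n) {T : Finset (Fin n)} (hT : T.card * r ≤ n) :
    (lsCode (n := n) (r := r) (α := α) T).cost ε ≤ 30 * (n * r) := by
  have h1 := cost_forEach_le (n := n) (r := r) (α := α) (ε := ε) (R := Reg n r α)
    (s := Finset.univ) (c := 1) (body := fun i => load (est i) i) fun p _ => le_rfl
  have h2 := cost_forEach_le (n := n) (r := r) (α := α) (ε := ε) (R := Reg n r α)
    (s := Finset.univ) (c := 1) (body := fun p : Fin r × Fin r =>
      const (inv p.1 p.2) ((1 : Matrix (Fin r) (Fin r) ℝ) p.1 p.2)) fun p _ => le_rfl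
  have h3 := cost_forEach_le (ε := ε) (s := T)
    (body := pivotCode (n := n) (r := r) (α := α)) fun i _ => cost_pivotCode_le hr i
  have h4 := cost_dots_le (n := n) (r := r) (α := α) (ε := ε) (R := Reg n r α) Finset.univ rhs tmp
    Tᶜ (fun a i => basis i a) (fun _ i => est i)
  have h5 := cost_dots_le (n := n) (r := r) (α := α) (ε := ε) (R := Reg n r α) Finset.univ wt tmp
    Finset.univ (fun a b => inv a b) (fun _ b => rhs b)
  have h6 := cost_dots_le (n := n) (r := r) (α := α) (ε := ε) (R := Reg n r α) T est tmp
    Finset.univ (fun i a => basis i a) (fun _ a => wt a)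
  have h7 : Tᶜ.card ≤ n := by simpa using Finset.card_le_univ Tᶜ
  simp only [Finset.card_univ, Fintype.card_prod, Fintype.card_fin] at h1 h2 h4 h5 h6
  simp only [lsCode, cost_seq, cost_ifLE, cost_const, cost_skip, Nat.max_zero]
  have h8 : r * (1 + 2 * Tᶜ.card) ≤ r * (1 + 2 * n) := Nat.mul_le_mul le_rfl (by omega)
  have h9 : T.card * (14 * (r * r)) ≤ 14 * (n * r) := by
    calc T.card * (14 * (r * r)) = 14 * (T.card * r * r) := by ring
      _ ≤ 14 * (n * r) := Nat.mul_le_mul le_rfl (Nat.mul_le_mul hT le_rfl)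
  have h10 : T.card ≤ n := (Nat.le_mul_of_pos_right _ hr).trans hT
  have h11 : T.card * (1 + 2 * r) = T.card + 2 * (T.card * r) := by ring
  have h12 : r * r ≤ n * r := Nat.mul_le_mul hrn le_rfl
  have h13 : n ≤ n * r := Nat.le_mul_of_pos_right _ hr
  have h14 : r * (1 + 2 * n) = r + 2 * (n * r) := by ring
  have h15 : r * (1 + 2 * r) = r + 2 * (r * r) := by ring
  omega

/-- The tail occurs in two branches, but only one of them is executed and the copy is made at most
once, so the cost is linear in the number of columns although the tree is not. -/
lemma cost_storeCode_le (l : List (Fin α)) :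
    (storeCode (n := n) (r := r) l).cost ε ≤ 3 * l.length + n := by
  induction l with
  | nil => simp [storeCode, cost_skip]
  | cons k l ih =>
    have h1 := cost_forEach_le (n := n) (r := r) (α := α) (ε := ε) (R := Reg n r α)
      (s := Finset.univ) (c := 1) (body := fun i => copy (buf i k) (est i)) fun p _ => le_rfl
    simp only [Finset.card_univ, Fintype.card_fin] at h1
    simp only [storeCode, cost_seq, cost_ifLE, cost_const, List.length_cons]
    omega

lemma cost_estimateCode_le (hr : 1 ≤ r) (hrn : r ≤ n) {T : Finset (Fin n)} (hT : T.card * r ≤ n) :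
    (estimateCode (n := n) (r := r) (α := α) T).cost ε ≤ 34 * (n * r) + 3 * α := by
  have h1 := cost_lsCode_le (α := α) (ε := ε) hr hrn hT
  have h2 := cost_storeCode_le (n := n) (r := r) (ε := ε) (List.finRange α)
  rw [List.length_finRange] at h2
  have h3 : n ≤ n * r := Nat.le_mul_of_pos_right _ hr
  simp only [estimateCode, cost_seq, cost_const, cost_add]
  omega

lemma cost_blockCode_le [NeZero n] [NeZero r] [NeZero α] (K : ℕ) (thr : ℝ) :
    (blockCode (n := n) (r := r) (α := α) K thr).cost ε ≤
      n * r * α * (30 + ⌈Real.log (1 / ε)⌉₊) := by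
  have h1 := cost_dots_le (n := n) (r := r) (α := α) (ε := ε) (R := Reg n r α) Finset.univ
    (fun p : Fin r × Fin α => coef p.1 p.2) tmp Finset.univ
    (fun p i => basis i p.1) (fun p i => buf i p.2)
  have h2 := cost_dots_le (n := n) (r := r) (α := α) (ε := ε) (R := Reg n r α) Finset.univ
    (fun p : Fin n × Fin α => res p.1 p.2) tmp Finset.univ
    (fun p a => basis p.1 a) (fun p a => coef a p.2)
  have h3 := cost_forEach_le (n := n) (r := r) (α := α) (ε := ε) (R := Reg n r α)
    (s := Finset.univ) (c := 1) (body := fun p : Fin n × Fin α =>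
      Code.sub (res p.1 p.2) (buf p.1 p.2) (res p.1 p.2)) fun p _ => le_rfl
  have h4 := cost_dots_le (n := n) (r := r) (α := α) (ε := ε) (R := Reg n r α) Finset.univ proj tmp
    Finset.univ (fun k i => res i k) (fun _ i => sing i 0)
  have h5 := cost_dot_le (n := n) (r := r) (α := α) (ε := ε) (R := Reg n r α) gain tmp Finset.univ
    proj proj
  have h6 := cost_forEach_le (n := n) (r := r) (α := α) (ε := ε) (R := Reg n r α)
    (s := Finset.univ) (c := 1)
    (body := fun i => copy (buf i 0) (buf i (lastCol α))) fun p _ => le_rfl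
  simp only [Finset.card_univ, Fintype.card_prod, Fintype.card_fin] at h1 h2 h3 h4 h5 h6
  simp only [blockCode, updateCode, detectCode, gainCode, alarmCode, cost_seq, cost_ifLE,
    cost_const, cost_skip, cost_add, cost_svd]
  have hn : 1 ≤ n := NeZero.one_le
  have hr : 1 ≤ r := NeZero.one_le
  have hα : 1 ≤ α := NeZero.one_le
  set X := n * r * α with hX
  have e1 : r * α * (1 + 2 * n) = r * α + 2 * X := by rw [hX]; ring
  have e2 : n * α * (1 + 2 * r) = n * α + 2 * X := by rw [hX]; ring
  have e3 : α * (1 + 2 * n) = α + 2 * (n * α) := by ring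
  have e4 : X * (30 + ⌈Real.log (1 / ε)⌉₊) = 30 * X + n * α * r * ⌈Real.log (1 / ε)⌉₊ := by
    rw [hX]; ring
  have l1 : r * α ≤ X := by
    rw [hX, Nat.mul_assoc]; exact Nat.le_mul_of_pos_left _ hn
  have l2 : n * α ≤ X := by
    rw [hX, Nat.mul_right_comm]; exact Nat.le_mul_of_pos_right _ hr
  have l3 : α ≤ n * α := Nat.le_mul_of_pos_left _ hn
  have l4 : n ≤ n * α := Nat.le_mul_of_pos_right _ hα
  omega

end Costs

/-! ### Counting the registers. -/

section Registers

open Reg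

variable {n r α : ℕ}

/-- Enumeration of the registers. -/
def regOfSum : (Fin n × Fin α ⊕ Fin n × Fin α) ⊕ (Fin r × Fin α ⊕ Fin n × Fin r) ⊕
    (Fin n × Fin r ⊕ Fin r × Fin r) ⊕ (Fin r ⊕ Fin r ⊕ Fin r) ⊕ (Fin n ⊕ Fin α) ⊕ Fin 8 →
    Reg n r α :=
  Sum.elim (Sum.elim (fun p => buf p.1 p.2) fun p => res p.1 p.2) <|
  Sum.elim (Sum.elim (fun p => coef p.1 p.2) fun p => basis p.1 p.2) <|
  Sum.elim (Sum.elim (fun p => sing p.1 p.2) fun p => inv p.1 p.2) <|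
  Sum.elim (Sum.elim sol (Sum.elim rhs wt)) <| Sum.elim (Sum.elim est proj)
    ![tmp, ref, pivot, gain, flag, next, phase, upd]

lemma regOfSum_surjective : Function.Surjective (regOfSum (n := n) (r := r) (α := α)) := by
  intro x
  cases x with
  | buf i k => exact ⟨.inl (.inl (i, k)), rfl⟩
  | res i k => exact ⟨.inl (.inr (i, k)), rfl⟩
  | coef i k => exact ⟨.inr (.inl (.inl (i, k))), rfl⟩
  | basis i k => exact ⟨.inr (.inl (.inr (i, k))), rfl⟩
  | sing i k => exact ⟨.inr (.inr (.inl (.inl (i, k)))), rfl⟩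
  | inv i k => exact ⟨.inr (.inr (.inl (.inr (i, k)))), rfl⟩
  | sol i => exact ⟨.inr (.inr (.inr (.inl (.inl i)))), rfl⟩
  | rhs i => exact ⟨.inr (.inr (.inr (.inl (.inr (.inl i))))), rfl⟩
  | wt i => exact ⟨.inr (.inr (.inr (.inl (.inr (.inr i))))), rfl⟩
  | est i => exact ⟨.inr (.inr (.inr (.inr (.inl (.inl i))))), rfl⟩
  | proj i => exact ⟨.inr (.inr (.inr (.inr (.inl (.inr i))))), rfl⟩
  | tmp => exact ⟨.inr (.inr (.inr (.inr (.inr 0)))), rfl⟩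
  | ref => exact ⟨.inr (.inr (.inr (.inr (.inr 1)))), rfl⟩
  | pivot => exact ⟨.inr (.inr (.inr (.inr (.inr 2)))), rfl⟩
  | gain => exact ⟨.inr (.inr (.inr (.inr (.inr 3)))), rfl⟩
  | flag => exact ⟨.inr (.inr (.inr (.inr (.inr 4)))), rfl⟩
  | next => exact ⟨.inr (.inr (.inr (.inr (.inr 5)))), rfl⟩
  | phase => exact ⟨.inr (.inr (.inr (.inr (.inr 6)))), rfl⟩
  | upd => exact ⟨.inr (.inr (.inr (.inr (.inr 7)))), rfl⟩

instance : Finite (Reg n r α) := Finite.of_surjective _ regOfSum_surjective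

lemma card_reg_le (hn : 1 ≤ n) (hr : 1 ≤ r) (hrn : r ≤ n) :
    Nat.card (Reg n r α) ≤ 4 * (n * α) + 15 * (n * r) := by
  have h := Nat.card_le_card_of_surjective _ (regOfSum_surjective (n := n) (r := r) (α := α))
  simp only [Nat.card_eq_fintype_card, Fintype.card_sum, Fintype.card_prod, Fintype.card_fin] at h
  have h1 : r * α ≤ n * α := Nat.mul_le_mul hrn le_rfl
  have h2 : r * r ≤ n * r := Nat.mul_le_mul hrn le_rfl
  have h3 : n ≤ n * r := Nat.le_mul_of_pos_right _ hr
  have h4 : α ≤ n * α := Nat.le_mul_of_pos_left _ hn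
  omega

end Registers

/-! ### The machine and its running time. -/

section Machines

open Reg Code

variable {n r α : ℕ}

/-- The machine that carries out the algorithm. -/
def norstMachine (n r α : ℕ) [NeZero r] [NeZero α] (K : ℕ) (thr : ℝ) :
    Machine n r α (Nat.card (Reg n r α)) where
  code T := (frameCode K (α * thr) T).compile (Finite.equivFin _) .halt
  outL i := Finite.equivFin _ (est i)
  outP i a := Finite.equivFin _ (basis i a)

variable [NeZero r] [NeZero α] {K : ℕ} {thr : ℝ}
  {f : Matrix (Fin n) (Fin α) ℝ → Matrix (Fin n) (Fin r) ℝ} {Y : ℕ → Fin n → ℝ}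
  {T : ℕ → Finset (Fin n)}

lemma norstMachine_run_succ (ε : ℝ) {t : ℕ} {m : Reg n r α → ℝ}
    (hm : ((norstMachine n r α K thr).run f ε Y T t).1 = m ∘ (Finite.equivFin _).symm) :
    (norstMachine n r α K thr).run f ε Y T (t + 1) =
      ((frameCode K (α * thr) (T (t + 1))).eval f (Y (t + 1)) m ∘ (Finite.equivFin _).symm,
        ((norstMachine n r α K thr).run f ε Y T t).2 +
          (n + (frameCode K (α * thr) (T (t + 1))).time f ε (Y (t + 1)) m)) := by
  simp only [Machine.run]
  rw [hm]
  simp only [norstMachine]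
  rw [exec_compile]
  rfl

/-- Here w counts the completed blocks. A block can reuse at most one column of its predecessor, so
it takes at least α - 1 new frames, which the inequality for (α - 1) w + c records. -/
lemma norstMachine_run [NeZero n] (hf : IsRSVD f) (hα : 2 ≤ α) (hK : 1 ≤ K) (ε : ℝ) {A H : ℕ}
    (hA : ∀ t, 1 ≤ t → (estimateCode (n := n) (r := r) (α := α) (T t)).cost ε ≤ A)
    (hH : (blockCode (n := n) (r := r) (α := α) K (α * thr)).cost ε ≤ H) (t : ℕ) :
    ∃ (m : Reg n r α → ℝ) (c w : ℕ),
      ((norstMachine n r α K thr).run f ε Y T t).1 = m ∘ (Finite.equivFin _).symm ∧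
      Represents K t c m (NORST.run α K thr f Y T t) ∧
      (1 ≤ t → ∀ i, m (est i) = (NORST.run α K thr f Y T t).lhat t i) ∧
      (α - 1) * w + c ≤ t + 1 ∧
      ((norstMachine n r α K thr).run f ε Y T t).2 ≤ (n + (A + 1)) * t + H * w := by
  induction t with
  | zero =>
    -- Zero registers already represent the initial state: the zero estimate of frame 0 counts as
    -- one stored column, for which `next` = c - 1 = 0, and the phase and update counters are 0.
    refine ⟨0, 1, 0, rfl, ⟨by omega, le_rfl, fun _ _ => rfl, by norm_num, fun i k hk => ?_,
      Or.inr rfl, Or.inl ⟨0, _, 0, 0, isUpdating_init, rfl, by omega, by omega, rfl, by norm_num⟩⟩,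
      by omega, by omega, le_of_eq (by simp [Machine.run])⟩
    rw [show 0 + 1 - 1 + (k : ℕ) = 0 by omega, run_lhat_zero]
    rfl
  | succ t ih =>
    obtain ⟨m, c, w, h1, h2, -, h4, h5⟩ := ih
    have h6 := norstMachine_run_succ (K := K) (thr := thr) ε h1
    obtain ⟨h7, c', h8, h9⟩ := h2.frame hf hα hK ε
    have hA' := hA (t + 1) (by omega)
    have e1 : (n + (A + 1)) * (t + 1) = (n + (A + 1)) * t + (n + (A + 1)) := by ring
    rcases h9 with ⟨h10, h11⟩ | ⟨h10, h11, h12⟩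
    · refine ⟨_, c', w, by rw [h6], h8, fun _ => h7, by omega, ?_⟩
      rw [h6, e1]
      simp only
      omega
    · refine ⟨_, c', w + 1, by rw [h6], h8, fun _ => h7, ?_, ?_⟩
      · rw [Nat.mul_add]; omega
      · rw [h6, e1, Nat.mul_add]
        simp only
        omega

end Machines

/-! ### Memory and time bounds. -/

section Complexity

/-- The algorithm is carried out with nearly optimal memory and time. -/
theorem exists_machine {μ f₀ : ℝ} (hμ : 1 ≤ μ) (hf₀ : 1 ≤ f₀) :
    ∃ C > (0 : ℝ), ∀ (n r α K : ℕ) (ε lamP lamM f : ℝ),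
      2 ≤ n → 1 ≤ r → r ≤ n →
      0 < lamM → lamM ≤ lamP → f = lamP / lamM → f ≤ f₀ →
      0 < ε → ε ≤ 0.01 →
      α = ⌈176000000 * μ * f ^ 2 * r * Real.log n⌉₊ →
      K = ⌈1 * Real.log (1 / ε)⌉₊ →
      ∃ (s : ℕ) (M : Machine n r α s),
        (s : ℝ) ≤ C * n * r * Real.log n * Real.log (1 / ε) ∧
        ∀ (svd : Matrix (Fin n) (Fin α) ℝ → Matrix (Fin n) (Fin r) ℝ)
          (y : ℕ → Fin n → ℝ) (T : ℕ → Finset (Fin n)),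
          IsRSVD svd →
          (∀ t, 1 ≤ t → ((T t).card : ℝ) / n ≤ 1 / 100 / (μ * r)) →
          ∀ t, 1 ≤ t →
            (∀ i, (M.run svd ε y T t).1 (M.outL i) =
              (run α K (2 * ε ^ 2 * lamP) svd y T t).lhat t i) ∧
            (∀ i k, (M.run svd ε y T t).1 (M.outP i k) =
              (run α K (2 * ε ^ 2 * lamP) svd y T t).Phat i k) ∧
            ((M.run svd ε y T t).2 : ℝ) ≤ C * n * t * r * Real.log (1 / ε) := by
  -- D bounds the coefficient of r log n in the window length uniformly in f ≤ f₀; the ceiling at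
  -- most doubles it.
  set D := 176000000 * μ * f₀ ^ 2 with hD
  have hD0 : 0 < D := by positivity
  refine ⟨8 * D + 300, by positivity, fun n r α K ε lamP lamM f hn hr hrn hM hMP hf hff hε hε1 hα
    hK => ?_⟩
  set L := Real.log (1 / ε) with hL
  have hL1 : 1 ≤ L := one_le_log_one_div hε hε1
  have hlog := half_le_log_natCast hn
  have hlogn : Real.log n ≤ n := Real.log_le_self (Nat.cast_nonneg n)
  have hf1 : 1 ≤ f := by rw [hf]; exact (one_le_div hM).mpr hMP
  have hbase := windowLength_base hμ hf1 hr hn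
  have hr1 : (1 : ℝ) ≤ r := by exact_mod_cast hr
  have hn1 : (2 : ℝ) ≤ n := by exact_mod_cast hn
  have hα2 : 2 ≤ α := by
    have : (2 : ℝ) ≤ α := hbase.trans (by rw [hα]; exact Nat.le_ceil _)
    exact_mod_cast this
  have hαle : (α : ℝ) ≤ 2 * D * r * Real.log n := by
    have h1 := (Nat.ceil_lt_add_one (by linarith :
      0 ≤ 176000000 * μ * f ^ 2 * r * Real.log n)).le
    rw [← hα] at h1
    have h2 : 176000000 * μ * f ^ 2 * r * Real.log n ≤ D * r * Real.log n := by
      rw [hD]; gcongr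
    linarith
  have hK1 : 1 ≤ K := by rw [hK, one_mul]; exact one_le_ceil_log hε hε1
  have : NeZero n := ⟨by omega⟩
  have : NeZero r := ⟨by omega⟩
  have : NeZero α := ⟨by omega⟩
  have hnr : (0 : ℝ) ≤ n * r := by positivity
  refine ⟨_, norstMachine n r α K (2 * ε ^ 2 * lamP), ?_, fun svd y T hsvd hT t ht => ?_⟩
  · have h1 : ((Nat.card (Reg n r α) : ℕ) : ℝ) ≤ 4 * (n * α) + 15 * (n * r) := by
      exact_mod_cast card_reg_le (α := α) (by omega) hr hrn
    have h2 : (n : ℝ) * α ≤ 2 * D * (n * r * Real.log n) := by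
      calc (n : ℝ) * α ≤ n * (2 * D * r * Real.log n) := by gcongr
        _ = _ := by ring
    have h3 : (n : ℝ) * r ≤ 2 * (n * r * Real.log n) := by nlinarith
    calc ((Nat.card (Reg n r α) : ℕ) : ℝ) ≤ (8 * D + 30) * (n * r * Real.log n) := by linarith
      _ ≤ (8 * D + 300) * (n * r * Real.log n) := by gcongr; norm_num
      _ ≤ (8 * D + 300) * (n * r * Real.log n) * L := le_mul_of_one_le_right (by positivity) hL1
      _ = _ := by ring
  · have hcard : ∀ q, 1 ≤ q → (T q).card * r ≤ n := fun q hq => by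
      have h1 := hT q hq
      rw [div_le_div_iff₀ (by linarith) (by positivity)] at h1
      have h2 : ((T q).card : ℝ) * r ≤ (T q).card * (μ * r) := by
        gcongr
        exact le_mul_of_one_le_left (by linarith) hμ
      have h3 : ((T q).card : ℝ) * r ≤ n := by linarith
      exact_mod_cast h3
    obtain ⟨m, c, w, h1, h2, h3, h4, h5⟩ := norstMachine_run (Y := y) (thr := 2 * ε ^ 2 * lamP)
      hsvd hα2 hK1 ε (fun q hq => cost_estimateCode_le hr hrn (hcard q hq))
      (cost_blockCode_le K (α * (2 * ε ^ 2 * lamP))) t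
    refine ⟨fun i => ?_, fun i a => ?_, ?_⟩
    · rw [h1]
      simpa [norstMachine] using h3 ht i
    · rw [h1]
      simpa [norstMachine] using h2.basis i a
    · have h6 : (((norstMachine n r α K (2 * ε ^ 2 * lamP)).run svd ε y T t).2 : ℝ) ≤
          (n + (34 * (n * r) + 3 * α + 1)) * t + n * r * α * (30 + ⌈L⌉₊) * w := by
        exact_mod_cast h5
      have h7 : α * w ≤ 4 * t := by
        have h8 : α * w ≤ 2 * ((α - 1) * w) := by
          rw [← Nat.mul_assoc]; exact Nat.mul_le_mul (by omega) le_rfl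
        omega
      have h7' : (α : ℝ) * w ≤ 4 * t := by exact_mod_cast h7
      have h8 : (⌈L⌉₊ : ℝ) ≤ L + 1 := (Nat.ceil_lt_add_one (by linarith)).le
      have ht1 : (1 : ℝ) ≤ t := by exact_mod_cast ht
      have h9 : (n : ℝ) ≤ n * r := le_mul_of_one_le_right (by linarith) hr1
      have h10 : (α : ℝ) ≤ 2 * D * (n * r) := hαle.trans (by
        calc 2 * D * r * Real.log n ≤ 2 * D * r * n := by gcongr
          _ = _ := by ring)
      have h11 : (n : ℝ) * r * α * (30 + ⌈L⌉₊) * w ≤ 128 * (n * r * t * L) := by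
        calc (n : ℝ) * r * α * (30 + ⌈L⌉₊) * w = n * r * (30 + ⌈L⌉₊) * (α * w) := by ring
          _ ≤ n * r * (32 * L) * (4 * t) := by gcongr; linarith
          _ = _ := by ring
      have h12 : ((n : ℝ) + (34 * (n * r) + 3 * α + 1)) * t ≤ (36 + 6 * D) * (n * r * t) := by
        calc ((n : ℝ) + (34 * (n * r) + 3 * α + 1)) * t ≤ ((36 + 6 * D) * (n * r)) * t := by
              gcongr; linarith
          _ = _ := by ring
      have h13 : (n : ℝ) * r * t ≤ n * r * t * L := le_mul_of_one_le_right (by positivity) hL1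
      calc (((norstMachine n r α K (2 * ε ^ 2 * lamP)).run svd ε y T t).2 : ℝ)
          ≤ (36 + 6 * D) * (n * r * t) + 128 * (n * r * t * L) := by linarith
        _ ≤ (36 + 6 * D) * (n * r * t * L) + 128 * (n * r * t * L) := by gcongr
        _ = (164 + 6 * D) * (n * r * t * L) := by ring
        _ ≤ (8 * D + 300) * (n * r * t * L) := 
            mul_le_mul_of_nonneg_right (by linarith) (by positivity)
        _ = _ := by ring

end Complexity

end NORST

end


end

theorem theorem1 :
    ∃ c₁ > (0 : ℝ), ∃ c₂ > (0 : ℝ), ∃ CK > (0 : ℝ), ∀ μ : ℝ, 1 ≤ μ →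
    ∃ Cα > (0 : ℝ), ∃ Cgap > (0 : ℝ),
      -- tracking guarantee
      (∀ (Ω : Type*) [MeasurableSpace Ω] (Pr : Measure Ω) [IsProbabilityMeasure Pr]
        (n r d J α K : ℕ) (ε lamP lamM f : ℝ) (lam : Fin r → ℝ)
        (P : ℕ → Matrix (Fin n) (Fin r) ℝ) (Pt : ℕ → Matrix (Fin n) (Fin r) ℝ) (tc : ℕ → ℕ)
        (a : ℕ → Ω → Fin r → ℝ) (T : ℕ → Ω → Finset (Fin n))
        (svd : Matrix (Fin n) (Fin α) ℝ → Matrix (Fin n) (Fin r) ℝ),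
        2 ≤ n → 1 ≤ r →
        NORST.IsRSVD svd → NORST.IsMeasurableRSVD svd →
        lamP = ⨆ k, lam k → lamM = ⨅ k, lam k → 0 < lamM → f = lamP / lamM →
        0 < ε → ε ≤ 0.01 →
        (∀ j < J, ε ≤ 0.03 * NORST.sinTheta (P j) (P (j + 1)) ^ 2 / f) →
        α = ⌈Cα * f ^ 2 * r * Real.log n⌉₊ →
        K = ⌈CK * Real.log (1 / ε)⌉₊ →
        (∀ j ≤ J, NORST.IsBasisMatrix (P j) ∧ NORST.IsIncoherent μ (P j)) →
        NORST.StatRightIncoherent Pr d μ lam a →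
        (∀ t ∈ Set.Icc 1 d, Measurable (T t)) →
        (∀ᵐ ω ∂Pr, NORST.maxMissFracCol d (fun t => T t ω) ≤ c₁ / (μ * r)) →
        (∀ᵐ ω ∂Pr, NORST.maxMissFracRow d α (fun t => T t ω) ≤ c₂ / f ^ 2) →
        tc 0 = 1 → tc (J + 1) = d + 1 →
        (∀ j ≤ J, ∀ t, tc j ≤ t → t < tc (j + 1) → Pt t = P j) →
        (∀ j ≤ J, (tc j : ℝ) + Cgap * f ^ 2 * r * Real.log n * Real.log (1 / ε) < tc (j + 1)) →
        IndepFun (fun ω (t : Set.Icc 1 d) => a t ω) (fun ω (t : Set.Icc 1 d) => T t ω) Pr →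
        Pr {ω | ¬ (
            let S := NORST.run α K (2 * ε ^ 2 * lamP) svd
              (fun t => NORST.mask (T t ω) (Pt t *ᵥ a t ω)) (fun t => T t ω)
            ∃ that : ℕ → ℕ, (∀ j ≤ J, (S d).that j = some (that j)) ∧
              -- detection
              (∀ j, 1 ≤ j → j ≤ J → tc j ≤ that j ∧ that j ≤ tc j + 2 * α) ∧
              -- subspace recovery
              (∀ j ≤ J, ∀ k, 1 ≤ k → k ≤ K → ∀ t, that j + k * α ≤ t → t < that j + (k + 1) * α →
                NORST.sinTheta (S t).Phat (Pt t) ≤ 0.3 ^ (k - 1) * (ε + NORST.dif P j)) ∧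
              (∀ j ≤ J, ∀ t, that j + (K + 1) * α ≤ t → t < tc (j + 1) →
                NORST.sinTheta (S t).Phat (Pt t) ≤ ε) ∧
              -- data recovery; the least squares problem of every frame is well posed
              (∀ t, 1 ≤ t → t ≤ d →
                IsUnit (NORST.lsGram (S (t - 1)).Phat (T t ω)).det ∧
                NORST.vnorm ((S t).lhat t - Pt t *ᵥ a t ω) ≤
                  1.2 * (NORST.sinTheta (S (t - 1)).Phat (Pt t) + ε) *
                    NORST.vnorm (Pt t *ᵥ a t ω)))}
          ≤ ENNReal.ofReal (10 * d / (n : ℝ) ^ 10)) ∧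
      -- memory and time complexity
      (∀ f₀ : ℝ, 1 ≤ f₀ → ∃ C > (0 : ℝ), ∀ (n r α K : ℕ) (ε lamP lamM f : ℝ),
        2 ≤ n → 1 ≤ r → r ≤ n →
        0 < lamM → lamM ≤ lamP → f = lamP / lamM → f ≤ f₀ →
        0 < ε → ε ≤ 0.01 →
        α = ⌈Cα * f ^ 2 * r * Real.log n⌉₊ →
        K = ⌈CK * Real.log (1 / ε)⌉₊ →
        ∃ (s : ℕ) (M : NORST.Machine n r α s),
          (s : ℝ) ≤ C * n * r * Real.log n * Real.log (1 / ε) ∧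
          ∀ (svd : Matrix (Fin n) (Fin α) ℝ → Matrix (Fin n) (Fin r) ℝ)
            (y : ℕ → Fin n → ℝ) (T : ℕ → Finset (Fin n)),
            NORST.IsRSVD svd →
            (∀ t, 1 ≤ t → ((T t).card : ℝ) / n ≤ c₁ / (μ * r)) →
            ∀ t, 1 ≤ t →
              (∀ i, (M.run svd ε y T t).1 (M.outL i) =
                (NORST.run α K (2 * ε ^ 2 * lamP) svd y T t).lhat t i) ∧
              (∀ i k, (M.run svd ε y T t).1 (M.outP i k) =
                (NORST.run α K (2 * ε ^ 2 * lamP) svd y T t).Phat i k) ∧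
              ((M.run svd ε y T t).2 : ℝ) ≤ C * n * t * r * Real.log (1 / ε)) := by
  -- 1/100 makes P have norm at most 0.1 on every missing set, 10⁻⁶ is the square of the relative
  -- accuracy 1/1000 on windows, and 176 · 10⁶ = 16 · 11 · 1000² yields failure probability of order
  -- n⁻¹⁰ per window.
  refine ⟨1 / 100, by norm_num, 1 / 1000000, by norm_num, 1, one_pos, fun μ hμ =>
    ⟨176000000 * μ, by linarith, 1760000000 * μ, by linarith, ?_, ?_⟩⟩
  · intro Ω _ Pr _ n r d J α K ε lamP lamM f lam P Pt tc a T svd hn hr hsvd hsvdm hP hM hM0 hf hε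
      hε1 hdif hα hK hbasis ha hT hcol hrow htc0 htcJ hPt hgap haT
    exact NORST.measure_not_tracked_le hμ Pr n r d J α K ε lamP lamM f lam P Pt tc a T svd hn hr
      hsvd hsvdm hP hM hM0 hf hε hε1 hdif hα hK hbasis ha hT hcol hrow htc0 htcJ hPt hgap haT
  · exact fun f₀ hf₀ => NORST.exists_machine hμ hf₀
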